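/- Let $S$ be a text of length $n$ over the integers (an infinite ordered alphabet) and let $1\le m\le n$. Let $T$ be the suffix tree of $S$ trimmed at word length $m$, i.e. the compacted trie whose leaves are the distinct length-$m$ factors of $S$; write $\mathcal L(u)$ for the word spelled from the root to a node $u$, $I_u$ for the set of leaves below $u$, and $Oc(z)$ for the number of positions of $S$ at which $\mathcal L(z)$ occurs. An edge $(u,v)$ of $T$ ($u$ the parent) is heavy if $|I_u|<2|I_v|$ and light otherwise; the heavy paths are the maximal paths of heavy edges (possibly with no edge). A sidetree of a heavy path $P$ emerging from $u\in P$ is the subtree rooted in $v$ for a light edge $(u,v)$. Let $z$ be a leaf of such a sidetree, $\mathcal L(z)=\mathcal L(u)\,c\,s$, with $c$ the first symbol of the light edge, and suppose that $P$ continues from $u$ through a heavy edge with first symbol $d$. The $P$-heavy occurrence of $z$ is the leaf $z'$ with $\mathcal L(z')=\mathcal L(u)\,d\,s$, if there is one. There is an algorithm that, given any such $S$ and $m$, computes for all leaves $z$ of $T$ (output at every position where $\mathcal L(z)$ occurs), in $O(n\log n)$ total time and $O(n)$ words of memory: (a) the sum of $Oc(z')$ over all heavy paths $P$ such that $z$ is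 a leaf in a sidetree of $P$ and has a $P$-heavy occurrence $z'$; (b) the sum of $Oc(z')$ over all leaves $z'$ such that, for some heavy path $P$, $z'$ is the $P$-heavy occurrence of $z$ or $z$ is the $P$-heavy occurrence of $z'$, every such $z'$ being counted once. Here the algorithm is a single program for a unit-cost word RAM with words of $O(\log n)$ bits, arithmetic operations $+,-,\times,\div$ on words, and read-only access to the text by comparisons $S[i]<S[j]$; the constants do not depend on $S$, $n$, $m$ or the alphabet. Moreover, no pair is counted twice: if $z'$ is the $P$-heavy occurrence of $z$ for a heavy path $P$, then it is not the $P'$-heavy occurrence of $z$ for any other heavy path $P'$, and $z$ is not the $P'$-heavy occurrence of $z'$ for any heavy path $P'$. -/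

import Mathlib

namespace Mappability

/-! ### The suffix tree trimmed at word length `m`, and its heavy paths

A node of the compact trie is identified with its locus (the concatenation of the edge labels on the
path from the root to the node), which is a finite word over the alphabet `ℤ`. Positions in the text
are numbered from `0`. -/

/-- The length-`m` factor of the text `S` that starts at position `i` (when `i + m ≤ |S|`). -/
def window (S : List ℤ) (m i : ℕ) : List ℤ := (S.drop i).take m

/-- The leaves of the suffix tree of `S` trimmed at word length `m`: the distinct length-`m` factors
of `S`. -/
def leaves (S : List ℤ) (m : ℕ) : Finset (List ℤ) :=
  ((Finset.range (S.length + 1)).filter (fun i => i + m ≤ S.length)).image (window S m)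

/-- The set `I_u` of the leaves in the subtree rooted in `u`. -/
def leavesBelow (S : List ℤ) (m : ℕ) (u : List ℤ) : Finset (List ℤ) :=
  (leaves S m).filter (fun z => u <+: z)

/-- The (explicit) nodes of the compact trie of the length-`m` factors of `S`: the root, the leaves
and the branching words. -/
def IsNode (S : List ℤ) (m : ℕ) (u : List ℤ) : Prop :=
  u = [] ∨ u ∈ leaves S m ∨
    ∃ a b : ℤ, a ≠ b ∧ (∃ z ∈ leaves S m, u ++ [a] <+: z) ∧ (∃ z ∈ leaves S m, u ++ [b] <+: z)

/-- `(u, v)` is an edge, `u` being the parent of `v`: `v` is a proper extension of `u`, and no node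
lies strictly between them. -/
def IsEdge (S : List ℤ) (m : ℕ) (u v : List ℤ) : Prop :=
  IsNode S m u ∧ IsNode S m v ∧ u <+: v ∧ u ≠ v ∧
    ∀ x, IsNode S m x → u <+: x → x <+: v → x = u ∨ x = v

/-- The edge `(u, v)` is heavy: `|I_u| < 2 |I_v|`. -/
def IsHeavyEdge (S : List ℤ) (m : ℕ) (u v : List ℤ) : Prop :=
  IsEdge S m u v ∧ (leavesBelow S m u).card < 2 * (leavesBelow S m v).card

/-- An edge that is not heavy is light. -/
def IsLightEdge (S : List ℤ) (m : ℕ) (u v : List ℤ) : Prop :=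
  IsEdge S m u v ∧ ¬ IsHeavyEdge S m u v

/-- A (non-empty, downwards) path of nodes all of whose edges are heavy; it may have `0` edges. -/
def IsHeavyChain (S : List ℤ) (m : ℕ) (P : List (List ℤ)) : Prop :=
  P ≠ [] ∧ (∀ u ∈ P, IsNode S m u) ∧ P.IsChain (IsHeavyEdge S m)

/-- A heavy path `P = (u₁, …, u_x)` of the heavy path decomposition: a maximal path of heavy
edges. -/
def IsHeavyPath (S : List ℤ) (m : ℕ) (P : List (List ℤ)) : Prop :=
  IsHeavyChain S m P ∧ ∀ Q, IsHeavyChain S m Q → P <:+: Q → Q = P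

/-- `z` is a leaf in the sidetree `T(v)` of the heavy path `P` that emerges from `u ∈ P`. -/
def InSidetree (S : List ℤ) (m : ℕ) (P : List (List ℤ)) (u v z : List ℤ) : Prop :=
  IsHeavyPath S m P ∧ u ∈ P ∧ IsLightEdge S m u v ∧ z ∈ leavesBelow S m v

/-- `h` is the `P`-heavy word of the leaf `z`: `z = u ++ c :: s` is a leaf in a sidetree `T(v)` of `P`
that emerges from `u` through a light edge with symbol `c`, the heavy edge of `P` that leaves `u` is
`(u, u')` and has symbol `d`, and `h = u ++ d :: s`. -/
def IsHeavyWord (S : List ℤ) (m : ℕ) (P : List (List ℤ)) (z h : List ℤ) : Prop :=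
  ∃ (u u' v : List ℤ) (c d : ℤ) (s : List ℤ),
    InSidetree S m P u v z ∧ u ++ [c] <+: v ∧
    [u, u'] <:+: P ∧ u ++ [d] <+: u' ∧
    z = u ++ c :: s ∧ h = u ++ d :: s

/-- The leaf `z'` is the `P`-heavy occurrence of the leaf `z`. -/
def IsHeavyOcc (S : List ℤ) (m : ℕ) (P : List (List ℤ)) (z z' : List ℤ) : Prop :=
  z' ∈ leaves S m ∧ IsHeavyWord S m P z z'

/-- The number of occurrences in the text of the `P`-heavy occurrences of `z`, summed over all the
heavy paths `P` such that `z` is a leaf in a sidetree of `P`. -/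
noncomputable def heavyCount (S : List ℤ) (m : ℕ) (z : List ℤ) : ℕ∞ :=
  {p : List (List ℤ) × ℕ |
    p.2 + m ≤ S.length ∧ IsHeavyOcc S m p.1 z (window S m p.2)}.encard

/-- The number of positions of the text at which there is a leaf that is related to `z` through some
heavy path, in one direction or in the other; every position counts once. -/
noncomputable def mutualCount (S : List ℤ) (m : ℕ) (z : List ℤ) : ℕ∞ :=
  {j : ℕ | j + m ≤ S.length ∧
    ∃ P, IsHeavyOcc S m P z (window S m j) ∨ IsHeavyOcc S m P (window S m j) z}.encard

/-! ### The machine: a unit-cost word RAM that can only compare the symbols of the text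

There are finitely many registers and finitely many arrays (those that the program names), holding
natural numbers. The text is read-only; its symbols can be compared and nothing else. -/

/-- The arithmetic instructions. -/
inductive Op
  | add | sub | mul | div

/-- Their values (subtraction is truncated at `0`, division rounds down). -/
def Op.eval : Op → ℕ → ℕ → ℕ
  | .add, a, b => a + b
  | .sub, a, b => a - b
  | .mul, a, b => a * b
  | .div, a, b => a / b

/-- Programs. -/
inductive Prog
  /-- do nothing -/
  | skip
  /-- `x := k` -/
  | const (x k : ℕ)
  /-- `x := y ∘ z` for registers `x`, `y`, `z` -/
  | arith (o : Op) (x y z : ℕ)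
  /-- `x := A[y]` for an array `A` and registers `x`, `y` -/
  | load (x A y : ℕ)
  /-- `A[x] := y` for an array `A` and registers `x`, `y` -/
  | store (A x y : ℕ)
  /-- first `p`, then `q` -/
  | seq (p q : Prog)
  /-- if `x < y` then `p` else `q` -/
  | ifLt (x y : ℕ) (p q : Prog)
  /-- if `S[x] < S[y]` then `p` else `q` -/
  | ifSymLt (x y : ℕ) (p q : Prog)
  /-- while `x < y` do `p` -/
  | whileLt (x y : ℕ) (p : Prog)

/-- The registers that a program names. -/
def Prog.regs : Prog → Finset ℕ
  | .skip => ∅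
  | .const x _ => {x}
  | .arith _ x y z => {x, y, z}
  | .load x _ y => {x, y}
  | .store _ x y => {x, y}
  | .seq p q => p.regs ∪ q.regs
  | .ifLt x y p q => {x, y} ∪ p.regs ∪ q.regs
  | .ifSymLt x y p q => {x, y} ∪ p.regs ∪ q.regs
  | .whileLt x y p => {x, y} ∪ p.regs

/-- The arrays that a program names. -/
def Prog.arrays : Prog → Finset ℕ
  | .skip => ∅
  | .const _ _ => ∅
  | .arith _ _ _ _ => ∅
  | .load _ A _ => {A}
  | .store A _ _ => {A}
  | .seq p q => p.arrays ∪ q.arrays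
  | .ifLt _ _ p q => p.arrays ∪ q.arrays
  | .ifSymLt _ _ p q => p.arrays ∪ q.arrays
  | .whileLt _ _ p => p.arrays

/-- The number of memory words that a program has at its disposal when each of its arrays has `cap`
cells. -/
def Prog.memory (p : Prog) (cap : ℕ) : ℕ := p.arrays.card * cap + p.regs.card

/-- The contents of the registers and of the arrays. -/
structure State where
  reg : ℕ → ℕ
  arr : ℕ → ℕ → ℕ

/-- Register `x` is set to `k`. -/
def State.setReg (σ : State) (x k : ℕ) : State :=
  { σ with reg := Function.update σ.reg x k }

/-- Cell `i` of the array `A` is set to `k`. -/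
def State.setArr (σ : State) (A i k : ℕ) : State :=
  { σ with arr := Function.update σ.arr A (Function.update (σ.arr A) i k) }

/-- Initially register `0` holds `n`, register `1` holds `m`, and everything else is `0`. -/
def State.init (n m : ℕ) : State where
  reg := fun x => if x = 0 then n else if x = 1 then m else 0
  arr := fun _ _ => 0

/-- `Exec S cap W p σ t τ`: on the text `S`, with arrays of `cap` cells and words that hold the numbers
`0, …, W`, the program `p` started in `σ` halts in `τ` after `t` steps. Each instruction and each test
is one step. A program that leaves an array, leaves the text or exceeds the word size does not halt in
this sense. -/
inductive Exec (S : List ℤ) (cap W : ℕ) : Prog → State → ℕ → State → Prop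
  | skip (σ : State) : Exec S cap W .skip σ 1 σ
  | const (σ : State) (x k : ℕ) (hk : k ≤ W) :
      Exec S cap W (.const x k) σ 1 (σ.setReg x k)
  | arith (σ : State) (o : Op) (x y z : ℕ) (hW : o.eval (σ.reg y) (σ.reg z) ≤ W) :
      Exec S cap W (.arith o x y z) σ 1 (σ.setReg x (o.eval (σ.reg y) (σ.reg z)))
  | load (σ : State) (x A y : ℕ) (hi : σ.reg y < cap) :
      Exec S cap W (.load x A y) σ 1 (σ.setReg x (σ.arr A (σ.reg y)))
  | store (σ : State) (A x y : ℕ) (hi : σ.reg x < cap) :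
      Exec S cap W (.store A x y) σ 1 (σ.setArr A (σ.reg x) (σ.reg y))
  | seq (σ σ' τ : State) (p q : Prog) (t t' : ℕ)
      (hp : Exec S cap W p σ t σ') (hq : Exec S cap W q σ' t' τ) :
      Exec S cap W (.seq p q) σ (t + t') τ
  | ifLt_true (σ τ : State) (x y : ℕ) (p q : Prog) (t : ℕ) (h : σ.reg x < σ.reg y)
      (hp : Exec S cap W p σ t τ) :
      Exec S cap W (.ifLt x y p q) σ (t + 1) τ
  | ifLt_false (σ τ : State) (x y : ℕ) (p q : Prog) (t : ℕ) (h : ¬ σ.reg x < σ.reg y)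
      (hq : Exec S cap W q σ t τ) :
      Exec S cap W (.ifLt x y p q) σ (t + 1) τ
  | ifSymLt_true (σ τ : State) (x y : ℕ) (p q : Prog) (t : ℕ)
      (hx : σ.reg x < S.length) (hy : σ.reg y < S.length) (h : S[σ.reg x] < S[σ.reg y])
      (hp : Exec S cap W p σ t τ) :
      Exec S cap W (.ifSymLt x y p q) σ (t + 1) τ
  | ifSymLt_false (σ τ : State) (x y : ℕ) (p q : Prog) (t : ℕ)
      (hx : σ.reg x < S.length) (hy : σ.reg y < S.length) (h : ¬ S[σ.reg x] < S[σ.reg y])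
      (hq : Exec S cap W q σ t τ) :
      Exec S cap W (.ifSymLt x y p q) σ (t + 1) τ
  | while_true (σ σ' τ : State) (x y : ℕ) (p : Prog) (t t' : ℕ) (h : σ.reg x < σ.reg y)
      (hp : Exec S cap W p σ t σ') (hr : Exec S cap W (.whileLt x y p) σ' t' τ) :
      Exec S cap W (.whileLt x y p) σ (t + t' + 1) τ
  | while_false (σ : State) (x y : ℕ) (p : Prog) (h : ¬ σ.reg x < σ.reg y) :
      Exec S cap W (.whileLt x y p) σ 1 σ

end Mappability

/-!
# Counting heavy occurrences in a trimmed suffix tree in time `O(n log n)`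

**The trie.** A heavy child of a node is unique, and so is the parent, so every node lies on exactly one
heavy path (`IsHeavyPath.eq_of_mem`, `exists_isHeavyPath`). If two leaves differ in exactly one symbol,
then they separate at a node, and one is a heavy occurrence of the other if and only if the heavy edge at
this node is on the side of the other (`isHeavyPair_iff`, `IsHeavyOcc.isHeavyPair`,
`IsHeavyPair.exists_isHeavyOcc`); the path is the one through this node. As two children cannot both have
more than half of the leaves, no pair is counted twice. Both counts thereby become sums over pairs of
leaves, in terms of a relation `HeavyRel` between the numbers of the leaves in lexicographic order
(`heavyCount_eq`, `mutualCount_eq`); paths no longer occur in it.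

**Longest common prefixes.** The suffix array is built by prefix doubling with counting sort, after the
symbols have been replaced by names with a merge sort by comparisons (`suffixArray_spec`). The common
prefixes of neighbours follow in linear time (`kasai_spec`). Range minima over them are answered in constant
time from `O(n)` words: inside windows of `log n + 1` cells by a bit mask per position, and between windows
by a sparse table over blocks (`rangeMin_spec`). Hence the longest common prefix of any two suffixes is
available in constant time (`lce_spec`); this replaces the tree, which is never built.

**The rounds.** The leaves are kept in lexicographic order, partitioned into intervals, each consisting of
the leaves of a subtree. A round follows in each interval a central path from the top to a leaf, which
takes the heavy edge wherever there is one. It always goes to the child that contains the middle leaf of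
the interval, and the cost of a step is charged to the leaves that are left behind, so a round takes linear
time (`Cluster.step`, `pathStep_spec`, `allPaths_spec`). Let the leaf `x` leave the path at a place from
which the path goes on through a heavy edge. The heavy occurrence of `x` there follows the path for one more
symbol and agrees with `x` afterwards; so it leaves the path at a depth that one longest common prefix
query yields, and continues from there as `x` does (`IsPath.treated_iff`). It is found by sorting the
triples (interval, depth, following word) of all leaves together with those that are searched for
(`nameItems_spec`, `collect_spec`). The leaves that leave the path through a common edge form the intervals
of the next round. This edge is light, so the intervals shrink to half of their size at least
(`IsPath.next_size`), and after `log n + 1` rounds all pairs have been separated, each of them counted in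
the round that separates it (`round_spec`, `allRounds_spec`).

**The machine.** Programs are written in a language with expressions and counting loops, which is translated
into the instructions of the word RAM. The weakest precondition `wp` includes the time, the array bounds and
the word size, and is sound for the translation (`wp_exec`). A specification of a command `c` has the form
`wp S cap W c Q σ T`: started at time `T` in the state `σ`, the command halts within the memory and word
bounds in a state and at a time with property `Q`.
-/

namespace Mappability

/-! ### A small imperative language over the word RAM -/

/-- Registers `≥ tempBase` are reserved for the intermediate results of expressions. -/
abbrev tempBase : ℕ := 1000

/-- Expressions over registers and array cells. -/
inductive Expr
  | lit (k : ℕ)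
  | reg (x : ℕ)
  | op (o : Op) (a b : Expr)
  | cell (A : ℕ) (e : Expr)

instance (k : ℕ) : OfNat Expr k := ⟨.lit k⟩
instance : Add Expr := ⟨.op .add⟩
instance : Sub Expr := ⟨.op .sub⟩
instance : Mul Expr := ⟨.op .mul⟩
instance : Div Expr := ⟨.op .div⟩

/-- The value of an expression. -/
def Expr.eval (σ : State) : Expr → ℕ
  | .lit k => k
  | .reg x => σ.reg x
  | .op o a b => o.eval (a.eval σ) (b.eval σ)
  | .cell A e => σ.arr A (e.eval σ)

/-- The evaluation of an expression stays inside the arrays and the word size. -/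
def Expr.Ok (cap W : ℕ) (σ : State) : Expr → Prop
  | .lit k => k ≤ W
  | .reg x => x < tempBase
  | .op o a b => a.Ok cap W σ ∧ b.Ok cap W σ ∧ o.eval (a.eval σ) (b.eval σ) ≤ W
  | .cell _ e => e.Ok cap W σ ∧ e.eval σ < cap

/-- The number of steps of the evaluation of an expression. -/
def Expr.cost : Expr → ℕ
  | .lit _ => 1
  | .reg _ => 2
  | .op _ a b => a.cost + b.cost + 1
  | .cell _ e => e.cost + 1

/-- Code that leaves the value of an expression in register `tempBase + k`, and uses only registers
`≥ tempBase + k` for it. -/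
def Expr.code : Expr → ℕ → Prog
  | .lit v, k => .const (tempBase + k) v
  | .reg x, k => .seq (.const (tempBase + k) 0) (.arith .add (tempBase + k) x (tempBase + k))
  | .op o a b, k => .seq (a.code k) (.seq (b.code (k + 1))
      (.arith o (tempBase + k) (tempBase + k) (tempBase + k + 1)))
  | .cell A e, k => .seq (e.code k) (.load (tempBase + k) A (tempBase + k))

/-- Commands: assignments, conditionals and loops over expressions. -/
inductive Cmd
  | skip
  | set (x : ℕ) (e : Expr)
  | put (A : ℕ) (i e : Expr)
  | seq (c d : Cmd)
  | ite (a b : Expr) (c d : Cmd)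
  | iteSym (a b : Expr) (c d : Cmd)
  | loop (a b : Expr) (c : Cmd)

/-- The translation of commands into programs of the word RAM. -/
def Cmd.code : Cmd → Prog
  | .skip => .skip
  | .set x e => .seq (e.code 0) (.seq (.const (tempBase + 1) 0)
      (.arith .add x tempBase (tempBase + 1)))
  | .put A i e => .seq (i.code 0) (.seq (e.code 1) (.store A tempBase (tempBase + 1)))
  | .seq c d => .seq c.code d.code
  | .ite a b c d => .seq (a.code 0) (.seq (b.code 1)
      (.ifLt tempBase (tempBase + 1) c.code d.code))
  | .iteSym a b c d => .seq (a.code 0) (.seq (b.code 1)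
      (.ifSymLt tempBase (tempBase + 1) c.code d.code))
  | .loop a b c => .seq (.seq (a.code 0) (b.code 1))
      (.whileLt tempBase (tempBase + 1) (.seq c.code (.seq (a.code 0) (b.code 1))))

/-- The registers that a command may change (the temporary ones excepted). -/
def Cmd.wr : Cmd → ℕ → Bool
  | .skip, _ => false
  | .set x _, y => y == x
  | .put _ _ _, _ => false
  | .seq c d, y => c.wr y || d.wr y
  | .ite _ _ c d, y => c.wr y || d.wr y
  | .iteSym _ _ c d, y => c.wr y || d.wr y
  | .loop _ _ c, y => c.wr y

/-- The arrays that a command may change. -/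
def Cmd.wa : Cmd → ℕ → Bool
  | .skip, _ => false
  | .set _ _, _ => false
  | .put A _ _, B => B == A
  | .seq c d, y => c.wa y || d.wa y
  | .ite _ _ c d, y => c.wa y || d.wa y
  | .iteSym _ _ c d, y => c.wa y || d.wa y
  | .loop _ _ c, y => c.wa y

/-- The states `σ` and `τ` agree outside of the registers and arrays that `c` may change. -/
def Cmd.Frame (c : Cmd) (σ τ : State) : Prop :=
  (∀ x, c.wr x = false → τ.reg x = σ.reg x) ∧ (∀ A, c.wa A = false → τ.arr A = σ.arr A)

theorem Cmd.Frame.reg {c : Cmd} {σ τ : State} (h : c.Frame σ τ) (x : ℕ)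
    (hx : c.wr x = false := by rfl) : τ.reg x = σ.reg x := h.1 x hx

theorem Cmd.Frame.arr {c : Cmd} {σ τ : State} (h : c.Frame σ τ) (A : ℕ)
    (hA : c.wa A = false := by rfl) : τ.arr A = σ.arr A := h.2 A hA

theorem Cmd.Frame.refl (c : Cmd) (σ : State) : c.Frame σ σ := ⟨fun _ _ => rfl, fun _ _ => rfl⟩

theorem Cmd.Frame.trans {c : Cmd} {σ τ υ : State} (h : c.Frame σ τ) (h' : c.Frame τ υ) :
    c.Frame σ υ :=
  ⟨fun x hx => (h'.1 x hx).trans (h.1 x hx), fun x hx => (h'.2 x hx).trans (h.2 x hx)⟩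

theorem Cmd.Frame.imp {c d : Cmd} {σ τ : State} (h : c.Frame σ τ)
    (hr : ∀ x, d.wr x = false → c.wr x = false) (ha : ∀ A, d.wa A = false → c.wa A = false) :
    d.Frame σ τ := ⟨fun x hx => h.1 x (hr x hx), fun x hx => h.2 x (ha x hx)⟩

@[simp] theorem State.setReg_reg (σ : State) (x k y : ℕ) :
    (σ.setReg x k).reg y = if y = x then k else σ.reg y := by
  simp [State.setReg, Function.update_apply]

@[simp] theorem State.setReg_arr (σ : State) (x k : ℕ) : (σ.setReg x k).arr = σ.arr := rfl

@[simp] theorem State.setArr_reg (σ : State) (A i k : ℕ) : (σ.setArr A i k).reg = σ.reg := rfl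

@[simp] theorem State.setArr_arr (σ : State) (A i k B j : ℕ) :
    (σ.setArr A i k).arr B j = if B = A ∧ j = i then k else σ.arr B j := by
  by_cases h : B = A
  · subst h; by_cases h' : j = i <;> simp [State.setArr, h']
  · simp [State.setArr, h]

theorem State.setArr_arr_ne (σ : State) (A i k B : ℕ) (h : B ≠ A) :
    (σ.setArr A i k).arr B = σ.arr B := by
  funext j; simp [h]

section wp
variable (S : List ℤ) (cap W : ℕ)

/-- At most `k` tests of the loop `while a < b`, whose body has the weakest precondition `body`. -/
def wpLoop (body : (State → ℕ → Prop) → State → ℕ → Prop) (a b : Expr)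
    (Q : State → ℕ → Prop) : ℕ → State → ℕ → Prop
  | 0, _, _ => False
  | k + 1, σ, T => a.Ok cap W σ ∧ b.Ok cap W σ ∧
      (a.eval σ < b.eval σ → body (wpLoop body a b Q k) σ (T + (a.cost + b.cost + 1))) ∧
      (¬ a.eval σ < b.eval σ → Q σ (T + (a.cost + b.cost + 1)))

/-- The weakest precondition of a command: started in `σ` at time `T`, it halts at a time `T'` in a
state `τ` with `Q τ T'`. -/
def wp : Cmd → (State → ℕ → Prop) → State → ℕ → Prop
  | .skip, Q, σ, T => Q σ (T + 1)
  | .set x e, Q, σ, T => x < tempBase ∧ e.Ok cap W σ ∧ Q (σ.setReg x (e.eval σ)) (T + (e.cost + 2))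
  | .put A i e, Q, σ, T => i.Ok cap W σ ∧ e.Ok cap W σ ∧ i.eval σ < cap ∧
      Q (σ.setArr A (i.eval σ) (e.eval σ)) (T + (i.cost + e.cost + 1))
  | .seq c d, Q, σ, T => wp c (wp d Q) σ T
  | .ite a b c d, Q, σ, T => a.Ok cap W σ ∧ b.Ok cap W σ ∧
      (a.eval σ < b.eval σ → wp c Q σ (T + (a.cost + b.cost + 1))) ∧
      (¬ a.eval σ < b.eval σ → wp d Q σ (T + (a.cost + b.cost + 1)))
  | .iteSym a b c d, Q, σ, T => a.Ok cap W σ ∧ b.Ok cap W σ ∧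
      a.eval σ < S.length ∧ b.eval σ < S.length ∧
      (S.getD (a.eval σ) 0 < S.getD (b.eval σ) 0 → wp c Q σ (T + (a.cost + b.cost + 1))) ∧
      (¬ S.getD (a.eval σ) 0 < S.getD (b.eval σ) 0 → wp d Q σ (T + (a.cost + b.cost + 1)))
  | .loop a b c, Q, σ, T => ∃ k : ℕ, wpLoop cap W (fun L σ T => wp c L σ T) a b Q k σ T

variable {S cap W}

theorem wp_mono {c : Cmd} {Q Q' : State → ℕ → Prop} {σ : State} {T : ℕ} (h : wp S cap W c Q σ T)
    (hQ : ∀ τ T', Q τ T' → Q' τ T') : wp S cap W c Q' σ T := by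
  induction c generalizing Q Q' σ T with
  | skip => exact hQ _ _ h
  | set x e => exact ⟨h.1, h.2.1, hQ _ _ h.2.2⟩
  | put A i e => exact ⟨h.1, h.2.1, h.2.2.1, hQ _ _ h.2.2.2⟩
  | seq c d ihc ihd => exact ihc h fun τ T' h' => ihd h' hQ
  | ite a b c d ihc ihd =>
    exact ⟨h.1, h.2.1, fun h' => ihc (h.2.2.1 h') hQ, fun h' => ihd (h.2.2.2 h') hQ⟩
  | iteSym a b c d ihc ihd =>
    exact ⟨h.1, h.2.1, h.2.2.1, h.2.2.2.1, fun h' => ihc (h.2.2.2.2.1 h') hQ,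
      fun h' => ihd (h.2.2.2.2.2 h') hQ⟩
  | loop a b c ihc =>
    obtain ⟨k, hk⟩ := h
    refine ⟨k, ?_⟩
    induction k generalizing σ T with
    | zero => exact hk
    | succ k ih => exact ⟨hk.1, hk.2.1, fun h' => ihc (hk.2.2.1 h') fun τ T' h'' => ih h'',
        fun h' => hQ _ _ (hk.2.2.2 h')⟩

/-- A command changes nothing outside of the registers and arrays that it names as targets. -/
theorem wp_frame {c : Cmd} {Q : State → ℕ → Prop} {σ : State} {T : ℕ} (h : wp S cap W c Q σ T) :
    wp S cap W c (fun τ T' => c.Frame σ τ ∧ Q τ T') σ T := by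
  induction c generalizing Q σ T with
  | skip => exact ⟨Cmd.Frame.refl _ _, h⟩
  | set x e =>
    refine ⟨h.1, h.2.1, ⟨fun y hy => ?_, fun A _ => rfl⟩, h.2.2⟩
    simp only [Cmd.wr, beq_eq_false_iff_ne] at hy
    simp [hy]
  | put A i e =>
    refine ⟨h.1, h.2.1, h.2.2.1, ⟨fun y hy => rfl, fun B hB => ?_⟩, h.2.2.2⟩
    simp only [Cmd.wa, beq_eq_false_iff_ne] at hB
    exact State.setArr_arr_ne _ _ _ _ _ hB
  | seq c d ihc ihd =>
    have h : wp S cap W c (wp S cap W d Q) σ T := h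
    show wp S cap W c (wp S cap W d _) σ T
    refine wp_mono (ihc h) fun τ T' ⟨hf, h'⟩ => wp_mono (ihd h') fun υ T'' ⟨hf', h''⟩ => ⟨?_, h''⟩
    exact (hf.imp (by simp [Cmd.wr]; tauto) (by simp [Cmd.wa]; tauto)).trans
      (hf'.imp (by simp [Cmd.wr]) (by simp [Cmd.wa]))
  | ite a b c d ihc ihd =>
    refine ⟨h.1, h.2.1, fun h' => wp_mono (ihc (h.2.2.1 h')) fun υ T'' ⟨hf', h''⟩ => ⟨?_, h''⟩,
      fun h' => wp_mono (ihd (h.2.2.2 h')) fun υ T'' ⟨hf', h''⟩ => ⟨?_, h''⟩⟩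
    · exact hf'.imp (by simp [Cmd.wr]; tauto) (by simp [Cmd.wa]; tauto)
    · exact hf'.imp (by simp [Cmd.wr]) (by simp [Cmd.wa])
  | iteSym a b c d ihc ihd =>
    refine ⟨h.1, h.2.1, h.2.2.1, h.2.2.2.1,
      fun h' => wp_mono (ihc (h.2.2.2.2.1 h')) fun υ T'' ⟨hf', h''⟩ => ⟨?_, h''⟩,
      fun h' => wp_mono (ihd (h.2.2.2.2.2 h')) fun υ T'' ⟨hf', h''⟩ => ⟨?_, h''⟩⟩
    · exact hf'.imp (by simp [Cmd.wr]; tauto) (by simp [Cmd.wa]; tauto)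
    · exact hf'.imp (by simp [Cmd.wr]) (by simp [Cmd.wa])
  | loop a b c ihc =>
    obtain ⟨k, hk⟩ := h
    refine ⟨k, ?_⟩
    have key : ∀ (k : ℕ) (σ₁ : State) (T : ℕ), (Cmd.loop a b c).Frame σ σ₁ →
        wpLoop cap W (fun L σ T => wp S cap W c L σ T) a b Q k σ₁ T →
        wpLoop cap W (fun L σ T => wp S cap W c L σ T) a b
          (fun τ T' => (Cmd.loop a b c).Frame σ τ ∧ Q τ T') k σ₁ T := by
      intro k
      induction k with
      | zero => exact fun _ _ _ h => h
      | succ k ih =>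
        intro σ₁ T hf h
        refine ⟨h.1, h.2.1, fun h' => ?_, fun h' => ⟨hf, h.2.2.2 h'⟩⟩
        exact wp_mono (ihc (h.2.2.1 h')) fun τ T' ⟨hf', h''⟩ =>
          ih _ _ (hf.trans (hf'.imp (by simp [Cmd.wr]) (by simp [Cmd.wa]))) h''
    exact key k σ T (Cmd.Frame.refl _ _) hk

/-- The states `σ` and `σ'` agree on everything but the temporary registers. -/
def State.Agree (σ σ' : State) : Prop :=
  (∀ x < tempBase, σ'.reg x = σ.reg x) ∧ σ'.arr = σ.arr

/-- All numbers in the memory are at most `W`. -/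
def State.Bounded (W : ℕ) (σ : State) : Prop :=
  (∀ x, σ.reg x ≤ W) ∧ ∀ A i, σ.arr A i ≤ W

theorem State.Bounded.setReg {σ : State} (h : σ.Bounded W) {x k : ℕ} (hk : k ≤ W) :
    (σ.setReg x k).Bounded W := by
  refine ⟨fun y => ?_, h.2⟩
  rw [State.setReg_reg]; split_ifs
  exacts [hk, h.1 y]

theorem State.Bounded.setArr {σ : State} (h : σ.Bounded W) {A i k : ℕ} (hk : k ≤ W) :
    (σ.setArr A i k).Bounded W := by
  refine ⟨h.1, fun B j => ?_⟩
  rw [State.setArr_arr]; split_ifs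
  exacts [hk, h.2 B j]

/-- The code of an expression leaves its value in register `tempBase + k` and does not disturb the
lower registers. Commands use `k = 0` and `k = 1`, so the value of a first expression survives the
evaluation of a second one. -/
theorem Expr.exec_code {e : Expr} {σ : State} (he : e.Ok cap W σ) (k : ℕ) {σ' : State}
    (h : σ.Agree σ') (hb : σ'.Bounded W) :
    ∃ τ', Exec S cap W (e.code k) σ' e.cost τ' ∧ τ'.reg (tempBase + k) = e.eval σ ∧
      τ'.arr = σ'.arr ∧ τ'.Bounded W ∧ ∀ y < tempBase + k, τ'.reg y = σ'.reg y := by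
  induction e generalizing k σ' with
  | lit v =>
    exact ⟨_, .const _ _ _ he, by simp [Expr.eval], rfl, hb.setReg he, fun y hy => by
      simp [hy.ne]⟩
  | reg x =>
    have hx : x < tempBase := he
    refine ⟨_, .seq _ _ _ _ _ _ _ (.const _ _ _ (Nat.zero_le _)) (.arith _ .add _ _ _ ?_), ?_, rfl,
      (hb.setReg (Nat.zero_le _)).setReg ?_, fun y hy => by simp [hy.ne]⟩
    · simp only [Op.eval, State.setReg_reg, if_true]
      rw [if_neg (by omega)]; exact hb.1 x
    · simp only [Op.eval, State.setReg_reg, if_true, Expr.eval]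
      rw [if_neg (by omega), h.1 x hx]; rfl
    · simp only [Op.eval, State.setReg_reg, if_true]
      rw [if_neg (by omega)]; exact hb.1 x
  | op o a b iha ihb =>
    obtain ⟨ha, hb', ho⟩ := he
    obtain ⟨τ₁, e₁, v₁, r₁, b₁, f₁⟩ := iha ha k h hb
    have h₁ : σ.Agree τ₁ := ⟨fun x hx => (f₁ x (by omega)).trans (h.1 x hx), r₁.trans h.2⟩
    obtain ⟨τ₂, e₂, v₂, r₂, b₂, f₂⟩ := ihb hb' (k + 1) h₁ b₁
    have hv : o.eval (τ₂.reg (tempBase + k)) (τ₂.reg (tempBase + k + 1))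
        = o.eval (a.eval σ) (b.eval σ) := by
      rw [f₂ _ (by omega), v₁, add_assoc, v₂]
    refine ⟨τ₂.setReg (tempBase + k) (o.eval (a.eval σ) (b.eval σ)), ?_, ?_, ?_, ?_, ?_⟩
    · rw [show (Expr.op o a b).cost = a.cost + (b.cost + 1) by simp [Expr.cost, add_assoc]]
      refine .seq _ _ _ _ _ _ _ e₁ (.seq _ _ _ _ _ _ _ e₂ ?_)
      rw [← hv]
      exact .arith _ _ _ _ _ (hv ▸ ho)
    · simp [Expr.eval]
    · exact r₂.trans r₁
    · exact b₂.setReg ho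
    · intro y hy
      simp only [State.setReg_reg]
      rw [if_neg hy.ne, f₂ y (by omega), f₁ y hy]
  | cell A e ih =>
    obtain ⟨he, hc⟩ := he
    obtain ⟨τ₁, e₁, v₁, r₁, b₁, f₁⟩ := ih he k h hb
    refine ⟨_, .seq _ _ _ _ _ _ _ e₁ (.load _ _ _ _ (v₁ ▸ hc)), ?_, r₁,
      b₁.setReg (b₁.2 _ _), fun y hy => ?_⟩
    · simp [Expr.eval, v₁, r₁, h.2]
    · simp [hy.ne, f₁ y hy]

theorem Expr.exec_pair {a b : Expr} {σ : State} (ha : a.Ok cap W σ) (hb : b.Ok cap W σ)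
    {σ' : State} (h : σ.Agree σ') (hB : σ'.Bounded W) :
    ∃ τ₁ τ', Exec S cap W (a.code 0) σ' a.cost τ₁ ∧ Exec S cap W (b.code 1) τ₁ b.cost τ' ∧
      τ'.reg tempBase = a.eval σ ∧ τ'.reg (tempBase + 1) = b.eval σ ∧ σ.Agree τ' ∧
      τ'.Bounded W := by
  obtain ⟨τ₁, e₁, v₁, r₁, b₁, f₁⟩ := Expr.exec_code (S := S) ha 0 h hB
  have h₁ : σ.Agree τ₁ := ⟨fun x hx => (f₁ x (by omega)).trans (h.1 x hx), r₁.trans h.2⟩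
  obtain ⟨τ₂, e₂, v₂, r₂, b₂, f₂⟩ := Expr.exec_code (S := S) hb 1 h₁ b₁
  exact ⟨τ₁, τ₂, e₁, e₂, (f₂ _ (by omega)).trans v₁, v₂,
    ⟨fun x hx => (f₂ x (by omega)).trans (h₁.1 x hx), r₂.trans h₁.2⟩, b₂⟩

theorem State.Agree.setReg {σ σ' : State} (h : σ.Agree σ') (x k : ℕ) :
    (σ.setReg x k).Agree (σ'.setReg x k) := by
  refine ⟨fun y hy => ?_, h.2⟩
  simp only [State.setReg_reg, h.1 y hy]

/-- The translation of commands into programs is correct. -/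
theorem wp_exec {c : Cmd} {Q : State → ℕ → Prop} {σ : State} {T : ℕ} (h : wp S cap W c Q σ T)
    {σ' : State} (ha : σ.Agree σ') (hb : σ'.Bounded W) :
    ∃ t τ' τ, Exec S cap W c.code σ' t τ' ∧ τ.Agree τ' ∧ τ'.Bounded W ∧ Q τ (T + t) := by
  induction c generalizing Q σ T σ' with
  | skip => exact ⟨1, σ', σ, .skip _, ha, hb, h⟩
  | set x e =>
    obtain ⟨hx, he, hQ⟩ := h
    obtain ⟨τ₁, e₁, v₁, r₁, b₁, f₁⟩ := Expr.exec_code (S := S) he 0 ha hb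
    have h₁ : σ.Agree τ₁ := ⟨fun x hx => (f₁ x (by omega)).trans (ha.1 x hx), r₁.trans ha.2⟩
    have hv : e.eval σ ≤ W := v₁ ▸ b₁.1 _
    have v₁' : τ₁.reg tempBase = e.eval σ := v₁
    have hev : Op.add.eval ((τ₁.setReg (tempBase + 1) 0).reg tempBase)
        ((τ₁.setReg (tempBase + 1) 0).reg (tempBase + 1)) = e.eval σ := by
      simp [Op.eval, v₁']
    refine ⟨_, _, σ.setReg x (e.eval σ), .seq _ _ _ _ _ _ _ e₁ (.seq _ _ _ _ _ _ _
      (.const _ _ _ (Nat.zero_le _)) (.arith _ .add _ _ _ (hev ▸ hv))), ?_, ?_, hQ⟩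
    · rw [hev]
      refine State.Agree.setReg (σ' := τ₁.setReg (tempBase + 1) 0) ⟨fun y hy => ?_, h₁.2⟩ _ _
      simp only [State.setReg_reg]
      rw [if_neg (by omega), h₁.1 y hy]
    · rw [hev]
      exact (b₁.setReg (Nat.zero_le _)).setReg hv
  | put A i e =>
    obtain ⟨hi, he, hc, hQ⟩ := h
    obtain ⟨τ₁, τ₂, e₁, e₂, v₁, v₂, h₂, b₂⟩ := Expr.exec_pair (S := S) hi he ha hb
    refine ⟨_, _, σ.setArr A (i.eval σ) (e.eval σ), .seq _ _ _ _ _ _ _ e₁ (.seq _ _ _ _ _ _ _ e₂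
      (.store _ _ _ _ (v₁ ▸ hc))), ?_, b₂.setArr (b₂.1 _), ?_⟩
    · rw [v₁, v₂]
      exact ⟨h₂.1, by simp [State.setArr, h₂.2]⟩
    · rwa [← add_assoc i.cost]
  | seq c d ihc ihd =>
    obtain ⟨t₁, τ₁', τ₁, e₁, a₁, b₁, h₁⟩ := ihc h ha hb
    obtain ⟨t₂, τ₂', τ₂, e₂, a₂, b₂, h₂⟩ := ihd h₁ a₁ b₁
    exact ⟨_, _, _, .seq _ _ _ _ _ _ _ e₁ e₂, a₂, b₂, by rwa [← add_assoc]⟩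
  | ite a b c d ihc ihd =>
    obtain ⟨oa, ob, h₁, h₂⟩ := h
    obtain ⟨τ₁, τ₂, e₁, e₂, v₁, v₂, h₃, b₂⟩ := Expr.exec_pair (S := S) oa ob ha hb
    by_cases hlt : a.eval σ < b.eval σ
    · obtain ⟨t, τ', τ, e, ag, bd, hQ⟩ := ihc (h₁ hlt) h₃ b₂
      refine ⟨_, τ', τ, .seq _ _ _ _ _ _ _ e₁ (.seq _ _ _ _ _ _ _ e₂
        (.ifLt_true _ _ _ _ _ _ _ (by rwa [v₁, v₂]) e)), ag, bd, ?_⟩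
      convert hQ using 1; ring
    · obtain ⟨t, τ', τ, e, ag, bd, hQ⟩ := ihd (h₂ hlt) h₃ b₂
      refine ⟨_, τ', τ, .seq _ _ _ _ _ _ _ e₁ (.seq _ _ _ _ _ _ _ e₂
        (.ifLt_false _ _ _ _ _ _ _ (by rwa [v₁, v₂]) e)), ag, bd, ?_⟩
      convert hQ using 1; ring
  | iteSym a b c d ihc ihd =>
    obtain ⟨oa, ob, la, lb, h₁, h₂⟩ := h
    obtain ⟨τ₁, τ₂, e₁, e₂, v₁, v₂, h₃, b₂⟩ := Expr.exec_pair (S := S) oa ob ha hb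
    rw [← v₁] at la
    rw [← v₂] at lb
    by_cases hlt : S.getD (a.eval σ) 0 < S.getD (b.eval σ) 0
    · obtain ⟨t, τ', τ, e, ag, bd, hQ⟩ := ihc (h₁ hlt) h₃ b₂
      refine ⟨_, τ', τ, .seq _ _ _ _ _ _ _ e₁ (.seq _ _ _ _ _ _ _ e₂
        (.ifSymLt_true _ _ _ _ _ _ _ la lb ?_ e)), ag, bd, ?_⟩
      · rw [← v₁, ← v₂] at hlt
        rwa [List.getD_eq_getElem _ _ la, List.getD_eq_getElem _ _ lb] at hlt
      · convert hQ using 1; ring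
    · obtain ⟨t, τ', τ, e, ag, bd, hQ⟩ := ihd (h₂ hlt) h₃ b₂
      refine ⟨_, τ', τ, .seq _ _ _ _ _ _ _ e₁ (.seq _ _ _ _ _ _ _ e₂
        (.ifSymLt_false _ _ _ _ _ _ _ la lb ?_ e)), ag, bd, ?_⟩
      · rw [← v₁, ← v₂] at hlt
        rwa [List.getD_eq_getElem _ _ la, List.getD_eq_getElem _ _ lb] at hlt
      · convert hQ using 1; ring
  | loop a b c ihc =>
    obtain ⟨k, hk⟩ := h
    -- the operands of the test are in the temporary registers whenever the loop is entered
    have key : ∀ (k : ℕ) (σ : State) (T : ℕ) (τ' : State),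
        wpLoop cap W (fun L σ T => wp S cap W c L σ T) a b Q k σ T →
        τ'.reg tempBase = a.eval σ → τ'.reg (tempBase + 1) = b.eval σ → σ.Agree τ' →
        τ'.Bounded W →
        ∃ t υ' υ, Exec S cap W (.whileLt tempBase (tempBase + 1)
            (.seq c.code (.seq (a.code 0) (b.code 1)))) τ' t υ' ∧ υ.Agree υ' ∧ υ'.Bounded W ∧
          Q υ (T + (a.cost + b.cost + t)) := by
      intro k
      induction k with
      | zero => exact fun _ _ _ h => h.elim
      | succ k ih =>
        rintro σ T τ' ⟨oa, ob, h₁, h₂⟩ va vb ag bd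
        by_cases hlt : a.eval σ < b.eval σ
        · obtain ⟨t₁, τ₁', τ₁, e₁, a₁, b₁, q₁⟩ := ihc (h₁ hlt) ag bd
          have hok : a.Ok cap W τ₁ ∧ b.Ok cap W τ₁ := by
            cases k with
            | zero => exact q₁.elim
            | succ k => exact ⟨q₁.1, q₁.2.1⟩
          obtain ⟨τ₂, τ₃, e₂, e₃, v₂, v₃, h₃, b₃⟩ :=
            Expr.exec_pair (S := S) hok.1 hok.2 a₁ b₁
          obtain ⟨t, υ', υ, e, ag', bd', hQ⟩ := ih τ₁ _ τ₃ q₁ v₂ v₃ h₃ b₃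
          refine ⟨_, υ', υ, .while_true _ _ _ _ _ _ _ _ (by rwa [va, vb])
            (.seq _ _ _ _ _ _ _ e₁ (.seq _ _ _ _ _ _ _ e₂ e₃)) e, ag', bd', ?_⟩
          convert hQ using 1; ring
        · exact ⟨_, τ', σ, .while_false _ _ _ _ (by rwa [va, vb]), ag, bd, h₂ hlt⟩
    have hok : a.Ok cap W σ ∧ b.Ok cap W σ := by
      cases k with
      | zero => exact hk.elim
      | succ k => exact ⟨hk.1, hk.2.1⟩
    obtain ⟨τ₂, τ₃, e₂, e₃, v₂, v₃, h₃, b₃⟩ := Expr.exec_pair (S := S) hok.1 hok.2 ha hb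
    obtain ⟨t, υ', υ, e, ag', bd', hQ⟩ := key k σ T τ₃ hk v₂ v₃ h₃ b₃
    exact ⟨_, υ', υ, .seq _ _ _ _ _ _ _ (.seq _ _ _ _ _ _ _ e₂ e₃) e, ag', bd', hQ⟩

/-- The rule for loops: `I` is an invariant and `v` a variant. -/
theorem wp_while {a b : Expr} {c : Cmd} {Q : State → ℕ → Prop} {σ₀ : State} {T₀ : ℕ}
    (I : State → ℕ → Prop) (v : State → ℕ) (h0 : I σ₀ T₀)
    (step : ∀ σ T, (Cmd.loop a b c).Frame σ₀ σ → I σ T → a.Ok cap W σ ∧ b.Ok cap W σ ∧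
      (a.eval σ < b.eval σ → wp S cap W c (fun τ T' => I τ T' ∧ v τ < v σ) σ
        (T + (a.cost + b.cost + 1))) ∧
      (¬ a.eval σ < b.eval σ → Q σ (T + (a.cost + b.cost + 1)))) :
    wp S cap W (.loop a b c) Q σ₀ T₀ := by
  have key : ∀ (k : ℕ) (σ : State) (T : ℕ), v σ < k → (Cmd.loop a b c).Frame σ₀ σ → I σ T →
      wpLoop cap W (fun L σ T => wp S cap W c L σ T) a b Q k σ T := by
    intro k
    induction k with
    | zero => exact fun _ _ h => absurd h (Nat.not_lt_zero _)
    | succ k ih =>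
      intro σ T hv hf hI
      obtain ⟨oa, ob, h₁, h₂⟩ := step σ T hf hI
      refine ⟨oa, ob, fun h => wp_mono (wp_frame (h₁ h)) fun τ T' ⟨hf', hI', hv'⟩ => ?_, h₂⟩
      exact ih τ T' (by omega) (hf.trans (hf'.imp (by simp [Cmd.wr]) (by simp [Cmd.wa]))) hI'
  exact ⟨v σ₀ + 1, key _ _ _ (Nat.lt_succ_self _) (Cmd.Frame.refl _ _) h0⟩

/-- `for x := e; x < r; x := x + 1 do c`, for registers `x` and `r`. -/
def Cmd.for (x : ℕ) (e : Expr) (r : ℕ) (c : Cmd) : Cmd :=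
  .seq (.set x e) (.loop (.reg x) (.reg r) (.seq c (.set x (.reg x + 1))))

@[simp] theorem Cmd.for_wr (x : ℕ) (e : Expr) (r : ℕ) (c : Cmd) (y : ℕ) :
    (Cmd.for x e r c).wr y = ((y == x) || (c.wr y || (y == x))) := rfl

@[simp] theorem Cmd.for_wa (x : ℕ) (e : Expr) (r : ℕ) (c : Cmd) (y : ℕ) :
    (Cmd.for x e r c).wa y = (false || (c.wa y || false)) := rfl

/-- The rule for counting loops, with an invariant that may speak about the time. -/
theorem wp_for {x r : ℕ} {e : Expr} {c : Cmd} {Q : State → ℕ → Prop} {σ₀ : State} {T₀ : ℕ}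
    (I : ℕ → State → ℕ → Prop) (lo N : ℕ) (hx : x < tempBase) (hr : r < tempBase) (hxr : r ≠ x)
    (hcx : c.wr x = false) (hcr : c.wr r = false) (hN : σ₀.reg r = N) (hW : N ≤ W) (hlo : lo ≤ N)
    (he : e.Ok cap W σ₀) (hev : e.eval σ₀ = lo)
    (h0 : I lo (σ₀.setReg x lo) (T₀ + (e.cost + 2)))
    (step : ∀ k σ T, lo ≤ k → k < N → σ.reg x = k → (Cmd.for x e r c).Frame σ₀ σ → I k σ T →
      wp S cap W c (fun τ T' => I (k + 1) (τ.setReg x (k + 1)) (T' + 6)) σ (T + 5))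
    (done : ∀ σ T, σ.reg x = N → (Cmd.for x e r c).Frame σ₀ σ → I N σ T → Q σ (T + 5)) :
    wp S cap W (Cmd.for x e r c) Q σ₀ T₀ := by
  refine ⟨hx, he, ?_⟩
  rw [hev]
  have fr : ∀ σ, (Cmd.loop (.reg x) (.reg r) (.seq c (.set x (.reg x + 1)))).Frame
      (σ₀.setReg x lo) σ → (Cmd.for x e r c).Frame σ₀ σ := by
    intro σ hf
    refine ⟨fun y hy => ?_, fun A hA => ?_⟩
    · simp only [Cmd.for_wr, Bool.or_eq_false_iff, beq_eq_false_iff_ne] at hy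
      rw [hf.1 y (by simp [Cmd.wr, hy]), State.setReg_reg, if_neg hy.1]
    · rw [hf.2 A (by simpa [Cmd.wa] using hA)]; rfl
  refine wp_while (fun σ T => ∃ k, σ.reg x = k ∧ lo ≤ k ∧ k ≤ N ∧ I k σ T)
    (fun σ => N - σ.reg x) ⟨lo, by simp, le_rfl, hlo, h0⟩ ?_
  rintro σ T hf ⟨k, hk, hlk, hkN, hI⟩
  have hf' := fr σ hf
  have hrN : σ.reg r = N := by
    rw [hf'.1 r (by simp [hcr, hxr]), hN]
  refine ⟨hx, hr, fun h => ?_, fun h => ?_⟩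
  · simp only [Expr.eval, hk, hrN] at h
    show wp S cap W c _ σ _
    refine wp_mono (wp_frame (step k σ T hlk h hk hf' hI)) fun τ T' ⟨hf'', h'⟩ => ?_
    have hτ : τ.reg x = k := by rw [hf''.1 x hcx, hk]
    have hev : (Expr.reg x + 1 : Expr).eval τ = k + 1 := by
      show τ.reg x + 1 = k + 1
      rw [hτ]
    refine ⟨hx, ⟨hx, show 1 ≤ W by omega, ?_⟩, ?_⟩
    · show τ.reg x + 1 ≤ W
      omega
    · rw [hev]
      exact ⟨⟨k + 1, by simp, by omega, by omega, h'⟩, by simp [hk]; omega⟩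
  · simp only [Expr.eval, hk, hrN] at h
    have : k = N := by omega
    subst this
    exact done σ T hk hf' hI

/-- The rule for counting loops whose body takes at most `K` steps. -/
theorem wp_for_const {x r : ℕ} {e : Expr} {c : Cmd} {Q : State → ℕ → Prop} {σ₀ : State} {T₀ : ℕ}
    (I : ℕ → State → Prop) (lo N K : ℕ) (hx : x < tempBase) (hr : r < tempBase) (hxr : r ≠ x)
    (hcx : c.wr x = false) (hcr : c.wr r = false) (hN : σ₀.reg r = N) (hW : N ≤ W) (hlo : lo ≤ N)
    (he : e.Ok cap W σ₀) (hev : e.eval σ₀ = lo)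
    (h0 : I lo (σ₀.setReg x lo))
    (step : ∀ k σ T, lo ≤ k → k < N → σ.reg x = k → (Cmd.for x e r c).Frame σ₀ σ → I k σ →
      wp S cap W c (fun τ T' => I (k + 1) (τ.setReg x (k + 1)) ∧ T' ≤ T + K) σ T)
    (done : ∀ σ T, σ.reg x = N → (Cmd.for x e r c).Frame σ₀ σ → I N σ →
      T ≤ T₀ + (e.cost + 7) + (K + 11) * (N - lo) → Q σ T) :
    wp S cap W (Cmd.for x e r c) Q σ₀ T₀ := by
  refine wp_for (fun k σ T => I k σ ∧ T ≤ T₀ + (e.cost + 2) + (K + 11) * (k - lo)) lo N hx hr hxr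
    hcx hcr hN hW hlo he hev ⟨h0, by omega⟩ ?_ ?_
  · rintro k σ T hlk hkN hk hf ⟨hI, hT⟩
    refine wp_mono (step k σ (T + 5) hlk hkN hk hf hI) fun τ T' ⟨hI', hT'⟩ => ⟨hI', ?_⟩
    rw [show k + 1 - lo = (k - lo) + 1 by omega, mul_add]
    omega
  · rintro σ T hk hf ⟨hI, hT⟩
    exact done σ _ hk hf hI (by omega)

end wp

/-! ### Symbolic execution -/

set_option linter.unusedSimpArgs false

/-- `c ;; d` runs `c` and then `d`. -/
infixr:60 " ;; " => Cmd.seq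

/-- `T'` is at most `T + k`; opaque to linear arithmetic, so that facts about elapsed time do not burden
the other arithmetical goals. -/
def Within (T' T k : ℕ) : Prop := T' ≤ T + k

theorem Within.add {T T₁ T₂ k l : ℕ} (h : Within T₁ T k) (h' : T₂ ≤ T₁ + l) : Within T₂ T (k + l) :=
  h'.trans (by have : T₁ ≤ T + k := h
               omega)

theorem Within.le {T T₁ k l : ℕ} (h : Within T₁ T k) (h' : k ≤ l) : T₁ ≤ T + l :=
  Nat.le_trans h (by omega)

section rules
variable {S : List ℤ} {cap W : ℕ}

theorem wp_seq {c d : Cmd} {Q : State → ℕ → Prop} {σ : State} {T : ℕ}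
    (h : wp S cap W c (wp S cap W d Q) σ T) : wp S cap W (c ;; d) Q σ T := h

/-- To run a command after one whose effect is known. -/
theorem wp_then {c d : Cmd} {P Q : State → ℕ → Prop} {σ : State} {T : ℕ}
    (h : wp S cap W c P σ T)
    (h' : ∀ τ T', c.Frame σ τ → P τ T' → wp S cap W d Q τ T') : wp S cap W (c ;; d) Q σ T :=
  wp_mono (c := c) (wp_frame h) fun τ T' h'' => h' τ T' h''.1 h''.2

/-- To end with a command whose effect is known. -/
theorem wp_last {c : Cmd} {P Q : State → ℕ → Prop} {σ : State} {T : ℕ}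
    (h : wp S cap W c P σ T)
    (h' : ∀ τ T', c.Frame σ τ → P τ T' → Q τ T') : wp S cap W c Q σ T :=
  wp_mono (c := c) (wp_frame h) fun τ T' h'' => h' τ T' h''.1 h''.2

/-- The rewriting rules of symbolic execution. -/
theorem wp_rules :
    (∀ Q σ T, wp S cap W .skip Q σ T = Q σ (T + 1)) ∧
    (∀ x e Q σ T, wp S cap W (.set x e) Q σ T =
      (x < 1000 ∧ e.Ok cap W σ ∧ Q (σ.setReg x (e.eval σ)) (T + (e.cost + 2)))) ∧
    (∀ A i e Q σ T, wp S cap W (.put A i e) Q σ T =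
      (i.Ok cap W σ ∧ e.Ok cap W σ ∧ i.eval σ < cap ∧
        Q (σ.setArr A (i.eval σ) (e.eval σ)) (T + (i.cost + e.cost + 1)))) ∧
    (∀ c d Q σ T, wp S cap W (.seq c d) Q σ T = wp S cap W c (wp S cap W d Q) σ T) ∧
    (∀ a b c d Q σ T, wp S cap W (.ite a b c d) Q σ T =
      (a.Ok cap W σ ∧ b.Ok cap W σ ∧
        (a.eval σ < b.eval σ → wp S cap W c Q σ (T + (a.cost + b.cost + 1))) ∧
        (¬ a.eval σ < b.eval σ → wp S cap W d Q σ (T + (a.cost + b.cost + 1))))) :=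
  ⟨fun _ _ _ => rfl, fun _ _ _ _ _ => rfl, fun _ _ _ _ _ _ => rfl, fun _ _ _ _ _ => rfl,
    fun _ _ _ _ _ _ _ => rfl⟩

/-- The rewriting rules for the safety of expressions. -/
theorem ok_rules :
    (∀ σ k, Expr.Ok cap W σ (.lit k) = (k ≤ W)) ∧
    (∀ σ, Expr.Ok cap W σ 0 = (0 ≤ W)) ∧ (∀ σ, Expr.Ok cap W σ 1 = (1 ≤ W)) ∧
    (∀ σ, Expr.Ok cap W σ 2 = (2 ≤ W)) ∧
    (∀ σ x, Expr.Ok cap W σ (.reg x) = (x < 1000)) ∧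
    (∀ σ a b, Expr.Ok cap W σ (a + b) =
      (a.Ok cap W σ ∧ b.Ok cap W σ ∧ a.eval σ + b.eval σ ≤ W)) ∧
    (∀ σ a b, Expr.Ok cap W σ (a - b) =
      (a.Ok cap W σ ∧ b.Ok cap W σ ∧ a.eval σ - b.eval σ ≤ W)) ∧
    (∀ σ a b, Expr.Ok cap W σ (a * b) =
      (a.Ok cap W σ ∧ b.Ok cap W σ ∧ a.eval σ * b.eval σ ≤ W)) ∧
    (∀ σ a b, Expr.Ok cap W σ (a / b) =
      (a.Ok cap W σ ∧ b.Ok cap W σ ∧ a.eval σ / b.eval σ ≤ W)) ∧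
    (∀ σ A e, Expr.Ok cap W σ (.cell A e) = (e.Ok cap W σ ∧ e.eval σ < cap)) :=
  ⟨fun _ _ => rfl, fun _ => rfl, fun _ => rfl, fun _ => rfl, fun _ _ => rfl, fun _ _ _ => rfl,
    fun _ _ _ => rfl, fun _ _ _ => rfl, fun _ _ _ => rfl, fun _ _ _ => rfl⟩

/-- The rewriting rules for the values and costs of expressions and for updated states. -/
theorem eval_rules :
    (∀ σ k, Expr.eval σ (.lit k) = k) ∧
    (∀ σ, Expr.eval σ 0 = 0) ∧ (∀ σ, Expr.eval σ 1 = 1) ∧ (∀ σ, Expr.eval σ 2 = 2) ∧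
    (∀ σ x, Expr.eval σ (.reg x) = σ.reg x) ∧
    (∀ σ a b, Expr.eval σ (a + b) = a.eval σ + b.eval σ) ∧
    (∀ σ a b, Expr.eval σ (a - b) = a.eval σ - b.eval σ) ∧
    (∀ σ a b, Expr.eval σ (a * b) = a.eval σ * b.eval σ) ∧
    (∀ σ a b, Expr.eval σ (a / b) = a.eval σ / b.eval σ) ∧
    (∀ σ A e, Expr.eval σ (.cell A e) = σ.arr A (e.eval σ)) ∧
    (∀ k, Expr.cost (.lit k) = 1) ∧
    Expr.cost 0 = 1 ∧ Expr.cost 1 = 1 ∧ Expr.cost 2 = 1 ∧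
    (∀ x, Expr.cost (.reg x) = 2) ∧
    (∀ a b, Expr.cost (a + b) = a.cost + b.cost + 1) ∧
    (∀ a b, Expr.cost (a - b) = a.cost + b.cost + 1) ∧
    (∀ a b, Expr.cost (a * b) = a.cost + b.cost + 1) ∧
    (∀ a b, Expr.cost (a / b) = a.cost + b.cost + 1) ∧
    (∀ A e, Expr.cost (.cell A e) = e.cost + 1) ∧
    (∀ (σ : State) x k y, (σ.setReg x k).reg y = if y = x then k else σ.reg y) ∧
    (∀ (σ : State) x k, (σ.setReg x k).arr = σ.arr) ∧
    (∀ (σ : State) A i k, (σ.setArr A i k).reg = σ.reg) ∧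
    (∀ (σ : State) A i k B j, (σ.setArr A i k).arr B j =
      if B = A ∧ j = i then k else σ.arr B j) ∧
    (∀ p : Prop, (True ∧ p) = p) ∧ (∀ p : Prop, (False ∧ p) = False) ∧
    (∀ p : Prop, (p ∧ True) = p) ∧ (∀ p q r : Prop, ((p ∧ q) ∧ r) = (p ∧ q ∧ r)) ∧
    (∀ n : ℕ, (0 ≤ n) = True) :=
  ⟨fun _ _ => rfl, fun _ => rfl, fun _ => rfl, fun _ => rfl, fun _ _ => rfl, fun _ _ _ => rfl,
    fun _ _ _ => rfl, fun _ _ _ => rfl, fun _ _ _ => rfl, fun _ _ _ => rfl, fun _ => rfl,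
    rfl, rfl, rfl, fun _ => rfl, fun _ _ => rfl, fun _ _ => rfl, fun _ _ => rfl,
    fun _ _ => rfl, fun _ _ => rfl, State.setReg_reg, fun _ _ _ => rfl, fun _ _ _ _ => rfl,
    State.setArr_arr, by simp, by simp, by simp, fun _ _ _ => propext and_assoc, by simp⟩

end rules

/-! ### Sorting -/

/-- The first `K` entries of the array `X` are a permutation of `0, …, K - 1`. -/
def IsPerm (K : ℕ) (X : ℕ → ℕ) : Prop :=
  (∀ t < K, X t < K) ∧ ∀ t < K, ∀ t' < K, X t = X t' → t = t'

theorem IsPerm.surj {K : ℕ} {X : ℕ → ℕ} (h : IsPerm K X) {i : ℕ} (hi : i < K) :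
    ∃ t < K, X t = i := by
  have h1 : Function.Injective (fun t : Fin K => (⟨X t, h.1 t t.2⟩ : Fin K)) := by
    intro a b hab
    exact Fin.ext (h.2 a a.2 b b.2 (by simpa using hab))
  obtain ⟨t, ht⟩ := (Finite.injective_iff_surjective.1 h1) ⟨i, hi⟩
  exact ⟨t, t.2, by simpa using ht⟩

theorem IsPerm.congr {K : ℕ} {X Y : ℕ → ℕ} (h : IsPerm K X) (hXY : ∀ t < K, Y t = X t) :
    IsPerm K Y :=
  ⟨fun t ht => hXY t ht ▸ h.1 t ht, fun t ht t' ht' e =>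
    h.2 t ht t' ht' (by rw [← hXY t ht, ← hXY t' ht', e])⟩

theorem IsPerm.of_surj {K : ℕ} {X : ℕ → ℕ} (h1 : ∀ t < K, X t < K)
    (h : ∀ i < K, ∃ t < K, X t = i) : IsPerm K X := by
  refine ⟨h1, fun t ht t' ht' e => ?_⟩
  have hs : Function.Surjective (fun t : Fin K => (⟨X t, h1 t t.2⟩ : Fin K)) := by
    intro ⟨i, hi⟩
    obtain ⟨t, ht, e⟩ := h i hi
    exact ⟨⟨t, ht⟩, by simpa using e⟩
  have := (Finite.injective_iff_surjective.2 hs) (a₁ := ⟨t, ht⟩) (a₂ := ⟨t', ht'⟩) (by simpa using e)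
  simpa using this

theorem IsPerm.count_comp {K : ℕ} {X : ℕ → ℕ} (h : IsPerm K X) (p : ℕ → Prop) [DecidablePred p] :
    Nat.count (fun t => p (X t)) K = Nat.count p K := by
  rw [Nat.count_eq_card_filter_range, Nat.count_eq_card_filter_range]
  refine Finset.card_bij (fun t _ => X t) ?_ ?_ ?_
  · intro t ht
    simp only [Finset.mem_filter, Finset.mem_range] at ht ⊢
    exact ⟨h.1 t ht.1, ht.2⟩
  · intro t ht t' ht' e
    simp only [Finset.mem_filter, Finset.mem_range] at ht ht'
    exact h.2 t ht.1 t' ht'.1 e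
  · intro i hi
    simp only [Finset.mem_filter, Finset.mem_range] at hi
    obtain ⟨t, ht, rfl⟩ := h.surj hi.1
    exact ⟨t, by simp [ht, hi.2], rfl⟩

theorem Nat.count_congr' {p q : ℕ → Prop} [DecidablePred p] [DecidablePred q] {K : ℕ}
    (h : ∀ t < K, p t ↔ q t) : Nat.count p K = Nat.count q K := by
  rw [Nat.count_eq_card_filter_range, Nat.count_eq_card_filter_range]
  congr 1
  ext t
  simp only [Finset.mem_filter, Finset.mem_range]
  exact and_congr_right (h t)

theorem Nat.count_or' {p q : ℕ → Prop} [DecidablePred p] [DecidablePred q] {K : ℕ}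
    (h : ∀ t < K, ¬ (p t ∧ q t)) :
    Nat.count (fun t => p t ∨ q t) K = Nat.count p K + Nat.count q K := by
  induction K with
  | zero => simp
  | succ K ih =>
    have := h K (by omega)
    rw [Nat.count_succ, Nat.count_succ, Nat.count_succ, ih fun t ht => h t (by omega)]
    by_cases h1 : p K <;> by_cases h2 : q K <;> simp_all <;> omega

/-- The position that a stable sort by `κ` (the key of the item at a position) gives to the item at
position `t`. -/
def stablePos (K : ℕ) (κ : ℕ → ℕ) (t : ℕ) : ℕ :=
  Nat.count (fun t' => κ t' < κ t) K + Nat.count (fun t' => κ t' = κ t) t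

theorem stablePos_eq (K : ℕ) (κ : ℕ → ℕ) {t : ℕ} (ht : t < K) :
    stablePos K κ t = Nat.count (fun t' => κ t' < κ t ∨ (κ t' = κ t ∧ t' < t)) K := by
  rw [Nat.count_or' (fun t' _ h => by omega), stablePos]
  congr 1
  rw [Nat.count_eq_card_filter_range, Nat.count_eq_card_filter_range]
  congr 1
  ext t'
  simp only [Finset.mem_filter, Finset.mem_range]
  constructor
  · rintro ⟨h1, h2⟩; exact ⟨by omega, h2, h1⟩
  · rintro ⟨h1, h2, h3⟩; exact ⟨h3, h2⟩

theorem stablePos_lt_of (K : ℕ) (κ : ℕ → ℕ) {t u : ℕ} (ht : t < K) (hu : u < K)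
    (h : κ t < κ u ∨ (κ t = κ u ∧ t < u)) : stablePos K κ t < stablePos K κ u := by
  rw [stablePos_eq K κ ht, stablePos_eq K κ hu, Nat.count_eq_card_filter_range,
    Nat.count_eq_card_filter_range]
  refine Finset.card_lt_card (Finset.ssubset_iff_of_subset ?_ |>.2 ⟨t, ?_, ?_⟩)
  · intro s hs
    simp only [Finset.mem_filter, Finset.mem_range] at hs ⊢
    omega
  · simp only [Finset.mem_filter, Finset.mem_range]; omega
  · simp

theorem stablePos_lt_iff (K : ℕ) (κ : ℕ → ℕ) {t u : ℕ} (ht : t < K) (hu : u < K) :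
    stablePos K κ t < stablePos K κ u ↔ κ t < κ u ∨ (κ t = κ u ∧ t < u) := by
  refine ⟨fun h => ?_, stablePos_lt_of K κ ht hu⟩
  by_contra hn
  rcases eq_or_ne t u with rfl | hne
  · exact lt_irrefl _ h
  · exact lt_asymm h (stablePos_lt_of K κ hu ht (by omega))

theorem stablePos_lt (K : ℕ) (κ : ℕ → ℕ) {t : ℕ} (ht : t < K) : stablePos K κ t < K := by
  rw [stablePos_eq K κ ht, Nat.count_eq_card_filter_range]
  refine (Finset.card_lt_card (Finset.ssubset_iff_of_subset (Finset.filter_subset _ _) |>.2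
    ⟨t, by simpa using ht, by simp⟩)).trans_eq (Finset.card_range K)

theorem stablePos_isPerm (K : ℕ) (κ : ℕ → ℕ) : IsPerm K (stablePos K κ) := by
  refine ⟨fun t => stablePos_lt K κ, fun t ht u hu h => ?_⟩
  by_contra hne
  rcases Nat.lt_trichotomy (κ t) (κ u) with h1 | h1 | h1
  · exact (stablePos_lt_of K κ ht hu (Or.inl h1)).ne h
  · rcases Nat.lt_or_gt_of_ne hne with h2 | h2
    · exact (stablePos_lt_of K κ ht hu (Or.inr ⟨h1, h2⟩)).ne h
    · exact (stablePos_lt_of K κ hu ht (Or.inr ⟨h1.symm, h2⟩)).ne h.symm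
  · exact (stablePos_lt_of K κ hu ht (Or.inl h1)).ne h.symm

/-- The items `X 0, …, X (K - 1)` are sorted by `f`. -/
def SortedBy {α : Type*} [Preorder α] (K : ℕ) (X : ℕ → ℕ) (f : ℕ → α) : Prop :=
  ∀ t u, t < u → u < K → f (X t) ≤ f (X u)

/-- A stable sort by `key` of what is sorted by `g` is sorted by the pair `(key, g)`. -/
theorem stable_sorted {α : Type*} [LinearOrder α] {K : ℕ} {X Y key : ℕ → ℕ} {g : ℕ → α}
    (hg : SortedBy K X g) (hY : ∀ t < K, Y (stablePos K (fun t => key (X t)) t) = X t) :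
    SortedBy K Y (fun i => toLex (key i, g i)) := by
  intro a b hab hb
  obtain ⟨t, ht, rfl⟩ := (stablePos_isPerm K (fun t => key (X t))).surj (hab.trans hb)
  obtain ⟨u, hu, rfl⟩ := (stablePos_isPerm K (fun t => key (X t))).surj hb
  rw [stablePos_lt_iff _ _ ht hu] at hab
  rw [hY t ht, hY u hu, Prod.Lex.toLex_le_toLex]
  rcases hab with h | ⟨h, h'⟩
  · exact Or.inl h
  · exact Or.inr ⟨h, hg t u h' hu⟩

/-! ### Stable counting sort

The arrays (`a_…`) and registers (`r_…`) of the program are numbered by notations rather than by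
definitions, so that simplification by `Nat.reduceEqDiff` tells them apart. The arrays `0` and `1` are
reserved for the results, the registers `0` and `1` for `n` and `m`. A register may serve several purposes, one after the other. -/

notation "a_ord" => (20 : ℕ)
notation "a_key" => (21 : ℕ)
notation "a_cnt" => (22 : ℕ)
notation "a_tmp" => (23 : ℕ)
notation "r_K" => (10 : ℕ)
notation "r_M" => (11 : ℕ)
notation "r_t" => (12 : ℕ)
notation "r_x" => (13 : ℕ)
notation "r_k" => (14 : ℕ)
notation "r_d" => (15 : ℕ)
notation "r_M1" => (16 : ℕ)

/-- Stable counting sort of the array `a_ord` of `K` items by `a_key`, whose entries are less than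
`M`. -/
def countingSort : Cmd :=
  .set r_M1 (.reg r_M + 1) ;;
  .for r_t 0 r_M1 (.put a_cnt (.reg r_t) 0) ;;
  .for r_t 0 r_K
    (.set r_k (.cell a_key (.reg r_t) + 1) ;;
      .put a_cnt (.reg r_k) (.cell a_cnt (.reg r_k) + 1)) ;;
  .for r_t 1 r_M1
    (.put a_cnt (.reg r_t) (.cell a_cnt (.reg r_t) + .cell a_cnt (.reg r_t - 1))) ;;
  .for r_t 0 r_K
    (.set r_x (.cell a_ord (.reg r_t)) ;;
      .set r_k (.cell a_key (.reg r_x)) ;;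
      .set r_d (.cell a_cnt (.reg r_k)) ;;
      .put a_tmp (.reg r_d) (.reg r_x) ;;
      .put a_cnt (.reg r_k) (.reg r_d + 1)) ;;
  .for r_t 0 r_K (.put a_ord (.reg r_t) (.cell a_tmp (.reg r_t)))

section
variable {S : List ℤ} {cap W : ℕ}

/-- Counting sort moves the item at position `t` to its stable position. -/
theorem countingSort_spec {σ : State} {T K M : ℕ} (hK : σ.reg r_K = K) (hM : σ.reg r_M = M)
    (hKc : K ≤ cap) (hMc : M + 1 ≤ cap) (hW : K + M + 2 ≤ W)
    (hkey : ∀ i < K, σ.arr a_key i < M) (hX : IsPerm K (σ.arr a_ord)) :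
    wp S cap W countingSort (fun τ T' => T' ≤ T + 200 * (K + M + 1) ∧ IsPerm K (τ.arr a_ord) ∧
      ∀ t < K, τ.arr a_ord (stablePos K (fun t => σ.arr a_key (σ.arr a_ord t)) t)
        = σ.arr a_ord t) σ T := by
  unfold countingSort
  simp only [wp_rules, ok_rules, eval_rules, hM, Nat.reduceLT]
  refine ⟨by omega, by omega, ?_⟩
  set σ₁ := σ.setReg r_M1 (M + 1) with hσ₁
  refine wp_for_const (fun k τ => ∀ v < k, τ.arr a_cnt v = 0) 0 (M + 1) 6 (by norm_num)
    (by norm_num) (by norm_num) rfl rfl (by simp [hσ₁]) (by omega) (by omega) (by simp [ok_rules])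
    (by simp [eval_rules]) (by simp) ?_ ?_
  · intro k τ T' _ hk hkτ hf hI
    simp only [wp_rules, ok_rules, eval_rules, hkτ, Nat.reduceLT]
    refine ⟨by omega, ?_, by omega⟩
    intro v hv
    split_ifs with h
    · rfl
    · exact hI v (by omega)
  intro τ₁ T₁ _ f₁ h₁ ht₁
  have k₁ : τ₁.reg r_K = K := by rw [f₁.reg r_K]; simp [hσ₁, hK]
  have key₁ : τ₁.arr a_key = σ.arr a_key := f₁.arr a_key
  refine wp_for_const (fun k τ => ∀ v < M + 1, τ.arr a_cnt v =
      Nat.count (fun i => σ.arr a_key i + 1 = v) k) 0 K 20 (by norm_num)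
    (by norm_num) (by norm_num) rfl rfl k₁ (by omega) (by omega) (by simp [ok_rules])
    (by simp [eval_rules]) (by simpa using fun v hv => h₁ v (by omega)) ?_ ?_
  · intro k τ T' _ hk hkτ hf hI
    have hkey' : τ.arr a_key = σ.arr a_key := (hf.arr a_key).trans key₁
    have hb := hkey k hk
    have hc : Nat.count (fun i => σ.arr a_key i + 1 = σ.arr a_key k + 1) k ≤ k := Nat.count_le _
    simp only [wp_rules, ok_rules, eval_rules, hkτ, hkey', Nat.reduceLT, Nat.reduceEqDiff, if_true,
      if_false]
    rw [hI _ (by omega)]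
    repeat refine And.intro (by omega) ?_
    refine ⟨?_, by omega⟩
    intro v hv
    rw [Nat.count_succ, hI v hv]
    split_ifs <;> first | omega | (subst_vars; omega)
  intro τ₂ T₂ _ f₂ h₂ ht₂
  have m₂ : τ₂.reg r_M1 = M + 1 := by rw [f₂.reg r_M1, f₁.reg r_M1]; simp [hσ₁]
  refine wp_for_const (fun k τ => ∀ v < M + 1, τ.arr a_cnt v =
      if v < k then Nat.count (fun i => σ.arr a_key i < v) K
      else Nat.count (fun i => σ.arr a_key i + 1 = v) K) 1 (M + 1) 20 (by norm_num)
    (by norm_num) (by norm_num) rfl rfl m₂ (by omega) (by omega) (by simp [ok_rules]; omega)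
    (by simp [eval_rules]) ?_ ?_ ?_
  · intro v hv
    simp only [eval_rules]
    rw [h₂ v hv]
    split_ifs with h
    · exact Nat.count_congr' fun t _ => by omega
    · rfl
  · intro k τ T' hk1 hk hkτ hf hI
    have hc1 : τ.arr a_cnt k = Nat.count (fun i => σ.arr a_key i + 1 = k) K := by
      rw [hI k hk, if_neg (lt_irrefl _)]
    have hc2 : τ.arr a_cnt (k - 1) = Nat.count (fun i => σ.arr a_key i < k - 1) K := by
      rw [hI (k - 1) (by omega), if_pos (by omega)]
    have hc3 : Nat.count (fun i => σ.arr a_key i < k) K =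
        Nat.count (fun i => σ.arr a_key i + 1 = k) K +
        Nat.count (fun i => σ.arr a_key i < k - 1) K := by
      rw [← Nat.count_or' (fun t _ h => by omega)]
      exact Nat.count_congr' fun t _ => by omega
    have hc4 : Nat.count (fun i => σ.arr a_key i < k) K ≤ K := Nat.count_le _
    simp only [wp_rules, ok_rules, eval_rules, hkτ, Nat.reduceLT, hc1, hc2, ← hc3]
    repeat refine And.intro (by omega) ?_
    refine ⟨?_, by omega⟩
    intro v hv
    by_cases hvk : v = k
    · subst hvk; simp
    · rw [if_neg (by simpa using hvk), hI v hv]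
      by_cases h : v < k
      · rw [if_pos h, if_pos (by omega)]
      · rw [if_neg h, if_neg (by omega)]
  intro τ₃ T₃ _ f₃ h₃ ht₃
  have k₃ : τ₃.reg r_K = K := by rw [f₃.reg r_K, f₂.reg r_K, k₁]
  have key₃ : τ₃.arr a_key = σ.arr a_key := by rw [f₃.arr a_key, f₂.arr a_key, key₁]
  have ord₃ : τ₃.arr a_ord = σ.arr a_ord := by rw [f₃.arr a_ord, f₂.arr a_ord, f₁.arr a_ord]; rfl
  set κ : ℕ → ℕ := fun t => σ.arr a_key (σ.arr a_ord t) with hκ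
  have hd := stablePos_isPerm K κ
  refine wp_for_const (fun k τ => (∀ v < M, τ.arr a_cnt v =
      Nat.count (fun i => σ.arr a_key i < v) K + Nat.count (fun t => κ t = v) k) ∧
      ∀ t < k, τ.arr a_tmp (stablePos K κ t) = σ.arr a_ord t) 0 K 40 (by norm_num)
    (by norm_num) (by norm_num) rfl rfl k₃ (by omega) (by omega) (by simp [ok_rules])
    (by simp [eval_rules]) ?_ ?_ ?_
  · refine ⟨fun v hv => ?_, by simp⟩
    simp only [eval_rules, h₃ v (by omega), Nat.count_zero, add_zero]
    rw [if_pos (by omega)]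
  · rintro k τ T' _ hk hkτ hf ⟨hI, hJ⟩
    have hkey' : τ.arr a_key = σ.arr a_key := (hf.arr a_key).trans key₃
    have hord' : τ.arr a_ord = σ.arr a_ord := (hf.arr a_ord).trans ord₃
    have hx := hX.1 k hk
    have hb := hkey _ hx
    have hdk : τ.arr a_cnt (σ.arr a_key (σ.arr a_ord k)) = stablePos K κ k := by
      rw [hI _ hb, stablePos]
      congr 1
      exact (hX.count_comp (fun i => σ.arr a_key i < κ k)).symm
    have hdK := stablePos_lt K κ hk
    simp only [wp_rules, ok_rules, eval_rules, hkτ, hkey', hord', Nat.reduceLT, Nat.reduceEqDiff, if_true,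
      if_false, hdk]
    repeat refine And.intro (by omega) ?_
    refine ⟨?_, ?_, by omega⟩
    · intro v hv
      split_ifs with h
      · subst h
        rw [Nat.count_succ, if_pos rfl, ← add_assoc, ← hI _ hb, hdk]
      · rw [Nat.count_succ, if_neg (fun h' => h h'.symm), hI v hv]; rfl
    · intro t ht
      by_cases htk : t = k
      · subst htk; simp
      · rw [if_neg fun h => htk (hd.2 t (by omega) k hk h)]
        exact hJ t (by omega)
  intro τ₄ T₄ _ f₄ h₄ ht₄
  have k₄ : τ₄.reg r_K = K := by rw [f₄.reg r_K, k₃]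
  refine wp_for_const (fun k τ => ∀ t < k, τ.arr a_ord t = τ₄.arr a_tmp t) 0 K 10 (by norm_num)
    (by norm_num) (by norm_num) rfl rfl k₄ (by omega) (by omega) (by simp [ok_rules])
    (by simp [eval_rules]) (by simp) ?_ ?_
  · rintro k τ T' _ hk hkτ hf hI
    simp only [wp_rules, ok_rules, eval_rules, hkτ, Nat.reduceLT, Nat.reduceEqDiff, if_true, if_false]
    refine ⟨by omega, by omega, ?_, by omega⟩
    intro t ht
    split_ifs with h
    · rw [h, hf.arr a_tmp]
    · exact hI t (by omega)
  intro τ₅ T₅ _ f₅ h₅ ht₅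
  have hY : ∀ t < K, τ₅.arr a_ord (stablePos K κ t) = σ.arr a_ord t := fun t ht => by
    rw [h₅ _ (stablePos_lt K κ ht), h₄.2 t ht]
  refine ⟨?_, IsPerm.of_surj ?_ ?_, hY⟩
  · simp only [eval_rules] at ht₁ ht₂ ht₃ ht₄ ht₅
    omega
  · intro t ht
    obtain ⟨u, hu, rfl⟩ := hd.surj ht
    rw [hY u hu]
    exact hX.1 u hu
  · intro i hi
    obtain ⟨t, ht, rfl⟩ := hX.surj hi
    exact ⟨_, stablePos_lt K κ ht, hY t ht⟩

end

/-! ### Merge sort by the symbols of the text -/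

notation "r_w" => (20 : ℕ)
notation "r_lo" => (21 : ℕ)
notation "r_mid" => (22 : ℕ)
notation "r_hi" => (23 : ℕ)
notation "r_i" => (24 : ℕ)
notation "r_j" => (25 : ℕ)
notation "r_g" => (26 : ℕ)
notation "r_n" => (0 : ℕ)
notation "r_m" => (1 : ℕ)

/-- Merge `a_ord[lo, mid)` and `a_ord[mid, hi)` into `a_tmp[lo, hi)`, by the symbols of the text. -/
def mergeBlocks : Cmd :=
  .set r_i (.reg r_lo) ;;
  .set r_j (.reg r_mid) ;;
  .for r_k (.reg r_lo) r_hi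
    (.ite (.reg r_i) (.reg r_mid)
      (.ite (.reg r_j) (.reg r_hi)
        (.iteSym (.cell a_ord (.reg r_j)) (.cell a_ord (.reg r_i)) (.set r_g 1) (.set r_g 0))
        (.set r_g 0))
      (.set r_g 1) ;;
    .ite (.reg r_g) 1
      (.put a_tmp (.reg r_k) (.cell a_ord (.reg r_i)) ;; .set r_i (.reg r_i + 1))
      (.put a_tmp (.reg r_k) (.cell a_ord (.reg r_j)) ;; .set r_j (.reg r_j + 1)))

/-- Set register `x` to the minimum of an expression and of register `y`. -/
def Cmd.setMin (x : ℕ) (e : Expr) (y : ℕ) : Cmd :=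
  .set x e ;; .ite (.reg y) (.reg x) (.set x (.reg y)) .skip

/-- One pass of merge sort: from sorted blocks of length `w` to sorted blocks of length `2 w`. -/
def mergePass : Cmd :=
  .set r_lo 0 ;;
  .loop (.reg r_lo) (.reg r_n)
    (.setMin r_mid (.reg r_lo + .reg r_w) r_n ;;
      .setMin r_hi (.reg r_mid + .reg r_w) r_n ;;
      mergeBlocks ;;
      .set r_lo (.reg r_hi)) ;;
  .for r_t 0 r_n (.put a_ord (.reg r_t) (.cell a_tmp (.reg r_t)))

/-- Sort the positions of the text by their symbols into the array `a_ord`. -/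
def mergeSort : Cmd :=
  .for r_t 0 r_n (.put a_ord (.reg r_t) (.reg r_t)) ;;
  .set r_w 1 ;;
  .loop (.reg r_w) (.reg r_n) (mergePass ;; .set r_w (.reg r_w + .reg r_w))

section
variable {S : List ℤ} {cap W : ℕ}

theorem wp_iteSym (a b : Expr) (c d : Cmd) (Q σ T) :
    wp S cap W (.iteSym a b c d) Q σ T = (a.Ok cap W σ ∧ b.Ok cap W σ ∧
      a.eval σ < S.length ∧ b.eval σ < S.length ∧
      (S.getD (a.eval σ) 0 < S.getD (b.eval σ) 0 →
        wp S cap W c Q σ (T + (a.cost + b.cost + 1))) ∧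
      (¬ S.getD (a.eval σ) 0 < S.getD (b.eval σ) 0 →
        wp S cap W d Q σ (T + (a.cost + b.cost + 1)))) := rfl

/-- The invariant of the merging loop, `X` being the contents of `a_ord`, `Y₀` the initial contents of
`a_tmp`, and `k` the number of the next cell to be filled. -/
def MergeInv (f : ℕ → ℤ) (X Y₀ : ℕ → ℕ) (n lo mid hi k : ℕ) (τ : State) : Prop :=
  ∃ i j, τ.reg r_i = i ∧ τ.reg r_j = j ∧ lo ≤ i ∧ i ≤ mid ∧
    mid ≤ j ∧ j ≤ hi ∧ i + j = k + mid ∧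
    (∀ t < lo, τ.arr a_tmp t = Y₀ t) ∧
    (∀ s, (lo ≤ s ∧ s < i) ∨ (mid ≤ s ∧ s < j) → ∃ t, lo ≤ t ∧ t < k ∧ τ.arr a_tmp t = X s) ∧
    (∀ t, lo ≤ t → t < k → τ.arr a_tmp t < n) ∧
    (∀ a b, lo ≤ a → a < b → b < k → f (τ.arr a_tmp a) ≤ f (τ.arr a_tmp b)) ∧
    (∀ a s, lo ≤ a → a < k → (i ≤ s ∧ s < mid) ∨ (j ≤ s ∧ s < hi) →
      f (τ.arr a_tmp a) ≤ f (X s))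

/-- One step of merging: the cell `k` receives the least of the items that remain in the two
blocks. -/
theorem MergeInv.step {f : ℕ → ℤ} {X Y₀ : ℕ → ℕ} {n lo mid hi k : ℕ} {τ υ : State}
    (h : MergeInv f X Y₀ n lo mid hi k τ) (hk : lo ≤ k) (hX : ∀ t < n, X t < n)
    (h3 : hi ≤ n) (p : ℕ) (hp : υ.reg r_i + υ.reg r_j = τ.reg r_i + τ.reg r_j + 1)
    (hp' : (p = τ.reg r_i ∧ υ.reg r_i = p + 1 ∧ p < mid) ∨
      (p = τ.reg r_j ∧ υ.reg r_j = p + 1 ∧ p < hi))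
    (hmin : ∀ s, (τ.reg r_i ≤ s ∧ s < mid) ∨ (τ.reg r_j ≤ s ∧ s < hi) → f (X p) ≤ f (X s))
    (hY : ∀ t, υ.arr a_tmp t = if t = k then X p else τ.arr a_tmp t) :
    MergeInv f X Y₀ n lo mid hi (k + 1) υ := by
  obtain ⟨i, j, ri, rj, i1, i2, j1, j2, ij, c0, c1, c2, c3, c4⟩ := h
  rw [ri, rj] at hp hmin
  rw [ri, rj] at hp'
  refine ⟨υ.reg r_i, υ.reg r_j, rfl, rfl, by omega, by omega, by omega, by omega, by omega,
    ?_, ?_, ?_, ?_, ?_⟩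
  · intro t ht; rw [hY, if_neg (by omega), c0 t ht]
  · intro s hs
    by_cases hsi : s = p
    · exact ⟨k, hk, by omega, by rw [hY, if_pos rfl, hsi]⟩
    · obtain ⟨t, t1, t2, t3⟩ := c1 s (by omega)
      exact ⟨t, t1, by omega, by rw [hY, if_neg (by omega), t3]⟩
  · intro t t1 t2
    rw [hY]; split_ifs with h
    · exact hX _ (by omega)
    · exact c2 t t1 (by omega)
  · intro a b ha hab hb
    rw [hY, hY, if_neg (by omega)]
    split_ifs with h
    · exact c4 a p ha (by omega) (by omega)
    · exact c3 a b ha hab (by omega)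
  · intro a s ha hak hs
    rw [hY]; split_ifs with h
    · exact hmin s (by omega)
    · exact c4 a s ha (by omega) (by omega)

theorem mergeBlocks_spec {σ : State} {T lo mid hi n : ℕ} {f : ℕ → ℤ}
    (hf : ∀ i, f i = S.getD i 0) (hn : S.length = n)
    (hlo : σ.reg r_lo = lo) (hmid : σ.reg r_mid = mid) (hhi : σ.reg r_hi = hi)
    (h1 : lo ≤ mid) (h2 : mid ≤ hi) (h3 : hi ≤ n) (hc : n ≤ cap) (hW : 2 * n + 2 ≤ W)
    (hX : ∀ t < n, σ.arr a_ord t < n)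
    (hs1 : ∀ s s', lo ≤ s → s ≤ s' → s' < mid → f (σ.arr a_ord s) ≤ f (σ.arr a_ord s'))
    (hs2 : ∀ s s', mid ≤ s → s ≤ s' → s' < hi → f (σ.arr a_ord s) ≤ f (σ.arr a_ord s')) :
    wp S cap W mergeBlocks (fun τ T' => T' ≤ T + 100 * (hi - lo) + 40 ∧
      (∀ t < lo, τ.arr a_tmp t = σ.arr a_tmp t) ∧
      (∀ s, lo ≤ s → s < hi → ∃ t, lo ≤ t ∧ t < hi ∧ τ.arr a_tmp t = σ.arr a_ord s) ∧
      (∀ t, lo ≤ t → t < hi → τ.arr a_tmp t < n) ∧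
      (∀ a b, lo ≤ a → a < b → b < hi → f (τ.arr a_tmp a) ≤ f (τ.arr a_tmp b))) σ T := by
  unfold mergeBlocks
  simp only [wp_rules, ok_rules, eval_rules, hlo, hmid, hhi, Nat.reduceLT, Nat.reduceEqDiff, if_false]
  refine wp_for_const (MergeInv f (σ.arr a_ord) (σ.arr a_tmp) n lo mid hi) lo hi 60
    (by norm_num) (by norm_num) (by norm_num) rfl rfl (by simp [hhi]) (by omega) (by omega)
    (by simp [ok_rules]) (by simp [eval_rules, hlo]) ?_ ?_ ?_
  · refine ⟨lo, mid, by simp, by simp, le_rfl, h1, le_rfl, h2, rfl, by simp, ?_, ?_, ?_, ?_⟩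
    · intro s h; omega
    · intro t h h'; omega
    · intro a b h h' h''; omega
    · intro a s h h'; omega
  · rintro k τ T' hk1 hk hkτ hfr hI
    have hI' := hI
    obtain ⟨i, j, ri, rj, i1, i2, j1, j2, ij, -⟩ := hI'
    have ho : τ.arr a_ord = σ.arr a_ord := hfr.arr a_ord
    have hm' : τ.reg r_mid = mid := by rw [hfr.reg r_mid]; simp [hmid]
    have hh' : τ.reg r_hi = hi := by rw [hfr.reg r_hi]; simp [hhi]
    simp only [wp_rules, wp_iteSym, ok_rules, eval_rules, hkτ, ho, hm', hh', ri, rj, hn,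
      Nat.reduceLT, Nat.reduceEqDiff, if_true, if_false, not_true, false_imp_iff, true_imp_iff,
      not_false_eq_true]
    have m1 : i < mid → (j < hi → f (σ.arr a_ord i) ≤ f (σ.arr a_ord j)) →
        ∀ s, (i ≤ s ∧ s < mid) ∨ (j ≤ s ∧ s < hi) → f (σ.arr a_ord i) ≤ f (σ.arr a_ord s) :=
      fun h h' s hs => hs.elim (fun hs => hs1 i s i1 hs.1 hs.2)
        fun hs => (h' (by omega)).trans (hs2 j s j1 hs.1 hs.2)
    have m2 : j < hi → (i < mid → f (σ.arr a_ord j) ≤ f (σ.arr a_ord i)) →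
        ∀ s, (i ≤ s ∧ s < mid) ∨ (j ≤ s ∧ s < hi) → f (σ.arr a_ord j) ≤ f (σ.arr a_ord s) :=
      fun h h' s hs => hs.elim (fun hs => (h' (by omega)).trans (hs1 i s i1 hs.1 hs.2))
        fun hs => hs2 j s j1 hs.1 hs.2
    refine ⟨fun hi1 => ⟨fun hj1 => ?_, fun hj1 => ?_⟩, fun hi1 => ?_⟩
    · refine ⟨by omega, by omega, hX _ (by omega), hX _ (by omega), fun hlt => ?_, fun hlt => ?_⟩
      · repeat refine And.intro (by omega) ?_
        refine ⟨hI.step hk1 hX h3 j (by simp [ri, rj]; omega) (Or.inr (by simp [rj, hj1])) ?_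
          (by intro t; simp), by omega⟩
        rw [ri, rj]
        exact m2 hj1 fun _ => by rw [hf, hf]; exact hlt.le
      · repeat refine And.intro (by omega) ?_
        refine ⟨hI.step hk1 hX h3 i (by simp [ri, rj]; omega) (Or.inl (by simp [ri, hi1])) ?_
          (by intro t; simp), by omega⟩
        rw [ri, rj]
        exact m1 hi1 fun _ => by rw [hf, hf]; exact not_lt.1 hlt
    · repeat refine And.intro (by omega) ?_
      refine ⟨hI.step hk1 hX h3 i (by simp [ri, rj]; omega) (Or.inl (by simp [ri, hi1])) ?_
        (by intro t; simp), by omega⟩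
      rw [ri, rj]
      exact m1 hi1 fun h => absurd h hj1
    · have hj1 : j < hi := by omega
      repeat refine And.intro (by omega) ?_
      refine ⟨hI.step hk1 hX h3 j (by simp [ri, rj]; omega) (Or.inr (by simp [rj, hj1])) ?_
        (by intro t; simp), by omega⟩
      rw [ri, rj]
      exact m2 hj1 fun h => absurd h hi1
  · rintro τ T' - hfr ⟨i, j, ri, rj, i1, i2, j1, j2, ij, c0, c1, c2, c3, c4⟩ hT
    simp only [eval_rules] at hT
    exact ⟨by omega, c0, fun s h h' => c1 s (by omega), c2, c3⟩

theorem wp_setMin {x y : ℕ} {e : Expr} {Q : State → ℕ → Prop} {σ : State} {T : ℕ} (hx : x < 1000)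
    (hy : y < 1000) (hxy : y ≠ x) (he : e.Ok cap W σ)
    (h : ∀ υ : State, υ.reg x = min (e.eval σ) (σ.reg y) → (∀ z, z ≠ x → υ.reg z = σ.reg z) →
      υ.arr = σ.arr → ∀ T', T' ≤ T + e.cost + 15 → Q υ T') :
    wp S cap W (.setMin x e y) Q σ T := by
  unfold Cmd.setMin
  simp only [wp_rules, ok_rules, eval_rules, hx, hy, hxy, if_true, if_false]
  refine ⟨he, fun hlt => ?_, fun hlt => ?_⟩
  · refine h _ ?_ (fun z hz => ?_) ?_ _ ?_
    · simp; omega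
    · simp [hz]
    · rfl
    · omega
  · refine h _ ?_ (fun z hz => ?_) ?_ _ ?_
    · simp; omega
    · simp [hz]
    · rfl
    · omega

/-- The items of each block of length `d` are sorted by `f`. -/
def BlocksSorted (f : ℕ → ℤ) (X : ℕ → ℕ) (d n : ℕ) : Prop :=
  ∀ a b, a ≤ b → b < n → a / d = b / d → f (X a) ≤ f (X b)

theorem mergePass_spec {σ : State} {T w n : ℕ} {f : ℕ → ℤ}
    (hf : ∀ i, f i = S.getD i 0) (hn : S.length = n) (hrn : σ.reg r_n = n)
    (hw : σ.reg r_w = w) (hw0 : 0 < w) (hwn : w < n) (hc : n ≤ cap) (hW : 2 * n + 2 ≤ W)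
    (hX : IsPerm n (σ.arr a_ord)) (hs : BlocksSorted f (σ.arr a_ord) w n) :
    wp S cap W mergePass (fun τ T' => T' ≤ T + 400 * n + 40 ∧
      IsPerm n (τ.arr a_ord) ∧ BlocksSorted f (τ.arr a_ord) (w + w) n) σ T := by
  unfold mergePass
  simp only [wp_rules, ok_rules, eval_rules, Nat.reduceLT]
  refine wp_while (fun τ T' => ∃ lo, τ.reg r_lo = lo ∧ lo ≤ n ∧
      (lo < n → ∃ q, lo = q * (w + w)) ∧ T' ≤ T + 5 + 300 * lo ∧
      (∀ s < lo, ∃ t < lo, τ.arr a_tmp t = σ.arr a_ord s) ∧ (∀ t < lo, τ.arr a_tmp t < n) ∧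
      BlocksSorted f (τ.arr a_tmp) (w + w) lo) (fun τ => n - τ.reg r_lo)
    ?_ ?_
  · exact ⟨0, by simp, by omega, fun _ => ⟨0, by simp⟩, by omega, by simp, by simp,
      fun a b _ h => by omega⟩
  rintro τ T₁ hfr ⟨lo, hlo, hlon, hq, hT, c1, c2, c3⟩
  have ho : τ.arr a_ord = σ.arr a_ord := hfr.arr a_ord
  have hw' : τ.reg r_w = w := by rw [hfr.reg r_w]; simp [hw]
  have hn' : τ.reg r_n = n := by rw [hfr.reg r_n]; simp [hrn]
  simp only [wp_rules, ok_rules, eval_rules, hlo, hn', Nat.reduceLT]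
  refine ⟨fun hlt => ?_, fun hlt => ?_⟩
  · obtain ⟨q, hq⟩ := hq hlt
    refine wp_setMin (by norm_num) (by norm_num) (by norm_num)
      (by simp only [ok_rules, eval_rules, Nat.reduceLT, hlo, hw']; omega) ?_
    intro τ₁ e1 f1 a1 T1 hT1
    simp only [eval_rules, hlo, hw', hn'] at e1 hT1
    refine wp_setMin (by norm_num) (by norm_num) (by norm_num)
      (by simp only [ok_rules, eval_rules, Nat.reduceLT, e1, f1 20 (by norm_num), hw']; omega) ?_
    intro τ₂ e2 f2 a2 T2 hT2
    simp only [eval_rules, e1, f1 20 (by norm_num), hw', f1 0 (by norm_num), hn'] at e2 hT2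
    have o2 : τ₂.arr = τ.arr := a2.trans a1
    have l2 : τ₂.reg r_lo = lo := by rw [f2 _ (by norm_num), f1 _ (by norm_num), hlo]
    have m2 : τ₂.reg r_mid = min (lo + w) n := by rw [f2 _ (by norm_num), e1]
    set mid := min (lo + w) n with hmid
    set hi := min (mid + w) n with hhi
    have hdiv : ∀ b, lo ≤ b → b < hi → b / (w + w) = q := fun b h1 h2 =>
      Nat.div_eq_of_lt_le (by omega) (by rw [Nat.succ_mul]; omega)
    have hdiv1 : ∀ b, lo ≤ b → b < mid → b / w = q + q := fun b h1 h2 =>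
      Nat.div_eq_of_lt_le (by rw [← hq.trans (by ring : _ = (q + q) * w)]; omega)
        (by rw [Nat.succ_mul, ← hq.trans (by ring : _ = (q + q) * w)]; omega)
    have hdiv2 : ∀ b, mid ≤ b → b < hi → b / w = q + q + 1 := fun b h1 h2 =>
      Nat.div_eq_of_lt_le
        (by rw [Nat.succ_mul, ← hq.trans (by ring : _ = (q + q) * w)]; omega)
        (by rw [Nat.succ_mul, Nat.succ_mul, ← hq.trans (by ring : _ = (q + q) * w)]; omega)
    refine wp_then (mergeBlocks_spec hf hn l2 m2 e2 (by omega) (by omega) (by omega) hc hW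
      (by rw [o2, ho]; exact hX.1) ?_ ?_) ?_
    · intro s s' h1 h2 h3
      rw [o2, ho]
      exact hs s s' h2 (by omega) (by rw [hdiv1 s h1 (by omega), hdiv1 s' (by omega) h3])
    · intro s s' h1 h2 h3
      rw [o2, ho]
      exact hs s s' h2 (by omega) (by rw [hdiv2 s h1 (by omega), hdiv2 s' (by omega) h3])
    rintro τ₃ T₃ f3 ⟨hT3, d0, d1, d2, d3⟩
    have h3 : τ₃.reg r_hi = hi := by rw [f3.reg r_hi, e2]
    rw [o2] at d0 d1
    simp only [wp_rules, ok_rules, eval_rules, h3, Nat.reduceLT]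
    refine ⟨⟨hi, by simp, by omega, fun h => ⟨q + 1, by rw [Nat.succ_mul]; omega⟩, by omega,
      ?_, ?_, ?_⟩, by simp; omega⟩
    · intro s hs'
      by_cases h : s < lo
      · obtain ⟨t, t1, t2⟩ := c1 s h
        exact ⟨t, by omega, by rw [d0 t t1, t2]⟩
      · obtain ⟨t, t1, t2, t3⟩ := d1 s (by omega) hs'
        exact ⟨t, t2, by rw [t3, ho]⟩
    · intro t ht
      by_cases h : t < lo
      · rw [d0 t h]; exact c2 t h
      · exact d2 t (by omega) ht
    · intro a b hab hb he
      by_cases h : b < lo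
      · rw [d0 a (by omega), d0 b h]
        exact c3 a b hab h he
      · rw [hdiv b (by omega) hb] at he
        have : lo ≤ a := by
          rw [hq, ← he]; exact Nat.div_mul_le_self _ _
        rcases Nat.eq_or_lt_of_le hab with rfl | hab
        · exact le_rfl
        · exact d3 a b this hab hb
  · have hln : lo = n := by omega
    subst hln
    refine wp_for_const (fun k υ => ∀ t < k, υ.arr a_ord t = τ.arr a_tmp t) 0 lo 20
      (by norm_num) (by norm_num) (by norm_num) rfl rfl hn' (by omega) (by omega)
      (by simp [ok_rules]) (by simp [eval_rules]) (by simp) ?_ ?_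
    · intro k υ T' _ hk hkυ hf' hI
      simp only [wp_rules, ok_rules, eval_rules, hkυ, Nat.reduceLT, Nat.reduceEqDiff, if_true]
      repeat refine And.intro (by omega) ?_
      refine ⟨?_, by omega⟩
      intro t ht
      split_ifs with h
      · rw [h, hf'.arr a_tmp]
      · exact hI t (by omega)
    · intro υ T' _ hf' hI hT'
      simp only [eval_rules] at hT'
      refine ⟨by omega, IsPerm.of_surj ?_ ?_, ?_⟩
      · intro t ht
        rw [hI t ht]; exact c2 t ht
      · intro i hi
        obtain ⟨s, hs', rfl⟩ := hX.surj hi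
        obtain ⟨t, ht, e⟩ := c1 s hs'
        exact ⟨t, ht, by rw [hI t ht, e]⟩
      · intro a b hab hb he
        rw [hI a (by omega), hI b hb]
        exact c3 a b hab hb he

/-- There are at most `log n + 1` passes, of linear time each. -/
theorem mergeSort_spec {σ : State} {T n : ℕ} {f : ℕ → ℤ}
    (hf : ∀ i, f i = S.getD i 0) (hn : S.length = n) (hrn : σ.reg r_n = n) (hn0 : 0 < n)
    (hc : n ≤ cap) (hW : 2 * n + 2 ≤ W) :
    wp S cap W mergeSort (fun τ T' => T' ≤ T + 1000 * (n * (Nat.log 2 n + 1)) ∧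
      IsPerm n (τ.arr a_ord) ∧ SortedBy n (τ.arr a_ord) f) σ T := by
  unfold mergeSort
  simp only [wp_rules]
  refine wp_for_const (fun k υ => ∀ t < k, υ.arr a_ord t = t) 0 n 20
    (by norm_num) (by norm_num) (by norm_num) rfl rfl hrn (by omega) (by omega)
    (by simp [ok_rules]) (by simp [eval_rules]) (by simp) ?_ ?_
  · intro k υ T' _ hk hkυ hf' hI
    simp only [wp_rules, ok_rules, eval_rules, hkυ, Nat.reduceLT, Nat.reduceEqDiff, if_true]
    repeat refine And.intro (by omega) ?_
    refine ⟨?_, by omega⟩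
    intro t ht
    split_ifs with h
    · exact h.symm
    · exact hI t (by omega)
  intro τ₁ T₁ _ f₁ h₁ hT₁
  simp only [wp_rules, ok_rules, eval_rules, Nat.reduceLT] at hT₁ ⊢
  refine ⟨by omega, ?_⟩
  refine wp_while (fun τ T' => ∃ k, τ.reg r_w = 2 ^ k ∧ 2 ^ k < 2 * n ∧
      T' ≤ T + 50 * n + (400 * n + 100) * k ∧ IsPerm n (τ.arr a_ord) ∧
      BlocksSorted f (τ.arr a_ord) (2 ^ k) n) (fun τ => n - τ.reg r_w)
    ⟨0, by simp, by omega, by omega, ?_, ?_⟩ ?_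
  · rw [State.setReg_arr]
    exact IsPerm.of_surj (fun t ht => by rw [h₁ t ht]; exact ht) fun i hi => ⟨i, hi, h₁ i hi⟩
  · intro a b _ _ h
    simp only [pow_zero, Nat.div_one] at h
    rw [h]
  rintro τ T' hfr ⟨k, hk, hk2, hT, hp, hs⟩
  have hn' : τ.reg r_n = n := by rw [hfr.reg r_n, State.setReg_reg, if_neg (by norm_num),
    f₁.reg r_n, hrn]
  simp only [wp_rules, ok_rules, eval_rules, hk, hn', Nat.reduceLT]
  refine ⟨fun hlt => ?_, fun hlt => ?_⟩
  · refine wp_last (mergePass_spec hf hn hn' hk (by positivity) hlt hc hW hp hs) ?_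
    rintro υ T'' f2 ⟨hT2, p2, s2⟩
    have hk' : υ.reg r_w = 2 ^ k := by rw [f2.reg r_w, hk]
    have hpow : 2 ^ (k + 1) = 2 ^ k + 2 ^ k := by ring
    simp only [wp_rules, ok_rules, eval_rules, hk', Nat.reduceLT]
    have hpos : 0 < 2 ^ k := by positivity
    refine ⟨by omega, ⟨k + 1, by simp [hpow], by omega, ?_, p2, by rwa [hpow]⟩, by simp; omega⟩
    rw [mul_add _ k 1]
    omega
  · refine ⟨?_, hp, fun a b hab hb => hs a b hab.le hb ?_⟩
    · have hkl : k ≤ Nat.log 2 n + 1 := by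
        by_contra hcon
        have h2 : n < 2 ^ (Nat.log 2 n + 1) := Nat.lt_pow_succ_log_self (by norm_num) n
        have h3 : 2 ^ (Nat.log 2 n + 1 + 1) ≤ 2 ^ k := Nat.pow_le_pow_right (by norm_num) (by omega)
        rw [pow_succ] at h3
        omega
      have h4 : (400 * n + 100) * k ≤ (500 * n) * (Nat.log 2 n + 1) :=
        Nat.mul_le_mul (by omega) hkl
      have h5 : n ≤ n * (Nat.log 2 n + 1) := Nat.le_mul_of_pos_right _ (by omega)
      rw [mul_assoc] at h4
      omega
    · rw [Nat.div_eq_of_lt (by omega), Nat.div_eq_of_lt (by omega)]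

end

/-! ### Suffixes -/

/-- The length-`l` prefix of the suffix that starts at position `i`, cut off at the end of the text. -/
def pre (S : List ℤ) (l i : ℕ) : List ℤ := (S.drop i).take l

theorem append_lt_append_of_lt {a b : List ℤ} (h : a < b) {a' b' : List ℤ}
    (hl : a.length < b.length → a' = []) : a ++ a' < b ++ b' := by
  induction a generalizing b with
  | nil =>
    cases b with
    | nil => exact absurd h (lt_irrefl _)
    | cons y t => rw [hl (by simp)]; simp
  | cons x s ih =>
    cases b with
    | nil => exact absurd h (by simp)
    | cons y t =>
      rw [List.cons_append, List.cons_append, List.cons_lt_cons_iff]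
      rw [List.cons_lt_cons_iff] at h
      rcases h with h | ⟨rfl, h⟩
      · exact Or.inl h
      · exact Or.inr ⟨rfl, ih h fun h' => hl (by simpa using h')⟩

/-- Concatenations are compared by their first parts, and then by their second parts, provided that
a first part is followed by something only if it is not shorter than the other one. This is the
situation for prefixes of suffixes, where only a suffix that has ended is cut short. -/
theorem append_lt_append_iff {a b a' b' : List ℤ} (h1 : a.length < b.length → a' = [])
    (h2 : b.length < a.length → b' = []) :
    a ++ a' < b ++ b' ↔ a < b ∨ (a = b ∧ a' < b') := by
  rcases lt_trichotomy a b with h | rfl | h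
  · exact ⟨fun _ => Or.inl h, fun _ => append_lt_append_of_lt h h1⟩
  · constructor
    · intro h
      refine Or.inr ⟨rfl, ?_⟩
      rcases lt_trichotomy a' b' with h' | rfl | h'
      · exact h'
      · exact absurd h (lt_irrefl _)
      · exact absurd h (lt_asymm (List.append_left_lt h'))
    · rintro (h | ⟨-, h⟩)
      · exact absurd h (lt_irrefl _)
      · exact List.append_left_lt h
  · have := append_lt_append_of_lt h (a' := b') (b' := a') h2
    constructor
    · exact fun h' => absurd h' (lt_asymm (this))
    · rintro (h' | ⟨rfl, -⟩)
      · exact absurd h' (lt_asymm h)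
      · exact absurd h (lt_irrefl _)

theorem pre_add (S : List ℤ) (l l' i : ℕ) : pre S (l + l') i = pre S l i ++ pre S l' (i + l) := by
  rw [pre, pre, pre, List.take_add, List.drop_drop]

theorem pre_min (S : List ℤ) (l i : ℕ) : pre S l (min i S.length) = pre S l i := by
  rcases le_total i S.length with h | h
  · rw [min_eq_left h]
  · rw [min_eq_right h, pre, pre, List.drop_length, List.drop_eq_nil_of_le h]

theorem pre_eq_drop (S : List ℤ) {l : ℕ} (i : ℕ) (h : S.length ≤ l) : pre S l i = S.drop i := by
  rw [pre, List.take_of_length_le (by simp; omega)]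

theorem pre_double_lt_iff (S : List ℤ) (l i j : ℕ) :
    pre S (l + l) i < pre S (l + l) j ↔ pre S l i < pre S l j ∨
      (pre S l i = pre S l j ∧
        pre S l (min (i + l) S.length) < pre S l (min (j + l) S.length)) := by
  have key : ∀ i j, (pre S l i).length < (pre S l j).length → pre S l (i + l) = [] := by
    intro i j h
    simp only [pre, List.length_take, List.length_drop] at h
    rw [pre, List.drop_eq_nil_of_le (by omega), List.take_nil]
  rw [pre_add, pre_add, pre_min, pre_min, append_lt_append_iff (key i j) (key j i)]

/-- The numbers `nm i` are ordered as the length-`l` prefixes of the suffixes. -/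
def IsNaming (S : List ℤ) (l : ℕ) (nm : ℕ → ℕ) : Prop :=
  ∀ i ≤ S.length, ∀ j ≤ S.length, nm i < nm j ↔ pre S l i < pre S l j

/-- As `nm` respects the strict order, equal names mean equal prefixes. -/
theorem IsNaming.eq_iff {S : List ℤ} {l : ℕ} {nm : ℕ → ℕ} (h : IsNaming S l nm) {i j : ℕ}
    (hi : i ≤ S.length) (hj : j ≤ S.length) : nm i = nm j ↔ pre S l i = pre S l j := by
  constructor
  · intro e
    rcases lt_trichotomy (pre S l i) (pre S l j) with h' | h' | h'
    · exact absurd ((h i hi j hj).2 h') (by omega)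
    · exact h'
    · exact absurd ((h j hj i hi).2 h') (by omega)
  · intro e
    have h1 := (h i hi j hj).not
    have h2 := (h j hj i hi).not
    rw [e] at h1 h2
    have := h1.2 (lt_irrefl _)
    have := h2.2 (lt_irrefl _)
    omega

notation "a_new" => (24 : ℕ)
notation "a_nm" => (25 : ℕ)
notation "a_sec" => (26 : ℕ)
notation "a_sym" => (27 : ℕ)
notation "a_sa" => (28 : ℕ)
notation "r_l" => (27 : ℕ)
notation "r_y" => (28 : ℕ)

/-- Number the items of the sorted array `a_ord`, equal items alike; `test` sets `r_g` to `0` if the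
items at the positions `r_t - 1` and `r_t` are equal, and to `1` otherwise. -/
def naming (test : Cmd) : Cmd :=
  .put a_new (.cell a_ord 0) 0 ;;
  .for r_t 1 r_K
    (test ;;
      .put a_new (.cell a_ord (.reg r_t)) (.cell a_new (.cell a_ord (.reg r_t - 1)) + .reg r_g))

section
variable {S : List ℤ} {cap W : ℕ}

/-- If `test` recognizes equal items in time `c`, then `a_new` orders the items as `f` does. -/
theorem naming_spec {α : Type*} [LinearOrder α] {test : Cmd} {σ : State} {T K c : ℕ} {f : ℕ → α}
    (hK : σ.reg r_K = K) (hK0 : 0 < K) (hc : K ≤ cap) (hW : K + 2 ≤ W)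
    (hX : IsPerm K (σ.arr a_ord)) (hs : SortedBy K (σ.arr a_ord) f)
    (h1 : test.wr r_t = false) (h2 : test.wr r_K = false) (h3 : test.wa a_ord = false)
    (h4 : test.wa a_new = false)
    (htest : ∀ τ T' t, 1 ≤ t → t < K → τ.reg r_t = t → (naming test).Frame σ τ →
      wp S cap W test (fun υ T'' => T'' ≤ T' + c ∧ υ.reg r_g =
        if f (σ.arr a_ord (t - 1)) = f (σ.arr a_ord t) then 0 else 1) τ T') :
    wp S cap W (naming test) (fun τ T' => T' ≤ T + (c + 50) * K ∧
      (∀ i < K, τ.arr a_new i < K) ∧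
      ∀ i < K, ∀ j < K, τ.arr a_new i < τ.arr a_new j ↔ f i < f j) σ T := by
  have hX0 := hX.1 0 hK0
  have fr : ∀ τ υ : State, (Cmd.for r_t 1 r_K
    (test ;;
      .put a_new (.cell a_ord (.reg r_t))
        (.cell a_new (.cell a_ord (.reg r_t - 1)) + .reg r_g))).Frame τ υ →
      (naming test).Frame τ υ := fun τ υ h => by
    refine h.imp (fun x hx => ?_) (fun A hA => ?_)
    · simpa [naming, Cmd.wr] using hx
    · simp [naming, Cmd.wa] at hA ⊢; exact hA.2
  have fr0 : (naming test).Frame σ (σ.setArr a_new (σ.arr a_ord 0) 0) := by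
    refine ⟨fun x _ => rfl, fun A hA => State.setArr_arr_ne _ _ _ _ _ ?_⟩
    simp [naming, Cmd.wa] at hA; exact hA.1
  unfold naming
  simp only [wp_rules, ok_rules, eval_rules, Nat.reduceLT]
  refine ⟨by omega, by omega, ?_⟩
  refine wp_for_const (fun k τ => ∀ t u, t ≤ u → u < k →
      τ.arr a_new (σ.arr a_ord t) ≤ τ.arr a_new (σ.arr a_ord u) ∧
      (τ.arr a_new (σ.arr a_ord t) = τ.arr a_new (σ.arr a_ord u) ↔
        f (σ.arr a_ord t) = f (σ.arr a_ord u)) ∧ τ.arr a_new (σ.arr a_ord u) ≤ u) 1 K (c + 20)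
    (by norm_num) (by norm_num) (by norm_num) ?_ ?_ hK (by omega) (by omega)
    (by simp [ok_rules]; omega) (by simp [eval_rules]) ?_ ?_ ?_
  · simp [Cmd.wr, h1]
  · simp [Cmd.wr, h2]
  · intro t u htu hu
    obtain rfl : u = 0 := by omega
    obtain rfl : t = 0 := by omega
    simp
  · intro k τ T' hk1 hk hkτ hf hI
    have hf' := fr0.trans (fr _ _ hf)
    have ho : τ.arr a_ord = σ.arr a_ord := hf'.arr a_ord (by simp [naming, Cmd.wa, h3])
    refine wp_then (htest τ T' k hk1 hk hkτ hf') ?_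
    rintro υ T'' f2 ⟨hT, hg⟩
    have ho' : υ.arr a_ord = σ.arr a_ord := (f2.arr a_ord h3).trans ho
    have hn' : υ.arr a_new = τ.arr a_new := f2.arr a_new h4
    have hkυ : υ.reg r_t = k := (f2.reg r_t h1).trans hkτ
    have e1 := hX.1 k hk
    have e2 := hX.1 (k - 1) (by omega)
    have e3 := hI (k - 1) (k - 1) le_rfl (by omega)
    have hg1 : υ.reg r_g ≤ 1 := by rw [hg]; split_ifs <;> omega
    simp only [wp_rules, ok_rules, eval_rules, Nat.reduceLT, ho', hkυ, hn', Nat.reduceEqDiff]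
    repeat refine And.intro (by omega) ?_
    refine ⟨?_, by omega⟩
    intro t u htu hu
    have hne : ∀ s, s < k → σ.arr a_ord s ≠ σ.arr a_ord k := fun s hs' h =>
      absurd (hX.2 s (by omega) k hk h) (by omega)
    by_cases huk : u = k
    · subst huk
      by_cases htu' : t = u
      · subst htu'
        simp only [if_true, true_and, le_refl]
        omega
      · have e4 := hI t (u - 1) (by omega) (by omega)
        have hs1 : f (σ.arr a_ord (u - 1)) ≤ f (σ.arr a_ord u) := hs _ _ (by omega) hk
        have hs2 : f (σ.arr a_ord t) ≤ f (σ.arr a_ord (u - 1)) := by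
          rcases Nat.eq_or_lt_of_le (show t ≤ u - 1 by omega) with h | h
          · rw [h]
          · exact hs _ _ h (by omega)
        rw [if_neg (by simpa using hne t (by omega)), if_pos rfl]
        refine ⟨by omega, ?_, by omega⟩
        rw [hg]
        split_ifs with h
        · rw [add_zero, e4.2.1, h]
        · constructor
          · intro h'; omega
          · intro h'
            exact absurd (le_antisymm hs1 (h' ▸ hs2)) h
    · rw [if_neg (by simpa using hne t (by omega)), if_neg (by simpa using hne u (by omega))]
      exact hI t u htu (by omega)
  · intro τ T' hk hf hI hT
    simp only [eval_rules] at hT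
    refine ⟨?_, ?_, ?_⟩
    · have : (c + 20 + 11) * (K - 1) + (c + 20 + 11) = (c + 20 + 11) * K := by
        obtain ⟨K', rfl⟩ : ∃ K', K = K' + 1 := ⟨K - 1, by omega⟩
        rw [Nat.add_sub_cancel, mul_add, mul_one]
      have h2 : (c + 50) * K = (c + 20 + 11) * K + 19 * K := by ring
      omega
    · intro i hi
      obtain ⟨t, ht, rfl⟩ := hX.surj hi
      have := (hI t t le_rfl ht).2.2
      omega
    · intro i hi j hj
      obtain ⟨t, ht, rfl⟩ := hX.surj hi
      obtain ⟨u, hu, rfl⟩ := hX.surj hj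
      have hmono : ∀ t u, t ≤ u → u < K → f (σ.arr a_ord t) ≤ f (σ.arr a_ord u) := by
        intro t u htu hu
        rcases Nat.eq_or_lt_of_le htu with rfl | h
        · exact le_rfl
        · exact hs _ _ h hu
      rcases Nat.le_total t u with h | h
      · have := hI t u h hu
        rw [lt_iff_le_and_ne, lt_iff_le_and_ne]
        exact ⟨fun h' => ⟨hmono t u h hu, fun e => h'.2 (this.2.1.2 e)⟩,
          fun h' => ⟨this.1, fun e => h'.2 (this.2.1.1 e)⟩⟩
      · have := hI u t h ht
        exact ⟨fun h' => absurd h' (by omega), fun h' => absurd h' (not_lt.2 (hmono u t h ht))⟩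

end

/-! ### The suffix array by prefix doubling -/

/-- `A[t] := e` for all `t < r`. -/
def Cmd.fill (A : ℕ) (e : Expr) (r : ℕ) : Cmd := .for r_t 0 r (.put A (.reg r_t) e)

section
variable {S : List ℤ} {cap W : ℕ}

theorem fill_spec {A : ℕ} {e : Expr} {r : ℕ} {σ : State} {T N : ℕ} (g : ℕ → ℕ) (hr : r < 1000)
    (hrt : r ≠ r_t) (hN : σ.reg r = N) (hW : N ≤ W) (hc : N ≤ cap)
    (he : ∀ τ : State, ∀ t < N, τ.reg r_t = t → (Cmd.fill A e r).Frame σ τ →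
      e.Ok cap W τ ∧ e.eval τ = g t) :
    wp S cap W (.fill A e r) (fun τ T' => T' ≤ T + ((e.cost + 20) * N + 10) ∧
      ∀ t < N, τ.arr A t = g t) σ T := by
  unfold Cmd.fill
  refine wp_for_const (fun k τ => ∀ t < k, τ.arr A t = g t) 0 N (e.cost + 5) (by norm_num) hr hrt
    rfl rfl hN hW (by omega) (by simp [ok_rules]) (by simp [eval_rules]) (by simp) ?_ ?_
  · intro k τ T' _ hk hkτ hf hI
    obtain ⟨h1, h2⟩ := he τ k hk hkτ hf
    simp only [wp_rules, ok_rules, eval_rules, hkτ, h2, Nat.reduceLT]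
    refine ⟨h1, by omega, fun t ht => ?_, by omega⟩
    split_ifs with h
    · rw [h]
    · exact hI t (by omega)
  · intro τ T' _ hf hI hT
    simp only [eval_rules] at hT
    refine ⟨?_, hI⟩
    have h3 : (e.cost + 20) * N = (e.cost + 5 + 11) * N + 4 * N := by ring
    rw [Nat.sub_zero] at hT
    omega

end

/-- Compare the items at the positions `r_t - 1` and `r_t` by the keys `a_nm` and `a_sec`. -/
def sameKeys : Cmd :=
  .set r_x (.cell a_ord (.reg r_t - 1)) ;;
  .set r_y (.cell a_ord (.reg r_t)) ;;
  .ite (.cell a_nm (.reg r_x)) (.cell a_nm (.reg r_y)) (.set r_g 1)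
    (.ite (.cell a_nm (.reg r_y)) (.cell a_nm (.reg r_x)) (.set r_g 1)
      (.ite (.cell a_sec (.reg r_x)) (.cell a_sec (.reg r_y)) (.set r_g 1)
        (.ite (.cell a_sec (.reg r_y)) (.cell a_sec (.reg r_x)) (.set r_g 1) (.set r_g 0))))

/-- From the names of the length-`l` prefixes of the suffixes to those of the length-`2 l` ones. -/
def doublingRound : Cmd :=
  .for r_t 0 r_K
    (.setMin r_x (.reg r_t + .reg r_l) r_n ;; .put a_sec (.reg r_t) (.cell a_nm (.reg r_x))) ;;
  .fill a_key (.cell a_sec (.reg r_t)) r_K ;;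
  countingSort ;;
  .fill a_key (.cell a_nm (.reg r_t)) r_K ;;
  countingSort ;;
  naming sameKeys ;;
  .fill a_nm (.cell a_new (.reg r_t)) r_K

/-- Compare the symbols at the positions `r_t - 1` and `r_t` of the sorted array `a_ord`. -/
def sameSymbols : Cmd :=
  .iteSym (.cell a_ord (.reg r_t - 1)) (.cell a_ord (.reg r_t)) (.set r_g 1) (.set r_g 0)

/-- Names of the symbols; position `n` has the least name. -/
def symbolNames : Cmd :=
  mergeSort ;;
  .set r_K (.reg r_n) ;;
  naming sameSymbols ;;
  .fill a_nm (.cell a_new (.reg r_t) + 1) r_K ;;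
  .put a_nm (.reg r_n) 0 ;;
  .put a_ord (.reg r_n) (.reg r_n) ;;
  .set r_K (.reg r_n + 1) ;;
  .set r_M (.reg r_n + 1) ;;
  .fill a_sym (.cell a_nm (.reg r_t)) r_K

/-- The suffix array: `a_nm` holds the ranks of the suffixes, and `a_sa` the inverse permutation. -/
def suffixArray : Cmd :=
  symbolNames ;;
  .set r_l 1 ;;
  .loop (.reg r_l) (.reg r_n) (doublingRound ;; .set r_l (.reg r_l + .reg r_l)) ;;
  .for r_t 0 r_K (.put a_sa (.cell a_nm (.reg r_t)) (.reg r_t))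

section
variable {S : List ℤ} {cap W : ℕ}

theorem sameKeys_spec {τ : State} {T t n : ℕ} (hc : n + 2 ≤ cap) (hW : n + 2 ≤ W)
    (ht : τ.reg r_t = t) (htn : t ≤ n) (h1 : τ.arr a_ord t ≤ n) (h2 : τ.arr a_ord (t - 1) ≤ n) :
    wp S cap W sameKeys (fun υ T' => T' ≤ T + 80 ∧ υ.reg r_g =
      if τ.arr a_nm (τ.arr a_ord (t - 1)) = τ.arr a_nm (τ.arr a_ord t) ∧
        τ.arr a_sec (τ.arr a_ord (t - 1)) = τ.arr a_sec (τ.arr a_ord t) then 0 else 1) τ T := by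
  unfold sameKeys
  simp only [wp_rules, ok_rules, eval_rules, ht, Nat.reduceLT, Nat.reduceEqDiff, if_true, if_false]
  repeat refine And.intro (by omega) ?_
  refine ⟨fun h => ?_, fun h => ⟨by omega, by omega, fun h => ?_, fun h => ⟨by omega, by omega,
    fun h => ?_, fun h => ⟨by omega, by omega, fun h => ?_, fun h => ?_⟩⟩⟩⟩
  · refine ⟨by omega, by omega, ?_⟩; rw [if_neg]; omega
  · refine ⟨by omega, by omega, ?_⟩; rw [if_neg]; omega
  · refine ⟨by omega, by omega, ?_⟩; rw [if_neg]; omega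
  · refine ⟨by omega, by omega, ?_⟩; rw [if_neg]; omega
  · refine ⟨by omega, ?_⟩; rw [if_pos]; omega

set_option maxHeartbeats 4000000 in
/-- A prefix of length `2 l` is a pair of prefixes of length `l`, the second of which starts `l`
positions later, or is empty beyond the end of the text. Two stable counting sorts put the pairs in
order. -/
theorem doublingRound_spec {σ : State} {T n l : ℕ} (hn : S.length = n) (hrn : σ.reg r_n = n)
    (hK : σ.reg r_K = n + 1) (hM : σ.reg r_M = n + 1) (hl : σ.reg r_l = l) (hln : l < n)
    (hc : n + 2 ≤ cap) (hW : 2 * n + 4 ≤ W) (hX : IsPerm (n + 1) (σ.arr a_ord))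
    (hnm : IsNaming S l (σ.arr a_nm)) (hnm' : ∀ i ≤ n, σ.arr a_nm i ≤ n) :
    wp S cap W doublingRound (fun τ T' => T' ≤ T + 2000 * (n + 1) ∧
      IsPerm (n + 1) (τ.arr a_ord) ∧ IsNaming S (l + l) (τ.arr a_nm) ∧
      ∀ i ≤ n, τ.arr a_nm i ≤ n) σ T := by
  unfold doublingRound
  refine wp_seq (wp_for_const (fun k τ => ∀ t < k, τ.arr a_sec t = σ.arr a_nm (min (t + l) n))
    0 (n + 1) 40 (by norm_num) (by norm_num) (by norm_num) rfl rfl hK (by omega) (by omega)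
    (by simp [ok_rules]) (by simp [eval_rules]) (by simp) ?_ ?_)
  · intro k τ T' _ hk hkτ hf hI
    have hl' : τ.reg r_l = l := by rw [hf.reg r_l, hl]
    have hn' : τ.reg r_n = n := by rw [hf.reg r_n, hrn]
    refine wp_seq (wp_setMin (by norm_num) (by norm_num) (by norm_num)
      (by simp only [ok_rules, eval_rules, Nat.reduceLT, hkτ, hl']; omega) ?_)
    intro υ e1 f1 a1 T1 hT1
    simp only [eval_rules, hkτ, hl', hn'] at e1 hT1
    simp only [wp_rules, ok_rules, eval_rules, hkτ, Nat.reduceLT, e1, f1 12 (by norm_num), a1,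
      hf.arr a_nm, Nat.reduceEqDiff]
    repeat refine And.intro (by omega) ?_
    refine ⟨?_, by omega⟩
    intro t ht
    split_ifs with h
    · rw [h]
    · exact hI t (by omega)
  intro τ₁ T₁ _ f₁ h₁ hT₁
  rw [add_assoc] at hT₁
  replace hT₁ : Within T₁ T _ := hT₁
  simp only [eval_rules] at hT₁
  have nm₁ : τ₁.arr a_nm = σ.arr a_nm := f₁.arr a_nm
  have k₁ : τ₁.reg r_K = n + 1 := by rw [f₁.reg r_K, hK]
  refine wp_then (fill_spec (fun t => σ.arr a_nm (min (t + l) n)) (by norm_num) (by norm_num) k₁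
    (by omega) (by omega) ?_) ?_
  · intro τ t ht htτ hf
    simp only [ok_rules, eval_rules, htτ, Nat.reduceLT, hf.arr a_sec]
    exact ⟨by omega, h₁ t ht⟩
  rintro τ₂ T₂ f₂ ⟨hT₂, h₂⟩
  replace hT₂ : Within T₂ T _ := hT₁.add hT₂
  clear hT₁
  simp only [eval_rules] at hT₂
  have o₂ : τ₂.arr a_ord = σ.arr a_ord := by rw [f₂.arr a_ord, f₁.arr a_ord]
  have k₂ : τ₂.reg r_K = n + 1 := by rw [f₂.reg r_K, k₁]
  have m₂ : τ₂.reg r_M = n + 1 := by rw [f₂.reg r_M, f₁.reg r_M, hM]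
  refine wp_then (countingSort_spec k₂ m₂ (by omega) (by omega) (by omega) ?_ (o₂ ▸ hX)) ?_
  · intro i hi; rw [h₂ i hi]; have := hnm' (min (i + l) n) (by omega); omega
  rintro τ₃ T₃ f₃ ⟨hT₃, p₃, h₃⟩
  replace hT₃ : Within T₃ T _ := hT₂.add hT₃
  clear hT₂
  have s₃ := stable_sorted (g := fun _ => (0 : ℕ)) (fun _ _ _ _ => le_rfl) h₃
  have nm₃ : τ₃.arr a_nm = σ.arr a_nm := by rw [f₃.arr a_nm, f₂.arr a_nm, nm₁]
  have k₃ : τ₃.reg r_K = n + 1 := by rw [f₃.reg r_K, k₂]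
  refine wp_then (fill_spec (fun t => σ.arr a_nm t) (by norm_num) (by norm_num) k₃
    (by omega) (by omega) ?_) ?_
  · intro τ t ht htτ hf
    simp only [ok_rules, eval_rules, htτ, Nat.reduceLT, hf.arr a_nm, nm₃]
    omega
  rintro τ₄ T₄ f₄ ⟨hT₄, h₄⟩
  replace hT₄ : Within T₄ T _ := hT₃.add hT₄
  clear hT₃
  simp only [eval_rules] at hT₄
  have o₄ : τ₄.arr a_ord = τ₃.arr a_ord := f₄.arr a_ord
  have k₄ : τ₄.reg r_K = n + 1 := by rw [f₄.reg r_K, k₃]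
  have m₄ : τ₄.reg r_M = n + 1 := by rw [f₄.reg r_M, f₃.reg r_M, m₂]
  refine wp_then (countingSort_spec k₄ m₄ (by omega) (by omega) (by omega) ?_ (o₄ ▸ p₃)) ?_
  · intro i hi; rw [h₄ i hi]; have := hnm' i (by omega); omega
  rintro τ₅ T₅ f₅ ⟨hT₅, p₅, h₅⟩
  replace hT₅ : Within T₅ T _ := hT₄.add hT₅
  clear hT₄
  have s₅ := stable_sorted (o₄ ▸ s₃) h₅
  have nm₅ : τ₅.arr a_nm = σ.arr a_nm := by rw [f₅.arr a_nm, f₄.arr a_nm, nm₃]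
  have sec₅ : ∀ i ≤ n, τ₅.arr a_sec i = σ.arr a_nm (min (i + l) n) := fun i hi => by
    rw [f₅.arr a_sec, f₄.arr a_sec, f₃.arr a_sec, f₂.arr a_sec, h₁ i (by omega)]
  have k₅ : τ₅.reg r_K = n + 1 := by rw [f₅.reg r_K, k₄]
  set f : ℕ → ℕ ×ₗ ℕ := fun i => toLex (σ.arr a_nm i, σ.arr a_nm (min (i + l) n)) with hf
  have sf : SortedBy (n + 1) (τ₅.arr a_ord) f := by
    intro a b hab hb
    have := s₅ a b hab hb
    have e1 := p₅.1 a (by omega)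
    have e2 := p₅.1 b hb
    simp only [h₄ _ e1, h₄ _ e2, h₂ _ e1, h₂ _ e2, Prod.Lex.toLex_le_toLex] at this
    rw [hf, Prod.Lex.toLex_le_toLex]
    clear * - this
    omega
  clear s₅ h₁ h₂ h₃ h₄ h₅ f₁ f₂ f₃ f₄ nm₁ nm₃ o₂ o₄ s₃ p₃ k₁ k₂ k₃ k₄ m₂ m₄ hX
  refine wp_then (naming_spec (c := 80) k₅ (by omega) (by omega) (by omega) p₅ sf rfl rfl rfl rfl ?_) ?_
  · intro τ T' t h1 h2 h3 hfr
    have e1 := p₅.1 t h2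
    have e2 := p₅.1 (t - 1) (by omega)
    have a1 : τ.arr a_ord = τ₅.arr a_ord := hfr.arr a_ord
    have a2 : τ.arr a_nm = σ.arr a_nm := (hfr.arr a_nm).trans nm₅
    have a3 : τ.arr a_sec = τ₅.arr a_sec := hfr.arr a_sec
    have a4 := sec₅ _ (by omega : τ₅.arr a_ord t ≤ n)
    have a5 := sec₅ _ (by omega : τ₅.arr a_ord (t - 1) ≤ n)
    have hff : f (τ₅.arr a_ord (t - 1)) = f (τ₅.arr a_ord t) ↔
        (σ.arr a_nm (τ₅.arr a_ord (t - 1)) = σ.arr a_nm (τ₅.arr a_ord t) ∧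
          τ₅.arr a_sec (τ₅.arr a_ord (t - 1)) = τ₅.arr a_sec (τ₅.arr a_ord t)) := by
      rw [hf, a4, a5]
      simp [Prod.ext_iff]
    refine wp_mono (sameKeys_spec (n := n) (by omega) (by omega) h3 (by omega)
      (by rw [a1]; omega) (by rw [a1]; omega)) ?_
    rintro υ T'' ⟨hT, hg⟩
    refine ⟨hT, ?_⟩
    rw [hg]
    simp only [hff, a1, a2, a3]
  rintro τ₆ T₆ f₆ ⟨hT₆, hb, h₆⟩
  replace hT₆ : Within T₆ T _ := hT₅.add hT₆
  clear hT₅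
  have k₆ : τ₆.reg r_K = n + 1 := by rw [f₆.reg r_K, k₅]
  refine wp_last (fill_spec (fun t => τ₆.arr a_new t) (by norm_num) (by norm_num) k₆
    (by omega) (by omega) ?_) ?_
  · intro τ t ht htτ hf
    simp only [ok_rules, eval_rules, htτ, Nat.reduceLT, hf.arr a_new]
    omega
  rintro τ₇ T₇ f₇ ⟨hT₇, h₇⟩
  replace hT₇ : Within T₇ T _ := hT₆.add hT₇
  clear hT₆
  simp only [eval_rules] at hT₇
  refine ⟨hT₇.le (by omega), ?_, ?_, ?_⟩
  · rw [f₇.arr a_ord, f₆.arr a_ord]; exact p₅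
  · intro i hi j hj
    rw [hn] at hi hj
    rw [h₇ i (by omega), h₇ j (by omega), h₆ i (by omega) j (by omega), hf,
      Prod.Lex.toLex_lt_toLex, pre_double_lt_iff, hn]
    have e1 := hnm i (by omega) j (by omega)
    have e2 := hnm.eq_iff (show i ≤ S.length by omega) (show j ≤ S.length by omega)
    have e3 := hnm (min (i + l) n) (by omega) (min (j + l) n) (by omega)
    rw [← e1, ← e2, ← e3]
  · intro i hi
    rw [h₇ i (by omega)]
    have := hb i (by omega)
    omega

/-- The names of the symbols take time `O(n log n)`, as the text can only be sorted by
comparisons. -/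
theorem symbolNames_spec {σ : State} {T n : ℕ} (hn : S.length = n) (hrn : σ.reg r_n = n)
    (hn0 : 0 < n) (hc : n + 2 ≤ cap) (hW : 2 * n + 4 ≤ W) :
    wp S cap W symbolNames (fun τ T' => T' ≤ T + 2000 * (n * (Nat.log 2 n + 1)) ∧
      τ.reg r_K = n + 1 ∧ τ.reg r_M = n + 1 ∧
      IsPerm (n + 1) (τ.arr a_ord) ∧ IsNaming S 1 (τ.arr a_nm) ∧
      (∀ i ≤ n, τ.arr a_nm i ≤ n) ∧ ∀ i ≤ n, τ.arr a_sym i = τ.arr a_nm i) σ T := by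
  unfold symbolNames
  refine wp_then (mergeSort_spec (f := fun i => S.getD i 0) (fun _ => rfl) hn hrn hn0 (by omega)
    (by omega)) ?_
  rintro τ₁ T₁ f₁ ⟨hT₁, p₁, s₁⟩
  have n₁ : τ₁.reg r_n = n := (f₁.reg r_n).trans hrn
  simp only [wp_rules, ok_rules, eval_rules, n₁, Nat.reduceLT]
  refine wp_last (naming_spec (c := 40) (σ := τ₁.setReg r_K n) (K := n) (by simp) hn0 (by omega)
    (by omega) p₁ s₁ rfl rfl rfl rfl ?_) ?_
  · intro τ T' t h1 h2 h3 hfr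
    have e1 := p₁.1 t h2
    have e2 := p₁.1 (t - 1) (by omega)
    have a1 : τ.arr a_ord = τ₁.arr a_ord := hfr.arr a_ord
    have a2 := s₁ (t - 1) t (by omega) h2
    unfold sameSymbols
    simp only [wp_iteSym, wp_rules, ok_rules, eval_rules, h3, Nat.reduceLT, Nat.reduceEqDiff, a1,
      if_true, hn] at a2 ⊢
    repeat refine And.intro (by omega) ?_
    refine ⟨fun h => ⟨by omega, by omega, ?_⟩, fun h => ⟨by omega, ?_⟩⟩
    · rw [if_neg h.ne]
    · rw [if_pos (le_antisymm a2 (not_lt.1 h))]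
  rintro τ₂ T₂ f₂ ⟨hT₂, b₂, h₂⟩
  have k₂ : τ₂.reg r_K = n := by rw [f₂.reg r_K]; simp
  have n₂ : τ₂.reg r_n = n := by rw [f₂.reg r_n]; simp [n₁]
  have o₂ : τ₂.arr a_ord = τ₁.arr a_ord := f₂.arr a_ord
  refine wp_then (fill_spec (fun t => τ₂.arr a_new t + 1) (by norm_num) (by norm_num) k₂
    (by omega) (by omega) ?_) ?_
  · intro τ t ht htτ hf
    have := b₂ t ht
    simp only [ok_rules, eval_rules, htτ, Nat.reduceLT, hf.arr a_new]
    omega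
  rintro τ₃ T₃ f₃ ⟨hT₃, h₃⟩
  have n₃ : τ₃.reg r_n = n := by rw [f₃.reg r_n, n₂]
  have o₃ : τ₃.arr a_ord = τ₁.arr a_ord := by rw [f₃.arr a_ord, o₂]
  simp only [wp_rules, ok_rules, eval_rules, n₃, Nat.reduceLT, Nat.reduceEqDiff, if_false] at hT₃ ⊢
  repeat refine And.intro (by omega) ?_
  set τ₄ := (((τ₃.setArr a_nm n 0).setArr a_ord n n).setReg r_K (n + 1)).setReg r_M (n + 1)
    with hτ₄
  refine wp_last (fill_spec (fun t => τ₄.arr a_nm t) (by norm_num) (by norm_num)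
    (show τ₄.reg r_K = n + 1 by simp [hτ₄]) (by omega) (by omega) ?_) ?_
  · intro τ t ht htτ hf
    simp only [ok_rules, eval_rules, htτ, Nat.reduceLT, hf.arr a_nm]
    omega
  rintro τ₅ T₅ f₅ ⟨hT₅, h₅⟩
  simp only [eval_rules] at hT₅
  have nm₅ : ∀ i, τ₅.arr a_nm i = if i = n then 0 else τ₃.arr a_nm i := by
    intro i
    rw [f₅.arr a_nm]
    simp [hτ₄]
  have o₅ : ∀ i, τ₅.arr a_ord i = if i = n then n else τ₁.arr a_ord i := by
    intro i
    rw [f₅.arr a_ord]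
    simp [hτ₄, o₃]
  have hpos : n ≤ n * (Nat.log 2 n + 1) := Nat.le_mul_of_pos_right _ (by omega)
  refine ⟨by omega, ?_, ?_, ?_, ?_, ?_, ?_⟩
  · rw [f₅.reg r_K]; simp [hτ₄]
  · rw [f₅.reg r_M]; simp [hτ₄]
  · refine IsPerm.of_surj ?_ ?_
    · intro t ht
      rw [o₅]; split_ifs with h
      · omega
      · have := p₁.1 t (by omega); omega
    · intro i hi
      by_cases h : i = n
      · exact ⟨n, by omega, by rw [o₅, if_pos rfl, h]⟩
      · obtain ⟨t, ht, e⟩ := p₁.surj (show i < n by omega)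
        exact ⟨t, by omega, by rw [o₅, if_neg (by omega), e]⟩
  · have pren : pre S 1 n = [] := by rw [pre, ← hn, List.drop_length, List.take_nil]
    have prei : ∀ i < n, pre S 1 i = [S.getD i 0] := by
      intro i hi
      rw [pre, List.drop_eq_getElem_cons (by omega), List.getD_eq_getElem _ _ (by omega)]
      rfl
    intro i hi j hj
    rw [hn] at hi hj
    rw [nm₅, nm₅]
    split_ifs with h1 h2 h2
    · subst h1; subst h2; simp
    · rw [h1, pren, prei j (by omega), h₃ j (by omega)]
      simp
    · rw [h2, pren]; simp
    · rw [h₃ i (by omega), h₃ j (by omega), prei i (by omega), prei j (by omega),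
        Nat.add_lt_add_iff_right, h₂ i (by omega) j (by omega), List.cons_lt_cons_iff]
      simp
  · intro i hi
    rw [nm₅]
    split_ifs with h
    · omega
    · rw [h₃ i (by omega)]
      have := b₂ i (by omega)
      omega
  · intro i hi
    rw [h₅ i (by omega), f₅.arr a_nm]

/-- The state holds the suffix array of the text, and the names of its symbols. -/
structure HasSuffixArray (S : List ℤ) (τ : State) : Prop where
  n_eq : τ.reg r_n = S.length
  rank_perm : IsPerm (S.length + 1) (τ.arr a_nm)
  rank_lt : ∀ i ≤ S.length, ∀ j ≤ S.length, τ.arr a_nm i < τ.arr a_nm j ↔ S.drop i < S.drop j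
  sa_rank : ∀ i ≤ S.length, τ.arr a_sa (τ.arr a_nm i) = i
  sym_le : ∀ i ≤ S.length, τ.arr a_sym i ≤ S.length
  sym_eq : ∀ i ≤ S.length, ∀ j ≤ S.length, τ.arr a_sym i = τ.arr a_sym j ↔ pre S 1 i = pre S 1 j

theorem HasSuffixArray.congr {σ τ : State} (h : HasSuffixArray S σ) (h1 : τ.reg r_n = σ.reg r_n)
    (h2 : τ.arr a_nm = σ.arr a_nm) (h3 : τ.arr a_sa = σ.arr a_sa)
    (h4 : τ.arr a_sym = σ.arr a_sym) : HasSuffixArray S τ := by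
  obtain ⟨a, b, c, d, e', e⟩ := h
  exact ⟨h1.trans a, h2 ▸ b, h2 ▸ c, h2 ▸ h3 ▸ d, h4 ▸ e', h4 ▸ e⟩

theorem HasSuffixArray.rank_le {σ : State} (h : HasSuffixArray S σ) {i : ℕ} (hi : i ≤ S.length) :
    σ.arr a_nm i ≤ S.length := Nat.lt_succ_iff.1 (h.rank_perm.1 i (by omega))

theorem HasSuffixArray.sa_le {σ : State} (h : HasSuffixArray S σ) {t : ℕ} (ht : t ≤ S.length) :
    σ.arr a_sa t ≤ S.length := by
  obtain ⟨i, hi, rfl⟩ := h.rank_perm.surj (Nat.lt_succ_iff.2 ht)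
  rw [h.sa_rank i (by omega)]
  omega

theorem HasSuffixArray.rank_sa {σ : State} (h : HasSuffixArray S σ) {t : ℕ} (ht : t ≤ S.length) :
    σ.arr a_nm (σ.arr a_sa t) = t := by
  obtain ⟨i, hi, rfl⟩ := h.rank_perm.surj (Nat.lt_succ_iff.2 ht)
  rw [h.sa_rank i (by omega)]

theorem log_bound {n k : ℕ} (h : 2 ^ k < 2 * n) : k ≤ Nat.log 2 n + 1 := by
  by_contra hcon
  have h2 : n < 2 ^ (Nat.log 2 n + 1) := Nat.lt_pow_succ_log_self (by norm_num) n
  have h3 : 2 ^ (Nat.log 2 n + 1 + 1) ≤ 2 ^ k := Nat.pow_le_pow_right (by norm_num) (by omega)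
  rw [pow_succ] at h3
  omega

set_option maxHeartbeats 1000000 in
/-- Once the length has reached `n`, the names of the prefixes are the ranks of the suffixes. -/
theorem suffixArray_spec {σ : State} {T n : ℕ} (hn : S.length = n) (hrn : σ.reg r_n = n)
    (hn0 : 0 < n) (hc : n + 2 ≤ cap) (hW : 2 * n + 4 ≤ W) :
    wp S cap W suffixArray (fun τ T' => T' ≤ T + 10000 * (n * (Nat.log 2 n + 1)) ∧
      HasSuffixArray S τ) σ T := by
  unfold suffixArray
  refine wp_then (symbolNames_spec hn hrn hn0 hc hW) ?_
  rintro τ₁ T₁ f₁ ⟨hT₁, k₁, m₁, p₁, nm₁, b₁, sy₁⟩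
  have n₁ : τ₁.reg r_n = n := (f₁.reg r_n).trans hrn
  simp only [wp_rules, ok_rules, eval_rules, Nat.reduceLT]
  refine ⟨by omega, ?_⟩
  refine wp_while (fun τ T' => ∃ k, τ.reg r_l = 2 ^ k ∧ 2 ^ k < 2 * n ∧
      T' ≤ T₁ + 20 + (2000 * (n + 1) + 50) * k ∧ IsPerm (n + 1) (τ.arr a_ord) ∧
      IsNaming S (2 ^ k) (τ.arr a_nm) ∧ ∀ i ≤ n, τ.arr a_nm i ≤ n) (fun τ => n - τ.reg r_l)
    ?_ ?_
  · exact ⟨0, by simp, by omega, by omega, p₁, nm₁, b₁⟩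
  rintro τ T' hfr ⟨k, hk, hk2, hT, hp, hs, hb⟩
  have hn' : τ.reg r_n = n := by rw [hfr.reg r_n, State.setReg_reg, if_neg (by norm_num), n₁]
  have hK' : τ.reg r_K = n + 1 := by
    rw [hfr.reg r_K, State.setReg_reg, if_neg (by norm_num), k₁]
  have hM' : τ.reg r_M = n + 1 := by
    rw [hfr.reg r_M, State.setReg_reg, if_neg (by norm_num), m₁]
  simp only [wp_rules, ok_rules, eval_rules, hk, hn', Nat.reduceLT]
  refine ⟨fun hlt => ?_, fun hlt => ?_⟩
  · refine wp_last (doublingRound_spec hn hn' hK' hM' hk hlt hc hW hp hs hb) ?_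
    rintro υ T'' f2 ⟨hT2, p2, s2, b2⟩
    have hk' : υ.reg r_l = 2 ^ k := by rw [f2.reg r_l, hk]
    have hpow : 2 ^ (k + 1) = 2 ^ k + 2 ^ k := by ring
    simp only [wp_rules, ok_rules, eval_rules, hk', Nat.reduceLT]
    have hpos : 0 < 2 ^ k := by positivity
    refine ⟨by omega, ⟨k + 1, by simp [hpow], by omega, ?_, p2, by rwa [hpow], b2⟩,
      by simp; omega⟩
    rw [mul_add _ k 1]
    omega
  · have hkl : k ≤ Nat.log 2 n + 1 := log_bound hk2
    have h4 : (2000 * (n + 1) + 50) * k ≤ (4500 * n) * (Nat.log 2 n + 1) :=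
      Nat.mul_le_mul (by omega) hkl
    have h5 : n ≤ n * (Nat.log 2 n + 1) := Nat.le_mul_of_pos_right _ (by omega)
    rw [mul_assoc] at h4
    have hlt' : ∀ i ≤ n, ∀ j ≤ n, τ.arr a_nm i < τ.arr a_nm j ↔ S.drop i < S.drop j := by
      intro i hi j hj
      rw [hs i (by omega) j (by omega), pre_eq_drop S i (by omega), pre_eq_drop S j (by omega)]
    have hinj : ∀ i ≤ n, ∀ j ≤ n, τ.arr a_nm i = τ.arr a_nm j → i = j := by
      intro i hi j hj h
      rw [hs.eq_iff (by omega) (by omega), pre_eq_drop S i (by omega), pre_eq_drop S j (by omega)]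
        at h
      have := congrArg List.length h
      simp only [List.length_drop] at this
      omega
    have hsy : τ.arr a_sym = τ₁.arr a_sym := by rw [hfr.arr a_sym]; rfl
    refine wp_for_const (fun k υ => ∀ t < k, υ.arr a_sa (τ.arr a_nm t) = t) 0 (n + 1) 20
      (by norm_num) (by norm_num) (by norm_num) rfl rfl hK' (by omega) (by omega)
      (by simp [ok_rules]) (by simp [eval_rules]) (by simp) ?_ ?_
    · intro k υ T' _ hk hkυ hf' hI
      have := hb k (by omega)
      simp only [wp_rules, ok_rules, eval_rules, hkυ, Nat.reduceLT, Nat.reduceEqDiff, hf'.arr a_nm]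
      repeat refine And.intro (by omega) ?_
      refine ⟨?_, by omega⟩
      intro t ht
      split_ifs with h
      · exact (hinj t (by omega) k (by omega) h).symm
      · exact hI t (by have : t ≠ k := fun h' => h (by rw [h'])
                       omega)
    · intro υ T' _ hf' hI hT'
      simp only [eval_rules] at hT'
      have hnm : υ.arr a_nm = τ.arr a_nm := hf'.arr a_nm
      refine ⟨by omega, ⟨?_, ?_, ?_, ?_, ?_, ?_⟩⟩
      · rw [hf'.reg r_n, hn', hn]
      · rw [hnm, hn]
        exact ⟨fun i hi => by have := hb i (by omega); omega,
          fun i hi j hj => hinj i (by omega) j (by omega)⟩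
      · rw [hnm, hn]; exact hlt'
      · rw [hnm, hn]; exact fun i hi => hI i (by omega)
      · rw [hn]
        intro i hi
        rw [hf'.arr a_sym, hsy, sy₁ i hi]
        exact b₁ i hi
      · rw [hn]
        intro i hi j hj
        rw [hf'.arr a_sym, hsy, sy₁ i hi, sy₁ j hj, nm₁.eq_iff (by omega) (by omega)]

end

/-! ### Longest common prefixes of neighbours in the suffix array -/

/-- The length of the longest common prefix. -/
def lcp : List ℤ → List ℤ → ℕ
  | a :: s, b :: t => if a = b then lcp s t + 1 else 0
  | [], _ => 0
  | _ :: _, [] => 0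

@[simp] theorem lcp_nil_left (t : List ℤ) : lcp [] t = 0 := by cases t <;> rfl
@[simp] theorem lcp_nil_right (s : List ℤ) : lcp s [] = 0 := by cases s <;> rfl
@[simp] theorem lcp_cons (a b : ℤ) (s t : List ℤ) :
    lcp (a :: s) (b :: t) = if a = b then lcp s t + 1 else 0 := rfl

theorem le_lcp_iff {l : ℕ} {s t : List ℤ} :
    l ≤ lcp s t ↔ l ≤ s.length ∧ l ≤ t.length ∧ s.take l = t.take l := by
  induction l generalizing s t with
  | zero => simp
  | succ l ih =>
    match s, t with
    | [], t => simp
    | a :: s, [] => simp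
    | a :: s, b :: t =>
      rw [lcp_cons]
      split_ifs with h
      · simp [ih, h]
      · simp [h]

theorem lcp_le_left (s t : List ℤ) : lcp s t ≤ s.length := (le_lcp_iff.1 le_rfl).1
theorem lcp_le_right (s t : List ℤ) : lcp s t ≤ t.length := (le_lcp_iff.1 le_rfl).2.1

theorem lcp_comm (s t : List ℤ) : lcp s t = lcp t s :=
  eq_of_forall_le_iff fun l => by rw [le_lcp_iff, le_lcp_iff]; tauto

@[simp] theorem lcp_self (s : List ℤ) : lcp s s = s.length :=
  eq_of_forall_le_iff fun l => by rw [le_lcp_iff]; tauto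

theorem le_lcp_trans {l : ℕ} {s t u : List ℤ} (h1 : l ≤ lcp s t) (h2 : l ≤ lcp t u) :
    l ≤ lcp s u := by
  rw [le_lcp_iff] at *
  exact ⟨h1.1, h2.2.1, h1.2.2.trans h2.2.2⟩

/-- Between two words with a common prefix of length `l` in the lexicographic order, all words have
this prefix. -/
theorem lcp_mono {s t u : List ℤ} (h1 : s ≤ t) (h2 : t ≤ u) :
    lcp s u ≤ lcp s t ∧ lcp s u ≤ lcp t u := by
  induction s generalizing t u with
  | nil => simp
  | cons a s ih =>
    match t, u with
    | t, [] => simp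
    | [], b :: u => exact absurd h1 (by simp)
    | b :: t, c :: u =>
      have h1 : a < b ∨ a = b ∧ s ≤ t := by
        rcases h1.lt_or_eq with h | h
        · rw [List.cons_lt_cons_iff] at h
          exact h.imp_right fun h => ⟨h.1, h.2.le⟩
        · rw [List.cons.injEq] at h
          exact Or.inr ⟨h.1, h.2.le⟩
      have h2 : b < c ∨ b = c ∧ t ≤ u := by
        rcases h2.lt_or_eq with h | h
        · rw [List.cons_lt_cons_iff] at h
          exact h.imp_right fun h => ⟨h.1, h.2.le⟩
        · rw [List.cons.injEq] at h
          exact Or.inr ⟨h.1, h.2.le⟩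
      simp only [lcp_cons]
      by_cases hac : a = c
      · subst hac
        have hab : a = b := by
          rcases h1 with h1 | h1 <;> rcases h2 with h2 | h2 <;> omega
        subst hab
        simp only [lt_irrefl, false_or, true_and] at h1 h2
        have := ih h1 h2
        simp only [if_true]
        omega
      · simp [hac]

theorem lcp_eq_add {l : ℕ} {s t : List ℤ} (h : l ≤ lcp s t) :
    lcp s t = l + lcp (s.drop l) (t.drop l) := by
  induction l generalizing s t with
  | zero => simp
  | succ l ih =>
    match s, t with
    | [], t => simp at h
    | a :: s, [] => simp at h
    | a :: s, b :: t =>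
      rw [lcp_cons] at *
      split_ifs at * with hab
      · have := ih (s := s) (t := t) (by omega)
        simp only [List.drop_succ_cons]
        omega
      · omega

theorem lcp_drop_drop {S : List ℤ} {i j l : ℕ} (h : l ≤ lcp (S.drop i) (S.drop j)) :
    lcp (S.drop i) (S.drop j) = l + lcp (S.drop (i + l)) (S.drop (j + l)) := by
  rw [← List.drop_drop, ← List.drop_drop]
  exact lcp_eq_add h

theorem lcp_pos_iff {S : List ℤ} {i j : ℕ} (hi : i ≤ S.length) (hj : j ≤ S.length) (hij : i ≠ j) :
    0 < lcp (S.drop i) (S.drop j) ↔ pre S 1 i = pre S 1 j := by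
  have h1 : 0 < lcp (S.drop i) (S.drop j) ↔ 1 ≤ lcp (S.drop i) (S.drop j) := Iff.rfl
  rw [h1, le_lcp_iff, pre, pre, List.length_drop, List.length_drop]
  refine ⟨fun h => h.2.2, fun h => ⟨?_, ?_, h⟩⟩ <;>
  · have := congrArg List.length h
    simp only [List.length_take, List.length_drop] at this
    omega

theorem lcp_step {S : List ℤ} {i j h : ℕ} (hij : i ≠ j) (hi : i ≤ S.length) (hj : j ≤ S.length)
    (hh : h ≤ lcp (S.drop i) (S.drop j)) :
    h < lcp (S.drop i) (S.drop j) ↔ pre S 1 (i + h) = pre S 1 (j + h) := by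
  have h1 := lcp_le_left (S.drop i) (S.drop j)
  have h2 := lcp_le_right (S.drop i) (S.drop j)
  rw [List.length_drop] at h1 h2
  rw [← lcp_pos_iff (by omega) (by omega) (by omega), lcp_drop_drop hh]
  omega

/-- Suffixes with the same first symbol keep their order when this symbol is removed. -/
theorem lcp_eq_zero_or_drop_lt {S : List ℤ} {i j : ℕ} (h : S.drop i < S.drop j)
    (hl : 0 < lcp (S.drop i) (S.drop j)) :
    S.drop (i + 1) < S.drop (j + 1) := by
  rw [← List.drop_drop, ← List.drop_drop]
  match hs : S.drop i, ht : S.drop j with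
  | [], t => simp [hs] at hl
  | a :: s, [] => simp [ht] at hl
  | a :: s, b :: t =>
    rw [hs, ht, List.cons_lt_cons_iff] at h
    rw [hs, ht, lcp_cons] at hl
    split_ifs at hl with hab
    · simp only [List.drop_succ_cons, List.drop_zero]
      rcases h with h | h
      · omega
      · exact h.2
    · omega

notation "a_lc" => (29 : ℕ)
notation "r_h" => (30 : ℕ)

/-- The array `a_lc` of the longest common prefixes of suffixes that are neighbours in the suffix
array. The common prefix of a suffix and its predecessor is found by prolonging that of the preceding
position of the text, less one symbol. -/
def kasai : Cmd :=
  .put a_lc 0 0 ;;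
  .set r_h 0 ;;
  .for r_t 0 r_n
    (.set r_x (.cell a_nm (.reg r_t)) ;;
      .set r_y (.cell a_sa (.reg r_x - 1)) ;;
      .loop ((.cell a_sym (.reg r_t + .reg r_h) - .cell a_sym (.reg r_y + .reg r_h)) +
          (.cell a_sym (.reg r_y + .reg r_h) - .cell a_sym (.reg r_t + .reg r_h))) 1
        (.set r_h (.reg r_h + 1)) ;;
      .put a_lc (.reg r_x) (.reg r_h) ;;
      .set r_h (.reg r_h - 1))

section
variable {S : List ℤ} {cap W : ℕ}

/-- The array `a_lc` holds the longest common prefixes of neighbours in the suffix array. -/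
structure HasLcp (S : List ℤ) (τ : State) : Prop extends HasSuffixArray S τ where
  lc_zero : τ.arr a_lc 0 = 0
  lc_eq : ∀ r, 1 ≤ r → r ≤ S.length →
    τ.arr a_lc r = lcp (S.drop (τ.arr a_sa (r - 1))) (S.drop (τ.arr a_sa r))

theorem HasSuffixArray.rank_pos {σ : State} (h : HasSuffixArray S σ) {i : ℕ} (hi : i < S.length) :
    1 ≤ σ.arr a_nm i := by
  have := (h.rank_lt S.length le_rfl i hi.le).2 (by
    rw [List.drop_length, List.drop_eq_getElem_cons hi]; exact List.nil_lt_cons _ _)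
  omega

theorem HasSuffixArray.sa_lt {σ : State} (h : HasSuffixArray S σ) {r s : ℕ} (hr : r ≤ S.length)
    (hs : s ≤ S.length) : S.drop (σ.arr a_sa r) < S.drop (σ.arr a_sa s) ↔ r < s := by
  rw [← h.rank_lt _ (h.sa_le hr) _ (h.sa_le hs), h.rank_sa hr, h.rank_sa hs]

/-- If a suffix shares `l > 0` symbols with its predecessor in the suffix array, then the suffix at
the next position shares at least `l - 1` symbols with its own predecessor: without its first
symbol, the first predecessor is still less than the suffix, and the second one lies in between. -/
theorem HasSuffixArray.kasai_step {σ : State} (h : HasSuffixArray S σ) {i : ℕ}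
    (hi : i + 1 < S.length) :
    lcp (S.drop (σ.arr a_sa (σ.arr a_nm i - 1))) (S.drop i) - 1 ≤
      lcp (S.drop (σ.arr a_sa (σ.arr a_nm (i + 1) - 1))) (S.drop (i + 1)) := by
  set j := σ.arr a_sa (σ.arr a_nm i - 1) with hj
  rcases Nat.eq_zero_or_pos (lcp (S.drop j) (S.drop i)) with h0 | h0
  · omega
  have r1 := h.rank_pos (show i < S.length by omega)
  have r2 := h.rank_le (show i ≤ S.length by omega)
  have r3 := h.rank_le (show i + 1 ≤ S.length by omega)
  have jn : j < S.length := by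
    by_contra hcon
    rw [List.drop_eq_nil_of_le (by omega)] at h0
    simp at h0
  have h1 : S.drop j < S.drop i := by
    have := (h.sa_lt (r := σ.arr a_nm i - 1) (s := σ.arr a_nm i) (by omega) r2).2 (by omega)
    rwa [h.sa_rank i (by omega)] at this
  have h2 := lcp_eq_zero_or_drop_lt h1 h0
  rw [lcp_drop_drop (l := 1) (by omega), Nat.add_sub_cancel_left]
  rw [← h.rank_lt _ (by omega) _ (by omega)] at h2
  refine (lcp_mono (t := S.drop (σ.arr a_sa (σ.arr a_nm (i + 1) - 1))) ?_ ?_).2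
  · rw [← not_lt, ← h.rank_lt _ (h.sa_le (by omega)) _ (by omega), h.rank_sa (by omega)]
    omega
  · rw [← not_lt, ← h.rank_lt _ (by omega) _ (h.sa_le (by omega)), h.rank_sa (by omega)]
    omega

/-- The computation is linear, since the length of the common prefix never drops by more than one
from one position to the next: the total number of successful comparisons is at most `2 n`. -/
theorem kasai_spec {σ : State} {T n : ℕ} (hn : S.length = n) (h : HasSuffixArray S σ)
    (hc : n + 2 ≤ cap) (hW : 2 * n + 4 ≤ W) :
    wp S cap W kasai (fun τ T' => T' ≤ T + 400 * (n + 1) ∧ HasLcp S τ) σ T := by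
  have hrn : σ.reg r_n = n := h.n_eq.trans hn
  unfold kasai
  simp only [wp_rules, ok_rules, eval_rules, Nat.reduceLT]
  refine ⟨by omega, ?_⟩
  refine wp_for (fun k τ T' => ∃ h, τ.reg r_h = h ∧ τ.arr a_lc 0 = 0 ∧
      (k < n → h ≤ lcp (S.drop (σ.arr a_sa (σ.arr a_nm k - 1))) (S.drop k)) ∧ h ≤ n ∧
      (∀ i < k, τ.arr a_lc (σ.arr a_nm i) =
        lcp (S.drop (σ.arr a_sa (σ.arr a_nm i - 1))) (S.drop i)) ∧
      T' ≤ T + 30 + 200 * k + 40 * h) 0 n (by norm_num) (by norm_num) (by norm_num) rfl rfl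
    (by simp [hrn]) (by omega) (by omega) (by simp [ok_rules]) (by simp [eval_rules]) ?_ ?_ ?_
  · refine ⟨0, by simp, by simp, by simp, by simp, by simp, ?_⟩
    simp only [eval_rules]
    omega
  · rintro k τ T' _ hk hkτ hf ⟨h0, hh0, hz, hle, hln, hI, hT⟩
    have hnm : τ.arr a_nm = σ.arr a_nm := by rw [hf.arr a_nm]; simp [State.setArr_arr_ne]
    have hsa : τ.arr a_sa = σ.arr a_sa := by rw [hf.arr a_sa]; simp [State.setArr_arr_ne]
    have hsy : τ.arr a_sym = σ.arr a_sym := by rw [hf.arr a_sym]; simp [State.setArr_arr_ne]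
    have r1 := h.rank_pos (show k < S.length by omega)
    have r2 := h.rank_le (show k ≤ S.length by omega)
    have hj := h.sa_le (show σ.arr a_nm k - 1 ≤ S.length by omega)
    have hjk : σ.arr a_sa (σ.arr a_nm k - 1) ≠ k := fun e => by
      have := h.rank_sa (show σ.arr a_nm k - 1 ≤ S.length by omega)
      rw [e] at this
      omega
    have hstep := fun hk' => h.kasai_step (i := k) hk'
    have hinj : ∀ i < k, σ.arr a_nm i ≠ σ.arr a_nm k := fun i hi e => by
      have := h.sa_rank i (by omega)
      rw [e, h.sa_rank k (by omega)] at this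
      omega
    replace hle := hle hk
    set j := σ.arr a_sa (σ.arr a_nm k - 1) with hjdef
    set L := lcp (S.drop j) (S.drop k) with hL
    have l1 : L ≤ n - j := by have := lcp_le_left (S.drop j) (S.drop k); simp at this; omega
    have l2 : L ≤ n - k := by have := lcp_le_right (S.drop j) (S.drop k); simp at this; omega
    simp only [wp_rules, ok_rules, eval_rules, hkτ, Nat.reduceLT, Nat.reduceEqDiff, if_true,
      if_false, hnm, hsa, ← hjdef]
    repeat refine And.intro (by omega) ?_
    refine wp_while (fun υ T' => ∃ h, υ.reg r_h = h ∧ h0 ≤ h ∧ h ≤ L ∧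
      T' ≤ T + 30 + 200 * k + 40 * h + 35) (fun υ => n - υ.reg r_h) ?_ ?_
    · exact ⟨h0, by simp [hh0], le_rfl, hle, by omega⟩
    rintro υ T₁ hf' ⟨g, hg, g1, g2, hT₁⟩
    have ek : υ.reg r_t = k := by rw [hf'.reg r_t]; simp [hkτ]
    have ex : υ.reg r_x = σ.arr a_nm k := by rw [hf'.reg r_x]; simp
    have ey : υ.reg r_y = j := by rw [hf'.reg r_y]; simp
    have esy : υ.arr a_sym = σ.arr a_sym := by rw [hf'.arr a_sym]; exact hsy
    have elc : υ.arr a_lc = τ.arr a_lc := by rw [hf'.arr a_lc]; rfl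
    have s1 := h.sym_le (k + g) (by omega)
    have s2 := h.sym_le (j + g) (by omega)
    have s3 := h.sym_eq (k + g) (by omega) (j + g) (by omega)
    have s4 := lcp_step (S := S) (h := g) hjk (by omega) (by omega) (by omega)
    rw [← hL] at s4
    simp only [wp_rules, ok_rules, eval_rules, hg, ek, ey, ex, esy, Nat.reduceLT, Nat.reduceEqDiff,
      if_true, if_false]
    repeat refine And.intro (by omega) ?_
    refine ⟨fun hlt => ?_, fun hlt => ?_⟩
    · have hgL : g < L := s4.2 ((s3.1 (by omega)).symm)
      exact ⟨by omega, by omega, ⟨g + 1, rfl, by omega, by omega, by omega⟩, by omega⟩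
    · have hgL : g = L := by
        rcases g2.lt_or_eq with h' | h'
        · have := s3.2 (s4.1 h').symm
          omega
        · exact h'
      refine ⟨by omega, by omega, by omega, _, rfl, ?_, ?_, by omega, ?_, by omega⟩
      · rw [if_neg (by omega), elc, hz]
      · intro hk'
        rw [hgL, hL]
        exact hstep (by omega)
      · intro i hi
        split_ifs with e
        · have : i = k := by
            by_contra hne
            exact hinj i (by omega) e
          rw [this, hgL]
        · rw [elc]
          exact hI i (by
            have : i ≠ k := fun h' => e (by rw [h'])
            omega)
  · rintro τ T' _ hf ⟨h0, _, hz, _, hln, hI, hT⟩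
    have hnm : τ.arr a_nm = σ.arr a_nm := by rw [hf.arr a_nm]; simp [State.setArr_arr_ne]
    have hsa : τ.arr a_sa = σ.arr a_sa := by rw [hf.arr a_sa]; simp [State.setArr_arr_ne]
    have hsy : τ.arr a_sym = σ.arr a_sym := by rw [hf.arr a_sym]; simp [State.setArr_arr_ne]
    refine ⟨by omega, ⟨h.congr ?_ hnm hsa hsy, hz, ?_⟩⟩
    · rw [hf.reg r_n]; simp
    · intro r r1 r2
      have e := hI (σ.arr a_sa r) (by
        by_contra hcon
        have h3 := h.sa_le r2
        have h4 := h.rank_sa r2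
        have h5 := h.rank_lt (σ.arr a_sa r) h3 (σ.arr a_sa 0) (h.sa_le (by omega))
        rw [h4, h.rank_sa (by omega), show σ.arr a_sa r = S.length by omega,
          List.drop_length] at h5
        have h6 : 0 < r := r1
        have := h.rank_lt (σ.arr a_sa 0) (h.sa_le (by omega)) S.length le_rfl
        rw [h.rank_sa (by omega), List.drop_length, show S.length = σ.arr a_sa r by omega, h4] at this
        exact absurd (this.1 h6) (by simp))
      rw [h.rank_sa r2] at e
      rw [hsa, e]

end

/-! ### Range minima by bit masks and a sparse table -/

/-- `v` is the least value of `f` on `{l, …, r}`. -/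
def RangeMin (f : ℕ → ℕ) (l r v : ℕ) : Prop :=
  (∀ k, l ≤ k → k ≤ r → v ≤ f k) ∧ ∃ k, l ≤ k ∧ k ≤ r ∧ f k = v

theorem RangeMin.union {f : ℕ → ℕ} {l r l₁ r₁ l₂ r₂ v w : ℕ} (h₁ : RangeMin f l₁ r₁ v)
    (h₂ : RangeMin f l₂ r₂ w) (e1 : l ≤ l₁) (e2 : r₁ ≤ r) (e3 : l ≤ l₂) (e4 : r₂ ≤ r)
    (hcov : ∀ k, l ≤ k → k ≤ r → (l₁ ≤ k ∧ k ≤ r₁) ∨ (l₂ ≤ k ∧ k ≤ r₂)) :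
    RangeMin f l r (min v w) := by
  obtain ⟨a₁, k₁, b₁, c₁, d₁⟩ := h₁
  obtain ⟨a₂, k₂, b₂, c₂, d₂⟩ := h₂
  refine ⟨fun k h h' => ?_, ?_⟩
  · rcases hcov k h h' with hk | hk
    · exact (min_le_left _ _).trans (a₁ k hk.1 hk.2)
    · exact (min_le_right _ _).trans (a₂ k hk.1 hk.2)
  · rcases le_total v w with h | h
    · exact ⟨k₁, by omega, by omega, by rw [min_eq_left h, d₁]⟩
    · exact ⟨k₂, by omega, by omega, by rw [min_eq_right h, d₂]⟩

/-- The least `d' < d` for which `f (r - d')` is minimal. -/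
def argMin (f : ℕ → ℕ) (r : ℕ) : ℕ → ℕ
  | 0 => 0
  | d + 1 => if f (r - d) < f (r - argMin f r d) then d else argMin f r d

/-- The set of the `d' < d` that are minimal in the sense that `f (r - d') < f (r - d'')` for all
`d'' < d'`, as a bit mask. -/
def minMask (f : ℕ → ℕ) (r : ℕ) : ℕ → ℕ
  | 0 => 0
  | d + 1 => if d = 0 then 1
      else if f (r - d) < f (r - argMin f r d) then minMask f r d + 2 ^ d else minMask f r d

theorem argMin_lt (f : ℕ → ℕ) (r : ℕ) {d : ℕ} (hd : 0 < d) : argMin f r d < d := by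
  induction d with
  | zero => omega
  | succ d ih =>
    rw [argMin]
    split_ifs
    · omega
    · rcases Nat.eq_zero_or_pos d with rfl | h
      · simp [argMin]
      · have := ih h; omega

theorem argMin_le (f : ℕ → ℕ) (r : ℕ) {d d' : ℕ} (hd : d' < d) :
    f (r - argMin f r d) ≤ f (r - d') := by
  induction d with
  | zero => omega
  | succ d ih =>
    rw [argMin]
    split_ifs with h
    · rcases Nat.lt_succ_iff_lt_or_eq.1 hd with h' | rfl
      · exact h.le.trans (ih h')
      · exact le_rfl
    · rcases Nat.lt_succ_iff_lt_or_eq.1 hd with h' | rfl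
      · exact ih h'
      · exact not_lt.1 h

theorem minMask_lt (f : ℕ → ℕ) (r d : ℕ) : minMask f r d < 2 ^ d := by
  induction d with
  | zero => simp [minMask]
  | succ d ih =>
    rw [minMask, pow_succ]
    split_ifs with h
    · subst h; simp
    · omega
    · omega

theorem minMask_mod (f : ℕ → ℕ) (r : ℕ) {d e : ℕ} (h : d ≤ e) :
    minMask f r e % 2 ^ d = minMask f r d := by
  induction e, h using Nat.le_induction with
  | base => exact Nat.mod_eq_of_lt (minMask_lt _ _ _)
  | succ e he ih =>
    rw [minMask]
    split_ifs with h h'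
    · obtain rfl : d = 0 := by omega
      simp [minMask, Nat.mod_one]
    · rw [Nat.add_mod, Nat.mod_eq_zero_of_dvd (pow_dvd_pow 2 he), add_zero, Nat.mod_mod, ih]
    · exact ih

/-- The position of the last minimum of a window is the highest bit of its mask. -/
theorem log_minMask (f : ℕ → ℕ) (r : ℕ) {d : ℕ} (hd : 0 < d) :
    0 < minMask f r d ∧ Nat.log 2 (minMask f r d) = argMin f r d := by
  induction d with
  | zero => omega
  | succ d ih =>
    have hlt := minMask_lt f r d
    rw [minMask, argMin]
    split_ifs with h h' h'
    · subst h; simp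
    · subst h; simp [argMin]
    · refine ⟨by positivity, ?_⟩
      rw [Nat.log_eq_iff (Or.inr ⟨by norm_num, by positivity⟩), pow_succ]
      omega
    · exact ih (by omega)

theorem rangeMin_argMin (f : ℕ → ℕ) {r d : ℕ} (hd : 0 < d) (hr : d ≤ r + 1) :
    RangeMin f (r + 1 - d) r (f (r - argMin f r d)) := by
  have h1 := argMin_lt f r hd
  refine ⟨fun k hk hk' => ?_, r - argMin f r d, by omega, by omega, rfl⟩
  have := argMin_le f r (show r - k < d by omega)
  rwa [show r - (r - k) = k by omega] at this

notation "a_mask" => (30 : ℕ)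
notation "a_lg" => (31 : ℕ)
notation "a_pw" => (32 : ℕ)
notation "a_st" => (33 : ℕ)
notation "r_b" => (31 : ℕ)
notation "r_N" => (32 : ℕ)
notation "r_p" => (40 : ℕ)
notation "r_q" => (41 : ℕ)
notation "r_v" => (42 : ℕ)
notation "r_u" => (43 : ℕ)
notation "r_l1" => (44 : ℕ)
notation "r_l2" => (45 : ℕ)
notation "r_l3" => (46 : ℕ)
notation "r_l4" => (47 : ℕ)
notation "r_l5" => (48 : ℕ)
notation "r_l6" => (49 : ℕ)

/-- The least of the `r_l3` values of `a_lc` up to position `r_l4`, where `r_l3` is at most the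
width of the masks. -/
def windowMin : Cmd :=
  .set r_v (.cell a_lc (.reg r_l4 - .cell a_lg (.cell a_mask (.reg r_l4) -
    .cell a_mask (.reg r_l4) / .cell a_pw (.reg r_l3) * .cell a_pw (.reg r_l3))))

/-- Tables of logarithms and powers of two. -/
def logTables : Cmd :=
  .put a_lg 1 0 ;;
  .set r_M (.reg r_n + .reg r_n + 1) ;;
  .for r_t 2 r_M (.put a_lg (.reg r_t) (.cell a_lg (.reg r_t / 2) + 1)) ;;
  .set r_b (.cell a_lg (.reg r_n) + 1) ;;
  .put a_pw 0 1 ;;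
  .set r_M (.reg r_b + 1) ;;
  .for r_t 1 r_M (.put a_pw (.reg r_t) (.cell a_pw (.reg r_t - 1) + .cell a_pw (.reg r_t - 1)))

/-- The bit masks of the minima in the windows of `r_b` cells of `a_lc`. -/
def maskTable : Cmd :=
  .set r_K (.reg r_n + 1) ;;
  .for r_t 0 r_K
    (.set r_x 0 ;;
      .set r_y 0 ;;
      .for r_k 0 r_b
        (.ite (.reg r_k) 1 (.set r_y 1)
          (.ite (.cell a_lc (.reg r_t - .reg r_k)) (.cell a_lc (.reg r_t - .reg r_x))
            (.set r_x (.reg r_k) ;; .set r_y (.reg r_y + .cell a_pw (.reg r_k))) .skip)) ;;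
      .put a_mask (.reg r_t) (.reg r_y))

/-- A sparse table over blocks of `r_b` cells of `a_lc`. -/
def blockTable : Cmd :=
  .set r_N ((.reg r_n + 1) / .reg r_b) ;;
  .set r_l3 (.reg r_b) ;;
  .for r_t 0 r_N
    (.set r_l4 (.reg r_t * .reg r_b + .reg r_b - 1) ;;
      windowMin ;;
      .put a_st (.reg r_t) (.reg r_v)) ;;
  .set r_w (.reg r_N - 1) ;;
  .for r_k 0 r_b
    (.set r_i (.reg r_k * .reg r_N) ;;
      .set r_j (.reg r_i + .reg r_N) ;;
      .for r_t 0 r_N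
        (.setMin r_x (.reg r_t + .cell a_pw (.reg r_k)) r_w ;;
          .set r_y (.cell a_st (.reg r_i + .reg r_x)) ;;
          .setMin r_x (.cell a_st (.reg r_i + .reg r_t)) r_y ;;
          .put a_st (.reg r_j + .reg r_t) (.reg r_x)))

/-- The least value of `a_lc` from position `r_l1` to position `r_l2`, in constant time. -/
def rangeMin : Cmd :=
  .set r_l3 (.reg r_l2 + 1 - .reg r_l1) ;;
  .set r_l4 (.reg r_l2) ;;
  .ite (.reg r_b) (.reg r_l3)
    (.set r_l3 (.reg r_b) ;;
      windowMin ;;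
      .set r_u (.reg r_v) ;;
      .set r_l4 (.reg r_l1 + .reg r_b - 1) ;;
      windowMin ;;
      .setMin r_v (.reg r_v) r_u ;;
      .set r_l5 ((.reg r_l1 + .reg r_b - 1) / .reg r_b) ;;
      .set r_l6 ((.reg r_l2 + 1) / .reg r_b) ;;
      .ite (.reg r_l5) (.reg r_l6)
        (.set r_l4 (.cell a_lg (.reg r_l6 - .reg r_l5)) ;;
          .set r_u (.cell a_st (.reg r_l4 * .reg r_N + .reg r_l5)) ;;
          .setMin r_v (.reg r_v) r_u ;;
          .set r_u (.cell a_st (.reg r_l4 * .reg r_N + (.reg r_l6 - .cell a_pw (.reg r_l4)))) ;;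
          .setMin r_v (.reg r_v) r_u)
        .skip)
    windowMin

/-- The length of the longest common prefix of the suffixes at `r_p` and `r_q`, in constant time. -/
def lce : Cmd :=
  .set r_l1 (.cell a_nm (.reg r_p)) ;;
  .set r_l2 (.cell a_nm (.reg r_q)) ;;
  .ite (.reg r_l1) (.reg r_l2)
    (.set r_l1 (.reg r_l1 + 1) ;; rangeMin)
    (.ite (.reg r_l2) (.reg r_l1)
      (.set r_v (.reg r_l1) ;; .set r_l1 (.reg r_l2 + 1) ;; .set r_l2 (.reg r_v) ;; rangeMin)
      (.set r_v (.reg r_n - .reg r_p)))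

section
variable {S : List ℤ} {cap W : ℕ}

theorem HasLcp.congr {σ τ : State} (h : HasLcp S σ) (h1 : τ.reg r_n = σ.reg r_n)
    (h2 : τ.arr a_nm = σ.arr a_nm) (h3 : τ.arr a_sa = σ.arr a_sa)
    (h4 : τ.arr a_sym = σ.arr a_sym) (h5 : τ.arr a_lc = σ.arr a_lc) : HasLcp S τ :=
  ⟨h.toHasSuffixArray.congr h1 h2 h3 h4, h5 ▸ h.lc_zero, h5 ▸ h3 ▸ h.lc_eq⟩

/-- The least of the longest common prefixes of neighbours is that of the ends. -/
theorem HasLcp.eq_of_rangeMin {σ : State} (h : HasLcp S σ) {r s v : ℕ} (hrs : r < s)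
    (hs : s ≤ S.length) (hv : RangeMin (σ.arr a_lc) (r + 1) s v) :
    v = lcp (S.drop (σ.arr a_sa r)) (S.drop (σ.arr a_sa s)) := by
  have mono : ∀ a b, a ≤ b → b ≤ S.length →
      S.drop (σ.arr a_sa a) ≤ S.drop (σ.arr a_sa b) := by
    intro a b hab hb
    rcases hab.eq_or_lt with rfl | hab
    · exact le_rfl
    · exact ((h.sa_lt (by omega) hb).2 hab).le
  obtain ⟨h1, k, hk, hk', rfl⟩ := hv
  refine le_antisymm ?_ ?_
  · have : ∀ d, r + d ≤ s → d ≠ 0 →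
        σ.arr a_lc k ≤ lcp (S.drop (σ.arr a_sa r)) (S.drop (σ.arr a_sa (r + d))) := by
      intro d
      induction d with
      | zero => simp
      | succ d ih =>
        intro hd _
        have e := h1 (r + (d + 1)) (by omega) hd
        rw [h.lc_eq (r + (d + 1)) (by omega) (by omega)] at e
        rcases Nat.eq_zero_or_pos d with rfl | hd'
        · exact e
        · exact le_lcp_trans (ih (by omega) (by omega)) e
    have := this (s - r) (by omega) (by omega)
    rwa [show r + (s - r) = s by omega] at this
  · rw [h.lc_eq k (by omega) (by omega)]
    exact (lcp_mono (mono r k (by omega) (by omega)) (mono k s hk' hs)).1.trans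
      (lcp_mono (mono r (k - 1) (by omega) (by omega)) (mono (k - 1) k (by omega) (by omega))).2

/-- The state holds the tables of logarithms and powers, and the bit masks of the minima of
`a_lc`. -/
structure HasMasks (S : List ℤ) (τ : State) : Prop extends HasLcp S τ where
  b_eq : τ.reg r_b = Nat.log 2 S.length + 1
  lg_eq : ∀ v, 1 ≤ v → v ≤ 2 * S.length → τ.arr a_lg v = Nat.log 2 v
  pw_eq : ∀ j ≤ Nat.log 2 S.length + 1, τ.arr a_pw j = 2 ^ j
  mask_eq : ∀ r ≤ S.length,
    τ.arr a_mask r = minMask (τ.arr a_lc) r (Nat.log 2 S.length + 1)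

theorem HasMasks.congr {σ τ : State} (h : HasMasks S σ) (h1 : τ.reg r_n = σ.reg r_n)
    (h2 : τ.arr a_nm = σ.arr a_nm) (h3 : τ.arr a_sa = σ.arr a_sa)
    (h4 : τ.arr a_sym = σ.arr a_sym) (h5 : τ.arr a_lc = σ.arr a_lc) (h6 : τ.reg r_b = σ.reg r_b)
    (h7 : τ.arr a_lg = σ.arr a_lg) (h8 : τ.arr a_pw = σ.arr a_pw)
    (h9 : τ.arr a_mask = σ.arr a_mask) : HasMasks S τ :=
  ⟨h.toHasLcp.congr h1 h2 h3 h4 h5, h6 ▸ h.b_eq, h7 ▸ h.lg_eq, h8 ▸ h.pw_eq, h9 ▸ h5 ▸ h.mask_eq⟩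

/-- All tables for longest common prefix queries are present. -/
structure HasLce (S : List ℤ) (τ : State) : Prop extends HasMasks S τ where
  N_eq : τ.reg r_N = (S.length + 1) / (Nat.log 2 S.length + 1)
  st_eq : ∀ j ≤ Nat.log 2 S.length + 1, ∀ q < (S.length + 1) / (Nat.log 2 S.length + 1),
    RangeMin (τ.arr a_lc) (q * (Nat.log 2 S.length + 1))
      (min (q + 2 ^ j) ((S.length + 1) / (Nat.log 2 S.length + 1)) * (Nat.log 2 S.length + 1) - 1)
      (τ.arr a_st (j * ((S.length + 1) / (Nat.log 2 S.length + 1)) + q))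

theorem HasLce.congr {σ τ : State} (h : HasLce S σ) (h1 : τ.reg r_n = σ.reg r_n)
    (h2 : τ.arr a_nm = σ.arr a_nm) (h3 : τ.arr a_sa = σ.arr a_sa)
    (h4 : τ.arr a_sym = σ.arr a_sym) (h5 : τ.arr a_lc = σ.arr a_lc) (h6 : τ.reg r_b = σ.reg r_b)
    (h7 : τ.arr a_lg = σ.arr a_lg) (h8 : τ.arr a_pw = σ.arr a_pw)
    (h9 : τ.arr a_mask = σ.arr a_mask) (h10 : τ.reg r_N = σ.reg r_N)
    (h11 : τ.arr a_st = σ.arr a_st) : HasLce S τ :=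
  ⟨h.toHasMasks.congr h1 h2 h3 h4 h5 h6 h7 h8 h9, h10 ▸ h.N_eq, h11 ▸ h5 ▸ h.st_eq⟩

theorem two_pow_log_le {n : ℕ} (hn : 0 < n) : 2 ^ (Nat.log 2 n + 1) ≤ 2 * n := by
  have := Nat.pow_log_le_self 2 hn.ne'
  rw [pow_succ]; omega

/-- The mask modulo `2 ^ d` describes the shorter window of `d` cells. -/
theorem windowMin_spec {σ : State} {T r d : ℕ} (h : HasMasks S σ) (hn0 : 0 < S.length)
    (hc : 2 * S.length + 4 ≤ cap) (hW : 2 * S.length + 4 ≤ W) (hr : σ.reg r_l4 = r)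
    (hd : σ.reg r_l3 = d) (hrn : r ≤ S.length) (hd0 : 0 < d)
    (hdb : d ≤ Nat.log 2 S.length + 1) (hdr : d ≤ r + 1) :
    wp S cap W windowMin (fun τ T' => T' ≤ T + 40 ∧
      RangeMin (σ.arr a_lc) (r + 1 - d) r (τ.reg r_v)) σ T := by
  obtain ⟨h1, h2⟩ := log_minMask (σ.arr a_lc) r hd0
  have h3 := minMask_lt (σ.arr a_lc) r (Nat.log 2 S.length + 1)
  have h4 := two_pow_log_le hn0
  have h5 := minMask_mod (σ.arr a_lc) r hdb
  have h6 : Nat.log 2 S.length < S.length := Nat.log_lt_self 2 (by omega)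
  have h7 := h.mask_eq r hrn
  have h8 := h.pw_eq d hdb
  have h9 : 0 < 2 ^ d := by positivity
  have h10 : minMask (σ.arr a_lc) r (Nat.log 2 S.length + 1) -
      minMask (σ.arr a_lc) r (Nat.log 2 S.length + 1) / 2 ^ d * 2 ^ d =
      minMask (σ.arr a_lc) r d := by
    rw [← h5]
    have := Nat.div_add_mod' (minMask (σ.arr a_lc) r (Nat.log 2 S.length + 1)) (2 ^ d)
    omega
  have h11 := minMask_lt (σ.arr a_lc) r d
  have h12 : 2 ^ d ≤ 2 ^ (Nat.log 2 S.length + 1) := Nat.pow_le_pow_right (by norm_num) hdb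
  have h13 := h.lg_eq (minMask (σ.arr a_lc) r d) h1 (by omega)
  have h14 := argMin_lt (σ.arr a_lc) r hd0
  have h15 : minMask (σ.arr a_lc) r (Nat.log 2 S.length + 1) / 2 ^ d ≤
    minMask (σ.arr a_lc) r (Nat.log 2 S.length + 1) := Nat.div_le_self _ _
  have h16 : minMask (σ.arr a_lc) r (Nat.log 2 S.length + 1) / 2 ^ d * 2 ^ d ≤
    minMask (σ.arr a_lc) r (Nat.log 2 S.length + 1) := Nat.div_mul_le_self _ _
  unfold windowMin
  simp only [wp_rules, ok_rules, eval_rules, hr, hd, h7, h8, h10, h13, h2, Nat.reduceLT, if_true]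
  repeat refine And.intro (by omega) ?_
  exact rangeMin_argMin _ hd0 hdr

end

/-! ### Longest common prefix queries in constant time -/

/-- `v` is the least value of `f` on the set `P`. -/
def SetMin (f : ℕ → ℕ) (P : ℕ → Prop) (v : ℕ) : Prop := (∀ k, P k → v ≤ f k) ∧ ∃ k, P k ∧ f k = v

theorem SetMin.union {f : ℕ → ℕ} {P Q : ℕ → Prop} {v w : ℕ} (h : SetMin f P v)
    (h' : SetMin f Q w) : SetMin f (fun k => P k ∨ Q k) (min v w) := by
  obtain ⟨a, i, b, c⟩ := h
  obtain ⟨a', i', b', c'⟩ := h'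
  refine ⟨fun k hk => ?_, ?_⟩
  · rcases hk with hk | hk
    · exact (min_le_left _ _).trans (a k hk)
    · exact (min_le_right _ _).trans (a' k hk)
  · rcases le_total v w with h | h
    · exact ⟨i, Or.inl b, by rw [min_eq_left h, c]⟩
    · exact ⟨i', Or.inr b', by rw [min_eq_right h, c']⟩

theorem RangeMin.setMin {f : ℕ → ℕ} {l r v : ℕ} (h : RangeMin f l r v) :
    SetMin f (fun k => l ≤ k ∧ k ≤ r) v :=
  ⟨fun k hk => h.1 k hk.1 hk.2, let ⟨k, h1, h2, h3⟩ := h.2; ⟨k, ⟨h1, h2⟩, h3⟩⟩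

theorem SetMin.rangeMin {f : ℕ → ℕ} {P : ℕ → Prop} {l r v : ℕ} (h : SetMin f P v)
    (hP : ∀ k, P k ↔ l ≤ k ∧ k ≤ r) : RangeMin f l r v :=
  ⟨fun k h1 h2 => h.1 k ((hP k).2 ⟨h1, h2⟩), let ⟨k, h1, h3⟩ := h.2;
    ⟨k, ((hP k).1 h1).1, ((hP k).1 h1).2, h3⟩⟩

section
variable {S : List ℤ} {cap W : ℕ}

/-- The width `r_b` of the windows is `log n + 1`. -/
theorem logTables_spec {σ : State} {T n : ℕ} (hrn : σ.reg r_n = n) (hn0 : 0 < n)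
    (hc : 2 * n + 4 ≤ cap) (hW : 4 * n + 4 ≤ W) :
    wp S cap W logTables (fun τ T' => T' ≤ T + 200 * (n + 1) ∧ τ.reg r_b = Nat.log 2 n + 1 ∧
      (∀ v, 1 ≤ v → v ≤ 2 * n → τ.arr a_lg v = Nat.log 2 v) ∧
      ∀ j ≤ Nat.log 2 n + 1, τ.arr a_pw j = 2 ^ j) σ T := by
  have hlog : Nat.log 2 n < n := Nat.log_lt_self 2 (by omega)
  have h4 := two_pow_log_le hn0
  unfold logTables
  simp only [wp_rules, ok_rules, eval_rules, hrn, Nat.reduceLT, Nat.reduceEqDiff, if_false]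
  repeat refine And.intro (by omega) ?_
  refine wp_for_const (fun k τ => ∀ v, 1 ≤ v → v < k → τ.arr a_lg v = Nat.log 2 v) 2 (n + n + 1) 30
    (by norm_num) (by norm_num) (by norm_num) rfl rfl (by simp) (by omega) (by omega)
    (by simp [ok_rules]; omega) (by simp [eval_rules]) ?_ ?_ ?_
  · intro v h1 h2
    obtain rfl : v = 1 := by omega
    simp
  · intro k τ T' hk1 hk hkτ hf hI
    have e := hI (k / 2) (by omega) (by omega)
    have e2 : Nat.log 2 k = Nat.log 2 (k / 2) + 1 := Nat.log_of_one_lt_of_le (by norm_num) hk1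
    have e3 : Nat.log 2 (k / 2) < k / 2 := Nat.log_lt_self 2 (by omega)
    simp only [wp_rules, ok_rules, eval_rules, hkτ, Nat.reduceLT, e]
    repeat refine And.intro (by omega) ?_
    refine ⟨fun v h1 h2 => ?_, by omega⟩
    split_ifs with h
    · rw [h, e2]
    · exact hI v h1 (by omega)
  intro τ₁ T₁ _ f₁ h₁ ht₁
  have n₁ : τ₁.reg r_n = n := by rw [f₁.reg r_n]; simp [hrn]
  have l₁ := h₁ n (by omega) (by omega)
  simp only [wp_rules, ok_rules, eval_rules, n₁, l₁, Nat.reduceLT, Nat.reduceEqDiff, if_true, if_false]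
  repeat refine And.intro (by omega) ?_
  refine wp_for_const (fun k τ => ∀ j < k, τ.arr a_pw j = 2 ^ j) 1 (Nat.log 2 n + 1 + 1) 30
    (by norm_num) (by norm_num) (by norm_num) rfl rfl (by simp) (by omega) (by omega)
    (by simp [ok_rules]; omega) (by simp [eval_rules]) ?_ ?_ ?_
  · intro v h1
    obtain rfl : v = 0 := by omega
    simp
  · intro k τ T' hk1 hk hkτ hf hI
    have e := hI (k - 1) (by omega)
    have e2 : 2 ^ k = 2 ^ (k - 1) + 2 ^ (k - 1) := by
      obtain ⟨k', rfl⟩ : ∃ k', k = k' + 1 := ⟨k - 1, by omega⟩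
      rw [Nat.add_sub_cancel]; ring
    have e3 : 2 ^ k ≤ 2 ^ (Nat.log 2 n + 1) := Nat.pow_le_pow_right (by norm_num) (by omega)
    simp only [wp_rules, ok_rules, eval_rules, hkτ, Nat.reduceLT, e]
    repeat refine And.intro (by omega) ?_
    refine ⟨fun v h1 => ?_, by omega⟩
    split_ifs with h
    · rw [h, e2]
    · exact hI v (by omega)
  · intro τ₂ T₂ _ f₂ h₂ ht₂
    simp only [eval_rules] at ht₁ ht₂
    refine ⟨by omega, ?_, ?_, fun j hj => h₂ j (by omega)⟩
    · rw [f₂.reg r_b]; simp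
    · intro v h1 h2
      rw [f₂.arr a_lg]
      simp only [eval_rules, Nat.reduceEqDiff, false_and, if_false]
      exact h₁ v h1 (by omega)

/-- Each of the `n + 1` masks is found by a scan of `log n + 1` cells. -/
theorem maskTable_spec {σ : State} {T n : ℕ} (hn : S.length = n) (h : HasLcp S σ)
    (hb : σ.reg r_b = Nat.log 2 n + 1)
    (hlg : ∀ v, 1 ≤ v → v ≤ 2 * n → σ.arr a_lg v = Nat.log 2 v)
    (hpw : ∀ j ≤ Nat.log 2 n + 1, σ.arr a_pw j = 2 ^ j) (hn0 : 0 < n)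
    (hc : 2 * n + 4 ≤ cap) (hW : 4 * n + 4 ≤ W) :
    wp S cap W maskTable (fun τ T' => T' ≤ T + (100 * (Nat.log 2 n + 1) + 200) * (n + 1) ∧
      HasMasks S τ) σ T := by
  have hlog : Nat.log 2 n < n := Nat.log_lt_self 2 (by omega)
  have h4 := two_pow_log_le hn0
  have hrn : σ.reg r_n = n := h.n_eq.trans hn
  set b := Nat.log 2 n + 1 with hbdef
  set f := σ.arr a_lc with hfdef
  unfold maskTable
  simp only [wp_rules, ok_rules, eval_rules, hrn, Nat.reduceLT, Nat.reduceEqDiff, if_false]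
  repeat refine And.intro (by omega) ?_
  refine wp_for_const (fun k τ => ∀ r < k, τ.arr a_mask r = minMask f r b) 0 (n + 1) (100 * b + 100)
    (by norm_num) (by norm_num) (by norm_num) rfl rfl (by simp) (by omega) (by omega)
    (by simp [ok_rules]) (by simp [eval_rules]) (by simp) ?_ ?_
  · intro k τ T' _ hk hkτ hf hI
    simp only [wp_rules, ok_rules, eval_rules, Nat.reduceLT, Nat.reduceEqDiff, if_false]
    have hb' : τ.reg r_b = b := by rw [hf.reg r_b]; simp [hb]
    have elc : τ.arr a_lc = f := hf.arr a_lc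
    have epw : τ.arr a_pw = σ.arr a_pw := hf.arr a_pw
    refine wp_for_const (fun d υ => υ.reg r_x = argMin f k d ∧ υ.reg r_y = minMask f k d) 0 b 70
      (by norm_num) (by norm_num) (by norm_num) rfl rfl (by simp [hb']) (by omega) (by omega)
      (by simp [ok_rules]) (by simp [eval_rules]) (by simp [argMin, minMask]) ?_ ?_
    · rintro d υ T₁ _ hd hdυ hf' ⟨hx, hy⟩
      have ek : υ.reg r_t = k := by rw [hf'.reg r_t]; simp [hkτ]
      have e1 : υ.arr a_lc = f := by rw [hf'.arr a_lc]; exact elc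
      have e2 : υ.arr a_pw d = 2 ^ d := by rw [hf'.arr a_pw, ← hpw d (by omega), ← epw]; rfl
      have e3 := minMask_lt f k d
      have e4 : 2 ^ (d + 1) ≤ 2 ^ b := Nat.pow_le_pow_right (by norm_num) (by omega)
      rw [pow_succ] at e4
      have e5 : argMin f k d ≤ d := by
        rcases Nat.eq_zero_or_pos d with rfl | h
        · simp [argMin]
        · exact (argMin_lt f k h).le
      simp only [wp_rules, ok_rules, eval_rules, hdυ, ek, e1, e2, hx, hy, Nat.reduceLT,
        Nat.reduceEqDiff, if_true, if_false]
      refine ⟨by omega, fun h0 => ⟨by omega, ?_, ?_, by omega⟩, fun h0 => ⟨by omega, by omega,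
        by omega, by omega, fun h1 => ⟨by omega, by omega, ?_, ?_, by omega⟩, fun h1 => ⟨?_, ?_, by omega⟩⟩⟩
      · obtain rfl : d = 0 := by omega
        simp [argMin]
      · rw [minMask, if_pos (by omega)]
      · rw [argMin, if_pos h1]
      · rw [minMask, if_neg (by omega), if_pos h1]
      · rw [argMin, if_neg h1]
      · rw [minMask, if_neg (by omega), if_neg h1]
    · rintro υ T₁ _ hf' ⟨hx, hy⟩ hT₁
      have ek : υ.reg r_t = k := by rw [hf'.reg r_t]; simp [hkτ]
      have em : υ.arr a_mask = τ.arr a_mask := hf'.arr a_mask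
      simp only [wp_rules, ok_rules, eval_rules, ek, hy, em, Nat.reduceLT] at hT₁ ⊢
      refine ⟨by omega, fun r hr => ?_, by omega⟩
      split_ifs with h'
      · rw [h']
      · exact hI r (by omega)
  · intro τ T₁ _ hf hI hT₁
    simp only [eval_rules] at hT₁
    refine ⟨?_, ⟨h.congr ?_ (hf.arr a_nm) (hf.arr a_sa) (hf.arr a_sym) (hf.arr a_lc), ?_, ?_, ?_, ?_⟩⟩
    · have : (100 * b + 200) * (n + 1) = (100 * b + 100 + 11) * (n + 1) + 89 * (n + 1) := by ring
      rw [Nat.sub_zero] at hT₁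
      omega
    · rw [hf.reg r_n]; simp
    · rw [hf.reg r_b, hn]; simp [hb, hbdef]
    · rw [hf.arr a_lg, hn]; exact hlg
    · rw [hf.arr a_pw, hn]; exact hpw
    · rw [hf.arr a_lc, hn]; exact fun r hr => hI r (by omega)

/-- There are `(n + 1) / b` blocks and `b + 1` levels for `b = log n + 1`, so the table has `O(n)`
cells. -/
theorem blockTable_spec {σ : State} {T n : ℕ} (hn : S.length = n) (h : HasMasks S σ)
    (hn0 : 0 < n) (hc : 4 * n + 4 ≤ cap) (hW : 4 * n + 8 ≤ W) :
    wp S cap W blockTable (fun τ T' => T' ≤ T + 1000 * (n + 1) * (Nat.log 2 n + 1) ∧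
      HasLce S τ) σ T := by
  have hlog : Nat.log 2 n < n := Nat.log_lt_self 2 (by omega)
  have hrn : σ.reg r_n = n := h.n_eq.trans hn
  have hb : σ.reg r_b = Nat.log 2 n + 1 := by rw [h.b_eq, hn]
  have h2b := two_pow_log_le hn0
  have hpw : ∀ j ≤ Nat.log 2 n + 1, σ.arr a_pw j = 2 ^ j := hn ▸ h.pw_eq
  obtain ⟨b, hbdef⟩ : ∃ b, Nat.log 2 n + 1 = b := ⟨_, rfl⟩
  rw [hbdef] at hb hpw h2b ⊢
  obtain ⟨N, hN⟩ : ∃ N, (n + 1) / b = N := ⟨_, rfl⟩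
  have hNb : N * b ≤ n + 1 := by rw [← hN]; exact Nat.div_mul_le_self _ _
  have hNn : N ≤ n + 1 := by rw [← hN]; exact Nat.div_le_self _ _
  have hmul : ∀ q < N, q * b + b ≤ N * b := fun q hq => by
    rw [← Nat.succ_mul]; exact Nat.mul_le_mul_right _ hq
  set f := σ.arr a_lc with hf
  unfold blockTable
  simp only [wp_rules, ok_rules, eval_rules, hrn, hb, hN, Nat.reduceLT, Nat.reduceEqDiff, if_false]
  repeat refine And.intro (by omega) ?_
  refine wp_for_const (fun k τ => ∀ q < k, RangeMin f (q * b) (min (q + 2 ^ 0) N * b - 1)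
      (τ.arr a_st q)) 0 N 100
    (by norm_num) (by norm_num) (by norm_num) rfl rfl (by simp) (by omega) (by omega)
    (by simp [ok_rules]) (by simp [eval_rules]) (by simp) ?_ ?_
  · intro k τ T' _ hk hkτ hf' hI
    have hk2 := hmul k hk
    have hb' : τ.reg r_b = b := by rw [hf'.reg r_b]; simp [hb]
    have hM : HasMasks S τ := h.congr (by rw [hf'.reg r_n]; simp) (hf'.arr a_nm) (hf'.arr a_sa)
      (hf'.arr a_sym) (hf'.arr a_lc) (by rw [hf'.reg r_b]; simp) (hf'.arr a_lg)
      (hf'.arr a_pw) (hf'.arr a_mask)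
    have h3 : τ.reg r_l3 = b := by rw [hf'.reg r_l3]; simp
    simp only [wp_rules, ok_rules, eval_rules, hkτ, hb', Nat.reduceLT]
    repeat refine And.intro (by omega) ?_
    refine wp_last (windowMin_spec (r := k * b + b - 1) (d := b)
      (hM.congr (by simp) rfl rfl rfl rfl (by simp) rfl rfl rfl) (by omega) (by omega) (by omega)
      (by simp) (by simp [h3]) (by omega) (by omega) (by rw [hn]; omega) (by omega)) ?_
    rintro υ T₁ f₁ ⟨hT₁, hv⟩
    have ek : υ.reg r_t = k := by rw [f₁.reg r_t]; simp [hkτ]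
    have est : υ.arr a_st = τ.arr a_st := f₁.arr a_st
    simp only [wp_rules, ok_rules, eval_rules, ek, est, Nat.reduceLT]
    refine ⟨by omega, fun q hq => ?_, by omega⟩
    split_ifs with e
    · rw [e]
      have e5 : τ.arr a_lc = f := hf'.arr a_lc
      simp only [eval_rules, e5] at hv
      rw [pow_zero, min_eq_left (by omega), add_mul, one_mul]
      rwa [show k * b + b - 1 + 1 - b = k * b by omega] at hv
    · exact hI q (by omega)
  intro τ₁ T₁ _ f₁ h₁ ht₁
  have n₁ : τ₁.reg r_N = N := by rw [f₁.reg r_N]; simp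
  have lc₁ : τ₁.arr a_lc = f := f₁.arr a_lc
  have b₁ : τ₁.reg r_b = b := by rw [f₁.reg r_b]; simp [hb]
  have pw₁ : τ₁.arr a_pw = σ.arr a_pw := f₁.arr a_pw
  simp only [wp_rules, ok_rules, eval_rules, n₁, Nat.reduceLT]
  repeat refine And.intro (by omega) ?_
  have hmain : ∀ (k t : ℕ) (X : ℕ → ℕ), t < N →
      (∀ q < N, RangeMin f (q * b) (min (q + 2 ^ k) N * b - 1) (X (k * N + q))) →
      RangeMin f (t * b) (min (t + 2 ^ (k + 1)) N * b - 1)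
        (min (X (k * N + t)) (X (k * N + min (t + 2 ^ k) (N - 1)))) := by
    intro k t X ht hX
    have e1 := hX t ht
    have e2 := hX (min (t + 2 ^ k) (N - 1)) (by omega)
    have hp : 0 < 2 ^ k := by positivity
    have m1 : min (t + 2 ^ k) N * b ≤ min (t + 2 ^ (k + 1)) N * b :=
      Nat.mul_le_mul_right _ (by rw [pow_succ]; omega)
    have m2 : min (min (t + 2 ^ k) (N - 1) + 2 ^ k) N * b = min (t + 2 ^ (k + 1)) N * b := by
      congr 1; rw [pow_succ]; omega
    have m3 : t * b ≤ min (t + 2 ^ k) (N - 1) * b := Nat.mul_le_mul_right _ (by omega)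
    have m4 : min (t + 2 ^ k) (N - 1) * b ≤ min (t + 2 ^ k) N * b :=
      Nat.mul_le_mul_right _ (by omega)
    refine e1.union e2 le_rfl (by omega) m3 (by rw [m2]) ?_
    intro i hi hi'
    clear e1 e2 hX
    omega
  refine wp_for_const (fun k τ => ∀ j ≤ k, ∀ q < N, RangeMin f (q * b) (min (q + 2 ^ j) N * b - 1)
      (τ.arr a_st (j * N + q))) 0 b (200 * N + 100)
    (by norm_num) (by norm_num) (by norm_num) rfl rfl (by simp [b₁]) (by omega) (by omega)
    (by simp [ok_rules]) (by simp [eval_rules]) ?_ ?_ ?_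
  · intro j hj q hq
    obtain rfl : j = 0 := by omega
    simpa using h₁ q hq
  · intro k τ T' _ hk hkτ hf' hI
    have hN' : τ.reg r_N = N := by rw [hf'.reg r_N]; simp [n₁]
    have hkN : k * N + N ≤ N * b := by
      rw [← Nat.succ_mul, mul_comm N]; exact Nat.mul_le_mul_right _ hk
    have hpk : τ.arr a_pw k = 2 ^ k := by
      rw [hf'.arr a_pw, ← hpw k (by omega), ← pw₁]; rfl
    have hpk2 : 2 ^ k ≤ 2 ^ b := Nat.pow_le_pow_right (by norm_num) hk.le
    have hw : τ.reg r_w = N - 1 := by rw [hf'.reg r_w]; simp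
    have hle : ∀ j ≤ k, ∀ q < N, j * N + q < k * N + N := fun j hj q hq => by
      have := Nat.mul_le_mul_right N hj; omega
    simp only [wp_rules, ok_rules, eval_rules, hkτ, hN', Nat.reduceLT, Nat.reduceEqDiff, if_false,
      if_true]
    repeat refine And.intro (by omega) ?_
    refine wp_for_const (fun t υ => (∀ s < k * N + N, υ.arr a_st s = τ.arr a_st s) ∧
        ∀ q < t, υ.arr a_st (k * N + N + q) =
          min (τ.arr a_st (k * N + q)) (τ.arr a_st (k * N + min (q + 2 ^ k) (N - 1)))) 0 N 150
      (by norm_num) (by norm_num) (by norm_num) rfl rfl (by simp [hN']) (by omega) (by omega)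
      (by simp [ok_rules]) (by simp [eval_rules]) (by simp) ?_ ?_
    · rintro t υ T₂ _ ht htυ hf₂ ⟨hs, hq⟩
      have ei : υ.reg r_i = k * N := by rw [hf₂.reg r_i]; simp
      have ej : υ.reg r_j = k * N + N := by rw [hf₂.reg r_j]; simp
      have ek : υ.reg r_k = k := by rw [hf₂.reg r_k]; simp [hkτ]
      have ew : υ.reg r_w = N - 1 := by rw [hf₂.reg r_w]; simp [hw]
      have ep : υ.arr a_pw k = 2 ^ k := by rw [hf₂.arr a_pw]; exact hpk
      refine wp_seq (wp_setMin (by norm_num) (by norm_num) (by norm_num) ?_ ?_)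
      · simp only [ok_rules, eval_rules, htυ, ek, ep, Nat.reduceLT]; omega
      intro υ₁ e1 g1 a1 T₃ hT₃
      simp only [eval_rules, htυ, ek, ew, ep] at e1 hT₃
      simp only [wp_rules, ok_rules, eval_rules, e1, g1 r_i (by norm_num), ei, a1, Nat.reduceLT]
      rw [hs (k * N + min (t + 2 ^ k) (N - 1)) (by omega)]
      repeat refine And.intro (by omega) ?_
      refine (wp_setMin (by norm_num) (by norm_num) (by norm_num) ?_ ?_)
      · simp only [ok_rules, eval_rules, g1 r_t (by norm_num), g1 r_i (by norm_num), htυ, ei,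
          Nat.reduceLT, Nat.reduceEqDiff, if_false]
        omega
      intro υ₂ e2 g2 a2 T₄ hT₄
      simp only [eval_rules, g1 r_t (by norm_num), g1 r_i (by norm_num), htυ, ei, a1, Nat.reduceEqDiff,
        if_true, if_false] at e2 hT₄
      rw [hs (k * N + t) (by omega)] at e2
      simp only [wp_rules, ok_rules, eval_rules, e2, a2, a1, g2 r_j (by norm_num),
        g2 r_t (by norm_num), g1 r_j (by norm_num), g1 r_t (by norm_num), ej, htυ, Nat.reduceLT,
        Nat.reduceEqDiff, if_false]
      repeat refine And.intro (by omega) ?_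
      refine ⟨fun s hs' => ?_, fun q hq' => ?_, by omega⟩
      · rw [if_neg (by omega), hs s hs']
      · by_cases hqt : q = t
        · rw [if_pos (by omega), hqt]
        · rw [if_neg (by omega), hq q (by omega)]
    · rintro υ T₂ _ hf₂ ⟨hs, hq⟩ hT₂
      simp only [eval_rules] at hT₂
      refine ⟨fun j hj q hq' => ?_, by omega⟩
      by_cases hjk : j = k + 1
      · subst hjk
        rw [add_mul, one_mul]
        rw [hq q hq']
        exact hmain k q _ hq' (hI k le_rfl)
      · rw [hs _ (hle j (by omega) q hq')]
        exact hI j (by omega) q hq'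
  · intro τ T₂ _ hf₂ hI hT₂
    simp only [eval_rules] at ht₁ hT₂
    refine ⟨?_, ⟨h.congr ?_ ?_ ?_ ?_ ?_ ?_ ?_ ?_ ?_, ?_, ?_⟩⟩
    · have e1 : (200 * N + 100 + 11) * b = 200 * (N * b) + 111 * b := by ring
      have e2 : 1000 * (n + 1) ≤ 1000 * (n + 1) * b := Nat.le_mul_of_pos_right _ (by omega)
      rw [Nat.sub_zero, e1] at hT₂
      omega
    · rw [hf₂.reg r_n]; exact (f₁.reg r_n).trans (by simp)
    · rw [hf₂.arr a_nm]; exact f₁.arr a_nm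
    · rw [hf₂.arr a_sa]; exact f₁.arr a_sa
    · rw [hf₂.arr a_sym]; exact f₁.arr a_sym
    · rw [hf₂.arr a_lc]; exact f₁.arr a_lc
    · rw [hf₂.reg r_b]; exact (f₁.reg r_b).trans (by simp)
    · rw [hf₂.arr a_lg]; exact f₁.arr a_lg
    · rw [hf₂.arr a_pw]; exact f₁.arr a_pw
    · rw [hf₂.arr a_mask]; exact f₁.arr a_mask
    · rw [hf₂.reg r_N, hn, hbdef, hN]; simp [n₁]
    · have e5 : τ.arr a_lc = f := by rw [hf₂.arr a_lc]; exact lc₁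
      rw [hn, hbdef, hN, e5]
      exact hI

/-- A range longer than a window is covered by two windows at its ends and the complete blocks
inside; the latter are covered by two ranges of blocks whose length is a power of two. -/
theorem rangeMin_spec {σ : State} {T l r : ℕ} (h : HasLce S σ) (hn0 : 0 < S.length)
    (hc : 4 * S.length + 4 ≤ cap) (hW : 4 * S.length + 8 ≤ W) (hl : σ.reg r_l1 = l)
    (hr : σ.reg r_l2 = r) (hlr : l ≤ r) (hrn : r ≤ S.length) :
    wp S cap W rangeMin (fun τ T' => T' ≤ T + 300 ∧ RangeMin (σ.arr a_lc) l r (τ.reg r_v)) σ T := by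
  have hlog : Nat.log 2 S.length < S.length := Nat.log_lt_self 2 (by omega)
  have hb := h.b_eq
  have hNeq := h.N_eq
  have hst := h.st_eq
  have hpw := h.pw_eq
  have hlg := h.lg_eq
  obtain ⟨n, hn⟩ : ∃ n, S.length = n := ⟨_, rfl⟩
  rw [hn] at hb hNeq hst hn0 hc hW hrn hpw hlg hlog
  obtain ⟨b, hbdef⟩ : ∃ b, Nat.log 2 n + 1 = b := ⟨_, rfl⟩
  rw [hbdef] at hb hNeq hst hpw
  obtain ⟨N, hN⟩ : ∃ N, (n + 1) / b = N := ⟨_, rfl⟩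
  rw [hN] at hNeq hst
  have hNb : N * b ≤ n + 1 := by rw [← hN]; exact Nat.div_mul_le_self _ _
  have hNn : N ≤ n + 1 := by rw [← hN]; exact Nat.div_le_self _ _
  unfold rangeMin
  simp only [wp_rules, ok_rules, eval_rules, hl, hr, hb, Nat.reduceLT, Nat.reduceEqDiff, if_false,
    if_true]
  repeat refine And.intro (by omega) ?_
  refine ⟨fun hlt => ?_, fun hlt => ?_⟩
  · set σ₀ := ((σ.setReg r_l3 (r + 1 - l)).setReg r_l4 r).setReg r_l3 b with hσ₀
    refine wp_last (windowMin_spec (r := r) (d := b) (h.toHasMasks.congr (by simp [hσ₀]) rfl rfl rfl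
      rfl (by simp [hσ₀]) rfl rfl rfl) (by omega) (by omega) (by omega) (by simp [hσ₀])
      (by simp [hσ₀]) (by omega) (by omega) (by rw [hn]; omega) (by omega)) ?_
    rintro τ₁ T₁ f₁ ⟨hT₁, v₁⟩
    have l₁ : τ₁.reg r_l1 = l := by rw [f₁.reg r_l1]; simp [hσ₀, hl]
    have r₁ : τ₁.reg r_l2 = r := by rw [f₁.reg r_l2]; simp [hσ₀, hr]
    have b₁ : τ₁.reg r_b = b := by rw [f₁.reg r_b]; simp [hσ₀, hb]
    have lc₀ : σ₀.arr a_lc = σ.arr a_lc := rfl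
    have d₁ : τ₁.reg r_l3 = b := by rw [f₁.reg r_l3]; simp [hσ₀]
    have H₁ : HasLce S τ₁ := h.congr (by rw [f₁.reg r_n]; simp [hσ₀]) (f₁.arr a_nm) (f₁.arr a_sa)
      (f₁.arr a_sym) (f₁.arr a_lc) (by rw [f₁.reg r_b]; simp [hσ₀]) (f₁.arr a_lg)
      (f₁.arr a_pw) (f₁.arr a_mask) (by rw [f₁.reg r_N]; simp [hσ₀]) (f₁.arr a_st)
    simp only [wp_rules, ok_rules, eval_rules, l₁, b₁, Nat.reduceLT, Nat.reduceEqDiff, if_false,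
      if_true]
    repeat refine And.intro (by omega) ?_
    refine wp_last (windowMin_spec (r := l + b - 1) (d := b) (H₁.toHasMasks.congr (by simp) rfl rfl
      rfl rfl (by simp) rfl rfl rfl) (by omega) (by omega) (by omega) (by simp)
      (by simp [d₁]) (by omega) (by omega) (by rw [hn]; omega) (by omega)) ?_
    rintro τ₂ T₂ f₂ ⟨hT₂, v₂⟩
    have l₂ : τ₂.reg r_l1 = l := by rw [f₂.reg r_l1]; simp [l₁]
    have r₂ : τ₂.reg r_l2 = r := by rw [f₂.reg r_l2]; simp [r₁]
    have b₂ : τ₂.reg r_b = b := by rw [f₂.reg r_b]; simp [b₁]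
    have u₂ : τ₂.reg r_u = τ₁.reg r_v := by rw [f₂.reg r_u]; simp
    have lc₁ : τ₁.arr a_lc = σ.arr a_lc := (f₁.arr a_lc).trans lc₀
    have H₂ : HasLce S τ₂ := H₁.congr (by rw [f₂.reg r_n]; simp) (f₂.arr a_nm) (f₂.arr a_sa)
      (f₂.arr a_sym) (f₂.arr a_lc) (by rw [f₂.reg r_b]; simp) (f₂.arr a_lg)
      (f₂.arr a_pw) (f₂.arr a_mask) (by rw [f₂.reg r_N]; simp) (f₂.arr a_st)
    rw [lc₀] at v₁
    simp only [eval_rules, lc₁] at v₂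
    have lc₂ : τ₂.arr a_lc = σ.arr a_lc := (f₂.arr a_lc).trans lc₁
    generalize hvdef : τ₁.reg r_v = w₁ at *
    obtain ⟨w₂, hw₂⟩ : ∃ w, τ₂.reg r_v = w := ⟨_, rfl⟩
    rw [hw₂] at v₂
    have st₂ : τ₂.arr a_st = σ.arr a_st := (f₂.arr a_st).trans (f₁.arr a_st)
    have lg₂ : τ₂.arr a_lg = σ.arr a_lg := (f₂.arr a_lg).trans (f₁.arr a_lg)
    have pw₂ : τ₂.arr a_pw = σ.arr a_pw := (f₂.arr a_pw).trans (f₁.arr a_pw)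
    have N₂ : τ₂.reg r_N = N := by
      rw [f₂.reg r_N]; refine Eq.trans ?_ ((f₁.reg r_N).trans (Eq.trans ?_ hNeq)) <;> simp [hσ₀]
    clear f₁ f₂ H₁ H₂ h hσ₀ lc₂ d₁ lc₀ l₁ r₁ b₁ hvdef
    rw [show l + b - 1 + 1 - b = l by omega] at v₂
    obtain ⟨q, hq⟩ : ∃ q, (l + b - 1) / b = q := ⟨_, rfl⟩
    obtain ⟨s, hs⟩ : ∃ s, (r + 1) / b = s := ⟨_, rfl⟩
    have q1 : q * b ≤ l + b - 1 := hq ▸ Nat.div_mul_le_self _ _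
    have q2 : l + b - 1 < q * b + b := by
      rw [← hq]; exact Nat.lt_div_mul_add (by omega)
    have s1 : s * b ≤ r + 1 := hs ▸ Nat.div_mul_le_self _ _
    have s2 : r + 1 < s * b + b := by
      rw [← hs]; exact Nat.lt_div_mul_add (by omega)
    have q3 : q ≤ l + b - 1 := hq ▸ Nat.div_le_self _ _
    have s3 : s ≤ r + 1 := hs ▸ Nat.div_le_self _ _
    have sN : s ≤ N := by rw [← hs, ← hN]; exact Nat.div_le_div_right (by omega)
    refine wp_seq (wp_setMin (by norm_num) (by norm_num) (by norm_num) (by simp [ok_rules]) ?_)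
    intro υ₁ e1 g1 a1 T₃ hT₃
    simp only [eval_rules, u₂, hw₂] at e1 hT₃
    simp only [wp_rules, ok_rules, eval_rules, g1 r_l1 (by norm_num), g1 r_l2 (by norm_num),
      g1 r_b (by norm_num), g1 r_N (by norm_num), a1, l₂, r₂, b₂, N₂, st₂, lg₂, pw₂, hq, hs,
      Nat.reduceLT, Nat.reduceEqDiff, if_false, if_true]
    repeat refine And.intro (by omega) ?_
    refine ⟨fun hqs => ?_, fun hqs => ⟨by omega, ?_⟩⟩
    · obtain ⟨k, hk⟩ : ∃ k, Nat.log 2 (s - q) = k := ⟨_, rfl⟩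
      have k1 : 2 ^ k ≤ s - q := by rw [← hk]; exact Nat.pow_log_le_self 2 (by omega)
      have k2 : s - q < 2 ^ (k + 1) := by rw [← hk]; exact Nat.lt_pow_succ_log_self (by norm_num) _
      have k3 : k ≤ b := by
        by_contra hcon
        have h1 : n < 2 ^ (Nat.log 2 n + 1) := Nat.lt_pow_succ_log_self (by norm_num) n
        have h2 : 2 ^ (b + 1) ≤ 2 ^ k := Nat.pow_le_pow_right (by norm_num) (by omega)
        rw [hbdef] at h1
        rw [pow_succ] at h2
        omega
      rw [pow_succ] at k2
      have k4 : k * N ≤ N * b := by rw [mul_comm N]; exact Nat.mul_le_mul_right _ k3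
      have e3 := hst k k3 q (by omega)
      have e4 := hst k k3 (s - 2 ^ k) (by omega)
      rw [min_eq_left (by omega)] at e3
      rw [show min (s - 2 ^ k + 2 ^ k) N = s by omega] at e4
      have hlgk := hlg (s - q) (by omega) (by omega)
      have hpk := hpw k k3
      have c1 : (s - 2 ^ k) * b ≤ (q + 2 ^ k) * b := Nat.mul_le_mul_right _ (by omega)
      have c2 : q * b ≤ (s - 2 ^ k) * b := Nat.mul_le_mul_right _ (by omega)
      have c3 : (q + 2 ^ k) * b ≤ s * b := Nat.mul_le_mul_right _ (by omega)
      rw [hlgk, hk]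
      clear hlg hpw hst
      repeat refine And.intro (by omega) ?_
      refine wp_seq (wp_setMin (by norm_num) (by norm_num) (by norm_num) (by simp [ok_rules]) ?_)
      intro υ₂ e5 g2 a2 T₄ hT₄
      simp only [eval_rules, Nat.reduceEqDiff, if_false, if_true, e1] at e5 hT₄
      simp only [wp_rules, ok_rules, eval_rules, g2 r_l6 (by norm_num), g2 r_l4 (by norm_num),
        g2 r_N (by norm_num), g1 r_N (by norm_num), a1, a2, N₂, st₂, pw₂, hpk,
        Nat.reduceLT, Nat.reduceEqDiff, if_false, if_true]
      repeat refine And.intro (by omega) ?_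
      refine (wp_setMin (by norm_num) (by norm_num) (by norm_num) (by simp [ok_rules]) ?_)
      intro υ₃ e6 g3 a3 T₅ hT₅
      simp only [eval_rules, Nat.reduceEqDiff, if_false, if_true, e5] at e6 hT₅
      refine ⟨by omega, ?_⟩
      rw [e6]
      refine (((v₂.setMin.union v₁.setMin).union e3.setMin).union e4.setMin).rangeMin fun k => ?_
      omega
    · rw [e1]
      refine (v₂.setMin.union v₁.setMin).rangeMin fun k => ?_
      have : s * b ≤ q * b := Nat.mul_le_mul_right _ (not_lt.1 hqs)
      omega
  · refine wp_mono (windowMin_spec (r := r) (d := r + 1 - l) (h.toHasMasks.congr (by simp) rfl rfl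
      rfl rfl (by simp) rfl rfl rfl) (by omega) (by omega) (by omega) (by simp)
      (by simp) (by omega) (by omega) (by rw [hn]; omega) (by omega)) ?_
    rintro τ T' ⟨hT, hv⟩
    refine ⟨by omega, ?_⟩
    rwa [show r + 1 - (r + 1 - l) = l by omega] at hv

/-- The longest common prefix of two suffixes in constant time, by a range minimum between their
ranks. -/
theorem lce_spec {σ : State} {T p q : ℕ} (h : HasLce S σ) (hn0 : 0 < S.length)
    (hc : 4 * S.length + 4 ≤ cap) (hW : 4 * S.length + 8 ≤ W) (hp : σ.reg r_p = p)
    (hq : σ.reg r_q = q) (hpn : p ≤ S.length) (hqn : q ≤ S.length) :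
    wp S cap W lce (fun τ T' => T' ≤ T + 350 ∧ τ.reg r_v = lcp (S.drop p) (S.drop q)) σ T := by
  have hp' := h.rank_le hpn
  have hq' := h.rank_le hqn
  have key : ∀ i j, i ≤ S.length → j ≤ S.length → σ.arr a_nm i < σ.arr a_nm j → ∀ v,
      RangeMin (σ.arr a_lc) (σ.arr a_nm i + 1) (σ.arr a_nm j) v →
      v = lcp (S.drop i) (S.drop j) := by
    intro i j hi hj hij v hv
    rw [h.toHasLcp.eq_of_rangeMin hij (h.rank_le hj) hv, h.sa_rank i hi, h.sa_rank j hj]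
  unfold lce
  simp only [wp_rules, ok_rules, eval_rules, hp, hq, Nat.reduceLT, Nat.reduceEqDiff, if_false,
    if_true]
  repeat refine And.intro (by omega) ?_
  refine ⟨fun hlt => ⟨by omega, by omega, ?_⟩, fun hlt => ⟨fun hlt' => ⟨by omega, by omega, ?_⟩,
    fun hlt' => ?_⟩⟩
  · refine wp_mono (rangeMin_spec (l := σ.arr a_nm p + 1) (r := σ.arr a_nm q)
      (h.congr (by simp) rfl rfl rfl rfl (by simp) rfl rfl rfl (by simp) rfl) hn0 hc hW
      (by simp) (by simp) hlt hq') ?_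
    rintro τ T' ⟨hT, hv⟩
    exact ⟨by omega, key p q hpn hqn hlt _ hv⟩
  · refine wp_mono (rangeMin_spec (l := σ.arr a_nm q + 1) (r := σ.arr a_nm p)
      (h.congr (by simp) rfl rfl rfl rfl (by simp) rfl rfl rfl (by simp) rfl) hn0 hc hW
      (by simp) (by simp) hlt' hp') ?_
    rintro τ T' ⟨hT, hv⟩
    refine ⟨by omega, ?_⟩
    rw [lcp_comm]
    exact key q p hqn hpn hlt' _ hv
  · have hpq : p = q := by
      rw [← h.sa_rank p hpn, ← h.sa_rank q hqn, show σ.arr a_nm p = σ.arr a_nm q by omega]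
    subst hpq
    rw [h.n_eq, lcp_self, List.length_drop]
    omega

end

/-! ### Central paths in intervals of sorted words -/

/-- `w 0, …, w (D - 1)` are words of length `m` in increasing lexicographic order. -/
structure Sorted (w : ℕ → List ℤ) (D m : ℕ) : Prop where
  len : ∀ x < D, (w x).length = m
  lt : ∀ x y, x < y → y < D → w x < w y

/-- The number of the words among `w 0, …, w (D - 1)` that share the first `e` symbols with `w y`. -/
def below (w : ℕ → List ℤ) (D y e : ℕ) : ℕ :=
  ((Finset.range D).filter fun x => e ≤ lcp (w x) (w y)).card

/-- `w y` is a heavy occurrence of `w x`: they differ in exactly one symbol, and the edge towards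
`w y` at the point of difference is heavy. -/
def HeavyRel (w : ℕ → List ℤ) (D x y : ℕ) : Prop :=
  x ≠ y ∧ (w x).drop (lcp (w x) (w y) + 1) = (w y).drop (lcp (w x) (w y) + 1) ∧
    below w D y (lcp (w x) (w y)) < 2 * below w D y (lcp (w x) (w y) + 1)

/-- `s x` is the first element of the interval of `x`, for a partition of `{0, …, D - 1}` into
intervals. -/
structure IsStarts (D : ℕ) (s : ℕ → ℕ) : Prop where
  le : ∀ x < D, s x ≤ x
  idem : ∀ x < D, s (s x) = s x
  mono : ∀ x y, x ≤ y → y < D → s x ≤ s y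

/-- Words in one interval share a longer prefix with each other than with words outside. -/
def Clusters (w : ℕ → List ℤ) (D : ℕ) (s : ℕ → ℕ) : Prop :=
  ∀ x y z, x < D → y < D → z < D → s x = s y → s z ≠ s x →
    lcp (w x) (w z) < lcp (w x) (w y)

/-- The central path of an interval leads from the top of the subtree to a leaf, and follows the heavy
edge wherever there is one (where there is none, it may continue through a light edge). `p x` is the leaf
at the end of the central path of the interval of `x`, `B x` is the depth at which the word `x` leaves this
path, and `hv x` tells whether the path continues from there through a heavy edge. The field `light` says
that no heavy edge is missed. -/
structure IsPath (w : ℕ → List ℤ) (D : ℕ) (s p B hv : ℕ → ℕ) : Prop where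
  lt : ∀ x < D, p x < D
  same : ∀ x < D, s (p x) = s x
  congr : ∀ x < D, ∀ y < D, s x = s y → p x = p y
  B_eq : ∀ x < D, B x = lcp (w x) (w (p x))
  light : ∀ x < D, x ≠ p x → 2 * below w D x (B x + 1) ≤ below w D x (B x)
  hv_eq : ∀ x < D, hv x = if x ≠ p x ∧ below w D (p x) (B x) < 2 * below w D (p x) (B x + 1)
    then 1 else 0

section
variable {w : ℕ → List ℤ} {D m : ℕ} {s p B hv : ℕ → ℕ}

theorem Sorted.le (h : Sorted w D m) {x y : ℕ} (hxy : x ≤ y) (hy : y < D) : w x ≤ w y := by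
  rcases hxy.eq_or_lt with rfl | h'
  · exact le_rfl
  · exact (h.lt x y h' hy).le

theorem Sorted.inj (h : Sorted w D m) {x y : ℕ} (hx : x < D) (hy : y < D) (e : w x = w y) :
    x = y := by
  by_contra hne
  rcases Nat.lt_or_gt_of_ne hne with h' | h'
  · exact (h.lt x y h' hy).ne e
  · exact (h.lt y x h' hx).ne e.symm

theorem Sorted.lcp_self (h : Sorted w D m) {x : ℕ} (hx : x < D) : lcp (w x) (w x) = m := by
  rw [Mappability.lcp_self, h.len x hx]

theorem Sorted.lcp_le (h : Sorted w D m) {x y : ℕ} (hx : x < D) : lcp (w x) (w y) ≤ m := by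
  rw [← h.len x hx]; exact lcp_le_left _ _

theorem Sorted.lcp_lt (h : Sorted w D m) {x y : ℕ} (hx : x < D) (hy : y < D) (hxy : x ≠ y) :
    lcp (w x) (w y) < m := by
  by_contra hcon
  rw [not_lt, le_lcp_iff] at hcon
  rw [List.take_of_length_le (h.len x hx).le, List.take_of_length_le (h.len y hy).le] at hcon
  exact hxy (h.inj hx hy hcon.2.2)

theorem Sorted.lcp_mono (h : Sorted w D m) {x y z : ℕ} (hxy : x ≤ y) (hyz : y ≤ z) (hz : z < D) :
    lcp (w x) (w z) ≤ lcp (w x) (w y) ∧ lcp (w x) (w z) ≤ lcp (w y) (w z) :=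
  Mappability.lcp_mono (h.le hxy (by omega)) (h.le hyz hz)

/-- Common prefixes satisfy the ultrametric inequality. -/
theorem min_lcp_le (s t u : List ℤ) : min (lcp s t) (lcp t u) ≤ lcp s u :=
  le_lcp_trans (min_le_left _ _) (min_le_right _ _)

theorem below_congr {y z e : ℕ} (h : e ≤ lcp (w y) (w z)) : below w D y e = below w D z e := by
  unfold below
  congr 1
  ext x
  simp only [Finset.mem_filter]
  exact and_congr_right fun _ => ⟨fun h' => le_lcp_trans h' h,
    fun h' => le_lcp_trans h' (by rwa [lcp_comm])⟩

/-- The length of the prefix that the heavy occurrence of `x` shares with the word at the end of the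
central path. -/
def partner (w : ℕ → List ℤ) (p B : ℕ → ℕ) (x : ℕ) : ℕ :=
  B x + 1 + lcp ((w x).drop (B x + 1)) ((w (p x)).drop (B x + 1))

theorem IsPath.partner_le (hw : Sorted w D m) (h : IsPath w D s p B hv) {x : ℕ} (hx : x < D)
    (hxp : x ≠ p x) : B x < partner w p B x ∧ partner w p B x ≤ m := by
  have h1 := hw.lcp_lt hx (h.lt x hx) hxp
  have h2 := h.B_eq x hx
  have h3 := lcp_le_left ((w x).drop (B x + 1)) ((w (p x)).drop (B x + 1))
  rw [List.length_drop, hw.len x hx] at h3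
  unfold partner
  omega

theorem take_drop_eq_of_lcp {s t : List ℤ} {b l : ℕ} (h : l ≤ lcp s t) :
    (s.drop b).take (l - b) = (t.drop b).take (l - b) := by
  rw [← List.drop_take, ← List.drop_take, (le_lcp_iff.1 h).2.2]

/-- The heavy occurrences `y` of `x` in the same interval from which `x` is separated on leaving the
central path are found by looking for a word that leaves the path at a prescribed depth and continues in a
prescribed way: `y` follows the path at the place where `x` leaves it, agrees with `x` from the next symbol
on, and therefore leaves the path where `x` first disagrees with it again. -/
theorem IsPath.treated_iff (hw : Sorted w D m) (h : IsPath w D s p B hv) {x y : ℕ} (hx : x < D)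
    (hy : y < D) (hs : s x = s y) :
    (hv x = 1 ∧ B y = partner w p B x ∧
      (w x).drop (partner w p B x) = (w y).drop (partner w p B x)) ↔
    HeavyRel w D x y ∧ lcp (w x) (w y) ≤ B x := by
  have hp : p y = p x := (h.congr x hx y hy hs).symm
  have hBx := h.B_eq x hx
  have hBy := h.B_eq y hy
  rw [hp] at hBy
  have hpx := h.lt x hx
  have hvx := h.hv_eq x hx
  have u1 := min_lcp_le (w x) (w y) (w (p x))
  have u2 := min_lcp_le (w x) (w (p x)) (w y)
  have u3 := min_lcp_le (w y) (w x) (w (p x))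
  rw [lcp_comm (w (p x)) (w y)] at u2
  rw [lcp_comm (w y) (w x)] at u3
  constructor
  · rintro ⟨h1, h2, h3⟩
    rw [hvx] at h1
    have h4 : x ≠ p x ∧ below w D (p x) (B x) < 2 * below w D (p x) (B x + 1) := by
      by_contra hcon
      rw [if_neg hcon] at h1
      omega
    have h5 := h.partner_le hw hx h4.1
    have hlt := hw.lcp_lt hx hpx h4.1
    have hl : lcp (w x) (w y) = B x := by omega
    refine ⟨⟨?_, ?_, ?_⟩, hl.le⟩
    · rintro rfl
      omega
    · rw [hl]
      set L := partner w p B x with hL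
      have e1 : ((w x).drop (B x + 1)).take (L - (B x + 1)) =
          ((w (p x)).drop (B x + 1)).take (L - (B x + 1)) := by
        have := (le_lcp_iff (l := L - (B x + 1)) (s := (w x).drop (B x + 1))
          (t := (w (p x)).drop (B x + 1))).1 (by rw [hL, partner]; omega)
        exact this.2.2
      have e2 : ((w y).drop (B x + 1)).take (L - (B x + 1)) =
          ((w (p x)).drop (B x + 1)).take (L - (B x + 1)) :=
        take_drop_eq_of_lcp (by omega)
      rw [← List.take_append_drop (L - (B x + 1)) ((w x).drop (B x + 1)),
        ← List.take_append_drop (L - (B x + 1)) ((w y).drop (B x + 1)), e1, e2, List.drop_drop,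
        List.drop_drop, show B x + 1 + (L - (B x + 1)) = L by omega, h3]
    · rw [hl, below_congr (y := y) (z := p x) (by omega), below_congr (y := y) (z := p x) (by omega)]
      exact h4.2
  · rintro ⟨⟨h1, h2, h3⟩, h4⟩
    set b := lcp (w x) (w y) with hb
    have hbm := hw.lcp_lt hx hy h1
    -- If `y` left the path where it separates from `x`, then its edge there would be light.
    have hlight : B y ≠ b := by
      intro e
      have := h.light y hy (fun e' => by
        rw [hp] at e'
        rw [hBy, ← e', hw.lcp_self hy] at e
        omega)
      rw [e] at this
      omega
    have hxp : x ≠ p x := by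
      intro e
      rw [hBy, ← e, lcp_comm] at hlight
      exact hlight rfl
    have hbx : b = B x := by
      by_contra hcon
      omega
    have hby : b < B y := by omega
    have hpart : partner w p B x = B y := by
      rw [hBy, lcp_eq_add (l := b + 1) (s := w y) (by omega), partner, ← hbx, h2]
    refine ⟨?_, hpart.symm, ?_⟩
    · rw [hvx, if_pos]
      refine ⟨hxp, ?_⟩
      rw [← hbx, below_congr (y := p x) (z := y) (by rw [lcp_comm]; omega),
        below_congr (y := p x) (z := y) (by rw [lcp_comm]; omega)]
      exact h3
    · have := congrArg (List.drop (B y - (b + 1))) h2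
      rwa [List.drop_drop, List.drop_drop, show b + 1 + (B y - (b + 1)) = B y by omega,
        ← hpart] at this

/-- The intervals of the next round are the sets of words that leave the central path through the same
edge. -/
theorem IsPath.next_eq_iff (hw : Sorted w D m) (h : IsPath w D s p B hv) (hs : IsStarts D s)
    {s' : ℕ → ℕ}
    (hs' : ∀ x < D, s' x = if x = s x ∨ lcp (w (x - 1)) (w x) ≤ B x then x else s' (x - 1)) :
    IsStarts D s' ∧ ∀ x < D, ∀ y < D, s' x = s' y ↔
      x = y ∨ (s x = s y ∧ B x < lcp (w x) (w y)) := by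
  have le : ∀ x < D, s' x ≤ x := by
    intro x
    induction x with
    | zero =>
      intro h0
      rw [hs' 0 h0, if_pos (Or.inl (by have := hs.le 0 h0; omega))]
    | succ x ih =>
      intro hx
      rw [hs' _ hx]
      split_ifs
      · exact le_rfl
      · have := ih (by omega)
        simp only [Nat.add_sub_cancel]
        omega
  have pos : ∀ x < D, ¬ (x = s x ∨ lcp (w (x - 1)) (w x) ≤ B x) → 0 < x := by
    intro x hx hcon
    by_contra h0
    obtain rfl : x = 0 := by omega
    exact hcon (Or.inl (by have := hs.le 0 hx; omega))
  have idem : ∀ x < D, s' (s' x) = s' x := by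
    intro x
    induction x with
    | zero => intro h0; have := le 0 h0; rw [show s' 0 = 0 by omega]; omega
    | succ x ih =>
      intro hx
      by_cases hc : x + 1 = s (x + 1) ∨ lcp (w (x + 1 - 1)) (w (x + 1)) ≤ B (x + 1)
      · have : s' (x + 1) = x + 1 := by rw [hs' _ hx, if_pos hc]
        rw [this, this]
      · have : s' (x + 1) = s' x := by rw [hs' _ hx, if_neg hc]; rfl
        rw [this, ih (by omega)]
  have mono : ∀ x y, x ≤ y → y < D → s' x ≤ s' y := by
    intro x y hxy
    induction y, hxy using Nat.le_induction with
    | base => intro _; exact le_rfl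
    | succ y hy ih =>
      intro hD
      rw [hs' _ hD]
      split_ifs
      · have := le x (by omega); omega
      · exact ih (by omega)
  refine ⟨⟨le, idem, mono⟩, ?_⟩
  have main : ∀ x y, x ≤ y → y < D → (s' x = s' y ↔
      x = y ∨ (s x = s y ∧ B x < lcp (w x) (w y))) := by
    intro x y hxy hy
    have hx : x < D := by omega
    constructor
    · intro e
      have key : ∀ z, x ≤ z → z ≤ y → x = z ∨ (s x = s z ∧ B x = B z ∧ B x < lcp (w x) (w z)) := by
        intro z hxz
        induction z, hxz using Nat.le_induction with
        | base => intro _; exact Or.inl rfl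
        | succ z hz ih =>
          intro hzy
          have hc : ¬ (z + 1 = s (z + 1) ∨ lcp (w (z + 1 - 1)) (w (z + 1)) ≤ B (z + 1)) := by
            intro hc
            have e1 := hs' (z + 1) (by omega)
            rw [if_pos hc] at e1
            have e2 := mono (z + 1) y hzy hy
            have e3 := le x hx
            omega
          rw [not_or, not_le, Nat.add_sub_cancel] at hc
          have e1 : s (z + 1) = s z := by
            have e1 := hs.le (z + 1) (by omega)
            have e2 := hs.idem (z + 1) (by omega)
            have e3 := hs.mono (s (z + 1)) z (by omega) (by omega)
            have e4 := hs.mono z (z + 1) (by omega) (by omega)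
            omega
          have e2 : B z = B (z + 1) := by
            have f1 := h.B_eq z (by omega)
            have f2 := h.B_eq (z + 1) (by omega)
            rw [h.congr (z + 1) (by omega) z (by omega) e1] at f2
            have u1 := min_lcp_le (w z) (w (z + 1)) (w (p z))
            have u2 := min_lcp_le (w (z + 1)) (w z) (w (p z))
            rw [lcp_comm (w (z + 1)) (w z)] at u2
            omega
          right
          rcases ih (by omega) with rfl | ⟨i1, i2, i3⟩
          · exact ⟨e1.symm, e2, by omega⟩
          · have u1 := min_lcp_le (w x) (w z) (w (z + 1))
            exact ⟨by omega, by omega, by omega⟩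
      rcases key y hxy le_rfl with h' | ⟨h1, h2, h3⟩
      · exact Or.inl h'
      · exact Or.inr ⟨h1, h3⟩
    · rintro (rfl | ⟨h1, h2⟩)
      · rfl
      · have key : ∀ z, x ≤ z → z ≤ y → s' x = s' z := by
          intro z hxz
          induction z, hxz using Nat.le_induction with
          | base => intro _; rfl
          | succ z hz ih =>
            intro hzy
            have m1 := hs.mono x (z + 1) (by omega) (by omega)
            have m2 := hs.mono (z + 1) y (by omega) (by omega)
            have e1 : s (z + 1) = s x := by omega
            have l1 := hs.le x hx
            have c1 := hw.lcp_mono (show x ≤ z + 1 by omega) hzy hy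
            have c2 := hw.lcp_mono (show x ≤ z by omega) (show z ≤ z + 1 by omega) (by omega)
            have f1 := h.B_eq x hx
            have f2 := h.B_eq (z + 1) (by omega)
            rw [h.congr (z + 1) (by omega) x hx e1] at f2
            have u1 := min_lcp_le (w x) (w (z + 1)) (w (p x))
            have u2 := min_lcp_le (w (z + 1)) (w x) (w (p x))
            rw [lcp_comm (w (z + 1)) (w x)] at u2
            rw [ih (by omega), hs' (z + 1) (by omega), if_neg]
            · rfl
            · rw [not_or, not_le, Nat.add_sub_cancel]
              exact ⟨by omega, by omega⟩
        exact key y hxy le_rfl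
  intro x hx y hy
  rcases le_total x y with hxy | hxy
  · exact main x y hxy hy
  · rw [eq_comm, main y x hxy hx, eq_comm (a := y), eq_comm (a := s y), lcp_comm (w y)]
    refine or_congr_right (and_congr_right fun e => ?_)
    have f1 := h.B_eq x hx
    have f2 := h.B_eq y hy
    rw [h.congr y hy x hx e.symm] at f2
    have u1 := min_lcp_le (w x) (w y) (w (p x))
    have u2 := min_lcp_le (w y) (w x) (w (p x))
    rw [lcp_comm (w y) (w x)] at u2
    omega

/-- The intervals of the next round are subtrees again. -/
theorem Clusters.next (hw : Sorted w D m) (hc : Clusters w D s)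
    {s' : ℕ → ℕ} (hs' : ∀ x < D, ∀ y < D, s' x = s' y ↔
      x = y ∨ (s x = s y ∧ B x < lcp (w x) (w y))) : Clusters w D s' := by
  intro x y z hx hy hz hxy hxz
  rw [hs' x hx y hy] at hxy
  rw [ne_comm, Ne, hs' x hx z hz, not_or, not_and] at hxz
  rcases hxy with rfl | ⟨h1, h2⟩
  · rw [hw.lcp_self hx]
    exact hw.lcp_lt hx hz hxz.1
  · by_cases hzs : s x = s z
    · have := hxz.2 hzs; omega
    · exact hc x y z hx hy hz h1 (Ne.symm hzs)

/-- The number of elements of the interval of `x`. -/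
def classSize (D : ℕ) (s : ℕ → ℕ) (x : ℕ) : ℕ := ((Finset.range D).filter fun y => s y = s x).card

/-- A leaf leaves the central path through a light edge, so that at most half of the leaves of its
interval go with it; the leaf at the end of the path is left alone. -/
theorem IsPath.next_size (h : IsPath w D s p B hv) (hc : Clusters w D s)
    {s' : ℕ → ℕ} (hs' : ∀ x < D, ∀ y < D, s' x = s' y ↔
      x = y ∨ (s x = s y ∧ B x < lcp (w x) (w y))) {x : ℕ} (hx : x < D) (hw : Sorted w D m) :
    classSize D s' x = 1 ∨ 2 * classSize D s' x ≤ classSize D s x := by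
  have hpx := h.lt x hx
  have hBx := h.B_eq x hx
  by_cases hxp : x = p x
  · left
    rw [classSize, Finset.card_eq_one]
    refine ⟨x, ?_⟩
    ext y
    simp only [Finset.mem_filter, Finset.mem_range, Finset.mem_singleton]
    constructor
    · rintro ⟨hy, e⟩
      rw [eq_comm, hs' x hx y hy, hBx, ← hxp, hw.lcp_self hx] at e
      have := hw.lcp_le (y := y) hx
      rcases e with e | e
      · exact e.symm
      · omega
    · rintro rfl
      exact ⟨hx, rfl⟩
  · right
    have h1 := h.light x hx hxp
    have h2 : classSize D s' x = below w D x (B x + 1) := by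
      unfold classSize below
      congr 1
      ext y
      simp only [Finset.mem_filter, Finset.mem_range]
      refine and_congr_right fun hy => ?_
      rw [eq_comm, hs' x hx y hy, lcp_comm (w y)]
      constructor
      · rintro (rfl | e)
        · rw [hw.lcp_self hx, hBx]; exact hw.lcp_lt hx hpx hxp
        · exact e.2
      · intro e
        refine Or.inr ⟨?_, e⟩
        by_contra hne
        have := hc x (p x) y hx hpx hy (h.same x hx).symm (Ne.symm hne)
        omega
    have h3 : below w D x (B x) ≤ classSize D s x := by
      refine Finset.card_le_card fun y => ?_
      simp only [Finset.mem_filter, Finset.mem_range]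
      rintro ⟨hy, e⟩
      refine ⟨hy, ?_⟩
      by_contra hne
      have := hc x (p x) y hx hpx hy (h.same x hx).symm hne
      rw [lcp_comm] at e
      omega
    omega

end

/-! ### The leaves in lexicographic order -/

notation "a_pos" => (34 : ℕ)
notation "a_cn" => (35 : ℕ)
notation "a_id" => (36 : ℕ)
notation "a_is" => (37 : ℕ)
notation "a_B" => (38 : ℕ)
notation "a_hv" => (39 : ℕ)
notation "a_pl" => (40 : ℕ)
notation "r_D" => (33 : ℕ)
notation "r_c" => (50 : ℕ)
notation "r_e" => (51 : ℕ)
notation "r_a" => (52 : ℕ)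
notation "r_z" => (53 : ℕ)
notation "r_del" => (54 : ℕ)
notation "r_md" => (55 : ℕ)
notation "r_lw" => (56 : ℕ)
notation "r_up" => (57 : ℕ)
notation "r_fl" => (58 : ℕ)

theorem lcp_take (m : ℕ) (s t : List ℤ) : lcp (s.take m) (t.take m) = min m (lcp s t) := by
  refine eq_of_forall_le_iff fun l => ?_
  rw [le_lcp_iff, le_min_iff, le_lcp_iff, List.length_take, List.length_take, List.take_take,
    List.take_take]
  constructor
  · rintro ⟨h1, h2, h3⟩
    rw [min_eq_left (show l ≤ m by omega)] at h3
    exact ⟨by omega, by omega, by omega, h3⟩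
  · rintro ⟨h1, h2, h3, h4⟩
    rw [min_eq_left (show l ≤ m by omega)]
    exact ⟨by omega, by omega, h4⟩

/-- The state holds, besides the tables for longest common prefix queries, the `D` leaves in
lexicographic order: `pos k` is a position at which the leaf number `k` occurs, and `cn k` is the
number of its occurrences. -/
structure HasLeaves (S : List ℤ) (m D : ℕ) (pos cn : ℕ → ℕ) (σ : State) : Prop
    extends HasLce S σ where
  m_eq : σ.reg r_m = m
  D_eq : σ.reg r_D = D
  pos_eq : σ.arr a_pos = pos
  cn_eq : σ.arr a_cn = cn
  pos_le : ∀ k < D, pos k + m ≤ S.length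
  sorted : Sorted (fun k => window S m (pos k)) D m
  D_le : D ≤ S.length
  m_pos : 1 ≤ m
  cn_sum : ∑ k ∈ Finset.range D, cn k ≤ S.length

/-- The registers on which `HasLeaves` depends. -/
def leafRegs : List ℕ := [r_n, r_m, r_D, r_b, r_N]

/-- The arrays on which `HasLeaves` depends. -/
def leafArrs : List ℕ := [a_nm, a_sa, a_sym, a_lc, a_lg, a_pw, a_mask, a_st, a_pos, a_cn]

section
variable {S : List ℤ} {cap W m D : ℕ} {pos cn : ℕ → ℕ}

theorem HasLeaves.congr {σ τ : State} (h : HasLeaves S m D pos cn σ)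
    (hr : ∀ x ∈ leafRegs, τ.reg x = σ.reg x) (ha : ∀ A ∈ leafArrs, τ.arr A = σ.arr A) :
    HasLeaves S m D pos cn τ := by
  refine ⟨h.toHasLce.congr (hr _ ?_) (ha _ ?_) (ha _ ?_) (ha _ ?_) (ha _ ?_) (hr _ ?_) (ha _ ?_)
    (ha _ ?_) (ha _ ?_) (hr _ ?_) (ha _ ?_), (hr _ ?_).trans h.m_eq, (hr _ ?_).trans h.D_eq,
    (ha _ ?_).trans h.pos_eq, (ha _ ?_).trans h.cn_eq, h.pos_le, h.sorted, h.D_le, h.m_pos, h.cn_sum⟩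
  all_goals decide

theorem HasLeaves.setReg {σ : State} (h : HasLeaves S m D pos cn σ) {x k : ℕ}
    (hx : x ∉ leafRegs := by decide) : HasLeaves S m D pos cn (σ.setReg x k) :=
  h.congr (fun y hy => by
    rw [State.setReg_reg, if_neg]
    rintro rfl
    exact hx hy) fun _ _ => rfl

theorem HasLeaves.setArr {σ : State} (h : HasLeaves S m D pos cn σ) {A i k : ℕ}
    (hA : A ∉ leafArrs := by decide) : HasLeaves S m D pos cn (σ.setArr A i k) :=
  h.congr (fun _ _ => rfl) fun B hB => State.setArr_arr_ne _ _ _ _ _ (by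
    rintro rfl
    exact hA hB)

theorem HasLeaves.frame {c : Cmd} {σ τ : State} (h : HasLeaves S m D pos cn σ) (f : c.Frame σ τ)
    (hc : (leafRegs.all fun x => !c.wr x) = true := by rfl)
    (hc' : (leafArrs.all fun x => !c.wa x) = true := by rfl) : HasLeaves S m D pos cn τ := by
  rw [List.all_eq_true] at hc hc'
  exact h.congr (fun x hx => f.1 x (by simpa using hc x hx))
    fun A hA => f.2 A (by simpa using hc' A hA)

/-- The length of the longest common prefix of two leaves; if they are equal, then the result is at
least `m`. -/
def leafLce (x y : Expr) : Cmd :=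
  .set r_p (.cell a_pos x) ;; .set r_q (.cell a_pos y) ;; lce

theorem leafLce_spec {σ : State} {T i j : ℕ} {x y : Expr} (h : HasLeaves S m D pos cn σ)
    (hc : 4 * S.length + 4 ≤ cap) (hW : 4 * S.length + 8 ≤ W) (hi : i < D) (hj : j < D)
    (hx : x.Ok cap W σ ∧ x.eval σ = i) (hy : ∀ k, y.Ok cap W (σ.setReg r_p k) ∧
      y.eval (σ.setReg r_p k) = j) (hcost : x.cost + y.cost ≤ 20) :
    wp S cap W (leafLce x y) (fun τ T' => T' ≤ T + 400 ∧ τ.reg r_v ≤ S.length ∧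
      min m (τ.reg r_v) = lcp (window S m (pos i)) (window S m (pos j))) σ T := by
  have hDn := h.D_le
  have p1 := h.pos_le i hi
  have p2 := h.pos_le j hj
  obtain ⟨hx1, hx2⟩ := hx
  have hyy := hy (pos i)
  unfold leafLce
  simp only [wp_rules, ok_rules, eval_rules, hx2, hx1, h.pos_eq, hyy.1, hyy.2, Nat.reduceLT]
  repeat refine And.intro (by omega) ?_
  refine wp_mono (lce_spec (p := pos i) (q := pos j) (h.setReg.setReg).toHasLce (by omega) hc hW
    (by simp) (by simp) (by omega) (by omega)) ?_
  rintro τ T' ⟨hT, hv⟩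
  refine ⟨by omega, ?_, ?_⟩
  · have := lcp_le_left (S.drop (pos i)) (S.drop (pos j))
    rw [List.length_drop] at this
    omega
  · rw [hv, window, window, lcp_take]

/-- The words `w c, …, w (e - 1)` share longer prefixes with each other than with other words. -/
structure Cluster (w : ℕ → List ℤ) (D c e : ℕ) : Prop where
  lt : c < e
  le : e ≤ D
  out : ∀ x y z, c ≤ x → x < e → c ≤ y → y < e → z < D → ¬ (c ≤ z ∧ z < e) →
    lcp (w x) (w z) < lcp (w x) (w y)

theorem card_filter_interval {D c e : ℕ} {P : ℕ → Prop} [DecidablePred P] (he : e ≤ D)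
    (hP : ∀ x < D, P x ↔ c ≤ x ∧ x < e) : ((Finset.range D).filter P).card = e - c := by
  rw [← Nat.card_Ico c e]
  congr 1
  ext x
  simp only [Finset.mem_filter, Finset.mem_range, Finset.mem_Ico]
  constructor
  · rintro ⟨h1, h2⟩; exact (hP x h1).1 h2
  · intro h; exact ⟨by omega, (hP x (by omega)).2 h⟩

/-- The step from a node of a central path to the child that contains the middle leaf. This is the heavy
child if there is one, because an interval with more than half of the leaves contains the middle one. -/
theorem Cluster.step {w : ℕ → List ℤ} {c e δ μ lo hi : ℕ} (hw : Sorted w D m)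
    (h : Cluster w D c e) (hce : c + 1 < e) (hδ : lcp (w c) (w (e - 1)) = δ) (hμ : (c + e) / 2 = μ)
    (h1 : c ≤ lo) (h2 : lo ≤ μ) (h3 : μ < hi) (h4 : hi ≤ e)
    (h5 : ∀ x, c ≤ x → x < lo → lcp (w x) (w μ) ≤ δ) (h6 : δ < lcp (w lo) (w μ))
    (h7 : ∀ x, hi ≤ x → x < e → lcp (w x) (w μ) ≤ δ) (h8 : δ < lcp (w (hi - 1)) (w μ)) :
    δ < m ∧ Cluster w D lo hi ∧ hi - lo < e - c ∧
    ∀ x, (c ≤ x ∧ x < lo) ∨ (hi ≤ x ∧ x < e) →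
      2 * below w D x (δ + 1) ≤ below w D x δ ∧ ∀ q, lo ≤ q → q < hi → lcp (w x) (w q) = δ ∧
        (below w D q δ < 2 * below w D q (δ + 1) ↔ e - c < 2 * (hi - lo)) := by
  have heD := h.le
  have hδm : δ < m := by rw [← hδ]; exact hw.lcp_lt (by omega) (by omega) (by omega)
  have hall : ∀ x y, c ≤ x → x < e → c ≤ y → y < e → δ ≤ lcp (w x) (w y) := by
    intro x y hx hx' hy hy'
    have key : ∀ x y, c ≤ x → x ≤ y → y < e → δ ≤ lcp (w x) (w y) := by
      intro x y hx hxy hy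
      have e1 := (hw.lcp_mono hx (show x ≤ e - 1 by omega) (by omega)).2
      have e2 := (hw.lcp_mono hxy (show y ≤ e - 1 by omega) (by omega)).1
      omega
    rcases le_total x y with hxy | hxy
    · exact key x y hx hxy hy'
    · rw [lcp_comm]; exact key y x hy hxy hx'
  have hinμ : ∀ x, lo ≤ x → x < hi → δ < lcp (w x) (w μ) := by
    intro x hx hx'
    rcases le_total x μ with hxμ | hxμ
    · have := (hw.lcp_mono hx hxμ (by omega)).2; omega
    · have := (hw.lcp_mono hxμ (show x ≤ hi - 1 by omega) (by omega)).1
      rw [lcp_comm (w (hi - 1)), lcp_comm (w x)] at *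
      omega
  have hin : ∀ x y, lo ≤ x → x < hi → lo ≤ y → y < hi → δ < lcp (w x) (w y) := by
    intro x y hx hx' hy hy'
    have e1 := hinμ x hx hx'
    have e2 := hinμ y hy hy'
    have := min_lcp_le (w x) (w μ) (w y)
    rw [lcp_comm (w y)] at e2
    omega
  have hout : ∀ x q, (c ≤ x ∧ x < lo) ∨ (hi ≤ x ∧ x < e) → lo ≤ q → q < hi →
      lcp (w x) (w q) = δ := by
    intro x q hx hq hq'
    refine le_antisymm ?_ (hall x q (by omega) (by omega) (by omega) (by omega))
    have e1 := min_lcp_le (w x) (w q) (w μ)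
    have e2 := hinμ q hq hq'
    have e3 : lcp (w x) (w μ) ≤ δ := by
      rcases hx with hx | hx
      · exact h5 x hx.1 hx.2
      · exact h7 x hx.1 hx.2
    omega
  have hfar : ∀ x z, c ≤ x → x < e → z < D → ¬ (c ≤ z ∧ z < e) → lcp (w x) (w z) < δ := by
    intro x z hx hx' hz hz'
    have e1 := h.out x c z hx hx' le_rfl h.lt hz hz'
    have e2 := h.out x (e - 1) z hx hx' (by omega) (by omega) hz hz'
    have e4 := min_lcp_le (w c) (w x) (w (e - 1))
    rw [lcp_comm (w c) (w x)] at e4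
    omega
  have hsub : ∀ x, c ≤ x → x < e → below w D x δ = e - c := by
    intro x hx hx'
    refine card_filter_interval heD fun z hz => ⟨fun h' => ?_, fun h' => ?_⟩
    · by_contra hcon
      have := hfar x z hx hx' hz hcon
      rw [lcp_comm] at this
      omega
    · exact hall z x h'.1 h'.2 hx hx'
  refine ⟨hδm, ⟨by omega, by omega, ?_⟩, ?_, ?_⟩
  · intro x y z hx hx' hy hy' hz hz'
    have e1 := hin x y hx hx' hy hy'
    by_cases hzc : c ≤ z ∧ z < e
    · have := hout z x (by omega) hx hx'
      rw [lcp_comm] at this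
      omega
    · have := hfar x z (by omega) (by omega) hz hzc
      omega
  · by_contra hcon
    have := hin c (e - 1) (by omega) (by omega) (by omega) (by omega)
    omega
  · intro x hx
    refine ⟨?_, fun q hq hq' => ⟨hout x q hx hq hq', ?_⟩⟩
    · rw [hsub x (by omega) (by omega)]
      have key : ∀ z < D, δ + 1 ≤ lcp (w z) (w x) → c ≤ z ∧ z < e ∧ (x < μ → z < μ) ∧
          (μ < x → μ < z) := by
        intro z hz hzx
        have hcz : c ≤ z ∧ z < e := by
          by_contra hcon
          have := hfar x z (by omega) (by omega) hz hcon
          rw [lcp_comm] at this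
          omega
        have hxμ := hout x μ hx h2 h3
        refine ⟨hcz.1, hcz.2, fun hlt => ?_, fun hlt => ?_⟩
        · by_contra hcon
          have := (hw.lcp_mono hlt.le (not_lt.1 hcon) hz).1
          rw [lcp_comm (w z)] at hzx
          omega
        · by_contra hcon
          have := (hw.lcp_mono (not_lt.1 hcon) hlt.le (by omega)).2
          rw [lcp_comm (w μ)] at this
          omega
      rcases Nat.lt_or_gt_of_ne (show x ≠ μ by omega) with hlt | hlt
      · have : below w D x (δ + 1) ≤ (Finset.Ico c μ).card := by
          refine Finset.card_le_card fun z hz => ?_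
          simp only [Finset.mem_filter, Finset.mem_range] at hz
          have := key z hz.1 hz.2
          rw [Finset.mem_Ico]
          exact ⟨this.1, this.2.2.1 hlt⟩
        rw [Nat.card_Ico] at this
        omega
      · have : below w D x (δ + 1) ≤ (Finset.Ico (μ + 1) e).card := by
          refine Finset.card_le_card fun z hz => ?_
          simp only [Finset.mem_filter, Finset.mem_range] at hz
          have := key z hz.1 hz.2
          rw [Finset.mem_Ico]
          exact ⟨this.2.2.2 hlt, this.2.1⟩
        rw [Nat.card_Ico] at this
        omega
    · have : below w D q (δ + 1) = hi - lo := by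
        refine card_filter_interval (by omega) fun z hz => ⟨fun h' => ?_, fun h' => ?_⟩
        · have hcz : c ≤ z ∧ z < e := by
            by_contra hcon
            have := hfar q z (by omega) (by omega) hz hcon
            rw [lcp_comm] at this
            omega
          by_contra hcon
          have := hout z q (by omega) hq hq'
          omega
        · exact hin z q h'.1 h'.2 hq hq'
      rw [hsub q (by omega) (by omega), this]

end

/-! ### Following a central path -/

/-- Find the least leaf `r_lw` from `r_c` on that shares more than `r_del` symbols with `r_md`. -/
def scanLow : Cmd :=
  .set r_lw (.reg r_c) ;;
  leafLce (.reg r_lw) (.reg r_md) ;;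
  .loop (.reg r_v) (.reg r_del + 1)
    (.set r_lw (.reg r_lw + 1) ;; leafLce (.reg r_lw) (.reg r_md))

/-- Find the end `r_up` of the leaves before `r_e` that share more than `r_del` symbols with
`r_md`. -/
def scanUp : Cmd :=
  .set r_up (.reg r_e) ;;
  leafLce (.reg r_up - 1) (.reg r_md) ;;
  .loop (.reg r_v) (.reg r_del + 1)
    (.set r_up (.reg r_up - 1) ;; leafLce (.reg r_up - 1) (.reg r_md))

/-- Record for a range of leaves the depth and the heaviness of the edge of the central path. -/
def markRange (lo hi : ℕ) : Cmd :=
  .for r_x (.reg lo) hi (.put a_B (.reg r_x) (.reg r_del) ;; .put a_hv (.reg r_x) (.reg r_fl))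

/-- Go down one edge of the central path. -/
def pathStep : Cmd :=
  leafLce (.reg r_c) (.reg r_e - 1) ;;
  .set r_del (.reg r_v) ;;
  .set r_md ((.reg r_c + .reg r_e) / 2) ;;
  scanLow ;;
  scanUp ;;
  .ite (.reg r_e - .reg r_c) ((.reg r_up - .reg r_lw) + (.reg r_up - .reg r_lw))
    (.set r_fl 1) (.set r_fl 0) ;;
  markRange r_c r_lw ;;
  markRange r_up r_e ;;
  .set r_c (.reg r_lw) ;;
  .set r_e (.reg r_up)

/-- Find the central path of the interval from `r_a` to `r_z`. -/
def findPath : Cmd :=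
  .set r_c (.reg r_a) ;;
  .set r_e (.reg r_z) ;;
  .loop (.reg r_c + 1) (.reg r_e) pathStep ;;
  .put a_B (.reg r_c) (.reg r_m) ;;
  .put a_hv (.reg r_c) 0 ;;
  .for r_x (.reg r_a) r_z (.put a_pl (.reg r_x) (.reg r_c))

/-- Find the central paths of all intervals. -/
def allPaths : Cmd :=
  .set r_a 0 ;;
  .loop (.reg r_a) (.reg r_D)
    (.set r_z (.reg r_a + 1) ;;
      .loop (.cell a_is (.reg r_z)) (.reg r_a + 1) (.set r_z (.reg r_z + 1)) ;;
      findPath ;;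
      .set r_a (.reg r_z))

section
variable {S : List ℤ} {cap W m D : ℕ} {pos cn : ℕ → ℕ}

/-- The time is proportional to the number of leaves that are cut off. -/
theorem scanLow_spec {σ : State} {T c μ δ : ℕ} (h : HasLeaves S m D pos cn σ)
    (hc : 4 * S.length + 4 ≤ cap) (hW : 4 * S.length + 8 ≤ W) (hrc : σ.reg r_c = c)
    (hμ : σ.reg r_md = μ) (hδ : σ.reg r_del = δ) (hcμ : c ≤ μ) (hμD : μ < D) (hδm : δ < m)
    (hmn : m ≤ S.length) :
    wp S cap W scanLow (fun τ T' => ∃ lo, T' ≤ T + 500 * (lo - c + 1) ∧ τ.reg r_lw = lo ∧ c ≤ lo ∧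
      lo ≤ μ ∧ (∀ x, c ≤ x → x < lo → lcp (window S m (pos x)) (window S m (pos μ)) ≤ δ) ∧
      δ < lcp (window S m (pos lo)) (window S m (pos μ))) σ T := by
  have hDn := h.D_le
  have hs := h.sorted
  unfold scanLow
  simp only [wp_rules, ok_rules, eval_rules, hrc, Nat.reduceLT]
  refine wp_last (leafLce_spec (i := c) (j := μ) h.setReg hc hW (by omega) hμD
    (by simp [ok_rules, eval_rules]) (by simp [ok_rules, eval_rules, hμ])
    (by simp [eval_rules])) ?_
  rintro τ₁ T₁ f₁ ⟨hT₁, hv₁, hl₁⟩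
  have H₁ := (h.setReg (x := r_lw) (k := c)).frame f₁
  have lw₁ : τ₁.reg r_lw = c := by rw [f₁.reg r_lw]; simp
  have μ₁ : τ₁.reg r_md = μ := by rw [f₁.reg r_md]; simp [hμ]
  have δ₁ : τ₁.reg r_del = δ := by rw [f₁.reg r_del]; simp [hδ]
  refine wp_while (fun τ T' => ∃ lo, τ.reg r_lw = lo ∧ c ≤ lo ∧ lo ≤ μ ∧
      (∀ x, c ≤ x → x < lo → lcp (window S m (pos x)) (window S m (pos μ)) ≤ δ) ∧
      τ.reg r_v ≤ S.length ∧ min m (τ.reg r_v) = lcp (window S m (pos lo)) (window S m (pos μ)) ∧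
      T' ≤ T + 450 * (lo - c) + 450) (fun τ => μ - τ.reg r_lw) ?_ ?_
  · exact ⟨c, lw₁, le_rfl, hcμ, fun x h1 h2 => absurd h1 (by omega), hv₁, hl₁, by omega⟩
  rintro τ T' hf ⟨lo, hlo, l1, l2, l3, l4, l5, hT⟩
  have H := H₁.frame hf
  have e2 : τ.reg r_md = μ := by rw [hf.reg r_md]; exact μ₁
  have e3 : τ.reg r_del = δ := by rw [hf.reg r_del]; exact δ₁
  simp only [wp_rules, ok_rules, eval_rules, hlo, e3, Nat.reduceLT]
  refine ⟨by omega, by omega, fun hlt => ⟨by omega, by omega, ?_⟩, fun hlt => ?_⟩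
  · have hne : lo ≠ μ := by
      rintro rfl
      have := hs.lcp_self hμD
      omega
    refine wp_mono (wp_frame (leafLce_spec (i := lo + 1) (j := μ) H.setReg hc hW (by omega) hμD
      (by simp [ok_rules, eval_rules]) (by simp [ok_rules, eval_rules, e2])
      (by simp [eval_rules]))) ?_
    rintro υ T₂ ⟨f₂, hT₂, hv₂, hl₂⟩
    have lw₂ : υ.reg r_lw = lo + 1 := by rw [f₂.reg r_lw]; simp
    refine ⟨⟨lo + 1, lw₂, by omega, by omega, ?_, hv₂, hl₂, by omega⟩, by rw [lw₂]; omega⟩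
    intro x h1 h2
    rcases Nat.lt_succ_iff_lt_or_eq.1 h2 with h' | rfl
    · exact l3 x h1 h'
    · omega
  · exact ⟨lo, by omega, rfl, l1, l2, l3, by omega⟩

/-- The time is proportional to the number of leaves that are cut off. -/
theorem scanUp_spec {σ : State} {T e μ δ : ℕ} (h : HasLeaves S m D pos cn σ)
    (hc : 4 * S.length + 4 ≤ cap) (hW : 4 * S.length + 8 ≤ W) (hre : σ.reg r_e = e)
    (hμ : σ.reg r_md = μ) (hδ : σ.reg r_del = δ) (hμe : μ < e) (heD : e ≤ D) (hδm : δ < m)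
    (hmn : m ≤ S.length) :
    wp S cap W scanUp (fun τ T' => ∃ hi, T' ≤ T + 500 * (e - hi + 1) ∧ τ.reg r_up = hi ∧ μ < hi ∧
      hi ≤ e ∧ (∀ x, hi ≤ x → x < e → lcp (window S m (pos x)) (window S m (pos μ)) ≤ δ) ∧
      δ < lcp (window S m (pos (hi - 1))) (window S m (pos μ))) σ T := by
  have hDn := h.D_le
  have hs := h.sorted
  unfold scanUp
  simp only [wp_rules, ok_rules, eval_rules, hre, Nat.reduceLT]
  refine wp_last (leafLce_spec (i := e - 1) (j := μ) h.setReg hc hW (by omega) (by omega)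
    (by simp [ok_rules, eval_rules]; omega) (by simp [ok_rules, eval_rules, hμ])
    (by simp [eval_rules])) ?_
  rintro τ₁ T₁ f₁ ⟨hT₁, hv₁, hl₁⟩
  have H₁ := (h.setReg (x := r_up) (k := e)).frame f₁
  have up₁ : τ₁.reg r_up = e := by rw [f₁.reg r_up]; simp
  have μ₁ : τ₁.reg r_md = μ := by rw [f₁.reg r_md]; simp [hμ]
  have δ₁ : τ₁.reg r_del = δ := by rw [f₁.reg r_del]; simp [hδ]
  refine wp_while (fun τ T' => ∃ hi, τ.reg r_up = hi ∧ μ < hi ∧ hi ≤ e ∧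
      (∀ x, hi ≤ x → x < e → lcp (window S m (pos x)) (window S m (pos μ)) ≤ δ) ∧
      τ.reg r_v ≤ S.length ∧
      min m (τ.reg r_v) = lcp (window S m (pos (hi - 1))) (window S m (pos μ)) ∧
      T' ≤ T + 450 * (e - hi) + 450) (fun τ => τ.reg r_up) ?_ ?_
  · exact ⟨e, up₁, hμe, le_rfl, fun x h1 h2 => absurd h1 (by omega), hv₁, hl₁, by omega⟩
  rintro τ T' hf ⟨hi, hhi, l1, l2, l3, l4, l5, hT⟩
  have H := H₁.frame hf
  have e2 : τ.reg r_md = μ := by rw [hf.reg r_md]; exact μ₁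
  have e3 : τ.reg r_del = δ := by rw [hf.reg r_del]; exact δ₁
  simp only [wp_rules, ok_rules, eval_rules, hhi, e3, Nat.reduceLT]
  refine ⟨by omega, by omega, fun hlt => ⟨by omega, by omega, ?_⟩, fun hlt => ?_⟩
  · have hne : hi - 1 ≠ μ := by
      intro e
      rw [e] at l5
      have := hs.lcp_self (x := μ) (by omega)
      omega
    refine wp_mono (wp_frame (leafLce_spec (i := hi - 1 - 1) (j := μ) H.setReg hc hW (by omega)
      (by omega) (by simp [ok_rules, eval_rules]; omega)
      (by simp [ok_rules, eval_rules, e2])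
      (by simp [eval_rules]))) ?_
    rintro υ T₂ ⟨f₂, hT₂, hv₂, hl₂⟩
    have up₂ : υ.reg r_up = hi - 1 := by rw [f₂.reg r_up]; simp
    refine ⟨⟨hi - 1, up₂, by omega, by omega, ?_, hv₂, hl₂, by omega⟩, by rw [up₂]; omega⟩
    intro x h1 h2
    by_cases hx : x = hi - 1
    · rw [hx]; omega
    · exact l3 x (by omega) h2
  · exact ⟨hi, by omega, rfl, l1, l2, l3, by omega⟩

theorem markRange_spec {σ : State} {T lo hi δ fl rl rh : ℕ} (hrl : σ.reg rl = lo)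
    (hrh : σ.reg rh = hi) (h1 : rl < 1000) (h2 : rh < 1000) (h3 : rh ≠ r_x)
    (hδ : σ.reg r_del = δ) (hfl : σ.reg r_fl = fl) (hle : lo ≤ hi) (hc : hi ≤ cap) (hW : hi ≤ W) :
    wp S cap W (markRange rl rh) (fun τ T' => T' ≤ T + 40 * (hi - lo) + 20 ∧
      (∀ x, τ.arr a_B x = if lo ≤ x ∧ x < hi then δ else σ.arr a_B x) ∧
      (∀ x, τ.arr a_hv x = if lo ≤ x ∧ x < hi then fl else σ.arr a_hv x)) σ T := by
  unfold markRange
  refine wp_for_const (fun k τ =>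
      (∀ x, τ.arr a_B x = if lo ≤ x ∧ x < k then δ else σ.arr a_B x) ∧
      (∀ x, τ.arr a_hv x = if lo ≤ x ∧ x < k then fl else σ.arr a_hv x)) lo hi 20
    (by norm_num) h2 h3 rfl (by simp [Cmd.wr]) hrh (by omega) hle (by simp [ok_rules, h1])
    (by simp [eval_rules, hrl]) ?_ ?_ ?_
  · constructor <;> intro x <;> rw [if_neg (by omega)] <;> rfl
  · rintro k τ T' hlk hk hkτ hf ⟨hB, hH⟩
    have e1 : τ.reg r_del = δ := by rw [hf.reg r_del]; exact hδ
    have e2 : τ.reg r_fl = fl := by rw [hf.reg r_fl]; exact hfl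
    simp only [wp_rules, ok_rules, eval_rules, hkτ, e1, e2, Nat.reduceLT, Nat.reduceEqDiff, if_false]
    repeat refine And.intro (by omega) ?_
    refine ⟨fun x => ?_, fun x => ?_, by omega⟩
    · by_cases hx : x = k
      · rw [if_pos hx, if_pos (by omega)]
      · rw [if_neg hx, hB]
        by_cases h' : lo ≤ x ∧ x < k
        · rw [if_pos h', if_pos (by omega)]
        · rw [if_neg h', if_neg (by omega)]
    · by_cases hx : x = k
      · rw [if_pos hx, if_pos (by omega)]
      · rw [if_neg hx, hH]
        by_cases h' : lo ≤ x ∧ x < k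
        · rw [if_pos h', if_pos (by omega)]
        · rw [if_neg h', if_neg (by omega)]
  · rintro τ T' _ hf ⟨hB, hH⟩ hT
    simp only [eval_rules] at hT
    exact ⟨by omega, hB, hH⟩

/-- The time of a step is charged to the leaves that leave the path at this step; there is at least
one. -/
theorem pathStep_spec {σ : State} {T c e : ℕ} (h : HasLeaves S m D pos cn σ)
    (hc : 4 * S.length + 4 ≤ cap) (hW : 4 * S.length + 8 ≤ W) (hrc : σ.reg r_c = c)
    (hre : σ.reg r_e = e) (hcl : Cluster (fun k => window S m (pos k)) D c e) (hce : c + 1 < e)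
    (hmn : m ≤ S.length) :
    wp S cap W pathStep (fun τ T' => ∃ lo hi δ, τ.reg r_c = lo ∧ τ.reg r_e = hi ∧
      T' ≤ T + 3000 * ((e - c) - (hi - lo)) ∧ c ≤ lo ∧ hi ≤ e ∧ hi - lo < e - c ∧
      Cluster (fun k => window S m (pos k)) D lo hi ∧
      (∀ x, τ.arr a_B x = if (c ≤ x ∧ x < lo) ∨ (hi ≤ x ∧ x < e) then δ else σ.arr a_B x) ∧
      (∀ x, τ.arr a_hv x = if (c ≤ x ∧ x < lo) ∨ (hi ≤ x ∧ x < e) then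
        (if e - c < 2 * (hi - lo) then 1 else 0) else σ.arr a_hv x) ∧
      ∀ x, (c ≤ x ∧ x < lo) ∨ (hi ≤ x ∧ x < e) →
        2 * below (fun k => window S m (pos k)) D x (δ + 1) ≤
          below (fun k => window S m (pos k)) D x δ ∧
        ∀ q, lo ≤ q → q < hi → lcp (window S m (pos x)) (window S m (pos q)) = δ ∧
        (below (fun k => window S m (pos k)) D q δ <
          2 * below (fun k => window S m (pos k)) D q (δ + 1) ↔ e - c < 2 * (hi - lo))) σ T := by
  have hDn := h.D_le
  have hs := h.sorted
  have heD := hcl.le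
  unfold pathStep
  refine wp_then (leafLce_spec (i := c) (j := e - 1) h hc hW (by omega) (by omega)
    (by simp [ok_rules, eval_rules, hrc]) (by simp [ok_rules, eval_rules, hre]; omega)
    (by simp [eval_rules])) ?_
  rintro τ₁ T₁ f₁ ⟨hT₁, hv₁, hl₁⟩
  have c₁ : τ₁.reg r_c = c := by rw [f₁.reg r_c, hrc]
  have e₁ : τ₁.reg r_e = e := by rw [f₁.reg r_e, hre]
  have hlt := hs.lcp_lt (show c < D by omega) (show e - 1 < D by omega) (by omega)
  obtain ⟨δ, hδ⟩ : ∃ δ, τ₁.reg r_v = δ := ⟨_, rfl⟩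
  rw [hδ] at hv₁ hl₁
  have hδl : lcp (window S m (pos c)) (window S m (pos (e - 1))) = δ := by omega
  have H₁ := h.frame f₁
  have B₁ : τ₁.arr a_B = σ.arr a_B := f₁.arr a_B
  have V₁ : τ₁.arr a_hv = σ.arr a_hv := f₁.arr a_hv
  clear f₁
  simp only [wp_rules, ok_rules, eval_rules, c₁, e₁, hδ, Nat.reduceLT, Nat.reduceEqDiff, if_false]
  repeat refine And.intro (by omega) ?_
  obtain ⟨μ, hμ⟩ : ∃ μ, (c + e) / 2 = μ := ⟨_, rfl⟩
  rw [hμ]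
  refine wp_last (scanLow_spec (c := c) (μ := μ) (δ := δ) H₁.setReg.setReg hc hW (by simp [c₁])
    (by simp) (by simp) (by omega) (by omega) (by omega) hmn) ?_
  rintro τ₂ T₂ f₂ ⟨lo, hT₂, lw₂, h1, h2, h5, h6⟩
  have H₂ := (H₁.setReg (x := r_del) (k := δ)).setReg (x := r_md) (k := μ) |>.frame f₂
  have e₂ : τ₂.reg r_e = e := by rw [f₂.reg r_e]; simp [e₁]
  have c₂ : τ₂.reg r_c = c := by rw [f₂.reg r_c]; simp [c₁]
  have μ₂ : τ₂.reg r_md = μ := by rw [f₂.reg r_md]; simp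
  have δ₂ : τ₂.reg r_del = δ := by rw [f₂.reg r_del]; simp
  have B₂ : τ₂.arr a_B = σ.arr a_B := (f₂.arr a_B).trans B₁
  have V₂ : τ₂.arr a_hv = σ.arr a_hv := (f₂.arr a_hv).trans V₁
  clear f₂
  refine wp_then (scanUp_spec (e := e) (μ := μ) (δ := δ) H₂ hc hW e₂ μ₂ δ₂ (by omega) heD (by omega)
    hmn) ?_
  rintro τ₃ T₃ f₃ ⟨hi, hT₃, up₃, h3, h4, h7, h8⟩
  have lw₃ : τ₃.reg r_lw = lo := by rw [f₃.reg r_lw, lw₂]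
  have e₃ : τ₃.reg r_e = e := by rw [f₃.reg r_e, e₂]
  have c₃ : τ₃.reg r_c = c := by rw [f₃.reg r_c, c₂]
  have δ₃ : τ₃.reg r_del = δ := by rw [f₃.reg r_del, δ₂]
  have B₃ : τ₃.arr a_B = σ.arr a_B := (f₃.arr a_B).trans B₂
  have V₃ : τ₃.arr a_hv = σ.arr a_hv := (f₃.arr a_hv).trans V₂
  clear f₃
  obtain ⟨g1, g2, g3, g4⟩ := Cluster.step hs hcl hce hδl hμ h1 h2 h3 h4 h5 h6 h7 h8
  have key : ∀ (σ' : State) (fl T' : ℕ), fl = (if e - c < 2 * (hi - lo) then 1 else 0) →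
      σ' = τ₃.setReg r_fl fl → T' ≤ T₃ + 100 →
      wp S cap W (markRange r_c r_lw ;; markRange r_up r_e ;; .set r_c (.reg r_lw) ;;
        .set r_e (.reg r_up)) (fun τ T' => ∃ lo hi δ, τ.reg r_c = lo ∧ τ.reg r_e = hi ∧
      T' ≤ T + 3000 * ((e - c) - (hi - lo)) ∧ c ≤ lo ∧ hi ≤ e ∧ hi - lo < e - c ∧
      Cluster (fun k => window S m (pos k)) D lo hi ∧
      (∀ x, τ.arr a_B x = if (c ≤ x ∧ x < lo) ∨ (hi ≤ x ∧ x < e) then δ else σ.arr a_B x) ∧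
      (∀ x, τ.arr a_hv x = if (c ≤ x ∧ x < lo) ∨ (hi ≤ x ∧ x < e) then
        (if e - c < 2 * (hi - lo) then 1 else 0) else σ.arr a_hv x) ∧
      ∀ x, (c ≤ x ∧ x < lo) ∨ (hi ≤ x ∧ x < e) →
        2 * below (fun k => window S m (pos k)) D x (δ + 1) ≤
          below (fun k => window S m (pos k)) D x δ ∧
        ∀ q, lo ≤ q → q < hi → lcp (window S m (pos x)) (window S m (pos q)) = δ ∧
        (below (fun k => window S m (pos k)) D q δ <
          2 * below (fun k => window S m (pos k)) D q (δ + 1) ↔ e - c < 2 * (hi - lo))) σ' T' := by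
    intro σ' fl T' hfl hσ' hT'
    refine wp_then (markRange_spec (lo := c) (hi := lo) (δ := δ) (fl := fl) (by simp [hσ', c₃])
      (by simp [hσ', lw₃]) (by norm_num) (by norm_num) (by norm_num) (by simp [hσ', δ₃])
      (by simp [hσ']) (by omega) (by omega) (by omega)) ?_
    rintro τ₄ T₄ f₄ ⟨hT₄, B₄, V₄⟩
    refine wp_then (markRange_spec (lo := hi) (hi := e) (δ := δ) (fl := fl)
      (by rw [f₄.reg r_up]; simp [hσ', up₃])
      (by rw [f₄.reg r_e]; simp [hσ', e₃]) (by norm_num) (by norm_num) (by norm_num)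
      (by rw [f₄.reg r_del]; simp [hσ', δ₃])
      (by rw [f₄.reg r_fl]; simp [hσ']) (by omega) (by omega) (by omega)) ?_
    rintro τ₅ T₅ f₅ ⟨hT₅, B₅, V₅⟩
    have lw₅ : τ₅.reg r_lw = lo := by rw [f₅.reg r_lw, f₄.reg r_lw]; simp [hσ', lw₃]
    have up₅ : τ₅.reg r_up = hi := by rw [f₅.reg r_up, f₄.reg r_up]; simp [hσ', up₃]
    simp only [wp_rules, ok_rules, eval_rules, lw₅, up₅, Nat.reduceLT, Nat.reduceEqDiff, if_false]
    refine ⟨lo, hi, δ, by simp, by simp, by omega, h1, h4, g3, g2, ?_, ?_, g4⟩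
    · intro x
      rw [B₅, B₄]
      simp only [hσ', eval_rules, B₃]
      by_cases a1 : c ≤ x ∧ x < lo <;> by_cases a2 : hi ≤ x ∧ x < e <;> simp [a1, a2]
    · intro x
      rw [V₅, V₄]
      simp only [hσ', eval_rules, V₃, ← hfl]
      by_cases a1 : c ≤ x ∧ x < lo <;> by_cases a2 : hi ≤ x ∧ x < e <;> simp [a1, a2]
  simp only [wp_rules, ok_rules, eval_rules, e₃, c₃, up₃, lw₃, Nat.reduceLT]
  refine ⟨by omega, by omega, by omega, by omega, fun hlt => ⟨by omega, ?_⟩, fun hlt => ?_⟩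
  · exact key _ _ _ (by rw [if_pos (by omega)]) rfl (by omega)
  · exact key _ _ _ (by rw [if_neg (by omega)]) rfl (by omega)

end

/-! ### The central paths of all intervals -/

section
variable {S : List ℤ} {cap W m D : ℕ} {pos cn : ℕ → ℕ}

/-- The leaf `x` leaves the central path to the leaf `q` at depth `b`, through a light edge; `v` tells
whether the path continues from there through a heavy edge. -/
def LeavesPath (w : ℕ → List ℤ) (D x q b v : ℕ) : Prop :=
  b = lcp (w x) (w q) ∧ (x ≠ q → 2 * below w D x (b + 1) ≤ below w D x b) ∧
    v = if x ≠ q ∧ below w D q b < 2 * below w D q (b + 1) then 1 else 0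

/-- As each leaf leaves the path once, the time is linear in the length of the interval. -/
theorem findPath_spec {σ : State} {T a z : ℕ} (h : HasLeaves S m D pos cn σ)
    (hc : 4 * S.length + 4 ≤ cap) (hW : 4 * S.length + 8 ≤ W) (hra : σ.reg r_a = a)
    (hrz : σ.reg r_z = z) (hcl : Cluster (fun k => window S m (pos k)) D a z)
    (hmn : m ≤ S.length) :
    wp S cap W findPath (fun τ T' => T' ≤ T + 4000 * (z - a) ∧ ∃ q, a ≤ q ∧ q < z ∧
      (∀ x, a ≤ x → x < z → τ.arr a_pl x = q ∧
        LeavesPath (fun k => window S m (pos k)) D x q (τ.arr a_B x) (τ.arr a_hv x)) ∧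
      ∀ x, ¬ (a ≤ x ∧ x < z) → τ.arr a_pl x = σ.arr a_pl x ∧ τ.arr a_B x = σ.arr a_B x ∧
        τ.arr a_hv x = σ.arr a_hv x) σ T := by
  have hDn := h.D_le
  have hs := h.sorted
  have hzD := hcl.le
  have haz := hcl.lt
  unfold findPath
  simp only [wp_rules, ok_rules, eval_rules, hra, hrz, Nat.reduceLT, Nat.reduceEqDiff, if_false]
  refine wp_while (fun τ T' => ∃ c e, τ.reg r_c = c ∧ τ.reg r_e = e ∧
      T' ≤ T + 10 + 3050 * ((z - a) - (e - c)) ∧ a ≤ c ∧ e ≤ z ∧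
      Cluster (fun k => window S m (pos k)) D c e ∧
      (∀ x, (a ≤ x ∧ x < c) ∨ (e ≤ x ∧ x < z) → ∀ q, c ≤ q → q < e →
        LeavesPath (fun k => window S m (pos k)) D x q (τ.arr a_B x) (τ.arr a_hv x)) ∧
      ∀ x, ¬ (a ≤ x ∧ x < z) → τ.arr a_B x = σ.arr a_B x ∧ τ.arr a_hv x = σ.arr a_hv x)
      (fun τ => τ.reg r_e - τ.reg r_c) ?_ ?_
  · exact ⟨a, z, by simp, by simp, by omega, le_rfl, le_rfl, hcl, fun x hx => by omega,
      fun x _ => ⟨rfl, rfl⟩⟩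
  rintro τ T' hf ⟨c, e, hrc, hre, hT, hac, hez, hce, hin, hout⟩
  have H := ((h.setReg (x := r_c) (k := a)).setReg (x := r_e) (k := z)).frame hf
  have hlt := hce.lt
  have pl : τ.arr a_pl = σ.arr a_pl := hf.arr a_pl
  have ra : τ.reg r_a = a := by rw [hf.reg r_a]; simp [hra]
  have rz : τ.reg r_z = z := by rw [hf.reg r_z]; simp [hrz]
  simp only [wp_rules, ok_rules, eval_rules, hrc, hre, Nat.reduceLT]
  refine ⟨by omega, by omega, fun hlt' => ?_, fun hge => ?_⟩
  · refine wp_mono (pathStep_spec H hc hW hrc hre hce hlt' hmn) ?_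
    rintro υ T₂ ⟨lo, hi, δ, rlo, rhi, hT₂, h1, h2, h3, h4, h5, h6, h7⟩
    have hlh := h4.lt
    refine ⟨⟨lo, hi, rlo, rhi, by omega, by omega, by omega, h4, ?_, ?_⟩, by rw [rlo, rhi]; omega⟩
    · intro x hx q hq hq'
      rw [h5, h6]
      by_cases hx' : (c ≤ x ∧ x < lo) ∨ (hi ≤ x ∧ x < e)
      · rw [if_pos hx', if_pos hx']
        obtain ⟨g1, g2⟩ := h7 x hx'
        obtain ⟨g3, g4⟩ := g2 q hq hq'
        have hne : x ≠ q := by omega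
        refine ⟨g3.symm, fun _ => g1, ?_⟩
        simp only [g4, hne, ne_eq, not_false_iff, true_and]
      · rw [if_neg hx', if_neg hx']
        exact hin x (by omega) q (by omega) (by omega)
    · intro x hx
      rw [h5, h6, if_neg (by omega), if_neg (by omega)]
      exact hout x hx
  · obtain rfl : e = c + 1 := by omega
    have hm : τ.reg r_m = m := H.m_eq
    simp only [hm]
    refine ⟨by omega, by omega, ?_⟩
    refine wp_for_const (fun k υ => ∀ x, υ.arr a_pl x = if a ≤ x ∧ x < k then c else τ.arr a_pl x)
      a z 20 (by norm_num) (by norm_num) (by norm_num) rfl rfl (by simp [rz]) (by omega) (by omega)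
      (by simp [ok_rules]) (by simp [eval_rules, ra]) ?_ ?_ ?_
    · intro x; rw [if_neg (by omega)]; simp
    · intro k υ T₂ hak hk hkυ hf₂ hI
      have e1 : υ.reg r_c = c := by rw [hf₂.reg r_c]; simp [hrc]
      simp only [wp_rules, ok_rules, eval_rules, hkυ, e1, Nat.reduceLT]
      refine ⟨by omega, fun x => ?_, by omega⟩
      by_cases hx : x = k
      · rw [if_pos hx, if_pos (by omega)]
      · rw [if_neg hx, hI]
        by_cases h' : a ≤ x ∧ x < k
        · rw [if_pos h', if_pos (by omega)]
        · rw [if_neg h', if_neg (by omega)]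
    · intro υ T₂ _ hf₂ hI hT₂
      simp only [eval_rules] at hT₂
      have hB : ∀ x, υ.arr a_B x = if x = c then m else τ.arr a_B x := by
        intro x; rw [hf₂.arr a_B]; simp
      have hV : ∀ x, υ.arr a_hv x = if x = c then 0 else τ.arr a_hv x := by
        intro x; rw [hf₂.arr a_hv]; simp
      refine ⟨by omega, c, hac, by omega, fun x h1 h2 => ⟨by rw [hI, if_pos ⟨h1, h2⟩], ?_⟩, ?_⟩
      · rw [hB, hV]
        by_cases hx : x = c
        · subst hx
          simp only [if_true]
          refine ⟨(hs.lcp_self (by omega)).symm, fun h => absurd rfl h, ?_⟩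
          simp
        · rw [if_neg hx, if_neg hx]
          exact hin x (by omega) c le_rfl (by omega)
      · intro x hx
        rw [hI, if_neg hx, hB, hV, if_neg (by omega), if_neg (by omega), pl]
        exact ⟨rfl, hout x hx⟩

/-- The central paths of all intervals take linear time in total. -/
theorem allPaths_spec {σ : State} {T : ℕ} {s : ℕ → ℕ} (h : HasLeaves S m D pos cn σ)
    (hc : 4 * S.length + 4 ≤ cap) (hW : 4 * S.length + 8 ≤ W) (hmn : m ≤ S.length)
    (his : σ.arr a_is = s) (hsD : s D = D) (hst : IsStarts D s)
    (hcl : Clusters (fun k => window S m (pos k)) D s) :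
    wp S cap W allPaths (fun τ T' => T' ≤ T + 5000 * D + 20 ∧
      IsPath (fun k => window S m (pos k)) D s (τ.arr a_pl) (τ.arr a_B) (τ.arr a_hv)) σ T := by
  have hDn := h.D_le
  have hs := h.sorted
  unfold allPaths
  simp only [wp_rules, ok_rules, eval_rules, Nat.reduceLT]
  refine wp_while (fun τ T' => ∃ a, τ.reg r_a = a ∧ T' ≤ T + 10 + 5000 * a ∧ a ≤ D ∧
      (∀ x < a, s x < a) ∧ s a = a ∧
      (∀ x < a, ∀ y < a, s x = s y → τ.arr a_pl x = τ.arr a_pl y) ∧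
      ∀ x < a, τ.arr a_pl x < D ∧ s (τ.arr a_pl x) = s x ∧
        LeavesPath (fun k => window S m (pos k)) D x (τ.arr a_pl x) (τ.arr a_B x) (τ.arr a_hv x))
    (fun τ => D - τ.reg r_a) ?_ ?_
  · refine ⟨0, by simp, by omega, by omega, by simp, ?_, by simp, by simp⟩
    rcases Nat.eq_zero_or_pos D with rfl | hD
    · exact hsD
    · have := hst.le 0 hD; omega
  rintro τ T' hf ⟨a, hra, hT, haD, hlt, hsa, hI, hJ⟩
  have H := (h.setReg (x := r_a) (k := 0)).frame hf
  have rD : τ.reg r_D = D := H.D_eq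
  have is' : τ.arr a_is = s := by rw [hf.arr a_is]; exact his
  simp only [wp_rules, ok_rules, eval_rules, hra, rD, Nat.reduceLT]
  refine ⟨fun haD' => ⟨by omega, by omega, ?_⟩, fun hge => ?_⟩
  · refine wp_while (fun υ T₂ => ∃ z, υ.reg r_z = z ∧ T₂ ≤ T' + 30 + 40 * (z - a) ∧ a < z ∧ z ≤ D ∧
      (∀ x, a ≤ x → x < z → s x = a)) (fun υ => D - υ.reg r_z) ?_ ?_
    · refine ⟨a + 1, by simp, by omega, by omega, by omega, fun x h1 h2 => ?_⟩
      obtain rfl : x = a := by omega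
      exact hsa
    rintro υ T₂ hf₂ ⟨z, hrz, hT₂, haz, hzD, hz⟩
    have H₂ := (H.setReg (x := r_z) (k := a + 1)).frame hf₂
    have ra₂ : υ.reg r_a = a := by rw [hf₂.reg r_a]; simp [hra]
    have is₂ : υ.arr a_is = s := by rw [hf₂.arr a_is]; exact is'
    simp only [wp_rules, ok_rules, eval_rules, hrz, ra₂, is₂, Nat.reduceLT, if_true]
    refine ⟨by omega, by omega, by omega, fun hcon => ?_, fun hcon => ?_⟩
    · have hzD' : z < D := by
        by_contra h'
        obtain rfl : z = D := by omega
        omega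
      refine ⟨by omega, by omega, ⟨z + 1, rfl, by omega, by omega, by omega, fun x h1 h2 => ?_⟩,
        by omega⟩
      by_cases hx : x = z
      · have := hst.mono a z (by omega) hzD'
        rw [hx]; omega
      · exact hz x h1 (by omega)
    · have hclass : ∀ x < D, s x = a ↔ a ≤ x ∧ x < z := by
        intro x hx
        refine ⟨fun e => ⟨?_, ?_⟩, fun e => hz x e.1 e.2⟩
        · have := hst.le x hx; omega
        · by_contra h'
          have := hst.mono z x (by omega) hx
          omega
      have hzz : s z = z := by
        rcases hzD.eq_or_lt with rfl | hz'
        · exact hsD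
        · have e1 := hst.le z hz'
          have e2 := hst.idem z hz'
          by_contra hne
          have := hz (s z) (by omega) (by omega)
          omega
      refine wp_last (findPath_spec (a := a) (z := z) H₂ hc hW ra₂ hrz ⟨haz, hzD, ?_⟩ hmn) ?_
      · intro x y u hx hx' hy hy' hu hu'
        exact hcl x y u (by omega) (by omega) hu (by rw [hz x hx hx', hz y hy hy'])
          (by rw [hz x hx hx', Ne, hclass u hu]; exact hu')
      rintro ρ T₃ f₃ ⟨hT₃, q, q1, q2, hin, hout⟩
      have rz₃ : ρ.reg r_z = z := by rw [f₃.reg r_z, hrz]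
      have pl₂ : υ.arr a_pl = τ.arr a_pl := hf₂.arr a_pl
      have B₂ : υ.arr a_B = τ.arr a_B := hf₂.arr a_B
      have V₂ : υ.arr a_hv = τ.arr a_hv := hf₂.arr a_hv
      simp only [wp_rules, ok_rules, eval_rules, rz₃, Nat.reduceLT, if_true]
      refine ⟨⟨z, rfl, by omega, hzD, ?_, hzz, ?_, ?_⟩, by omega⟩
      · intro x hx
        have := hst.le x (by omega)
        omega
      · intro x hx y hy hxy
        by_cases h1 : x < a
        · have h2 : y < a := by
            by_contra h2
            have := hz y (by omega) hy
            have := hlt x h1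
            omega
          rw [(hout x (by omega)).1, (hout y (by omega)).1, pl₂]
          exact hI x h1 y h2 hxy
        · have h2 : ¬ y < a := by
            intro h2
            have := hz x (by omega) hx
            have := hlt y h2
            omega
          rw [(hin x (by omega) hx).1, (hin y (by omega) hy).1]
      · intro x hx
        by_cases h1 : x < a
        · obtain ⟨e1, e2, e3⟩ := hout x (by omega)
          simp only [e1, e2, e3, pl₂, B₂, V₂]
          exact hJ x h1
        · obtain ⟨e1, e2⟩ := hin x (by omega) hx
          rw [e1]
          refine ⟨by omega, ?_, e2⟩
          rw [hz q q1 q2, hz x (by omega) hx]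
  · obtain rfl : a = D := by omega
    refine ⟨by omega, ⟨fun x hx => (hJ x hx).1, fun x hx => (hJ x hx).2.1, hI,
      fun x hx => (hJ x hx).2.2.1, fun x hx => (hJ x hx).2.2.2.1, fun x hx => (hJ x hx).2.2.2.2⟩⟩

end

/-! ### Naming the places where leaves leave the central paths -/

notation "a_fst" => (41 : ℕ)
notation "a_dep" => (42 : ℕ)
notation "a_beg" => (43 : ℕ)
notation "a_lf" => (44 : ℕ)
notation "a_A" => (45 : ℕ)
notation "a_Mu" => (46 : ℕ)

/-- The items to be named in a round: for each leaf `t` an item for the place where it leaves the central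
path (number `t`), and one for the place where its heavy occurrence has to do so (number `D + t`; a
dummy if there is no such place). An item consists of an interval, a depth, and a position of the
text. -/
def makeItems : Cmd :=
  .set r_K (.reg r_D + .reg r_D) ;;
  .for r_t 0 r_D
    (.put a_fst (.reg r_t) (.cell a_is (.reg r_t)) ;;
      .put a_dep (.reg r_t) (.cell a_B (.reg r_t)) ;;
      .put a_beg (.reg r_t) (.cell a_pos (.reg r_t) + .cell a_B (.reg r_t))) ;;
  .for r_t 0 r_D
    (.set r_x (.reg r_D + .reg r_t) ;;
      .ite (.cell a_hv (.reg r_t)) 1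
        (.put a_fst (.reg r_x) (.reg r_D) ;;
          .put a_dep (.reg r_x) 0 ;;
          .put a_beg (.reg r_x) (.cell a_pos (.reg r_t)))
        (.set r_d (.cell a_B (.reg r_t) + 1) ;;
          .set r_p (.cell a_pos (.reg r_t) + .reg r_d) ;;
          .set r_q (.cell a_pos (.cell a_pl (.reg r_t)) + .reg r_d) ;;
          lce ;;
          .set r_u (.reg r_m - .reg r_d) ;;
          .setMin r_v (.reg r_v) r_u ;;
          .set r_v (.reg r_d + .reg r_v) ;;
          .put a_fst (.reg r_x) (.cell a_is (.reg r_t)) ;;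
          .put a_dep (.reg r_x) (.reg r_v) ;;
          .put a_beg (.reg r_x) (.cell a_pos (.reg r_t) + .reg r_v)))

/-- Compare the items at the positions `r_t - 1` and `r_t` of `a_ord`: two items are equal if their
intervals and depths are, and if they are followed by equal words up to the end of the leaves. -/
def sameItems : Cmd :=
  .set r_x (.cell a_ord (.reg r_t - 1)) ;;
  .set r_y (.cell a_ord (.reg r_t)) ;;
  .ite 0 ((.cell a_fst (.reg r_x) - .cell a_fst (.reg r_y)) +
      (.cell a_fst (.reg r_y) - .cell a_fst (.reg r_x)) +
      ((.cell a_dep (.reg r_x) - .cell a_dep (.reg r_y)) +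
      (.cell a_dep (.reg r_y) - .cell a_dep (.reg r_x))))
    (.set r_g 1)
    (.set r_d (.cell a_dep (.reg r_x)) ;;
      .set r_p (.cell a_beg (.reg r_x)) ;;
      .set r_q (.cell a_beg (.reg r_y)) ;;
      lce ;;
      .ite (.reg r_v + .reg r_d) (.reg r_m) (.set r_g 1) (.set r_g 0))

/-- Sort the items and name them. -/
def nameItems : Cmd :=
  .fill a_ord (.reg r_t) r_K ;;
  .set r_M (.reg r_n + 1) ;;
  .fill a_key (.cell a_nm (.cell a_beg (.reg r_t))) r_K ;;
  countingSort ;;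
  .fill a_key (.cell a_dep (.reg r_t)) r_K ;;
  countingSort ;;
  .fill a_key (.cell a_fst (.reg r_t)) r_K ;;
  countingSort ;;
  naming sameItems

/-- Add the numbers of occurrences of the heavy occurrences that are found in this round. -/
def collect : Cmd :=
  .fill a_lf (.reg r_D) r_K ;;
  .for r_t 0 r_D (.put a_lf (.cell a_new (.reg r_t)) (.reg r_t)) ;;
  .for r_t 0 r_D
    (.set r_x (.cell a_lf (.cell a_new (.reg r_D + .reg r_t))) ;;
      .ite (.reg r_x) (.reg r_D)
        (.put a_A (.reg r_t) (.cell a_A (.reg r_t) + .cell a_cn (.reg r_x)) ;;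
          .put a_Mu (.reg r_t) (.cell a_Mu (.reg r_t) + .cell a_cn (.reg r_x)) ;;
          .put a_Mu (.reg r_x) (.cell a_Mu (.reg r_x) + .cell a_cn (.reg r_t)))
        .skip)

/-- The intervals of the next round. -/
def nextStarts : Cmd :=
  .for r_t 0 r_D
    (.ite (.reg r_t - .cell a_is (.reg r_t)) 1
      (.put a_is (.reg r_t) (.reg r_t))
      (leafLce (.reg r_t - 1) (.reg r_t) ;;
        .ite (.cell a_B (.reg r_t)) (.reg r_v)
          (.put a_is (.reg r_t) (.cell a_is (.reg r_t - 1)))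
          (.put a_is (.reg r_t) (.reg r_t))))

section
variable {S : List ℤ} {cap W m D : ℕ} {pos cn : ℕ → ℕ}

theorem window_drop (S : List ℤ) (m i b : ℕ) :
    (window S m i).drop b = (S.drop (i + b)).take (m - b) := by
  rw [window, List.drop_take, List.drop_drop]

/-- The dummy items carry the number `D`, which is not the start of an interval. -/
theorem makeItems_spec {σ : State} {T : ℕ} {s p B hv : ℕ → ℕ} (h : HasLeaves S m D pos cn σ)
    (hc : 4 * S.length + 4 ≤ cap) (hW : 4 * S.length + 8 ≤ W)
    (his : σ.arr a_is = s) (hp : σ.arr a_pl = p) (hB : σ.arr a_B = B)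
    (hhv : σ.arr a_hv = hv) (hpath : IsPath (fun k => window S m (pos k)) D s p B hv) :
    wp S cap W makeItems (fun τ T' => T' ≤ T + 1000 * (D + 1) ∧ τ.reg r_K = D + D ∧
      ∀ x < D, (τ.arr a_fst x = s x ∧ τ.arr a_dep x = B x ∧ τ.arr a_beg x = pos x + B x) ∧
        (τ.arr a_fst (D + x) = if hv x = 1 then s x else D) ∧
        (τ.arr a_dep (D + x) =
          if hv x = 1 then partner (fun k => window S m (pos k)) p B x else 0) ∧
        (τ.arr a_beg (D + x) = pos x + τ.arr a_dep (D + x))) σ T := by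
  have hDn := h.D_le
  have hs := h.sorted
  have hB_le : ∀ x < D, B x ≤ m := fun x hx => by
    rw [hpath.B_eq x hx]; exact hs.lcp_le hx
  unfold makeItems
  simp only [wp_rules, ok_rules, eval_rules, h.D_eq, Nat.reduceLT, Nat.reduceEqDiff, if_false]
  repeat refine And.intro (by omega) ?_
  have H₀ := h.setReg (x := r_K) (k := D + D)
  refine wp_for_const (fun k τ => ∀ x < k, τ.arr a_fst x = s x ∧ τ.arr a_dep x = B x ∧
      τ.arr a_beg x = pos x + B x) 0 D 60 (by norm_num) (by norm_num) (by norm_num) rfl rfl H₀.D_eq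
    (by omega) (by omega) (by simp [ok_rules]) (by simp [eval_rules]) (by simp) ?_ ?_
  · intro k τ T' _ hk hkτ hf hI
    have e1 : τ.arr a_is = s := by rw [hf.arr a_is]; exact his
    have e2 : τ.arr a_B = B := by rw [hf.arr a_B]; exact hB
    have e3 := (H₀.frame hf).pos_eq
    have e4 := hB_le k hk
    have e5 := h.pos_le k hk
    simp only [wp_rules, ok_rules, eval_rules, hkτ, e1, e2, e3, Nat.reduceLT, Nat.reduceEqDiff,
      if_false]
    repeat refine And.intro (by omega) ?_
    refine ⟨fun x hx => ?_, by omega⟩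
    by_cases hxk : x = k
    · subst hxk; simp
    · simp only [hxk, if_false]
      exact hI x (by omega)
  intro τ₁ T₁ _ f₁ h₁ hT₁
  simp only [eval_rules] at hT₁
  have H₁ := H₀.frame f₁
  have is₁ : τ₁.arr a_is = s := by rw [f₁.arr a_is]; exact his
  have B₁ : τ₁.arr a_B = B := by rw [f₁.arr a_B]; exact hB
  have p₁ : τ₁.arr a_pl = p := by rw [f₁.arr a_pl]; exact hp
  have v₁ : τ₁.arr a_hv = hv := by rw [f₁.arr a_hv]; exact hhv
  have K₁ : τ₁.reg r_K = D + D := by rw [f₁.reg r_K]; simp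
  clear f₁
  refine wp_for_const (fun k τ => (∀ x < D, τ.arr a_fst x = s x ∧ τ.arr a_dep x = B x ∧
      τ.arr a_beg x = pos x + B x) ∧ ∀ x < k, (τ.arr a_fst (D + x) = if hv x = 1 then s x else D) ∧
        (τ.arr a_dep (D + x) =
          if hv x = 1 then partner (fun k => window S m (pos k)) p B x else 0) ∧
        (τ.arr a_beg (D + x) = pos x + τ.arr a_dep (D + x))) 0 D 600 (by norm_num) (by norm_num)
    (by norm_num) rfl rfl H₁.D_eq (by omega) (by omega) (by simp [ok_rules]) (by simp [eval_rules])
    ⟨h₁, by simp⟩ ?_ ?_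
  · rintro k τ T' _ hk hkτ hf ⟨hI, hJ⟩
    have H := H₁.frame hf
    have e1 : τ.arr a_is = s := by rw [hf.arr a_is]; exact is₁
    have e2 : τ.arr a_B = B := by rw [hf.arr a_B]; exact B₁
    have e3 := H.pos_eq
    have e4 := hB_le k hk
    have e5 := h.pos_le k hk
    have e6 : τ.arr a_pl = p := by rw [hf.arr a_pl]; exact p₁
    have e7 : τ.arr a_hv = hv := by rw [hf.arr a_hv]; exact v₁
    have e8 := hpath.hv_eq k hk
    have e9 := hpath.lt k hk
    have e10 := h.pos_le (p k) e9
    have hv1 : hv k ≤ 1 := by rw [e8]; split_ifs <;> omega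
    simp only [wp_rules, ok_rules, eval_rules, hkτ, e7, H.D_eq, e3, Nat.reduceLT, Nat.reduceEqDiff,
      if_false, if_true]
    refine ⟨by omega, by omega, by omega, fun hlt => ?_, fun hlt => ?_⟩
    · repeat refine And.intro (by omega) ?_
      refine ⟨fun x hx => ?_, fun x hx => ?_, by omega⟩
      · simp only [show x ≠ D + k by omega, if_false]
        exact hI x hx
      · by_cases hxk : x = k
        · subst hxk
          simp [show hv x ≠ 1 by omega]
        · simp only [show D + x ≠ D + k by omega, if_false]
          exact hJ x (by omega)
    · have hxp : k ≠ p k := by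
        intro e
        rw [if_neg (fun h' => h'.1 e)] at e8
        omega
      have hBm : B k < m := by rw [hpath.B_eq k hk]; exact hs.lcp_lt hk e9 hxp
      have hpar := hpath.partner_le hs hk hxp
      rw [e2, e6]
      repeat refine And.intro (by omega) ?_
      refine wp_last (lce_spec (p := pos k + (B k + 1)) (q := pos (p k) + (B k + 1))
        (H.setReg.setReg.setReg.setReg).toHasLce (by omega) hc hW
        (by simp) (by simp) (by omega) (by omega)) ?_
      rintro υ T₂ f₂ ⟨hT₂, hv₂⟩
      have H₂ := H.setReg (x := r_x) (k := D + k) |>.setReg (x := r_d) (k := B k + 1)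
        |>.setReg (x := r_p) (k := pos k + (B k + 1))
        |>.setReg (x := r_q) (k := pos (p k) + (B k + 1)) |>.frame f₂
      have hpart : partner (fun k => window S m (pos k)) p B k =
          B k + 1 + min (υ.reg r_v) (m - (B k + 1)) := by
        rw [partner, hv₂]
        simp only [window_drop]
        rw [lcp_take, min_comm]
      have hvn : υ.reg r_v ≤ S.length := by
        have := lcp_le_left (S.drop (pos k + (B k + 1))) (S.drop (pos (p k) + (B k + 1)))
        rw [List.length_drop] at this
        omega
      have d₂ : υ.reg r_d = B k + 1 := by rw [f₂.reg r_d]; simp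
      have x₂ : υ.reg r_x = D + k := by rw [f₂.reg r_x]; simp
      have t₂ : υ.reg r_t = k := by rw [f₂.reg r_t]; simp [hkτ]
      have is₂ : υ.arr a_is = s := (f₂.arr a_is).trans e1
      have g1 : υ.arr a_fst = τ.arr a_fst := f₂.arr a_fst
      have g2 : υ.arr a_dep = τ.arr a_dep := f₂.arr a_dep
      have g3 : υ.arr a_beg = τ.arr a_beg := f₂.arr a_beg
      simp only [wp_rules, ok_rules, eval_rules, d₂, H₂.m_eq, Nat.reduceLT]
      refine ⟨by omega, ?_⟩
      refine wp_setMin (by norm_num) (by norm_num) (by norm_num) (by simp [ok_rules]) ?_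
      intro ρ r1 r2 r3 T₃ hT₃
      simp only [eval_rules, Nat.reduceEqDiff, if_false, if_true] at r1 hT₃
      simp only [wp_rules, ok_rules, eval_rules, r1, r2 r_d (by norm_num), r2 r_x (by norm_num),
        r2 r_t (by norm_num), r3, d₂, x₂, t₂, is₂, H₂.pos_eq, g1, g2, g3, ← hpart, Nat.reduceLT,
        Nat.reduceEqDiff, if_false, if_true]
      have hv1' : hv k = 1 := by omega
      repeat refine And.intro (by omega) ?_
      refine ⟨fun x hx => ?_, fun x hx => ?_, by omega⟩
      · simp only [show x ≠ D + k by omega, if_false]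
        exact hI x hx
      · by_cases hxk : x = k
        · subst hxk
          simp only [hv1', if_true]
          exact ⟨trivial, trivial, trivial⟩
        · simp only [show D + x ≠ D + k by omega, if_false]
          exact hJ x (by omega)
  · rintro τ T' _ hf ⟨hI, hJ⟩ hT
    simp only [eval_rules] at hT
    refine ⟨by omega, ?_, fun x hx => ?_⟩
    · rw [hf.reg r_K, K₁]
    · obtain ⟨g1, g2, g3⟩ := hI x hx
      exact ⟨g1, g2, g3, hJ x hx⟩

theorem take_le_take {s t : List ℤ} (h : s ≤ t) (k : ℕ) : s.take k ≤ t.take k := by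
  by_contra hcon
  have := append_lt_append_of_lt (not_le.1 hcon) (a' := t.drop k) (b' := s.drop k) (by
    intro hl
    rw [List.length_take, List.length_take] at hl
    exact List.drop_eq_nil_of_le (by omega))
  rw [List.take_append_drop, List.take_append_drop] at this
  exact absurd h (not_le.2 this)

/-- The test of `sameItems` is equality of interval, depth and following word. -/
theorem sameItems_spec {σ : State} {T a b : ℕ} {fst dep beg : ℕ → ℕ}
    (h : HasLeaves S m D pos cn σ) (hc : 4 * S.length + 4 ≤ cap) (hW : 4 * S.length + 8 ≤ W)
    (h1 : σ.arr a_fst = fst) (h2 : σ.arr a_dep = dep) (h3 : σ.arr a_beg = beg)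
    (ht0 : 1 ≤ σ.reg r_t) (htc : σ.reg r_t < cap) (htW : σ.reg r_t ≤ W)
    (ha : σ.arr a_ord (σ.reg r_t - 1) = a) (hb : σ.arr a_ord (σ.reg r_t) = b)
    (hac : a < cap) (hbc : b < cap) (hfa : fst a ≤ D) (hfb : fst b ≤ D)
    (hda : dep a ≤ m) (hdb : dep b ≤ m) (hba : beg a + (m - dep a) ≤ S.length)
    (hbb : beg b + (m - dep b) ≤ S.length) (hmn : m ≤ S.length) :
    wp S cap W sameItems (fun τ T' => T' ≤ T + 450 ∧ τ.reg r_g =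
      if fst a = fst b ∧ dep a = dep b ∧ (S.drop (beg a)).take (m - dep a) =
        (S.drop (beg b)).take (m - dep b) then 0 else 1) σ T := by
  have hDn := h.D_le
  have hm := h.m_pos
  unfold sameItems
  simp only [wp_rules, ok_rules, eval_rules, ha, hb, h1, h2, h3, Nat.reduceLT, Nat.reduceEqDiff,
    if_true, if_false]
  repeat refine And.intro (by omega) ?_
  refine ⟨fun hne => ?_, fun heq => ?_⟩
  · refine ⟨by omega, by omega, ?_⟩
    rw [if_neg]
    rintro ⟨e1, e2, -⟩
    omega
  have e1 : fst a = fst b := by omega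
  have e2 : dep a = dep b := by omega
  repeat refine And.intro (by omega) ?_
  refine wp_last (lce_spec (p := beg a) (q := beg b)
    (h.setReg.setReg.setReg.setReg.setReg).toHasLce (by omega) hc hW
    (by simp) (by simp) (by omega) (by omega)) ?_
  rintro υ T₂ f₂ ⟨hT₂, hv₂⟩
  have hm₂ : υ.reg r_m = m := by rw [f₂.reg r_m]; simp [h.m_eq]
  have hd₂ : υ.reg r_d = dep a := by rw [f₂.reg r_d]; simp
  have hvn := lcp_le_left (S.drop (beg a)) (S.drop (beg b))
  rw [List.length_drop] at hvn
  have hiff : (S.drop (beg a)).take (m - dep a) = (S.drop (beg b)).take (m - dep b) ↔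
      m - dep a ≤ lcp (S.drop (beg a)) (S.drop (beg b)) := by
    rw [le_lcp_iff, List.length_drop, List.length_drop, ← e2]
    exact ⟨fun e => ⟨by omega, by omega, e⟩, fun e => e.2.2⟩
  simp only [wp_rules, ok_rules, eval_rules, hm₂, hd₂, hv₂, hiff, Nat.reduceLT, if_true]
  refine ⟨by omega, fun hlt => ⟨by omega, by omega, ?_⟩, fun hge => ⟨by omega, ?_⟩⟩
  · rw [if_neg (by omega)]
  · rw [if_pos (by omega)]

set_option maxHeartbeats 1000000 in
/-- The items are sorted by interval, depth and rank of the following suffix; the last criterion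
puts equal words of the prescribed length next to each other. All keys are at most `n`, so that
counting sort takes linear time. -/
theorem nameItems_spec {σ : State} {T K : ℕ} {fst dep beg : ℕ → ℕ}
    (h : HasLeaves S m D pos cn σ) (hc : 4 * S.length + 4 ≤ cap) (hW : 4 * S.length + 8 ≤ W)
    (hK : σ.reg r_K = K) (hK0 : 0 < K) (hKn : K ≤ 2 * S.length)
    (h1 : σ.arr a_fst = fst) (h2 : σ.arr a_dep = dep) (h3 : σ.arr a_beg = beg)
    (hf : ∀ i < K, fst i ≤ D) (hd : ∀ i < K, dep i ≤ m)
    (hb : ∀ i < K, beg i + (m - dep i) ≤ S.length) (hmn : m ≤ S.length) :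
    wp S cap W nameItems (fun τ T' => T' ≤ T + 10000 * (S.length + 1) ∧
      (∀ i < K, τ.arr a_new i < K) ∧
      ∀ i < K, ∀ j < K, τ.arr a_new i = τ.arr a_new j ↔
        fst i = fst j ∧ dep i = dep j ∧
          (S.drop (beg i)).take (m - dep i) = (S.drop (beg j)).take (m - dep j)) σ T := by
  obtain ⟨n, hn⟩ : ∃ n, S.length = n := ⟨_, rfl⟩
  have hDn := h.D_le
  have hrn := h.n_eq
  rw [hn] at hDn hc hW hKn hmn hrn
  unfold nameItems
  refine wp_then (fill_spec (fun t => t) (by norm_num) (by norm_num) hK (by omega) (by omega)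
    (fun τ t ht htτ hf => by simp only [ok_rules, eval_rules, htτ, Nat.reduceLT, and_self])) ?_
  rintro τ₁ T₁ f₁ ⟨hT₁, o₁⟩
  replace hT₁ : Within T₁ T _ := hT₁
  simp only [eval_rules] at hT₁
  have n₁ : τ₁.reg r_n = n := (f₁.reg r_n).trans hrn
  simp only [wp_rules, ok_rules, eval_rules, n₁, Nat.reduceLT]
  refine ⟨by omega, by omega, ?_⟩
  have H₁ := (h.frame f₁).setReg (x := r_M) (k := n + 1)
  have K₁ : (τ₁.setReg r_M (n + 1)).reg r_K = K := by simp [f₁.reg r_K, hK]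
  have P₁ : IsPerm K ((τ₁.setReg r_M (n + 1)).arr a_ord) := by
    refine IsPerm.congr (X := fun t => t) ⟨fun t ht => ht, fun t _ u _ h => h⟩ fun t ht => ?_
    rw [State.setReg_arr, o₁ t ht]
  have M₁ : (τ₁.setReg r_M (n + 1)).reg r_M = n + 1 := by simp
  have x₁ : (τ₁.setReg r_M (n + 1)).arr a_fst = fst := (f₁.arr a_fst).trans h1
  have y₁ : (τ₁.setReg r_M (n + 1)).arr a_dep = dep := (f₁.arr a_dep).trans h2
  have z₁ : (τ₁.setReg r_M (n + 1)).arr a_beg = beg := (f₁.arr a_beg).trans h3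
  obtain ⟨υ₁, hυ₁⟩ : ∃ υ, τ₁.setReg r_M (n + 1) = υ := ⟨_, rfl⟩
  rw [hυ₁] at H₁ K₁ P₁ M₁ x₁ y₁ z₁ ⊢
  have hT₁' : Within (T₁ + (2 + 1 + 1 + 2)) T ((2 + 20) * K + 10 + 6) := hT₁.add le_rfl
  clear hT₁ o₁ f₁ hυ₁ n₁
  -- the three stages: by the following words, by the depths, by the intervals
  have rk : ∀ i < K, υ₁.arr a_nm (beg i) < n + 1 := fun i hi => by
    have := hb i hi
    have := H₁.rank_le (show beg i ≤ S.length by omega)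
    omega
  have hbn : ∀ i < K, beg i ≤ n := fun i hi => by have := hb i hi; omega
  refine wp_last (fill_spec (fun t => υ₁.arr a_nm (beg t)) (by norm_num) (by norm_num) K₁
    (by omega) (by omega) ?_) ?_
  · intro τ t ht htτ hf'
    simp only [ok_rules, eval_rules, htτ, Nat.reduceLT, hf'.arr a_nm, hf'.arr a_beg, z₁]
    have := hbn t ht
    omega
  rintro τ₂ T₂ f₂ ⟨hT₂, k₂⟩
  replace hT₂ : Within T₂ T _ := hT₁'.add hT₂
  clear hT₁'
  simp only [eval_rules] at hT₂
  refine wp_then (countingSort_spec ((f₂.reg r_K).trans K₁) ((f₂.reg r_M).trans M₁) (by omega)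
    (by omega) (by omega) (fun i hi => by rw [k₂ i hi]; exact rk i hi) (by
      rw [f₂.arr a_ord]; exact P₁)) ?_
  rintro τ₃ T₃ f₃ ⟨hT₃, P₃, s₃⟩
  replace hT₃ : Within T₃ T _ := hT₂.add hT₃
  clear hT₂
  replace s₃ := stable_sorted (g := fun _ => (0 : ℕ)) (fun _ _ _ _ => le_rfl) s₃
  have K₃ : τ₃.reg r_K = K := by rw [f₃.reg r_K, f₂.reg r_K, K₁]
  have M₃ : τ₃.reg r_M = n + 1 := by rw [f₃.reg r_M, f₂.reg r_M, M₁]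
  have H₃ := (H₁.frame f₂).frame f₃
  have nm₃ : τ₃.arr a_nm = υ₁.arr a_nm := by rw [f₃.arr a_nm, f₂.arr a_nm]
  have x₃ : τ₃.arr a_fst = fst := by rw [f₃.arr a_fst, f₂.arr a_fst, x₁]
  have y₃ : τ₃.arr a_dep = dep := by rw [f₃.arr a_dep, f₂.arr a_dep, y₁]
  have z₃ : τ₃.arr a_beg = beg := by rw [f₃.arr a_beg, f₂.arr a_beg, z₁]
  clear f₂ f₃ K₁ M₁ x₁ y₁
  refine wp_then (fill_spec dep (by norm_num) (by norm_num) K₃ (by omega) (by omega) ?_) ?_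
  · intro τ t ht htτ hf'
    simp only [ok_rules, eval_rules, htτ, Nat.reduceLT, hf'.arr a_dep, y₃]
    omega
  rintro τ₄ T₄ f₄ ⟨hT₄, k₄⟩
  replace hT₄ : Within T₄ T _ := hT₃.add hT₄
  clear hT₃
  simp only [eval_rules] at hT₄
  have o₄ : τ₄.arr a_ord = τ₃.arr a_ord := f₄.arr a_ord
  refine wp_then (countingSort_spec ((f₄.reg r_K).trans K₃) ((f₄.reg r_M).trans M₃) (by omega)
    (by omega) (by omega) (fun i hi => by rw [k₄ i hi]; have := hd i hi; omega) (o₄ ▸ P₃)) ?_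
  rintro τ₅ T₅ f₅ ⟨hT₅, P₅, s₅⟩
  replace hT₅ : Within T₅ T _ := hT₄.add hT₅
  clear hT₄
  replace s₅ := stable_sorted (o₄ ▸ s₃) s₅
  have K₅ : τ₅.reg r_K = K := by rw [f₅.reg r_K, f₄.reg r_K, K₃]
  have M₅ : τ₅.reg r_M = n + 1 := by rw [f₅.reg r_M, f₄.reg r_M, M₃]
  have H₅ := (H₃.frame f₄).frame f₅
  have nm₅ : τ₅.arr a_nm = υ₁.arr a_nm := by rw [f₅.arr a_nm, f₄.arr a_nm, nm₃]
  have x₅ : τ₅.arr a_fst = fst := by rw [f₅.arr a_fst, f₄.arr a_fst, x₃]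
  have y₅ : τ₅.arr a_dep = dep := by rw [f₅.arr a_dep, f₄.arr a_dep, y₃]
  have z₅ : τ₅.arr a_beg = beg := by rw [f₅.arr a_beg, f₄.arr a_beg, z₃]
  clear f₄ f₅ K₃ M₃ x₃ y₃ z₃ H₃ nm₃ s₃ o₄ P₃
  refine wp_then (fill_spec fst (by norm_num) (by norm_num) K₅ (by omega) (by omega) ?_) ?_
  · intro τ t ht htτ hf'
    simp only [ok_rules, eval_rules, htτ, Nat.reduceLT, hf'.arr a_fst, x₅]
    omega
  rintro τ₆ T₆ f₆ ⟨hT₆, k₆⟩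
  replace hT₆ : Within T₆ T _ := hT₅.add hT₆
  clear hT₅
  simp only [eval_rules] at hT₆
  have o₆ : τ₆.arr a_ord = τ₅.arr a_ord := f₆.arr a_ord
  refine wp_then (countingSort_spec ((f₆.reg r_K).trans K₅) ((f₆.reg r_M).trans M₅) (by omega)
    (by omega) (by omega) (fun i hi => by rw [k₆ i hi]; have := hf i hi; omega) (o₆ ▸ P₅)) ?_
  rintro τ₇ T₇ f₇ ⟨hT₇, P₇, s₇⟩
  replace hT₇ : Within T₇ T _ := hT₆.add hT₇
  clear hT₆
  replace s₇ := stable_sorted (o₆ ▸ s₅) s₇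
  have K₇ : τ₇.reg r_K = K := by rw [f₇.reg r_K, f₆.reg r_K, K₅]
  have H₇ := (H₅.frame f₆).frame f₇
  have nm₇ : τ₇.arr a_nm = υ₁.arr a_nm := by rw [f₇.arr a_nm, f₆.arr a_nm, nm₅]
  have x₇ : τ₇.arr a_fst = fst := by rw [f₇.arr a_fst, f₆.arr a_fst, x₅]
  have y₇ : τ₇.arr a_dep = dep := by rw [f₇.arr a_dep, f₆.arr a_dep, y₅]
  have z₇ : τ₇.arr a_beg = beg := by rw [f₇.arr a_beg, f₆.arr a_beg, z₅]
  clear f₆ f₇ K₅ M₅ x₅ y₅ z₅ H₅ nm₅ s₅ o₆ P₅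
  set f : ℕ → ℕ ×ₗ ℕ ×ₗ List ℤ := fun i =>
    toLex (fst i, toLex (dep i, (S.drop (beg i)).take (m - dep i))) with hfdef
  have sf : SortedBy K (τ₇.arr a_ord) f := by
    intro a b hab hbK
    have := s₇ a b hab hbK
    have e1 := P₇.1 a (by omega)
    have e2 := P₇.1 b hbK
    have b1 := hbn _ e1
    have b2 := hbn _ e2
    have hr := (H₁.rank_lt (beg (τ₇.arr a_ord b)) (by omega) (beg (τ₇.arr a_ord a)) (by omega)).not
    simp only [k₆ _ e1, k₆ _ e2, k₄ _ e1, k₄ _ e2, k₂ _ e1, k₂ _ e2, Prod.Lex.toLex_le_toLex,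
      le_refl, and_true, ← le_iff_lt_or_eq] at this
    rw [hfdef, Prod.Lex.toLex_le_toLex, Prod.Lex.toLex_le_toLex]
    refine this.imp_right (And.imp_right (Or.imp_right ?_))
    rintro ⟨hda, h'⟩
    refine ⟨hda, ?_⟩
    show (S.drop (beg (τ₇.arr a_ord a))).take (m - dep (τ₇.arr a_ord a)) ≤
      (S.drop (beg (τ₇.arr a_ord b))).take (m - dep (τ₇.arr a_ord b))
    rw [hda]
    exact take_le_take (not_lt.1 (hr.1 (by omega))) _
  clear s₇ k₂ k₄ k₆
  have hff : ∀ i j, f i = f j ↔ fst i = fst j ∧ dep i = dep j ∧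
      (S.drop (beg i)).take (m - dep i) = (S.drop (beg j)).take (m - dep j) := by
    intro i j
    rw [hfdef, toLex_inj, Prod.ext_iff]
    simp only [toLex_inj, Prod.ext_iff]
  refine wp_last (naming_spec (c := 450) K₇ hK0 (by omega) (by omega) P₇ sf rfl rfl rfl rfl ?_) ?_
  · intro τ T' t ht1 ht2 ht3 hfr
    have e1 := P₇.1 t ht2
    have e2 := P₇.1 (t - 1) (by omega)
    refine wp_mono (sameItems_spec (a := τ₇.arr a_ord (t - 1)) (b := τ₇.arr a_ord t)
      (fst := fst) (dep := dep) (beg := beg) (H₇.frame hfr) (by omega)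
      (by omega) ((hfr.arr a_fst).trans x₇) ((hfr.arr a_dep).trans y₇) ((hfr.arr a_beg).trans z₇)
      (by omega) (by omega) (by omega) (by rw [ht3, hfr.arr a_ord]) (by rw [ht3, hfr.arr a_ord])
      (by omega) (by omega) (hf _ e2) (hf _ e1) (hd _ e2) (hd _ e1) (hb _ e2) (hb _ e1)
      (by omega)) ?_
    rintro υ T'' ⟨hT, hg⟩
    refine ⟨hT, ?_⟩
    rw [hg]
    simp only [hff]
  rintro τ₈ T₈ f₈ ⟨hT₈, hb₈, h₈⟩
  replace hT₈ : Within T₈ T _ := hT₇.add hT₈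
  refine ⟨hT₈.le (by omega), hb₈, fun i hi j hj => ?_⟩
  rw [← hff]
  have e1 := h₈ i hi j hj
  have e2 := h₈ j hj i hi
  constructor
  · intro e
    rw [e] at e1 e2
    exact le_antisymm (not_lt.1 fun h' => absurd (e2.2 h') (lt_irrefl _))
      (not_lt.1 fun h' => absurd (e1.2 h') (lt_irrefl _))
  · intro e
    rw [e] at e1 e2
    have := e1.not.2 (lt_irrefl _)
    have := e2.not.2 (lt_irrefl _)
    omega

end

/-! ### Collecting the heavy occurrences, and the intervals of the next round -/

section
variable {S : List ℤ} {cap W m D : ℕ} {pos cn : ℕ → ℕ}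

set_option maxHeartbeats 1000000 in
/-- The names `nw` of the leaves are distinct, and the leaf with the name of the item `D + k`, if there is
one, is the heavy occurrence of `k` that the round finds. -/
theorem collect_spec {σ : State} {T : ℕ} {nw A M : ℕ → ℕ} (h : HasLeaves S m D pos cn σ)
    (hc : 4 * S.length + 4 ≤ cap) (hW : 4 * S.length + 8 ≤ W) (hK : σ.reg r_K = D + D)
    (hnw : σ.arr a_new = nw) (hb : ∀ i < D + D, nw i < D + D)
    (hinj : ∀ i < D, ∀ j < D, nw i = nw j → i = j) (hA : σ.arr a_A = A) (hM : σ.arr a_Mu = M)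
    (hAn : ∀ k < D, A k ≤ S.length) (hMn : ∀ k < D, M k ≤ S.length) :
    wp S cap W collect (fun τ T' => T' ≤ T + 400 * (D + 1) ∧ ∀ k < D,
      τ.arr a_A k = A k + ∑ z ∈ Finset.range D, (if nw (D + k) = nw z then cn z else 0) ∧
      τ.arr a_Mu k = M k + ∑ z ∈ Finset.range D, (if nw (D + k) = nw z then cn z else 0) +
        ∑ z ∈ Finset.range D, (if nw (D + z) = nw k then cn z else 0)) σ T := by
  have hDn := h.D_le
  have hcn := h.cn_sum
  unfold collect
  refine wp_then (fill_spec (fun _ => D) (by norm_num) (by norm_num) hK (by omega) (by omega)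
    (fun τ t ht htτ hf => ?_)) ?_
  · simp only [ok_rules, eval_rules, (h.frame hf).D_eq, Nat.reduceLT, and_self]
  rintro τ₁ T₁ f₁ ⟨hT₁, h₁⟩
  simp only [eval_rules] at hT₁
  have H₁ := h.frame f₁
  have w₁ : τ₁.arr a_new = nw := (f₁.arr a_new).trans hnw
  have A₁ : τ₁.arr a_A = A := (f₁.arr a_A).trans hA
  have M₁ : τ₁.arr a_Mu = M := (f₁.arr a_Mu).trans hM
  clear f₁
  refine wp_seq (wp_for_const (fun k τ => (∀ x < k, τ.arr a_lf (nw x) = x) ∧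
      ∀ v < D + D, τ.arr a_lf v = D ∨ (τ.arr a_lf v < k ∧ nw (τ.arr a_lf v) = v)) 0 D 20
    (by norm_num) (by norm_num) (by norm_num) rfl rfl H₁.D_eq (by omega) (by omega)
    (by simp [ok_rules]) (by simp [eval_rules]) ⟨by simp, fun v hv => Or.inl (h₁ v hv)⟩ ?_ ?_)
  · rintro k τ T' _ hk hkτ hf ⟨hI, hJ⟩
    have e1 : τ.arr a_new = nw := (hf.arr a_new).trans w₁
    have e2 := hb k (by omega)
    simp only [wp_rules, ok_rules, eval_rules, hkτ, e1, Nat.reduceLT, Nat.reduceEqDiff, if_true,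
      if_false]
    repeat refine And.intro (by omega) ?_
    refine ⟨fun x hx => ?_, fun v hv => ?_, by omega⟩
    · by_cases hxk : x = k
      · rw [hxk, if_pos rfl]
      · rw [if_neg fun e => hxk (hinj x (by omega) k hk e)]
        exact hI x (by omega)
    · by_cases hv' : v = nw k
      · rw [if_pos hv']
        exact Or.inr ⟨by omega, hv'.symm⟩
      · rw [if_neg hv']
        exact (hJ v hv).imp_right fun h' => ⟨by omega, h'.2⟩
  rintro τ₂ T₂ _ f₂ ⟨hI₂, hJ₂⟩ hT₂
  simp only [eval_rules] at hT₂
  have H₂ := H₁.frame f₂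
  have w₂ : τ₂.arr a_new = nw := (f₂.arr a_new).trans w₁
  have A₂ : τ₂.arr a_A = A := (f₂.arr a_A).trans A₁
  have M₂ : τ₂.arr a_Mu = M := (f₂.arr a_Mu).trans M₁
  clear f₂
  obtain ⟨y, hy⟩ : ∃ y : ℕ → ℕ, ∀ k, y k = τ₂.arr a_lf (nw (D + k)) := ⟨_, fun _ => rfl⟩
  have hyD : ∀ k < D, y k ≤ D := fun k hk => by
    have := hJ₂ (nw (D + k)) (hb _ (by omega))
    rw [← hy] at this
    omega
  have hyz : ∀ k < D, ∀ z < D, y k = z ↔ nw (D + k) = nw z := fun k hk z hz => by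
    constructor
    · intro e
      have := hJ₂ (nw (D + k)) (hb _ (by omega))
      rw [← hy, e] at this
      rcases this with h' | h'
      · omega
      · exact h'.2.symm
    · intro e
      rw [hy, e, hI₂ z hz]
  have hg : ∀ k < D, (if y k < D then cn (y k) else 0) =
      ∑ z ∈ Finset.range D, (if nw (D + k) = nw z then cn z else 0) := fun k hk => by
    have : ∀ z ∈ Finset.range D, (if nw (D + k) = nw z then cn z else 0) =
        if y k = z then cn z else 0 := fun z hz => by
      simp only [hyz k hk z (Finset.mem_range.1 hz)]
    rw [Finset.sum_congr rfl this, Finset.sum_ite_eq]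
    simp only [Finset.mem_range]
  have hcn1 : ∀ z < D, cn z ≤ S.length := fun z hz =>
    (Finset.single_le_sum (f := cn) (fun _ _ => Nat.zero_le _) (Finset.mem_range.2 hz)).trans hcn
  have hsum : ∀ j k, k ≤ D → ∑ x ∈ Finset.range k, (if y x = j then cn x else 0) ≤ S.length :=
    fun j k hk => by
      refine le_trans (le_trans (Finset.sum_le_sum fun x _ => ?_)
        (Finset.sum_le_sum_of_subset (Finset.range_mono hk))) hcn
      split_ifs
      · exact le_rfl
      · exact Nat.zero_le _
  refine wp_for_const (fun k τ => ∀ j < D,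
      τ.arr a_A j = A j + (if j < k then if y j < D then cn (y j) else 0 else 0) ∧
      τ.arr a_Mu j = M j + (if j < k then if y j < D then cn (y j) else 0 else 0) +
        ∑ x ∈ Finset.range k, (if y x = j then cn x else 0)) 0 D 100
    (by norm_num) (by norm_num) (by norm_num) rfl rfl H₂.D_eq (by omega) (by omega)
    (by simp [ok_rules]) (by simp [eval_rules]) ?_ ?_ ?_
  · intro j hj
    simp [A₂, M₂]
  · intro k τ T' _ hk hkτ hf hI
    have H := H₂.frame hf
    have e1 : τ.arr a_new = nw := (hf.arr a_new).trans w₂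
    have e2 : τ.arr a_lf = τ₂.arr a_lf := hf.arr a_lf
    have e3 := hyD k hk
    have e4 := hb (D + k) (by omega)
    have e5 := hAn k hk
    have e6 := hMn k hk
    have e7 := hcn1 k hk
    simp only [wp_rules, ok_rules, eval_rules, hkτ, e1, e2, ← hy, H.D_eq, H.cn_eq, Nat.reduceLT,
      Nat.reduceEqDiff, if_true, if_false]
    repeat refine And.intro (by omega) ?_
    refine ⟨fun hlt => ?_, fun hge => ?_⟩
    · have e8 := hcn1 _ hlt
      have e9 := hMn _ hlt
      obtain ⟨i1, i2⟩ := hI k hk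
      obtain ⟨i3, i4⟩ := hI _ hlt
      have s1 := hsum k k hk.le
      have s2 := hsum (y k) k hk.le
      have s3 : (if y k < k then if y (y k) < D then cn (y (y k)) else 0 else 0) ≤ S.length := by
        split_ifs with h1 h2
        · exact hcn1 _ h2
        · omega
        · omega
      rw [if_neg (lt_irrefl k)] at i1 i2
      have s4 : (if y k = k then τ.arr a_Mu k + cn (y k) else τ.arr a_Mu (y k)) + cn k ≤ W := by
        split_ifs <;> omega
      clear hI₂ hJ₂ h₁
      repeat refine And.intro (by omega) ?_
      refine ⟨fun j hj => ?_, by omega⟩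
      obtain ⟨i5, i6⟩ := hI j hj
      rw [Finset.sum_range_succ]
      by_cases hjk : j = k
      · rw [hjk, if_pos rfl, if_pos (show k < k + 1 by omega), if_pos hlt, i1, if_pos rfl, i2]
        refine ⟨by omega, ?_⟩
        by_cases hyk : y k = k
        · simp only [hyk, if_true]; omega
        · rw [if_neg (Ne.symm hyk), if_neg hyk]; omega
      · simp only [show j < k + 1 ↔ j < k by omega, hjk, if_false]
        refine ⟨i5, ?_⟩
        by_cases hyj : y k = j
        · rw [hyj] at i4 ⊢
          rw [if_pos rfl, if_pos rfl, if_neg hjk, i4]; omega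
        · rw [if_neg (Ne.symm hyj), if_neg hyj, i6]; omega
    · refine ⟨fun j hj => ?_, by omega⟩
      obtain ⟨i1, i2⟩ := hI j hj
      rw [Finset.sum_range_succ, i1, i2, if_neg (show y k ≠ j by omega)]
      by_cases hjk : j = k
      · subst hjk
        simp [hge]
      · simp only [show j < k + 1 ↔ j < k by omega, add_zero, and_self]
  · intro τ T' _ hf hI hT
    simp only [eval_rules] at hT
    refine ⟨by omega, fun k hk => ?_⟩
    obtain ⟨i1, i2⟩ := hI k hk
    rw [if_pos hk, hg k hk] at i1 i2
    refine ⟨i1, i2.trans ?_⟩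
    congr 1
    refine Finset.sum_congr rfl fun x hx => ?_
    simp only [hyz x (Finset.mem_range.1 hx) k hk]

/-- Two neighbours stay together if they belong to the same interval and leave the central path
through the same edge. The array is overwritten from left to right; the old value of the cell `x` is
still present when it is read. -/
theorem nextStarts_spec {σ : State} {T : ℕ} {s B : ℕ → ℕ} (h : HasLeaves S m D pos cn σ)
    (hc : 4 * S.length + 4 ≤ cap) (hW : 4 * S.length + 8 ≤ W) (his : σ.arr a_is = s)
    (hB : σ.arr a_B = B) (hst : IsStarts D s) (hBm : ∀ x < D, B x ≤ m) :
    wp S cap W nextStarts (fun τ T' => T' ≤ T + 600 * (D + 1) ∧ τ.arr a_is D = s D ∧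
      ∀ x < D, τ.arr a_is x = if x = s x ∨ lcp (window S m (pos (x - 1))) (window S m (pos x)) ≤ B x
        then x else τ.arr a_is (x - 1)) σ T := by
  have hDn := h.D_le
  unfold nextStarts
  refine wp_for_const (fun k τ => (∀ x, k ≤ x → τ.arr a_is x = s x) ∧ ∀ x < k,
      τ.arr a_is x = if x = s x ∨ lcp (window S m (pos (x - 1))) (window S m (pos x)) ≤ B x
        then x else τ.arr a_is (x - 1)) 0 D 500
    (by norm_num) (by norm_num) (by norm_num) rfl rfl h.D_eq (by omega) (by omega)
    (by simp [ok_rules]) (by simp [eval_rules]) ⟨fun x _ => congrFun his x, by simp⟩ ?_ ?_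
  · rintro k τ T' _ hk hkτ hf ⟨hI, hJ⟩
    have H := h.frame hf
    have e1 := hI k le_rfl
    have e2 := hst.le k hk
    have e3 : τ.arr a_B = B := (hf.arr a_B).trans hB
    have e4 := hBm k hk
    have hm := H.m_pos
    simp only [wp_rules, ok_rules, eval_rules, hkτ, e1, Nat.reduceLT]
    repeat refine And.intro (by omega) ?_
    refine ⟨fun hlt => ?_, fun hge => ?_⟩
    · refine ⟨by omega, fun x hx => ?_, fun x hx => ?_, by omega⟩
      · rw [if_neg (by omega)]
        exact hI x (by omega)
      · by_cases hxk : x = k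
        · rw [if_pos hxk, hxk, if_pos (Or.inl (by omega))]
        · rw [if_neg hxk, if_neg (show x - 1 ≠ k by omega)]
          exact hJ x (by omega)
    · have hkp : 1 ≤ k := by omega
      refine wp_last (leafLce_spec H hc hW (show k - 1 < D by omega) hk (by
        simp only [ok_rules, eval_rules, hkτ, Nat.reduceLT]; omega) (by
        simp only [ok_rules, eval_rules, hkτ, Nat.reduceLT, Nat.reduceEqDiff, if_false, implies_true,
          and_self]) (by simp only [eval_rules]; omega)) ?_
      rintro υ T₂ f₂ ⟨hT₂, hvn, hv⟩
      have hlt := H.sorted.lcp_lt (show k - 1 < D by omega) hk (by omega)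
      have t₂ : υ.reg r_t = k := (f₂.reg r_t).trans hkτ
      have b₂ : υ.arr a_B = B := (f₂.arr a_B).trans e3
      have s₂ : υ.arr a_is = τ.arr a_is := f₂.arr a_is
      simp only [wp_rules, ok_rules, eval_rules, t₂, b₂, s₂, Nat.reduceLT]
      repeat refine And.intro (by omega) ?_
      have hwrite : ∀ v, v = (if k = s k ∨ lcp (window S m (pos (k - 1))) (window S m (pos k)) ≤ B k
          then k else τ.arr a_is (k - 1)) →
          (∀ x, k + 1 ≤ x → (if x = k then v else τ.arr a_is x) = s x) ∧
          ∀ x < k + 1, (if x = k then v else τ.arr a_is x) =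
            if x = s x ∨ lcp (window S m (pos (x - 1))) (window S m (pos x)) ≤ B x
            then x else if x - 1 = k then v else τ.arr a_is (x - 1) := by
        intro v hv
        refine ⟨fun x hx => ?_, fun x hx => ?_⟩
        · rw [if_neg (by omega)]
          exact hI x (by omega)
        · rw [if_neg (show x - 1 ≠ k by omega)]
          by_cases hxk : x = k
          · rw [if_pos hxk, hxk, hv]
          · rw [if_neg hxk]
            exact hJ x (by omega)
      refine ⟨fun hlt' => ?_, fun hge' => ?_⟩
      · obtain ⟨g1, g2⟩ := hwrite (τ.arr a_is (k - 1)) (by rw [if_neg (by omega)])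
        exact ⟨by omega, by omega, by omega, by omega, g1, g2, by omega⟩
      · obtain ⟨g1, g2⟩ := hwrite k (by rw [if_pos (by omega)])
        exact ⟨by omega, g1, g2, by omega⟩
  · rintro τ T' _ hf ⟨hI, hJ⟩ hT
    simp only [eval_rules] at hT
    exact ⟨by omega, hI D le_rfl, hJ⟩

end

/-! ### The rounds -/

notation "r_rd" => (59 : ℕ)

open Classical in
/-- The number of occurrences of the heavy occurrences of `k` that have been separated from `k`. -/
noncomputable def heavySum (w : ℕ → List ℤ) (D : ℕ) (cn s : ℕ → ℕ) (k : ℕ) : ℕ :=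
  ∑ z ∈ Finset.range D, if s k ≠ s z ∧ HeavyRel w D k z then cn z else 0

open Classical in
/-- The number of occurrences of the leaves that have been separated from `k` and are related to `k`
in one direction or the other. -/
noncomputable def mutualSum (w : ℕ → List ℤ) (D : ℕ) (cn s : ℕ → ℕ) (k : ℕ) : ℕ :=
  ∑ z ∈ Finset.range D, if s k ≠ s z ∧ (HeavyRel w D k z ∨ HeavyRel w D z k) then cn z else 0

section
variable {w : ℕ → List ℤ} {D m : ℕ} {cn s : ℕ → ℕ}

/-- Of the subtrees of two children of a node, at most one contains more than half of the leaves. -/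
theorem HeavyRel.asymm {x y : ℕ} (h : HeavyRel w D x y) : ¬ HeavyRel w D y x := by
  rintro ⟨-, -, h2⟩
  have h1 := h.2.2
  rw [lcp_comm (w y)] at h2
  rw [below_congr (y := y) (z := x) (by rw [lcp_comm])] at h1
  have : below w D y (lcp (w x) (w y) + 1) + below w D x (lcp (w x) (w y) + 1) ≤
      below w D x (lcp (w x) (w y)) := by
    unfold below
    rw [← Finset.card_union_of_disjoint]
    · refine Finset.card_le_card fun z hz => ?_
      simp only [Finset.mem_union, Finset.mem_filter] at hz ⊢
      rcases hz with ⟨hz, h'⟩ | ⟨hz, h'⟩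
      · exact ⟨hz, le_lcp_trans (by omega : _ ≤ lcp (w z) (w y)) (by rw [lcp_comm])⟩
      · exact ⟨hz, by omega⟩
    · rw [Finset.disjoint_left]
      intro z hz hz'
      simp only [Finset.mem_filter] at hz hz'
      have := le_lcp_trans (by rw [lcp_comm (w x) (w z)]; exact hz'.2) hz.2
      omega
  omega

theorem heavySum_le (k : ℕ) : heavySum w D cn s k ≤ ∑ z ∈ Finset.range D, cn z :=
  Finset.sum_le_sum fun z _ => by split_ifs <;> simp

theorem mutualSum_le (k : ℕ) : mutualSum w D cn s k ≤ ∑ z ∈ Finset.range D, cn z :=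
  Finset.sum_le_sum fun z _ => by split_ifs <;> simp

/-- The intervals `s` are split into the intervals `s'`; the leaves that are separated and related are
those for which `F` holds. -/
theorem heavySum_next {s' : ℕ → ℕ} {F : ℕ → ℕ → Prop} [DecidableRel F]
    (hs : ∀ x < D, ∀ y < D, s' x = s' y → s x = s y)
    (hF : ∀ x < D, ∀ y < D, F x y ↔ s x = s y ∧ s' x ≠ s' y ∧ HeavyRel w D x y) {k : ℕ} (hk : k < D) :
    heavySum w D cn s' k = heavySum w D cn s k +
      ∑ z ∈ Finset.range D, if F k z then cn z else 0 := by
  unfold heavySum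
  rw [← Finset.sum_add_distrib]
  refine Finset.sum_congr rfl fun z hz => ?_
  rw [Finset.mem_range] at hz
  have h1 := hs k hk z hz
  have h2 := hF k hk z hz
  by_cases hH : HeavyRel w D k z <;> by_cases e : s k = s z <;> by_cases e' : s' k = s' z <;>
    simp_all

/-- The relations in the two directions exclude each other (`HeavyRel.asymm`), so their
contributions can be added without counting a leaf twice. -/
theorem mutualSum_next {s' : ℕ → ℕ} {F : ℕ → ℕ → Prop} [DecidableRel F]
    (hs : ∀ x < D, ∀ y < D, s' x = s' y → s x = s y)
    (hF : ∀ x < D, ∀ y < D, F x y ↔ s x = s y ∧ s' x ≠ s' y ∧ HeavyRel w D x y) {k : ℕ} (hk : k < D) :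
    mutualSum w D cn s' k = mutualSum w D cn s k +
      (∑ z ∈ Finset.range D, if F k z then cn z else 0) +
      ∑ z ∈ Finset.range D, if F z k then cn z else 0 := by
  unfold mutualSum
  rw [← Finset.sum_add_distrib, ← Finset.sum_add_distrib]
  refine Finset.sum_congr rfl fun z hz => ?_
  rw [Finset.mem_range] at hz
  have h1 := hs k hk z hz
  have h2 := hF k hk z hz
  have h3 := hF z hz k hk
  rw [eq_comm (a := s z), ne_comm (a := s' z)] at h3
  have h4 : HeavyRel w D k z → ¬ HeavyRel w D z k := HeavyRel.asymm
  by_cases hH : HeavyRel w D k z <;> by_cases hH' : HeavyRel w D z k <;>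
    by_cases e : s k = s z <;> by_cases e' : s' k = s' z <;> simp_all

theorem heavySum_of_eq (hs : ∀ x < D, ∀ y < D, s x = s y) {k : ℕ} (hk : k < D) :
    heavySum w D cn s k = 0 :=
  Finset.sum_eq_zero fun z hz => if_neg fun h => h.1 (hs k hk z (Finset.mem_range.1 hz))

theorem mutualSum_of_eq (hs : ∀ x < D, ∀ y < D, s x = s y) {k : ℕ} (hk : k < D) :
    mutualSum w D cn s k = 0 :=
  Finset.sum_eq_zero fun z hz => if_neg fun h => h.1 (hs k hk z (Finset.mem_range.1 hz))

theorem eq_of_classSize_le_one {x y : ℕ} (hx : x < D) (hy : y < D) (h : classSize D s x ≤ 1)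
    (e : s x = s y) : x = y :=
  Finset.card_le_one.1 h x (by simp [hx]) y (by simp [hy, e])

open Classical in
theorem heavySum_of_inj (hs : ∀ x < D, ∀ y < D, s x = s y → x = y) {k : ℕ} (hk : k < D) :
    heavySum w D cn s k = ∑ z ∈ Finset.range D, if HeavyRel w D k z then cn z else 0 := by
  refine Finset.sum_congr rfl fun z hz => ?_
  simp only [and_iff_right_of_imp fun h : HeavyRel w D k z =>
    fun e => h.1 (hs k hk z (Finset.mem_range.1 hz) e)]

open Classical in
theorem mutualSum_of_inj (hs : ∀ x < D, ∀ y < D, s x = s y → x = y) {k : ℕ} (hk : k < D) :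
    mutualSum w D cn s k =
      ∑ z ∈ Finset.range D, if HeavyRel w D k z ∨ HeavyRel w D z k then cn z else 0 := by
  refine Finset.sum_congr rfl fun z hz => ?_
  have : (HeavyRel w D k z ∨ HeavyRel w D z k) → s k ≠ s z := by
    intro h e
    have := hs k hk z (Finset.mem_range.1 hz) e
    rcases h with h | h
    · exact h.1 this
    · exact h.1 this.symm
  simp only [and_iff_right_of_imp this]

end

/-- One round: all intervals are treated. -/
def round : Cmd := allPaths ;; makeItems ;; nameItems ;; collect ;; nextStarts

/-- The state after `j` rounds: the intervals of `a_is` are subtrees that consist of one leaf or of at most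
`D / 2 ^ j` leaves, and the related pairs with members in different intervals have been counted. -/
structure RoundInv (w : ℕ → List ℤ) (D : ℕ) (cn : ℕ → ℕ) (j : ℕ) (σ : State) : Prop where
  starts : IsStarts D (σ.arr a_is)
  starts_D : σ.arr a_is D = D
  clusters : Clusters w D (σ.arr a_is)
  size : ∀ x < D, classSize D (σ.arr a_is) x = 1 ∨ classSize D (σ.arr a_is) x * 2 ^ j ≤ D
  heavy : ∀ x < D, σ.arr a_A x = heavySum w D cn (σ.arr a_is) x
  mutual_eq : ∀ x < D, σ.arr a_Mu x = mutualSum w D cn (σ.arr a_is) x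

theorem RoundInv.setReg {w : ℕ → List ℤ} {D j x k : ℕ} {cn : ℕ → ℕ} {σ : State}
    (h : RoundInv w D cn j σ) : RoundInv w D cn j (σ.setReg x k) :=
  ⟨h.starts, h.starts_D, h.clusters, h.size, h.heavy, h.mutual_eq⟩

section
variable {S : List ℤ} {cap W m D : ℕ} {pos cn : ℕ → ℕ}

/-- In a round, exactly those related pairs are counted whose members are separated by it, that is,
belong to different intervals of the next round for the first time. -/
theorem round_spec {σ : State} {T j : ℕ} (h : HasLeaves S m D pos cn σ)
    (hc : 4 * S.length + 4 ≤ cap) (hW : 4 * S.length + 8 ≤ W) (hmn : m ≤ S.length) (hD0 : 0 < D)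
    (hI : RoundInv (fun k => window S m (pos k)) D cn j σ) :
    wp S cap W round (fun τ T' => T' ≤ T + 20000 * (S.length + 1) ∧
      RoundInv (fun k => window S m (pos k)) D cn (j + 1) τ) σ T := by
  have hDn := h.D_le
  have hw := h.sorted
  obtain ⟨s, hs⟩ : ∃ s, σ.arr a_is = s := ⟨_, rfl⟩
  obtain ⟨A, hA⟩ : ∃ A, σ.arr a_A = A := ⟨_, rfl⟩
  obtain ⟨M, hM⟩ : ∃ M, σ.arr a_Mu = M := ⟨_, rfl⟩
  obtain ⟨i1, i2, i3, i4, i5, i6⟩ := hI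
  rw [hs] at i1 i2 i3 i4 i5 i6
  rw [hA] at i5
  rw [hM] at i6
  unfold round
  refine wp_then (allPaths_spec h hc hW hmn hs i2 i1 i3) ?_
  rintro τ₁ T₁ f₁ ⟨hT₁, hpath⟩
  obtain ⟨p, hp⟩ : ∃ p, τ₁.arr a_pl = p := ⟨_, rfl⟩
  obtain ⟨B, hB⟩ : ∃ B, τ₁.arr a_B = B := ⟨_, rfl⟩
  obtain ⟨hv, hhv⟩ : ∃ hv, τ₁.arr a_hv = hv := ⟨_, rfl⟩
  rw [hp, hB, hhv] at hpath
  have H₁ := h.frame f₁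
  have s₁ := (f₁.arr a_is).trans hs
  have A₁ := (f₁.arr a_A).trans hA
  have M₁ := (f₁.arr a_Mu).trans hM
  refine wp_then (makeItems_spec H₁ hc hW s₁ hp hB hhv hpath) ?_
  rintro τ₂ T₂ f₂ ⟨hT₂, K₂, h₂⟩
  have H₂ := H₁.frame f₂
  have s₂ := (f₂.arr a_is).trans s₁
  have A₂ := (f₂.arr a_A).trans A₁
  have M₂ := (f₂.arr a_Mu).trans M₁
  have B₂ := (f₂.arr a_B).trans hB
  have hB_le : ∀ x < D, B x ≤ m := fun x hx => by
    rw [hpath.B_eq x hx]; exact hw.lcp_le hx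
  have hpart : ∀ x < D, hv x = 1 → partner (fun k => window S m (pos k)) p B x ≤ m :=
    fun x hx h1 => by
      rw [hpath.hv_eq x hx] at h1
      have : x ≠ p x := by
        intro e
        rw [if_neg fun h' => h'.1 e] at h1
        omega
      exact (hpath.partner_le hw hx this).2
  have items : ∀ i < D + D, τ₂.arr a_fst i ≤ D ∧ τ₂.arr a_dep i ≤ m ∧
      τ₂.arr a_beg i + (m - τ₂.arr a_dep i) ≤ S.length := by
    intro i hi
    rcases Nat.lt_or_ge i D with hiD | hiD
    · obtain ⟨⟨g1, g2, g3⟩, -⟩ := h₂ i hiD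
      have := i1.le i hiD
      have := hB_le i hiD
      have := h.pos_le i hiD
      omega
    · obtain ⟨x, rfl⟩ : ∃ x, i = D + x := ⟨i - D, by omega⟩
      have hx : x < D := by omega
      obtain ⟨-, g1, g2, g3⟩ := h₂ x hx
      have := i1.le x hx
      have := hpart x hx
      have := h.pos_le x hx
      split_ifs at g1 g2 with h1 <;> omega
  refine wp_then (nameItems_spec H₂ hc hW K₂ (by omega) (by omega) rfl rfl rfl
    (fun i hi => (items i hi).1) (fun i hi => (items i hi).2.1) (fun i hi => (items i hi).2.2) hmn) ?_
  rintro τ₃ T₃ f₃ ⟨hT₃, b₃, h₃⟩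
  have H₃ := H₂.frame f₃
  have s₃ := (f₃.arr a_is).trans s₂
  have A₃ := (f₃.arr a_A).trans A₂
  have M₃ := (f₃.arr a_Mu).trans M₂
  have B₃ := (f₃.arr a_B).trans B₂
  have K₃ := (f₃.reg r_K).trans K₂
  obtain ⟨nw, hnw⟩ : ∃ nw, τ₃.arr a_new = nw := ⟨_, rfl⟩
  rw [hnw] at b₃ h₃
  -- Leaves with equal items agree up to the depth `B`, being on the same path, and behind it.
  have leaf_inj : ∀ x < D, ∀ y < D, nw x = nw y → x = y := by
    intro x hx y hy e
    rw [h₃ x (by omega) y (by omega)] at e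
    obtain ⟨⟨u1, u2, u3⟩, -⟩ := h₂ x hx
    obtain ⟨⟨v1, v2, v3⟩, -⟩ := h₂ y hy
    rw [u1, u2, u3, v1, v2, v3, ← window_drop, ← window_drop] at e
    obtain ⟨e1, e2, e3⟩ := e
    refine hw.inj hx hy ?_
    have b1 := hpath.B_eq x hx
    have b2 := hpath.B_eq y hy
    rw [← hpath.congr x hx y hy e1] at b2
    have t1 := (le_lcp_iff.1 b1.le).2.2
    have t2 := (le_lcp_iff.1 b2.le).2.2
    show window S m (pos x) = window S m (pos y)
    rw [← List.take_append_drop (B x) (window S m (pos x)),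
      ← List.take_append_drop (B x) (window S m (pos y)), t1, e3, e2, t2]
  refine wp_then (collect_spec H₃ hc hW K₃ hnw b₃ leaf_inj A₃ M₃
    (fun k hk => by rw [i5 k hk]; exact (heavySum_le k).trans h.cn_sum)
    (fun k hk => by rw [i6 k hk]; exact (mutualSum_le k).trans h.cn_sum)) ?_
  rintro τ₄ T₄ f₄ ⟨hT₄, h₄⟩
  refine wp_last (nextStarts_spec (H₃.frame f₄) hc hW ((f₄.arr a_is).trans s₃)
    ((f₄.arr a_B).trans B₃) i1 hB_le) ?_
  rintro τ₅ T₅ f₅ ⟨hT₅, d₅, h₅⟩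
  obtain ⟨s', hs'⟩ : ∃ s', τ₅.arr a_is = s' := ⟨_, rfl⟩
  rw [hs'] at d₅ h₅
  obtain ⟨n1, n2⟩ := hpath.next_eq_iff hw i1 (s' := s') h₅
  have hss : ∀ x < D, ∀ y < D, s' x = s' y → s x = s y := by
    intro x hx y hy e
    rcases (n2 x hx y hy).1 e with rfl | e
    · rfl
    · exact e.1
  -- Equality of names means that `y` is the heavy occurrence of `x` and that this round separates them.
  have hF : ∀ x < D, ∀ y < D, nw (D + x) = nw y ↔
      s x = s y ∧ s' x ≠ s' y ∧ HeavyRel (fun k => window S m (pos k)) D x y := by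
    intro x hx y hy
    rw [h₃ (D + x) (by omega) y (by omega)]
    obtain ⟨-, u1, u2, u3⟩ := h₂ x hx
    obtain ⟨⟨v1, v2, v3⟩, -⟩ := h₂ y hy
    rw [u3, v3, u1, v1, u2, v2]
    have hsy := i1.le y hy
    by_cases h1 : hv x = 1
    · rw [if_pos h1, if_pos h1]
      have ht := fun e => hpath.treated_iff hw hx hy (e : s x = s y)
      constructor
      · rintro ⟨e1, e2, e3⟩
        rw [← e2, ← window_drop, ← window_drop] at e3
        obtain ⟨r1, r2⟩ := (ht e1).1 ⟨h1, e2.symm, e3⟩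
        refine ⟨e1, fun e => ?_, r1⟩
        rcases (n2 x hx y hy).1 e with e | e
        · exact r1.1 e
        · omega
      · rintro ⟨e1, e2, e3⟩
        obtain ⟨-, r2, r3⟩ := (ht e1).2 ⟨e3, not_lt.1 fun e => e2 ((n2 x hx y hy).2 (Or.inr ⟨e1, e⟩))⟩
        refine ⟨e1, r2.symm, ?_⟩
        rw [r2, ← window_drop, ← window_drop]
        exact r3
    · rw [if_neg h1]
      refine ⟨fun e => by omega, fun e => ?_⟩
      exact absurd ((hpath.treated_iff hw hx hy e.1).2 ⟨e.2.2, not_lt.1 fun e' =>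
        e.2.1 ((n2 x hx y hy).2 (Or.inr ⟨e.1, e'⟩))⟩).1 h1
  refine ⟨by linarith, ?_⟩
  refine ⟨hs' ▸ n1, by rw [hs', d₅, i2], hs' ▸ i3.next hw n2, fun x hx => ?_, fun x hx => ?_,
    fun x hx => ?_⟩
  · rw [hs']
    rcases hpath.next_size i3 n2 hx hw with e | e
    · exact Or.inl e
    · rcases i4 x hx with e' | e'
      · left
        have : 0 < classSize D s' x := Finset.card_pos.2 ⟨x, by simp [hx]⟩
        omega
      · right
        rw [pow_succ, ← mul_assoc, mul_right_comm, mul_comm (classSize D s' x)]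
        exact (Nat.mul_le_mul_right _ e).trans e'
  · rw [f₅.arr a_A, (h₄ x hx).1, i5 x hx, hs', heavySum_next (F := fun x y => nw (D + x) = nw y)
      hss hF hx]
  · rw [f₅.arr a_Mu, (h₄ x hx).2, i6 x hx, hs', mutualSum_next (F := fun x y => nw (D + x) = nw y)
      hss hF hx]

/-- For every leaf, the number of occurrences of its heavy occurrences (in `a_A`), and of the leaves to
which it is related in one direction or the other (in `a_Mu`). -/
def allRounds : Cmd :=
  .fill a_is 0 r_D ;;
  .put a_is (.reg r_D) (.reg r_D) ;;
  .fill a_A 0 r_D ;;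
  .fill a_Mu 0 r_D ;;
  .for r_rd 0 r_b round

open Classical in
/-- The intervals shrink to at most half in each round, or become single leaves; so after `log n +
1` rounds all leaves are separated, and every related pair has been counted once. -/
theorem allRounds_spec {σ : State} {T : ℕ} (h : HasLeaves S m D pos cn σ)
    (hc : 4 * S.length + 4 ≤ cap) (hW : 4 * S.length + 8 ≤ W) (hmn : m ≤ S.length) (hD0 : 0 < D) :
    wp S cap W allRounds (fun τ T' =>
      T' ≤ T + 21000 * ((S.length + 1) * (Nat.log 2 S.length + 1)) ∧ ∀ x < D,
      (τ.arr a_A x = ∑ z ∈ Finset.range D,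
        if HeavyRel (fun k => window S m (pos k)) D x z then cn z else 0) ∧
      (τ.arr a_Mu x = ∑ z ∈ Finset.range D,
        if HeavyRel (fun k => window S m (pos k)) D x z ∨ HeavyRel (fun k => window S m (pos k)) D z x
        then cn z else 0)) σ T := by
  have hDn := h.D_le
  have hlog := Nat.log_le_self 2 S.length
  unfold allRounds
  refine wp_then (fill_spec (fun _ => 0) (by norm_num) (by norm_num) h.D_eq (by omega) (by omega)
    (fun τ t ht htτ hf => by simp only [ok_rules, eval_rules, Nat.zero_le, and_self])) ?_
  rintro τ₁ T₁ f₁ ⟨hT₁, h₁⟩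
  simp only [eval_rules] at hT₁
  have H₁ := h.frame f₁
  simp only [wp_rules, ok_rules, eval_rules, H₁.D_eq, Nat.reduceLT]
  refine ⟨by omega, ?_⟩
  have H₁' := H₁.setArr (A := a_is) (i := D) (k := D)
  have h₁' : ∀ t < D, (τ₁.setArr a_is D D).arr a_is t = 0 := fun t ht => by
    simp [show t ≠ D by omega, h₁ t ht]
  have d₁' : (τ₁.setArr a_is D D).arr a_is D = D := by simp
  obtain ⟨υ₁, hυ₁⟩ : ∃ υ, τ₁.setArr a_is D D = υ := ⟨_, rfl⟩
  rw [hυ₁] at H₁' h₁' d₁' ⊢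
  refine wp_last (fill_spec (fun _ => 0) (by norm_num) (by norm_num) H₁'.D_eq (by omega) (by omega)
    (fun τ t ht htτ hf => by simp only [ok_rules, eval_rules, Nat.zero_le, and_self])) ?_
  rintro τ₂ T₂ f₂ ⟨hT₂, h₂⟩
  simp only [eval_rules] at hT₂
  have H₂ := H₁'.frame f₂
  refine wp_then (fill_spec (fun _ => 0) (by norm_num) (by norm_num) H₂.D_eq (by omega) (by omega)
    (fun τ t ht htτ hf => by simp only [ok_rules, eval_rules, Nat.zero_le, and_self])) ?_
  rintro τ₃ T₃ f₃ ⟨hT₃, h₃⟩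
  simp only [eval_rules] at hT₃
  have H₃ := H₂.frame f₃
  have is₃ : τ₃.arr a_is = υ₁.arr a_is := (f₃.arr a_is).trans (f₂.arr a_is)
  have A₃ : τ₃.arr a_A = τ₂.arr a_A := f₃.arr a_A
  have hall : ∀ x < D, ∀ y < D, υ₁.arr a_is x = υ₁.arr a_is y := fun x hx y hy => by
    rw [h₁' x hx, h₁' y hy]
  refine wp_for_const (fun k τ => RoundInv (fun k => window S m (pos k)) D cn k τ) 0
    (Nat.log 2 S.length + 1) (20000 * (S.length + 1)) (by norm_num)
    (by norm_num) (by norm_num) rfl rfl H₃.b_eq (by omega) (by omega) (by simp [ok_rules])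
    (by simp [eval_rules]) ?_ ?_ ?_
  · refine RoundInv.setReg ⟨?_, ?_, ?_, fun x hx => ?_, fun x hx => ?_, fun x hx => ?_⟩
    · rw [is₃]
      refine ⟨fun x hx => by rw [h₁' x hx]; omega, fun x hx => ?_, fun x y hxy hy => ?_⟩
      · rw [h₁' x hx, h₁' 0 (by omega)]
      · rw [h₁' x (by omega)]; omega
    · rw [is₃, d₁']
    · rw [is₃]
      intro x y z hx hy hz _ hne
      exact absurd (hall z hz x hx) hne
    · right
      rw [pow_zero, mul_one, classSize]
      exact (Finset.card_filter_le _ _).trans (Finset.card_range D).le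
    · rw [A₃, h₂ x hx, is₃, heavySum_of_eq hall hx]
    · rw [h₃ x hx, is₃, mutualSum_of_eq hall hx]
  · intro k τ T' _ hk hkτ hf hI
    exact wp_mono (round_spec (H₃.frame hf) hc hW hmn hD0 hI) fun τ T' h =>
      ⟨h.2.setReg, h.1⟩
  · intro τ T' _ hf hI hT
    simp only [eval_rules] at hT
    have hinj : ∀ x < D, ∀ y < D, τ.arr a_is x = τ.arr a_is y → x = y := by
      intro x hx y hy e
      refine eq_of_classSize_le_one hx hy ?_ e
      rcases hI.size x hx with h' | h'
      · exact h'.le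
      · have := Nat.lt_pow_succ_log_self (b := 2) (by norm_num) S.length
        by_contra hcon
        have := Nat.mul_le_mul_right (2 ^ (Nat.log 2 S.length + 1)) (not_le.1 hcon).le
        rw [one_mul] at this
        rw [Nat.succ_eq_add_one] at *
        omega
    refine ⟨?_, fun x hx => ⟨?_, ?_⟩⟩
    · have e1 : (20000 * (S.length + 1) + 11) * (Nat.log 2 S.length + 1 - 0) =
          20000 * ((S.length + 1) * (Nat.log 2 S.length + 1)) + 11 * (Nat.log 2 S.length + 1) := by
        rw [Nat.sub_zero]; ring
      have e2 : S.length + 1 ≤ (S.length + 1) * (Nat.log 2 S.length + 1) :=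
        Nat.le_mul_of_pos_right _ (by omega)
      rw [e1] at hT
      linarith
    · rw [hI.heavy x hx, heavySum_of_inj hinj hx]
    · rw [hI.mutual_eq x hx, mutualSum_of_inj hinj hx]

end

/-! ### Finding the leaves -/

/-- Whether the leaf at position `r_y` differs from the last leaf that has been found. -/
def isNewLeaf : Cmd :=
  .ite 0 (.reg r_D)
    (.set r_p (.cell a_pos (.reg r_D - 1)) ;; .set r_q (.reg r_y) ;; lce ;;
      .ite (.reg r_v) (.reg r_m) (.set r_g 1) (.set r_g 0))
    (.set r_g 1)

/-- Find the leaves: the suffixes with at least `m` symbols are visited in lexicographic order. For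
the leaf number `k`, `a_pos k` is a position and `a_cn k` is the number of its occurrences; `a_id` gives
the number of the leaf at each position. -/
def findLeaves : Cmd :=
  .set r_D 0 ;;
  .set r_e (.reg r_n + 1) ;;
  .for r_t 1 r_e
    (.set r_y (.cell a_sa (.reg r_t)) ;;
      .ite (.reg r_n) (.reg r_y + .reg r_m)
        .skip
        (isNewLeaf ;;
          .ite 0 (.reg r_g)
            (.put a_pos (.reg r_D) (.reg r_y) ;; .put a_cn (.reg r_D) 0 ;;
              .set r_D (.reg r_D + 1))
            .skip ;;
          .set r_x (.reg r_D - 1) ;;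
          .put a_cn (.reg r_x) (.cell a_cn (.reg r_x) + 1) ;;
          .put a_id (.reg r_y) (.reg r_x)))

/-- The number of positions at which `p` occurs, among the suffixes of rank less than `k`. -/
def occBelow (S : List ℤ) (m : ℕ) (rank : ℕ → ℕ) (k : ℕ) (p : List ℤ) : ℕ :=
  ((Finset.range (S.length + 1)).filter fun i =>
    i + m ≤ S.length ∧ rank i < k ∧ window S m i = p).card

/-- The leaves at the suffixes of rank less than `k` have been found. -/
structure LeavesInv (S : List ℤ) (m k : ℕ) (rank : ℕ → ℕ) (τ : State) : Prop where
  D_lt : τ.reg r_D < k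
  pos_le : ∀ j < τ.reg r_D, τ.arr a_pos j + m ≤ S.length ∧ rank (τ.arr a_pos j) < k
  sorted : ∀ i j, i < j → j < τ.reg r_D → window S m (τ.arr a_pos i) < window S m (τ.arr a_pos j)
  id_eq : ∀ i, i + m ≤ S.length → rank i < k → τ.arr a_id i < τ.reg r_D ∧
    window S m (τ.arr a_pos (τ.arr a_id i)) = window S m i
  cn_eq : ∀ j < τ.reg r_D, τ.arr a_cn j = occBelow S m rank k (window S m (τ.arr a_pos j))

section
variable {S : List ℤ} {cap W m : ℕ}

theorem window_length {i : ℕ} (h : i + m ≤ S.length) : (window S m i).length = m := by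
  rw [window, List.length_take, List.length_drop]; omega

theorem lcp_window_lt_iff {i j : ℕ} (hi : i + m ≤ S.length) (hj : j + m ≤ S.length) :
    lcp (S.drop i) (S.drop j) < m ↔ window S m i ≠ window S m j := by
  rw [← not_le, not_iff_not, le_lcp_iff, List.length_drop, List.length_drop, window, window]
  exact ⟨fun h => h.2.2, fun h => ⟨by omega, by omega, h⟩⟩

theorem occBelow_le (rank : ℕ → ℕ) (k : ℕ) (p : List ℤ) :
    occBelow S m rank k p ≤ S.length + 1 :=
  (Finset.card_filter_le _ _).trans (Finset.card_range _).le

theorem occBelow_succ {σ : State} (h : HasSuffixArray S σ) {k y : ℕ} (p : List ℤ)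
    (hy : y ≤ S.length) (hyk : σ.arr a_nm y = k) :
    occBelow S m (σ.arr a_nm) (k + 1) p = occBelow S m (σ.arr a_nm) k p +
      if y + m ≤ S.length ∧ window S m y = p then 1 else 0 := by
  have hk : ∀ i ≤ S.length, σ.arr a_nm i < k + 1 ↔ σ.arr a_nm i < k ∨ i = y := fun i hi => by
    constructor
    · intro h'
      rcases Nat.lt_succ_iff_lt_or_eq.1 h' with h' | h'
      · exact Or.inl h'
      · exact Or.inr (h.rank_perm.2 i (by omega) y (by omega) (by omega))
    · rintro (h' | rfl) <;> omega
  unfold occBelow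
  split_ifs with hp
  · rw [← Finset.card_insert_of_notMem (a := y)]
    · congr 1
      ext i
      simp only [Finset.mem_filter, Finset.mem_insert, Finset.mem_range]
      constructor
      · rintro ⟨h1, h2, h3, h4⟩
        rcases (hk i (by omega)).1 h3 with h3 | h3
        · exact Or.inr ⟨h1, h2, h3, h4⟩
        · exact Or.inl h3
      · rintro (rfl | ⟨h1, h2, h3, h4⟩)
        · exact ⟨by omega, hp.1, by omega, hp.2⟩
        · exact ⟨h1, h2, by omega, h4⟩
    · simp [hyk]
  · rw [add_zero]
    congr 1
    ext i
    simp only [Finset.mem_filter, Finset.mem_range]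
    refine and_congr_right fun h1 => and_congr_right fun h2 => ?_
    rw [hk i (by omega)]
    constructor
    · rintro ⟨h3 | rfl, h4⟩
      · exact ⟨h3, h4⟩
      · exact absurd ⟨h2, h4⟩ hp
    · rintro ⟨h3, h4⟩
      exact ⟨Or.inl h3, h4⟩

theorem LeavesInv.window_le {k : ℕ} {rank : ℕ → ℕ} {τ : State} (h : LeavesInv S m k rank τ) {i : ℕ}
    (hi : i + m ≤ S.length) (hik : rank i < k) :
    0 < τ.reg r_D ∧ window S m i ≤ window S m (τ.arr a_pos (τ.reg r_D - 1)) := by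
  obtain ⟨h1, h2⟩ := h.id_eq i hi hik
  refine ⟨by omega, ?_⟩
  rw [← h2]
  rcases Nat.eq_or_lt_of_le (show τ.arr a_id i ≤ τ.reg r_D - 1 by omega) with e | e
  · rw [e]
  · exact (h.sorted _ _ e (by omega)).le

theorem isNewLeaf_spec {σ : State} {T y k : ℕ} (h : HasLce S σ) (hn0 : 0 < S.length)
    (hc : 4 * S.length + 4 ≤ cap) (hW : 4 * S.length + 8 ≤ W) (hm : σ.reg r_m = m)
    (hy : σ.reg r_y = y) (hyn : y + m ≤ S.length) (hkn : k ≤ S.length)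
    (hI : LeavesInv S m k (σ.arr a_nm) σ) :
    wp S cap W isNewLeaf (fun τ T' => T' ≤ T + 400 ∧ τ.reg r_g =
      if σ.reg r_D = 0 ∨ window S m (σ.arr a_pos (σ.reg r_D - 1)) ≠ window S m y then 1 else 0)
      σ T := by
  have hDk := hI.D_lt
  unfold isNewLeaf
  simp only [wp_rules, ok_rules, eval_rules, hy, Nat.reduceLT, Nat.reduceEqDiff, if_true, if_false]
  refine ⟨fun hD => ?_, fun hD => ?_⟩
  · obtain ⟨p1, -⟩ := hI.pos_le (σ.reg r_D - 1) (by omega)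
    repeat refine And.intro (by omega) ?_
    refine wp_last (lce_spec (p := σ.arr a_pos (σ.reg r_D - 1)) (q := y)
      (h.congr (τ := (σ.setReg r_p (σ.arr a_pos (σ.reg r_D - 1))).setReg r_q y)
        rfl rfl rfl rfl rfl rfl rfl rfl rfl rfl rfl) hn0 hc hW (by simp) (by simp)
      (by omega) (by omega)) ?_
    rintro τ T' f ⟨hT, hv⟩
    have m₁ : τ.reg r_m = m := by rw [f.reg r_m]; simp [hm]
    simp only [wp_rules, ok_rules, eval_rules, hv, m₁, lcp_window_lt_iff p1 hyn, Nat.reduceLT,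
      if_true]
    refine ⟨fun hlt => ⟨by omega, by omega, ?_⟩, fun hge => ⟨by omega, ?_⟩⟩
    · rw [if_pos (Or.inr hlt)]
    · rw [if_neg (not_or.2 ⟨by omega, hge⟩)]
  · refine ⟨by omega, by omega, ?_⟩
    rw [if_pos (Or.inl (by omega))]

/-- A suffix of length less than `m` is not the position of a leaf. -/
theorem LeavesInv.skip {σ : State} {k y : ℕ} (h : HasSuffixArray S σ)
    (hI : LeavesInv S m k (σ.arr a_nm) σ) (hy : y ≤ S.length) (hyk : σ.arr a_nm y = k)
    (hym : S.length < y + m) : LeavesInv S m (k + 1) (σ.arr a_nm) σ := by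
  have hk : ∀ i, i + m ≤ S.length → σ.arr a_nm i < k + 1 → σ.arr a_nm i < k := by
    intro i hi hik
    by_contra hcon
    have := h.rank_perm.2 i (by omega) y (by omega) (by omega)
    omega
  refine ⟨by have := hI.D_lt; omega, fun j hj => ⟨(hI.pos_le j hj).1, by
    have := (hI.pos_le j hj).2; omega⟩, hI.sorted, fun i hi hik => hI.id_eq i hi (hk i hi hik),
    fun j hj => ?_⟩
  rw [occBelow_succ h _ hy hyk, if_neg (by omega), hI.cn_eq j hj, add_zero]

/-- A suffix that starts with a new leaf. -/
theorem LeavesInv.step_new {σ υ : State} {k y : ℕ} (h : HasSuffixArray S σ)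
    (hI : LeavesInv S m k (σ.arr a_nm) σ) (hy : y + m ≤ S.length) (hyk : σ.arr a_nm y = k)
    (hnew : σ.reg r_D = 0 ∨ window S m (σ.arr a_pos (σ.reg r_D - 1)) ≠ window S m y)
    (h1 : υ.reg r_D = σ.reg r_D + 1)
    (h2 : ∀ j, υ.arr a_pos j = if j = σ.reg r_D then y else σ.arr a_pos j)
    (h3 : ∀ j, υ.arr a_cn j = if j = σ.reg r_D then 1 else σ.arr a_cn j)
    (h4 : ∀ i, υ.arr a_id i = if i = y then σ.reg r_D else σ.arr a_id i) :
    LeavesInv S m (k + 1) (σ.arr a_nm) υ := by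
  have hDk := hI.D_lt
  have hlt : ∀ i, i + m ≤ S.length → σ.arr a_nm i < k → window S m i < window S m y := by
    intro i hi hik
    obtain ⟨g1, g2⟩ := hI.window_le hi hik
    have hne := hnew.resolve_left (by omega)
    obtain ⟨p1, p2⟩ := hI.pos_le (σ.reg r_D - 1) (by omega)
    refine lt_of_le_of_lt g2 (lt_of_le_of_ne ?_ hne)
    rw [← hyk, h.rank_lt _ (by omega) _ (by omega)] at p2
    exact take_le_take p2.le m
  have hk : ∀ i, i + m ≤ S.length → σ.arr a_nm i < k + 1 → σ.arr a_nm i < k ∨ i = y := by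
    intro i hi hik
    by_contra hcon
    rw [not_or] at hcon
    exact hcon.2 (h.rank_perm.2 i (by omega) y (by omega) (by omega))
  refine ⟨by omega, fun j hj => ?_, fun i j hij hj => ?_, fun i hi hik => ?_, fun j hj => ?_⟩
  · rw [h2]
    split_ifs with hjD
    · exact ⟨hy, by omega⟩
    · obtain ⟨p1, p2⟩ := hI.pos_le j (by omega)
      exact ⟨p1, by omega⟩
  · rw [h2, h2, if_neg (show i ≠ σ.reg r_D by omega)]
    split_ifs with hjD
    · obtain ⟨p1, p2⟩ := hI.pos_le i (by omega)
      exact hlt _ p1 p2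
    · exact hI.sorted i j hij (by omega)
  · rw [h4]
    split_ifs with hiy
    · rw [h2, if_pos rfl, hiy]
      exact ⟨by omega, rfl⟩
    · obtain ⟨g1, g2⟩ := hI.id_eq i hi ((hk i hi hik).resolve_right hiy)
      rw [h2, if_neg (by omega)]
      exact ⟨by omega, g2⟩
  · rw [h3, h2, occBelow_succ h _ (by omega) hyk]
    split_ifs with hjD hcond hcond
    · rw [eq_comm, Nat.add_eq_right, occBelow, Finset.card_eq_zero]
      refine Finset.filter_eq_empty_iff.2 fun i hi hcon => ?_
      exact (hlt i hcon.1 hcon.2.1).ne hcon.2.2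
    · exact absurd ⟨hy, rfl⟩ hcond
    · obtain ⟨p1, p2⟩ := hI.pos_le j (by omega)
      exact absurd hcond.2.symm (hlt _ p1 p2).ne
    · exact hI.cn_eq j (by omega)

/-- A suffix that starts with the last leaf. By the order of the suffixes, it cannot start with an
earlier one. -/
theorem LeavesInv.step_old {σ υ : State} {k y : ℕ} (h : HasSuffixArray S σ)
    (hI : LeavesInv S m k (σ.arr a_nm) σ) (hy : y + m ≤ S.length) (hyk : σ.arr a_nm y = k)
    (hD : σ.reg r_D ≠ 0) (hold : window S m (σ.arr a_pos (σ.reg r_D - 1)) = window S m y)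
    (h1 : υ.reg r_D = σ.reg r_D) (h2 : ∀ j, υ.arr a_pos j = σ.arr a_pos j)
    (h3 : ∀ j, υ.arr a_cn j = if j = σ.reg r_D - 1 then σ.arr a_cn j + 1 else σ.arr a_cn j)
    (h4 : ∀ i, υ.arr a_id i = if i = y then σ.reg r_D - 1 else σ.arr a_id i) :
    LeavesInv S m (k + 1) (σ.arr a_nm) υ := by
  have hDk := hI.D_lt
  refine ⟨by omega, fun j hj => ?_, fun i j hij hj => ?_, fun i hi hik => ?_, fun j hj => ?_⟩
  · rw [h2]
    obtain ⟨p1, p2⟩ := hI.pos_le j (by omega)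
    exact ⟨p1, by omega⟩
  · rw [h2, h2]
    exact hI.sorted i j hij (by omega)
  · rw [h4, h1, h2]
    split_ifs with hiy
    · rw [hiy]
      exact ⟨by omega, hold⟩
    · refine hI.id_eq i hi ?_
      by_contra hcon
      exact hiy (h.rank_perm.2 i (by omega) y (by omega) (by omega))
  · rw [h3, h2, occBelow_succ h _ (by omega) hyk, ← hI.cn_eq j (by omega), ← hold]
    by_cases hjD : j = σ.reg r_D - 1
    · rw [if_pos hjD, if_pos ⟨hy, by rw [hjD]⟩]
    · rw [if_neg hjD, if_neg, add_zero]
      rintro ⟨-, e⟩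
      exact (hI.sorted j (σ.reg r_D - 1) (by omega) (by omega)).ne e.symm

theorem findLeaves_spec {σ : State} {T : ℕ} (h : HasLce S σ) (hn0 : 0 < S.length)
    (hc : 4 * S.length + 4 ≤ cap) (hW : 4 * S.length + 8 ≤ W) (hm : σ.reg r_m = m) (hm0 : 1 ≤ m)
    (hmn : m ≤ S.length) :
    wp S cap W findLeaves (fun τ T' => T' ≤ T + 700 * (S.length + 1) ∧ ∃ D, 0 < D ∧
      HasLeaves S m D (τ.arr a_pos) (τ.arr a_cn) τ ∧
      (∀ i, i + m ≤ S.length → τ.arr a_id i < D ∧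
        window S m (τ.arr a_pos (τ.arr a_id i)) = window S m i) ∧
      ∀ j < D, τ.arr a_cn j = ((Finset.range (S.length + 1)).filter fun i =>
        i + m ≤ S.length ∧ window S m i = window S m (τ.arr a_pos j)).card) σ T := by
  have hrn := h.n_eq
  unfold findLeaves
  simp only [wp_rules, ok_rules, eval_rules, hrn, Nat.reduceLT, Nat.reduceEqDiff, if_false]
  repeat refine And.intro (by omega) ?_
  have H₀ : HasLce S ((σ.setReg r_D 0).setReg r_e (S.length + 1)) :=
    h.congr rfl rfl rfl rfl rfl rfl rfl rfl rfl rfl rfl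
  obtain ⟨υ₀, hυ₀⟩ : ∃ υ, (σ.setReg r_D 0).setReg r_e (S.length + 1) = υ := ⟨_, rfl⟩
  have m₀ : υ₀.reg r_m = m := by rw [← hυ₀]; simp [hm]
  have D₀ : υ₀.reg r_D = 0 := by rw [← hυ₀]; simp
  have e₀ : υ₀.reg r_e = S.length + 1 := by rw [← hυ₀]; simp
  rw [hυ₀] at H₀ ⊢
  have rp : ∀ i, i + m ≤ S.length → 1 ≤ υ₀.arr a_nm i := fun i hi => H₀.rank_pos (by omega)
  refine wp_for_const (fun k τ => LeavesInv S m k (υ₀.arr a_nm) τ) 1 (S.length + 1) 600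
    (by norm_num) (by norm_num) (by norm_num) rfl rfl e₀ (by omega) (by omega)
    (by simp [ok_rules]; omega) (by simp [eval_rules]) ?_ ?_ ?_
  · have e : (υ₀.setReg r_t 1).reg r_D = 0 := by simp [D₀]
    refine ⟨by omega, by omega, by omega, fun i hi hik => ?_, by omega⟩
    have := rp i hi
    omega
  · intro k τ T' hk1 hk hkτ hf hI
    have nm : τ.arr a_nm = υ₀.arr a_nm := hf.arr a_nm
    have H : HasLce S τ := H₀.congr (hf.reg r_n) nm (hf.arr a_sa) (hf.arr a_sym) (hf.arr a_lc)
      (hf.reg r_b) (hf.arr a_lg) (hf.arr a_pw) (hf.arr a_mask) (hf.reg r_N) (hf.arr a_st)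
    have mτ : τ.reg r_m = m := (hf.reg r_m).trans m₀
    obtain ⟨y, hy⟩ : ∃ y, τ.arr a_sa k = y := ⟨_, rfl⟩
    have hyn : y ≤ S.length := hy ▸ H.sa_le (by omega)
    have hyk : τ.arr a_nm y = k := hy ▸ H.rank_sa (by omega)
    rw [← nm] at hI ⊢
    have hIy : LeavesInv S m k ((τ.setReg r_y y).arr a_nm) (τ.setReg r_y y) := by
      refine ⟨?_, ?_, ?_, ?_, ?_⟩
      · simpa using hI.D_lt
      · simpa using hI.pos_le
      · simpa using hI.sorted
      · simpa using hI.id_eq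
      · simpa using hI.cn_eq
    have Hy : HasLce S (τ.setReg r_y y) := H.congr rfl rfl rfl rfl rfl rfl rfl rfl rfl rfl rfl
    simp only [wp_rules, ok_rules, eval_rules, hkτ, hy, H.n_eq, mτ, Nat.reduceLT, Nat.reduceEqDiff,
      if_true, if_false]
    repeat refine And.intro (by omega) ?_
    refine ⟨fun hlt => ?_, fun hge => ?_⟩
    · refine ⟨?_, by omega⟩
      have := LeavesInv.skip Hy.toHasSuffixArray hIy hyn hyk (by omega)
      refine ⟨?_, ?_, ?_, ?_, ?_⟩
      · simpa using this.D_lt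
      · simpa using this.pos_le
      · simpa using this.sorted
      · simpa using this.id_eq
      · simpa using this.cn_eq
    · have hym : y + m ≤ S.length := by omega
      refine wp_last (isNewLeaf_spec Hy hn0 hc hW (by simp [mτ]) (by simp) hym (by omega) hIy) ?_
      rintro υ T₂ f₂ ⟨hT₂, hg⟩
      have yυ : υ.reg r_y = y := by rw [f₂.reg r_y]; simp
      have tυ : υ.reg r_t = k := by rw [f₂.reg r_t]; simp [hkτ]
      have Dυ : υ.reg r_D = τ.reg r_D := by rw [f₂.reg r_D]; simp
      have posυ : υ.arr a_pos = τ.arr a_pos := f₂.arr a_pos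
      have cnυ : υ.arr a_cn = τ.arr a_cn := f₂.arr a_cn
      have idυ : υ.arr a_id = τ.arr a_id := f₂.arr a_id
      have hDk := hI.D_lt
      simp only [State.setReg_arr, State.setReg_reg, Nat.reduceEqDiff, if_false] at hg
      simp only [wp_rules, ok_rules, eval_rules, yυ, tυ, Dυ, posυ, cnυ, idυ, hg, Nat.reduceLT, Nat.reduceEqDiff,
        if_true, if_false]
      refine ⟨fun hlt => ?_, fun hge => ?_⟩
      · have hcond : τ.reg r_D = 0 ∨ window S m (τ.arr a_pos (τ.reg r_D - 1)) ≠ window S m y := by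
          by_contra hcon
          rw [if_neg hcon] at hlt
          omega
        clear hg hlt
        simp only [Nat.add_sub_cancel, if_true, zero_add]
        repeat refine And.intro (by omega) ?_
        refine ⟨hI.step_new H.toHasSuffixArray hym hyk hcond (by simp) (fun j => ?_) (fun j => ?_)
          fun i => ?_, by omega⟩
        · simp [posυ]
        · by_cases hj : j = τ.reg r_D <;> simp [cnυ, hj]
        · simp [idυ]
      · have hcond : ¬ (τ.reg r_D = 0 ∨
            window S m (τ.arr a_pos (τ.reg r_D - 1)) ≠ window S m y) := by
          intro hcon
          rw [if_pos hcon] at hge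
          omega
        clear hg hge
        rw [not_or, not_not] at hcond
        have hcn := hI.cn_eq (τ.reg r_D - 1) (by omega)
        have := occBelow_le (S := S) (m := m) (τ.arr a_nm) k
          (window S m (τ.arr a_pos (τ.reg r_D - 1)))
        repeat refine And.intro (by omega) ?_
        refine ⟨hI.step_old H.toHasSuffixArray hym hyk hcond.1 hcond.2 (by simp [Dυ]) (fun j => ?_)
          (fun j => ?_) fun i => ?_, by omega⟩
        · simp [posυ]
        · by_cases hj : j = τ.reg r_D - 1 <;> simp [cnυ, hj]
        · simp [idυ]
  · intro τ T' _ hf hI hT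
    simp only [eval_rules] at hT
    have nm : τ.arr a_nm = υ₀.arr a_nm := hf.arr a_nm
    have H : HasLce S τ := H₀.congr (hf.reg r_n) nm (hf.arr a_sa) (hf.arr a_sym) (hf.arr a_lc)
      (hf.reg r_b) (hf.arr a_lg) (hf.arr a_pw) (hf.arr a_mask) (hf.reg r_N) (hf.arr a_st)
    rw [← nm] at hI
    have rk : ∀ i ≤ S.length, τ.arr a_nm i < S.length + 1 := fun i hi => by
      have := H.rank_le hi
      omega
    have hid := fun i hi => hI.id_eq i hi (rk i (by omega))
    have hcn : ∀ j < τ.reg r_D, τ.arr a_cn j = ((Finset.range (S.length + 1)).filter fun i =>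
        i + m ≤ S.length ∧ window S m i = window S m (τ.arr a_pos j)).card := fun j hj => by
      rw [hI.cn_eq j hj, occBelow]
      congr 1
      ext i
      simp only [Finset.mem_filter, Finset.mem_range]
      refine and_congr_right fun h1 => and_congr_right fun _ => ?_
      rw [and_iff_right (rk i (by omega))]
    have hinj : ∀ i < τ.reg r_D, ∀ j < τ.reg r_D,
        window S m (τ.arr a_pos i) = window S m (τ.arr a_pos j) → i = j := by
      intro i hi j hj e
      rcases Nat.lt_trichotomy i j with h' | h' | h'
      · exact absurd e (hI.sorted i j h' hj).ne
      · exact h'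
      · exact absurd e (hI.sorted j i h' hi).ne'
    refine ⟨by omega, τ.reg r_D, ?_, ?_, hid, hcn⟩
    · have := (hid 0 (by omega)).1
      omega
    · refine ⟨H, (hf.reg r_m).trans m₀, rfl, rfl, rfl, fun k hk => (hI.pos_le k hk).1,
        ⟨fun k hk => window_length (hI.pos_le k hk).1, hI.sorted⟩, by have := hI.D_lt; omega, hm0, ?_⟩
      rw [Finset.sum_congr rfl fun j hj => hcn j (Finset.mem_range.1 hj), ← Finset.card_biUnion]
      · refine (Finset.card_le_card (t := Finset.range S.length) fun i => ?_).trans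
          (Finset.card_range _).le
        simp only [Finset.mem_biUnion, Finset.mem_filter, Finset.mem_range]
        rintro ⟨j, -, -, h', -⟩
        omega
      · intro i hi j hj hij
        rw [Function.onFun, Finset.disjoint_left]
        intro z hz hz'
        simp only [Finset.mem_filter] at hz hz'
        exact hij (hinj i (by simpa using hi) j (by simpa using hj) (hz.2.2.symm.trans hz'.2.2))

end

/-! ### Heavy paths of the suffix tree -/

/-- The leaves `z` and `z'` differ in exactly one symbol, and more than half of the leaves below the
place where they separate are on the side of `z'`. -/
def IsHeavyPair (S : List ℤ) (m : ℕ) (z z' : List ℤ) : Prop :=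
  ∃ (u : List ℤ) (c d : ℤ) (s : List ℤ), c ≠ d ∧ z = u ++ c :: s ∧ z' = u ++ d :: s ∧
    (leavesBelow S m u).card < 2 * (leavesBelow S m (u ++ [d])).card

section
variable {S : List ℤ} {m : ℕ}

theorem mem_leavesBelow {u z : List ℤ} : z ∈ leavesBelow S m u ↔ z ∈ leaves S m ∧ u <+: z := by
  rw [leavesBelow, Finset.mem_filter]

theorem mem_leaves {z : List ℤ} : z ∈ leaves S m ↔ ∃ i, i + m ≤ S.length ∧ window S m i = z := by
  simp only [leaves, Finset.mem_image, Finset.mem_filter, Finset.mem_range]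
  exact ⟨fun ⟨i, h, e⟩ => ⟨i, h.2, e⟩, fun ⟨i, h, e⟩ => ⟨i, ⟨by omega, h⟩, e⟩⟩

theorem length_of_mem_leaves {z : List ℤ} (h : z ∈ leaves S m) : z.length = m := by
  obtain ⟨i, hi, rfl⟩ := mem_leaves.1 h
  exact window_length hi

theorem leavesBelow_anti {u v : List ℤ} (h : u <+: v) : leavesBelow S m v ⊆ leavesBelow S m u :=
  fun _ hz => mem_leavesBelow.2 ⟨(mem_leavesBelow.1 hz).1, h.trans (mem_leavesBelow.1 hz).2⟩

theorem card_leavesBelow_add_le {u v v' : List ℤ} (hv : u <+: v) (hv' : u <+: v')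
    (h : ∀ z, v <+: z → v' <+: z → False) :
    (leavesBelow S m v).card + (leavesBelow S m v').card ≤ (leavesBelow S m u).card := by
  rw [← Finset.card_union_of_disjoint]
  · exact Finset.card_le_card (Finset.union_subset (leavesBelow_anti hv) (leavesBelow_anti hv'))
  · rw [Finset.disjoint_left]
    exact fun z hz hz' => h z (mem_leavesBelow.1 hz).2 (mem_leavesBelow.1 hz').2

theorem concat_prefix_unique {u z : List ℤ} {c d : ℤ} (hc : u ++ [c] <+: z) (hd : u ++ [d] <+: z) :
    c = d := by
  have := (List.prefix_of_prefix_length_le hc hd (by simp)).eq_of_length (by simp)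
  simpa using this

theorem concat_prefix {u x : List ℤ} (h : u <+: x) (hne : u ≠ x) : ∃ a, u ++ [a] <+: x := by
  obtain ⟨t, rfl⟩ := h
  cases t with
  | nil => simp at hne
  | cons a t => exact ⟨a, t, by simp⟩

/-- If a leaf `z` and a word `v` differ after the common prefix `u`, but share its extension by one
symbol, then they agree on `v`, or separate at a node strictly between `u` and `v`. -/
theorem prefix_or_branch {u v z : List ℤ} {c : ℤ} (hz : u ++ [c] <+: z) (hv : u ++ [c] <+: v)
    (hlen : v.length ≤ z.length) : v <+: z ∨ ∃ (x : List ℤ) (a b : ℤ), a ≠ b ∧ u ++ [c] <+: x ∧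
      x ++ [a] <+: z ∧ x ++ [b] <+: v := by
  by_cases hvz : v <+: z
  · exact Or.inl hvz
  right
  set l := lcp z v with hl
  have h1 := lcp_le_left z v
  have h2 := lcp_le_right z v
  have h3 := (le_lcp_iff.1 hl.le).2.2
  have hlv : l < v.length := by
    by_contra hcon
    refine hvz ?_
    rw [List.prefix_iff_eq_take, show v.length = l by omega, h3, List.take_of_length_le (by omega)]
  refine ⟨z.take l, z[l], v[l], ?_, ?_, ?_, ?_⟩
  · intro e
    have : l + 1 ≤ lcp z v := le_lcp_iff.2 ⟨by omega, by omega, by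
      rw [← List.take_concat_get' z l (by omega), ← List.take_concat_get' v l hlv, h3, e]⟩
    omega
  · refine List.prefix_take_iff.2 ⟨hz, le_lcp_iff.2 ⟨hz.length_le, hv.length_le, ?_⟩⟩
    rw [← List.prefix_iff_eq_take.1 hz, ← List.prefix_iff_eq_take.1 hv]
  · rw [List.take_concat_get']
    exact List.take_prefix _ _
  · rw [h3, List.take_concat_get']
    exact List.take_prefix _ _

theorem IsNode.exists_leaf {u : List ℤ} (hmn : m ≤ S.length) (h : IsNode S m u) :
    ∃ z ∈ leaves S m, u <+: z := by
  rcases h with rfl | h | ⟨a, b, -, ⟨z, hz, h⟩, -⟩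
  · exact ⟨window S m 0, mem_leaves.2 ⟨0, by omega, rfl⟩, List.nil_prefix⟩
  · exact ⟨u, h, List.prefix_rfl⟩
  · exact ⟨z, hz, (List.prefix_append _ _).trans h⟩

theorem IsNode.length_le {u : List ℤ} (hmn : m ≤ S.length) (h : IsNode S m u) : u.length ≤ m := by
  obtain ⟨z, hz, h⟩ := h.exists_leaf hmn
  rw [← length_of_mem_leaves hz]
  exact h.length_le

/-- All the leaves that continue with the first symbol of an edge are below the edge. -/
theorem IsEdge.prefix_of_mem {u v z : List ℤ} {c : ℤ} (hmn : m ≤ S.length) (h : IsEdge S m u v)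
    (hv : u ++ [c] <+: v) (hz : z ∈ leaves S m) (hzc : u ++ [c] <+: z) : v <+: z := by
  refine (prefix_or_branch hzc hv ?_).resolve_right ?_
  · rw [length_of_mem_leaves hz]
    exact h.2.1.length_le hmn
  rintro ⟨x, a, b, hab, hx, hxz, hxv⟩
  obtain ⟨y, hy, hvy⟩ := h.2.1.exists_leaf hmn
  have hxn : IsNode S m x := Or.inr (Or.inr ⟨a, b, hab, ⟨z, hz, hxz⟩, ⟨y, hy, hxv.trans hvy⟩⟩)
  rcases h.2.2.2.2 x hxn ((List.prefix_append _ _).trans hx) ((List.prefix_append _ _).trans hxv) with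
    e | e
  · have := hx.length_le
    rw [e] at this
    simp at this
  · have := hxv.length_le
    rw [e] at this
    simp at this

/-- The edge from a node towards a leaf. -/
theorem exists_edge {u z : List ℤ} {c : ℤ} (hu : IsNode S m u) (hz : z ∈ leaves S m)
    (hc : u ++ [c] <+: z) : ∃ v, IsEdge S m u v ∧ u ++ [c] <+: v ∧ v <+: z := by
  classical
  have hex : ∃ l, ∃ x, x.length = l ∧ IsNode S m x ∧ u ++ [c] <+: x ∧ x <+: z :=
    ⟨_, z, rfl, Or.inr (Or.inl hz), hc, List.prefix_rfl⟩
  obtain ⟨v, hl, hv, hcv, hvz⟩ := Nat.find_spec hex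
  refine ⟨v, ⟨hu, hv, (List.prefix_append _ _).trans hcv, ?_, fun x hx hux hxv => ?_⟩, hcv, hvz⟩
  · rintro rfl
    have := hcv.length_le
    simp at this
  · by_cases hne : u = x
    · exact Or.inl hne.symm
    right
    obtain ⟨a, ha⟩ := concat_prefix hux hne
    obtain rfl := concat_prefix_unique (ha.trans (hxv.trans hvz)) hc
    have := Nat.find_min' hex ⟨x, rfl, hx, ha, hxv.trans hvz⟩
    exact hxv.eq_of_length_le (by omega)

theorem IsEdge.eq_of_common {u v v' z : List ℤ} (h : IsEdge S m u v) (h' : IsEdge S m u v')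
    (hz : v <+: z) (hz' : v' <+: z) : v = v' := by
  rcases List.prefix_or_prefix_of_prefix hz hz' with hp | hp
  · rcases h'.2.2.2.2 v h.2.1 h.2.2.1 hp with e | e
    · exact absurd e.symm h.2.2.2.1
    · exact e
  · rcases h.2.2.2.2 v' h'.2.1 h'.2.2.1 hp with e | e
    · exact absurd e.symm h'.2.2.2.1
    · exact e.symm

theorem IsEdge.parent_unique {u u' v : List ℤ} (h : IsEdge S m u v) (h' : IsEdge S m u' v) :
    u = u' := by
  rcases List.prefix_or_prefix_of_prefix h.2.2.1 h'.2.2.1 with hp | hp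
  · rcases h.2.2.2.2 u' h'.1 hp h'.2.2.1 with e | e
    · exact e.symm
    · exact absurd e h'.2.2.2.1
  · rcases h'.2.2.2.2 u h.1 hp h.2.2.1 with e | e
    · exact e
    · exact absurd e h.2.2.2.1

/-- Two children of a node cannot both have more than half of its leaves. -/
theorem IsHeavyEdge.child_unique {u v v' : List ℤ} (h : IsHeavyEdge S m u v)
    (h' : IsHeavyEdge S m u v') : v = v' := by
  by_contra hne
  have := card_leavesBelow_add_le (S := S) (m := m) h.1.2.2.1 h'.1.2.2.1
    fun z hz hz' => hne (h.1.eq_of_common h'.1 hz hz')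
  have := h.2
  have := h'.2
  omega

/-- The place where two words that differ in one symbol separate is determined by them. -/
theorem append_cons_inj {u u₁ s s₁ : List ℤ} {c c₁ d d₁ : ℤ} (h : c ≠ d) (h₁ : c₁ ≠ d₁)
    (e : u ++ c :: s = u₁ ++ c₁ :: s₁) (e' : u ++ d :: s = u₁ ++ d₁ :: s₁) :
    u = u₁ ∧ c = c₁ ∧ d = d₁ := by
  have key : ∀ (u u₁ : List ℤ) (c c₁ d d₁ : ℤ) (s s₁ : List ℤ), c₁ ≠ d₁ →
      u ++ c :: s = u₁ ++ c₁ :: s₁ → u ++ d :: s = u₁ ++ d₁ :: s₁ → u.length ≤ u₁.length := by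
    intro u u₁ c c₁ d d₁ s s₁ h2 e1 e2
    by_contra hcon
    have g1 := congrArg (fun l => l[u₁.length]?) e1
    have g2 := congrArg (fun l => l[u₁.length]?) e2
    rw [not_le] at hcon
    simp only [List.getElem?_append_left hcon, List.getElem?_append_right le_rfl, Nat.sub_self,
      List.getElem?_cons_zero] at g1 g2
    rw [g1] at g2
    exact h2 (Option.some.inj g2)
  have hl := le_antisymm (key _ _ _ _ _ _ _ _ h₁ e e') (key _ _ _ _ _ _ _ _ h e.symm e'.symm)
  obtain ⟨g1, g2⟩ := List.append_inj e hl
  obtain ⟨-, g3⟩ := List.append_inj e' hl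
  exact ⟨g1, (List.cons.inj g2).1, (List.cons.inj g3).1⟩

/-- A heavy occurrence is a heavy pair; the node at which the two leaves separate lies on the
path. -/
theorem IsHeavyOcc.isHeavyPair {P : List (List ℤ)} {z z' : List ℤ} (hmn : m ≤ S.length)
    (h : IsHeavyOcc S m P z z') :
    IsHeavyPair S m z z' ∧ ∀ u c d s, c ≠ d → z = u ++ c :: s → z' = u ++ d :: s → u ∈ P := by
  obtain ⟨hz', u, u', v, c, d, s, ⟨hP, huP, huv, hzv⟩, hcv, hinf, hdu', rfl, rfl⟩ := h
  rw [mem_leavesBelow] at hzv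
  have hheavy : IsHeavyEdge S m u u' := by
    simpa using hP.1.2.2.infix hinf
  have hcd : c ≠ d := by
    rintro rfl
    have := hheavy.1.prefix_of_mem hmn hdu' hzv.1 (hcv.trans hzv.2)
    exact huv.2 (huv.1.eq_of_common hheavy.1 hzv.2 this ▸ hheavy)
  refine ⟨⟨u, c, d, s, hcd, rfl, rfl, hheavy.2.trans_le ?_⟩, ?_⟩
  · exact Nat.mul_le_mul_left _ (Finset.card_le_card (leavesBelow_anti hdu'))
  · intro u₁ c₁ d₁ s₁ hne e1 e2
    rw [← (append_cons_inj hcd hne e1 e2).1]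
    exact huP

/-- The two sides of the place of separation cannot both have more than half of the leaves. -/
theorem IsHeavyPair.asymm {z z' : List ℤ} (h : IsHeavyPair S m z z') : ¬ IsHeavyPair S m z' z := by
  obtain ⟨u, c, d, s, hcd, rfl, rfl, hlt⟩ := h
  rintro ⟨u₁, c₁, d₁, s₁, hcd₁, e1, e2, hlt₁⟩
  obtain ⟨rfl, rfl, rfl⟩ := append_cons_inj hcd hcd₁.symm e2 e1
  have := card_leavesBelow_add_le (S := S) (m := m) (List.prefix_append u [c])
    (List.prefix_append u [d]) fun z hz hz' => hcd (concat_prefix_unique hz hz')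
  omega

/-- Two chains of a deterministic relation that start at the same place. -/
theorem prefix_or_prefix_of_isChain {α : Type*} {R : α → α → Prop}
    (hR : ∀ a b c, R a b → R a c → b = c) {a : α} {l l' : List α} (h : (a :: l).IsChain R)
    (h' : (a :: l').IsChain R) : l <+: l' ∨ l' <+: l := by
  induction l generalizing a l' with
  | nil => exact Or.inl List.nil_prefix
  | cons b l ih =>
    cases l' with
    | nil => exact Or.inr List.nil_prefix
    | cons b' l' =>
      rw [List.isChain_cons_cons] at h h'
      obtain rfl := hR _ _ _ h.1 h'.1
      simpa using ih h.2 h'.2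

/-- A node lies on only one heavy path: above and below it, the two paths are comparable, since the
parent and the heavy child of a node are unique; the longer halves together form a chain of heavy
edges, with which both paths agree by maximality. -/
theorem IsHeavyPath.eq_of_mem {P P' : List (List ℤ)} {u : List ℤ} (h : IsHeavyPath S m P)
    (h' : IsHeavyPath S m P') (hu : u ∈ P) (hu' : u ∈ P') : P = P' := by
  obtain ⟨A, B, rfl⟩ := List.append_of_mem hu
  obtain ⟨A', B', rfl⟩ := List.append_of_mem hu'
  obtain ⟨c1, c2⟩ := List.isChain_split.1 h.1.2.2
  obtain ⟨c1', c2'⟩ := List.isChain_split.1 h'.1.2.2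
  have hB := prefix_or_prefix_of_isChain (fun _ _ _ g g' => g.child_unique g') c2 c2'
  have hA : A.reverse <+: A'.reverse ∨ A'.reverse <+: A.reverse := by
    refine prefix_or_prefix_of_isChain (R := fun x y => IsHeavyEdge S m y x) (a := u)
      (fun _ _ _ g g' => g.1.parent_unique g'.1) ?_ ?_
    · rw [← List.isChain_reverse]; simpa using c1
    · rw [← List.isChain_reverse]; simpa using c1'
  simp only [List.reverse_prefix] at hA
  -- the union of the two paths
  have key : ∀ A₀ B₀, (A₀ = A ∨ A₀ = A') → (B₀ = B ∨ B₀ = B') → A <:+ A₀ → A' <:+ A₀ → B <+: B₀ →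
      B' <+: B₀ → A ++ u :: B = A' ++ u :: B' := by
    intro A₀ B₀ hA₀ hB₀ s1 s2 p1 p2
    have hchain : IsHeavyChain S m (A₀ ++ u :: B₀) := by
      refine ⟨by simp, fun x hx => ?_, List.isChain_split.2 ⟨?_, ?_⟩⟩
      · rw [List.mem_append, List.mem_cons] at hx
        have n1 := fun hx => h.1.2.1 x hx
        have n2 := fun hx => h'.1.2.1 x hx
        simp only [List.mem_append, List.mem_cons] at n1 n2
        rcases hx with hx | hx | hx
        · rcases hA₀ with rfl | rfl
          · exact n1 (Or.inl hx)
          · exact n2 (Or.inl hx)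
        · exact n1 (Or.inr (Or.inl hx))
        · rcases hB₀ with rfl | rfl
          · exact n1 (Or.inr (Or.inr hx))
          · exact n2 (Or.inr (Or.inr hx))
      · rcases hA₀ with rfl | rfl
        · exact c1
        · exact c1'
      · rcases hB₀ with rfl | rfl
        · exact c2
        · exact c2'
    have hinf : ∀ A B, A <:+ A₀ → B <+: B₀ → A ++ u :: B <:+: A₀ ++ u :: B₀ := by
      rintro A B ⟨X, rfl⟩ ⟨Y, rfl⟩
      exact ⟨X, Y, by simp⟩
    rw [← h.2 _ hchain (hinf A B s1 p1), ← h'.2 _ hchain (hinf A' B' s2 p2)]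
  rcases hA with hA | hA <;> rcases hB with hB | hB
  · exact key A' B' (Or.inr rfl) (Or.inr rfl) hA List.suffix_rfl hB List.prefix_rfl
  · exact key A' B (Or.inr rfl) (Or.inl rfl) hA List.suffix_rfl List.prefix_rfl hB
  · exact key A B' (Or.inl rfl) (Or.inr rfl) List.suffix_rfl hA hB List.prefix_rfl
  · exact key A B (Or.inl rfl) (Or.inl rfl) List.suffix_rfl hA List.prefix_rfl hB

theorem IsHeavyChain.length_le {P : List (List ℤ)} (hmn : m ≤ S.length)
    (h : IsHeavyChain S m P) : P.length ≤ m + 1 := by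
  have key : ∀ (l : List (List ℤ)) (u : List ℤ), (∀ x ∈ u :: l, IsNode S m x) →
      (u :: l).IsChain (IsHeavyEdge S m) → u.length + l.length ≤ m := by
    intro l
    induction l with
    | nil => exact fun u hu _ => (hu u (by simp)).length_le hmn
    | cons v l ih =>
      intro u hu hc
      rw [List.isChain_cons_cons] at hc
      have h1 := ih v (fun x hx => hu x (List.mem_cons_of_mem _ hx)) hc.2
      have h2 : u.length < v.length := by
        by_contra hcon
        exact hc.1.1.2.2.2.1 (hc.1.1.2.2.1.eq_of_length_le (not_lt.1 hcon))
      rw [List.length_cons]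
      omega
  obtain ⟨h1, h2, h3⟩ := h
  cases P with
  | nil => exact absurd rfl h1
  | cons u l =>
    have := key l u h2 h3
    rw [List.length_cons]
    omega

/-- A chain of heavy edges is part of a heavy path: the depth of the trie is bounded. -/
theorem exists_isHeavyPath {Q : List (List ℤ)} (hmn : m ≤ S.length) (hQ : IsHeavyChain S m Q) :
    ∃ P, IsHeavyPath S m P ∧ Q <:+: P := by
  obtain ⟨k, hk⟩ : ∃ k, m + 1 - Q.length = k := ⟨_, rfl⟩
  induction k using Nat.strong_induction_on generalizing Q with
  | _ k ih =>
    by_cases hmax : ∀ R, IsHeavyChain S m R → Q <:+: R → R = Q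
    · exact ⟨Q, ⟨hQ, hmax⟩, List.infix_rfl⟩
    · push Not at hmax
      obtain ⟨R, hR, hQR, hne⟩ := hmax
      have h1 := hR.length_le hmn
      have h2 : Q.length < R.length := by
        by_contra hcon
        exact hne (hQR.eq_of_length_le (not_lt.1 hcon)).symm
      obtain ⟨P, hP, hRP⟩ := ih (m + 1 - R.length) (by omega) hR rfl
      exact ⟨P, hP, hQR.trans hRP⟩

/-- Conversely, a heavy pair is a heavy occurrence for some path: the place of separation branches,
so it is a node, and the edge towards `z'` belongs to a maximal path. -/
theorem IsHeavyPair.exists_isHeavyOcc {z z' : List ℤ} (hmn : m ≤ S.length) (hz : z ∈ leaves S m)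
    (hz' : z' ∈ leaves S m) (h : IsHeavyPair S m z z') : ∃ P, IsHeavyOcc S m P z z' := by
  obtain ⟨u, c, d, s, hcd, rfl, rfl, hlt⟩ := h
  have hc : u ++ [c] <+: u ++ c :: s := ⟨s, by simp⟩
  have hd : u ++ [d] <+: u ++ d :: s := ⟨s, by simp⟩
  have hu : IsNode S m u := Or.inr (Or.inr ⟨c, d, hcd, ⟨_, hz, hc⟩, ⟨_, hz', hd⟩⟩)
  obtain ⟨v, hv, hcv, hvz⟩ := exists_edge hu hz hc
  obtain ⟨u', hu', hdu', huz⟩ := exists_edge hu hz' hd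
  have heq : leavesBelow S m (u ++ [d]) = leavesBelow S m u' := by
    refine Finset.Subset.antisymm (fun x hx => ?_) (leavesBelow_anti hdu')
    rw [mem_leavesBelow] at hx ⊢
    exact ⟨hx.1, hu'.prefix_of_mem hmn hdu' hx.1 hx.2⟩
  rw [heq] at hlt
  have hheavy : IsHeavyEdge S m u u' := ⟨hu', hlt⟩
  -- Towards `z` there is another child, whose edge cannot be heavy as well.
  have hlight : IsLightEdge S m u v := by
    refine ⟨hv, fun hcon => ?_⟩
    obtain rfl := hcon.child_unique hheavy
    exact hcd (concat_prefix_unique hcv hdu')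
  obtain ⟨P, hP, hinf⟩ := exists_isHeavyPath (Q := [u, u']) hmn
    ⟨by simp, by simp [hu, hu'.2.1], by simpa using hheavy⟩
  exact ⟨P, hz', u, u', v, c, d, s, ⟨hP, hinf.subset (by simp), hlight,
    mem_leavesBelow.2 ⟨hz, hvz⟩⟩, hcv, hinf, hdu', rfl, rfl⟩

/-- The node at which the two leaves separate determines the path. -/
theorem IsHeavyOcc.path_unique {P P' : List (List ℤ)} {z z' : List ℤ} (hmn : m ≤ S.length)
    (h : IsHeavyOcc S m P z z') (h' : IsHeavyOcc S m P' z z') : P = P' := by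
  obtain ⟨u, c, d, s, hcd, e, e', -⟩ := (h.isHeavyPair hmn).1
  have hu := (h.isHeavyPair hmn).2 u c d s hcd e e'
  have hu' := (h'.isHeavyPair hmn).2 u c d s hcd e e'
  obtain ⟨-, -, -, -, -, -, -, ⟨hP, -⟩, -⟩ := h
  obtain ⟨-, -, -, -, -, -, -, ⟨hP', -⟩, -⟩ := h'
  exact hP.eq_of_mem hP' hu hu'

theorem IsHeavyOcc.asymm {P P' : List (List ℤ)} {z z' : List ℤ} (hmn : m ≤ S.length)
    (h : IsHeavyOcc S m P z z') : ¬ IsHeavyOcc S m P' z' z := fun h' =>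
  (h.isHeavyPair hmn).1.asymm (h'.isHeavyPair hmn).1

theorem exists_isHeavyOcc_iff {z z' : List ℤ} (hmn : m ≤ S.length) (hz : z ∈ leaves S m)
    (hz' : z' ∈ leaves S m) : (∃ P, IsHeavyOcc S m P z z') ↔ IsHeavyPair S m z z' :=
  ⟨fun ⟨_, h⟩ => (h.isHeavyPair hmn).1, fun h => h.exists_isHeavyOcc hmn hz hz'⟩

theorem lcp_append_cons (u s t : List ℤ) {c d : ℤ} (h : c ≠ d) :
    lcp (u ++ c :: s) (u ++ d :: t) = u.length := by
  induction u with
  | nil => simp [h]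
  | cons a u ih => simp [ih]

/-- The leaves below a prefix of a leaf in terms of their numbers. -/
theorem card_leavesBelow {D : ℕ} {w : ℕ → List ℤ} (hw : Sorted w D m)
    (hl : ∀ z, z ∈ leaves S m ↔ ∃ k < D, w k = z) {y e : ℕ} (hy : y < D) (he : e ≤ m) :
    (leavesBelow S m ((w y).take e)).card = below w D y e := by
  rw [below, eq_comm]
  refine Finset.card_bij (fun k _ => w k) (fun k hk => ?_) (fun k hk l hl' e => ?_) fun z hz => ?_
  · simp only [Finset.mem_filter, Finset.mem_range] at hk
    refine mem_leavesBelow.2 ⟨(hl _).2 ⟨k, hk.1, rfl⟩, ?_⟩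
    rw [← (le_lcp_iff.1 hk.2).2.2]
    exact List.take_prefix _ _
  · simp only [Finset.mem_filter, Finset.mem_range] at hk hl'
    exact hw.inj hk.1 hl'.1 e
  · obtain ⟨h1, h2⟩ := mem_leavesBelow.1 hz
    obtain ⟨k, hk, rfl⟩ := (hl _).1 h1
    refine ⟨k, ?_, rfl⟩
    simp only [Finset.mem_filter, Finset.mem_range]
    refine ⟨hk, le_lcp_iff.2 ⟨by rw [hw.len k hk]; exact he, by rw [hw.len y hy]; exact he, ?_⟩⟩
    have := List.prefix_iff_eq_take.1 h2
    rw [List.length_take, hw.len y hy, min_eq_left he] at this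
    exact this.symm

/-- The relation in terms of the numbers of the leaves. -/
theorem isHeavyPair_iff {D : ℕ} {w : ℕ → List ℤ} (hw : Sorted w D m)
    (hl : ∀ z, z ∈ leaves S m ↔ ∃ k < D, w k = z) {x y : ℕ} (hx : x < D) (hy : y < D) :
    IsHeavyPair S m (w x) (w y) ↔ HeavyRel w D x y := by
  have hlx := hw.len x hx
  have hly := hw.len y hy
  constructor
  · rintro ⟨u, c, d, s, hcd, ex, ey, hlt⟩
    have hum : u.length + 1 ≤ m := by rw [← hlx, ex]; simp
    have hxy : lcp (w x) (w y) = u.length := by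
      rw [ex, ey, lcp_append_cons _ _ _ hcd]
    refine ⟨?_, ?_, ?_⟩
    · intro e
      rw [e, hw.lcp_self hy] at hxy
      omega
    · rw [hxy, ex, ey]
      simp [List.drop_append]
    · rw [hxy, ← card_leavesBelow hw hl hy (by omega), ← card_leavesBelow hw hl hy hum, ey]
      simpa [List.take_append, List.take_of_length_le] using hlt
  · rintro ⟨hne, hdrop, hlt⟩
    have hl' := hw.lcp_lt hx hy hne
    obtain ⟨l, hlcp⟩ : ∃ l, lcp (w x) (w y) = l := ⟨_, rfl⟩
    rw [hlcp] at hdrop hlt hl'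
    have ht := (le_lcp_iff.1 hlcp.ge).2.2
    refine ⟨(w y).take l, (w x)[l], (w y)[l], (w y).drop (l + 1), ?_, ?_, ?_, ?_⟩
    · intro e
      have : l + 1 ≤ lcp (w x) (w y) := le_lcp_iff.2 ⟨by omega, by omega, by
        rw [← List.take_concat_get' (w x) l (by omega), ← List.take_concat_get' (w y) l (by omega),
          ht, e]⟩
      omega
    · rw [← hdrop, ← ht, ← List.drop_eq_getElem_cons, List.take_append_drop]
    · rw [← List.drop_eq_getElem_cons, List.take_append_drop]
    · rw [List.take_concat_get', card_leavesBelow hw hl hy (by omega),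
        card_leavesBelow hw hl hy (by omega)]
      exact hlt

open Classical in
/-- The positions at which a leaf with property `R` occurs, counted leaf by leaf. -/
theorem card_positions {D : ℕ} {w : ℕ → List ℤ} {cn : ℕ → ℕ} (hw : Sorted w D m)
    (hl : ∀ z, z ∈ leaves S m ↔ ∃ k < D, w k = z)
    (hcn : ∀ j < D, cn j = ((Finset.range (S.length + 1)).filter fun i =>
        i + m ≤ S.length ∧ window S m i = w j).card) (R : List ℤ → Prop) :
    {j : ℕ | j + m ≤ S.length ∧ R (window S m j)}.encard =
      ((∑ y ∈ Finset.range D, if R (w y) then cn y else 0 : ℕ) : ℕ∞) := by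
  have h1 : {j : ℕ | j + m ≤ S.length ∧ R (window S m j)} =
      (((Finset.range D).filter fun y => R (w y)).biUnion fun y =>
        (Finset.range (S.length + 1)).filter fun i => i + m ≤ S.length ∧ window S m i = w y :
          Finset ℕ) := by
    ext j
    simp only [Set.mem_ofPred_eq, Finset.coe_biUnion, Finset.mem_coe, Finset.mem_filter,
      Finset.mem_range, Set.mem_iUnion, exists_prop]
    constructor
    · rintro ⟨h, hR⟩
      obtain ⟨k, hk, e⟩ := (hl _).1 (mem_leaves.2 ⟨j, h, rfl⟩)
      exact ⟨k, ⟨hk, e ▸ hR⟩, by omega, h, e.symm⟩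
    · rintro ⟨y, ⟨-, hR⟩, -, h, e⟩
      exact ⟨h, e ▸ hR⟩
  rw [h1, Set.encard_coe_eq_coe_finsetCard, Finset.card_biUnion, Finset.sum_filter]
  · congr 1
    refine Finset.sum_congr rfl fun y hy => ?_
    rw [hcn y (Finset.mem_range.1 hy)]
  · intro x hx y hy hxy
    simp only [Finset.coe_filter, Finset.mem_range, Set.mem_ofPred_eq] at hx hy
    rw [Function.onFun, Finset.disjoint_left]
    intro z hz hz'
    simp only [Finset.mem_filter] at hz hz'
    exact hxy (hw.inj hx.1 hy.1 (hz.2.2.symm.trans hz'.2.2))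

open Classical in
/-- By uniqueness of the path, the pairs (path, position) correspond to positions. -/
theorem heavyCount_eq {D : ℕ} {w : ℕ → List ℤ} {cn : ℕ → ℕ} (hmn : m ≤ S.length)
    (hw : Sorted w D m) (hl : ∀ z, z ∈ leaves S m ↔ ∃ k < D, w k = z)
    (hcn : ∀ j < D, cn j = ((Finset.range (S.length + 1)).filter fun i =>
        i + m ≤ S.length ∧ window S m i = w j).card) {x : ℕ} (hx : x < D) :
    heavyCount S m (w x) =
      ((∑ y ∈ Finset.range D, if HeavyRel w D x y then cn y else 0 : ℕ) : ℕ∞) := by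
  have hmem : ∀ y < D, w y ∈ leaves S m := fun y hy => (hl _).2 ⟨y, hy, rfl⟩
  have h1 : heavyCount S m (w x) =
      {j : ℕ | j + m ≤ S.length ∧ IsHeavyPair S m (w x) (window S m j)}.encard := by
    have himg : {j : ℕ | j + m ≤ S.length ∧ IsHeavyPair S m (w x) (window S m j)} =
        Prod.snd '' {p : List (List ℤ) × ℕ |
          p.2 + m ≤ S.length ∧ IsHeavyOcc S m p.1 (w x) (window S m p.2)} := by
      ext j
      simp only [Set.mem_ofPred_eq, Set.mem_image, Prod.exists, exists_eq_right]
      constructor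
      · rintro ⟨h, hp⟩
        obtain ⟨P, hP⟩ := hp.exists_isHeavyOcc hmn (hmem x hx) (mem_leaves.2 ⟨j, h, rfl⟩)
        exact ⟨P, h, hP⟩
      · rintro ⟨P, h, hP⟩
        exact ⟨h, (hP.isHeavyPair hmn).1⟩
    rw [himg, Set.InjOn.encard_image, heavyCount]
    rintro ⟨P, j⟩ ⟨-, h⟩ ⟨P', j'⟩ ⟨-, h'⟩ (rfl : j = j')
    exact Prod.ext (h.path_unique hmn h') rfl
  rw [h1, card_positions hw hl hcn]
  congr 1
  refine Finset.sum_congr rfl fun y hy => ?_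
  simp only [isHeavyPair_iff hw hl hx (Finset.mem_range.1 hy)]

open Classical in
theorem mutualCount_eq {D : ℕ} {w : ℕ → List ℤ} {cn : ℕ → ℕ} (hmn : m ≤ S.length)
    (hw : Sorted w D m) (hl : ∀ z, z ∈ leaves S m ↔ ∃ k < D, w k = z)
    (hcn : ∀ j < D, cn j = ((Finset.range (S.length + 1)).filter fun i =>
        i + m ≤ S.length ∧ window S m i = w j).card) {x : ℕ} (hx : x < D) :
    mutualCount S m (w x) = ((∑ y ∈ Finset.range D,
      if HeavyRel w D x y ∨ HeavyRel w D y x then cn y else 0 : ℕ) : ℕ∞) := by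
  have hmem : ∀ y < D, w y ∈ leaves S m := fun y hy => (hl _).2 ⟨y, hy, rfl⟩
  rw [mutualCount, card_positions hw hl hcn fun z' =>
    ∃ P, IsHeavyOcc S m P (w x) z' ∨ IsHeavyOcc S m P z' (w x)]
  congr 1
  refine Finset.sum_congr rfl fun y hy => ?_
  have hy' := Finset.mem_range.1 hy
  simp only [exists_or, exists_isHeavyOcc_iff hmn (hmem x hx) (hmem y hy'),
    exists_isHeavyOcc_iff hmn (hmem y hy') (hmem x hx), isHeavyPair_iff hw hl hx hy',
    isHeavyPair_iff hw hl hy' hx]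

end

/-! ### The program -/

/-- Copy the results from the leaves to the positions of the text. -/
def output : Cmd :=
  .set r_e (.reg r_n + 1) ;;
  .for r_t 0 r_e
    (.ite (.reg r_n) (.reg r_t + .reg r_m)
      .skip
      (.put 0 (.reg r_t) (.cell a_A (.cell a_id (.reg r_t))) ;;
        .put 1 (.reg r_t) (.cell a_Mu (.cell a_id (.reg r_t)))))

/-- The whole program. -/
def countHeavy : Cmd :=
  suffixArray ;; kasai ;; logTables ;; maskTable ;; blockTable ;; findLeaves ;; allRounds ;; output

section
variable {S : List ℤ} {cap W m : ℕ}

/-- The results of the leaf at position `i` end up in the cells `i` of the arrays `0` and `1`. -/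
theorem output_spec {σ : State} {T D : ℕ} (hrn : σ.reg r_n = S.length) (hrm : σ.reg r_m = m)
    (hc : 4 * S.length + 4 ≤ cap) (hW : 4 * S.length + 8 ≤ W) (hmn : m ≤ S.length) (hm0 : 1 ≤ m)
    (hDn : D ≤ S.length) (hid : ∀ i, i + m ≤ S.length → σ.arr a_id i < D) :
    wp S cap W output (fun τ T' => T' ≤ T + 100 * (S.length + 1) ∧ ∀ i, i + m ≤ S.length →
      τ.arr 0 i = σ.arr a_A (σ.arr a_id i) ∧ τ.arr 1 i = σ.arr a_Mu (σ.arr a_id i)) σ T := by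
  unfold output
  simp only [wp_rules, ok_rules, eval_rules, hrn, Nat.reduceLT, Nat.reduceEqDiff, if_false]
  repeat refine And.intro (by omega) ?_
  refine wp_for_const (fun k τ => ∀ i < k, i + m ≤ S.length →
      τ.arr 0 i = σ.arr a_A (σ.arr a_id i) ∧ τ.arr 1 i = σ.arr a_Mu (σ.arr a_id i)) 0 (S.length + 1) 40
    (by norm_num) (by norm_num) (by norm_num) rfl rfl (by simp) (by omega) (by omega)
    (by simp [ok_rules]) (by simp [eval_rules]) (by simp) ?_ ?_
  · intro k τ T' _ hk hkτ hf hI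
    have e1 : τ.reg r_n = S.length := by rw [hf.reg r_n]; simp [hrn]
    have e2 : τ.reg r_m = m := by rw [hf.reg r_m]; simp [hrm]
    have e3 : τ.arr a_A = σ.arr a_A := hf.arr a_A
    have e4 : τ.arr a_Mu = σ.arr a_Mu := hf.arr a_Mu
    have e5 : τ.arr a_id = σ.arr a_id := hf.arr a_id
    simp only [wp_rules, ok_rules, eval_rules, hkτ, e1, e2, e3, e4, e5, Nat.reduceLT,
      Nat.reduceEqDiff, if_true, if_false]
    repeat refine And.intro (by omega) ?_
    refine ⟨fun hlt => ⟨fun i hi him => hI i (by omega) him, by omega⟩, fun hge => ?_⟩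
    have e6 := hid k (by omega)
    repeat refine And.intro (by omega) ?_
    refine ⟨fun i hi him => ?_, by omega⟩
    by_cases hik : i = k
    · simp [hik]
    · simpa [hik] using hI i (by omega) him
  · intro τ T' _ hf hI hT
    simp only [eval_rules] at hT
    exact ⟨by omega, fun i hi => hI i (by omega) hi⟩

/-- The program computes both counts, in time `O(n log n)`. -/
theorem countHeavy_spec {σ : State} (hrn : σ.reg r_n = S.length) (hrm : σ.reg r_m = m)
    (hc : 4 * S.length + 4 ≤ cap) (hW : 4 * S.length + 8 ≤ W) (hmn : m ≤ S.length) (hm0 : 1 ≤ m) :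
    wp S cap W countHeavy (fun τ T' =>
      T' ≤ 40000 * ((S.length + 1) * (Nat.log 2 S.length + 1)) ∧ ∀ i, i + m ≤ S.length →
        heavyCount S m (window S m i) = (τ.arr 0 i : ℕ∞) ∧
        mutualCount S m (window S m i) = (τ.arr 1 i : ℕ∞)) σ 0 := by
  have hn0 : 0 < S.length := by omega
  unfold countHeavy
  refine wp_then (suffixArray_spec rfl hrn hn0 (by omega) (by omega)) ?_
  rintro τ₁ T₁ f₁ ⟨hT₁, H₁⟩
  refine wp_then (kasai_spec rfl H₁ (by omega) (by omega)) ?_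
  rintro τ₂ T₂ f₂ ⟨hT₂, H₂⟩
  refine wp_then (logTables_spec H₂.n_eq hn0 (by omega) (by omega)) ?_
  rintro τ₃ T₃ f₃ ⟨hT₃, b₃, lg₃, pw₃⟩
  have H₃ : HasLcp S τ₃ := H₂.congr (f₃.reg r_n) (f₃.arr a_nm) (f₃.arr a_sa) (f₃.arr a_sym)
    (f₃.arr a_lc)
  refine wp_then (maskTable_spec rfl H₃ b₃ lg₃ pw₃ hn0 (by omega) (by omega)) ?_
  rintro τ₄ T₄ f₄ ⟨hT₄, H₄⟩
  refine wp_then (blockTable_spec rfl H₄ hn0 (by omega) (by omega)) ?_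
  rintro τ₅ T₅ f₅ ⟨hT₅, H₅⟩
  have m₅ : τ₅.reg r_m = m := by
    rw [f₅.reg r_m, f₄.reg r_m, f₃.reg r_m, f₂.reg r_m, f₁.reg r_m, hrm]
  refine wp_then (findLeaves_spec H₅ hn0 hc hW m₅ hm0 hmn) ?_
  rintro τ₆ T₆ f₆ ⟨hT₆, D, hD0, H₆, id₆, cn₆⟩
  refine wp_then (allRounds_spec H₆ hc hW hmn hD0) ?_
  rintro τ₇ T₇ f₇ ⟨hT₇, h₇⟩
  have H₇ := H₆.frame f₇
  have id₇ : τ₇.arr a_id = τ₆.arr a_id := f₇.arr a_id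
  refine wp_last (output_spec (D := D) H₇.n_eq H₇.m_eq hc hW hmn hm0 H₆.D_le
    fun i hi => by rw [id₇]; exact (id₆ i hi).1) ?_
  rintro τ₈ T₈ f₈ ⟨hT₈, h₈⟩
  refine ⟨?_, fun i hi => ?_⟩
  · obtain ⟨l, hl⟩ : ∃ l, Nat.log 2 S.length + 1 = l := ⟨_, rfl⟩
    have hl1 : 1 ≤ l := by omega
    rw [hl] at hT₁ hT₄ hT₅ hT₇ ⊢
    obtain ⟨b, hb⟩ : ∃ b, (S.length + 1) * l = b := ⟨_, rfl⟩
    have e1 : S.length * l ≤ b := by rw [← hb]; exact Nat.mul_le_mul_right _ (by omega)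
    have e2 : S.length + 1 ≤ b := by rw [← hb]; exact Nat.le_mul_of_pos_right _ hl1
    have e3 : (100 * l + 200) * (S.length + 1) = 100 * b + 200 * (S.length + 1) := by
      rw [← hb]; ring
    have e4 : 1000 * (S.length + 1) * l = 1000 * b := by rw [← hb]; ring
    rw [hb] at hT₇ ⊢
    linarith
  · obtain ⟨g1, g2⟩ := h₈ i hi
    obtain ⟨g3, g4⟩ := id₆ i hi
    obtain ⟨g5, g6⟩ := h₇ _ g3
    have hl : ∀ z, z ∈ leaves S m ↔ ∃ k < D, window S m (τ₆.arr a_pos k) = z := fun z => by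
      rw [mem_leaves]
      constructor
      · rintro ⟨j, hj, rfl⟩
        exact ⟨_, (id₆ j hj).1, (id₆ j hj).2⟩
      · rintro ⟨k, hk, rfl⟩
        exact ⟨_, H₆.pos_le k hk, rfl⟩
    rw [g1, g2, id₇, g5, g6, ← g4]
    exact ⟨heavyCount_eq hmn H₆.sorted hl cn₆ g3, mutualCount_eq hmn H₆.sorted hl cn₆ g3⟩

end
end Mappability

theorem theoremt :
    -- one program, for all texts and word lengths: time `O(n log n)`, `O(n)` words of `O(log n)` bits
    (∃ (p : Mappability.Prog) (C : ℕ), ∀ (S : List ℤ) (m : ℕ), 1 ≤ m → m ≤ S.length →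
      ∃ (cap t : ℕ) (τ : Mappability.State),
        Mappability.Exec S cap ((S.length + 1) ^ C) p
          (Mappability.State.init S.length m) t τ ∧
        t ≤ C * (S.length * Nat.log 2 S.length + 1) ∧
        p.memory cap ≤ C * S.length ∧
        ∀ i : ℕ, i + m ≤ S.length →
          Mappability.heavyCount S m (Mappability.window S m i) = (τ.arr 0 i : ℕ∞) ∧
          Mappability.mutualCount S m (Mappability.window S m i) = (τ.arr 1 i : ℕ∞)) ∧
    -- no pair of leaves is counted twice
    (∀ (S : List ℤ) (m : ℕ), 1 ≤ m → m ≤ S.length →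
      ∀ (P P' : List (List ℤ)) (z z' : List ℤ), Mappability.IsHeavyOcc S m P z z' →
        ¬ Mappability.IsHeavyOcc S m P' z' z ∧
        (Mappability.IsHeavyOcc S m P' z z' → P' = P)) := by
  constructor
  · obtain ⟨C, hC⟩ : ∃ C, 160000 + 8 * Mappability.countHeavy.code.arrays.card +
        Mappability.countHeavy.code.regs.card ≤ C := ⟨_, le_rfl⟩
    refine ⟨Mappability.countHeavy.code, C, fun S m hm hmn => ?_⟩
    obtain ⟨n, hn⟩ : ∃ n, S.length = n := ⟨_, rfl⟩
    -- With arrays of `4 n + 4` cells, words that hold the numbers up to `4 n + 8` are enough.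
    have hW : 4 * n + 8 ≤ (n + 1) ^ C := by
      refine le_trans ?_ (Nat.pow_le_pow_right (by omega) (show 4 ≤ C by omega))
      nlinarith [Nat.one_le_pow 2 n (by omega), Nat.one_le_pow 3 n (by omega),
        Nat.one_le_pow 4 n (by omega)]
    have hb : (Mappability.State.init S.length m).Bounded ((S.length + 1) ^ C) := by
      rw [hn]
      refine ⟨fun x => ?_, fun _ _ => Nat.zero_le _⟩
      simp only [Mappability.State.init]
      split_ifs <;> omega
    obtain ⟨t, τ', τ, hexec, hagree, -, ht, hτ⟩ := Mappability.wp_exec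
      (Mappability.countHeavy_spec (S := S) (cap := 4 * S.length + 4) (W := (S.length + 1) ^ C)
        (m := m) (σ := Mappability.State.init S.length m) rfl rfl le_rfl (by rw [hn]; exact hW)
        hmn hm) (σ' := Mappability.State.init S.length m) ⟨fun _ _ => rfl, rfl⟩ hb
    refine ⟨4 * S.length + 4, t, τ', hexec, ?_, ?_, fun i hi => ?_⟩
    · rw [hn, zero_add] at ht
      rw [hn]
      obtain ⟨l, hl⟩ : ∃ l, Nat.log 2 n = l := ⟨_, rfl⟩
      rw [hl] at ht ⊢
      -- `160000 = 4 * 40000`; the summand `1` takes care of `n = 1`, where `log n = 0`.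
      have h1 : (n + 1) * (l + 1) ≤ 4 * (n * l + 1) := by
        rcases Nat.lt_or_ge n 2 with h | h
        · obtain rfl : n = 1 := by omega
          omega
        · have : 1 ≤ l := by rw [← hl]; exact Nat.log_pos (by norm_num) h
          nlinarith
      have h2 : 160000 * (n * l + 1) ≤ C * (n * l + 1) := Nat.mul_le_mul_right _ (by omega)
      linarith
    · rw [Mappability.Prog.memory]
      have h2 := Nat.mul_le_mul_right S.length hC
      have h3 := Nat.mul_le_mul_left Mappability.countHeavy.code.arrays.card
        (show 4 * S.length + 4 ≤ 8 * S.length by omega)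
      have h4 := Nat.mul_le_mul_left Mappability.countHeavy.code.regs.card
        (show 1 ≤ S.length by omega)
      nlinarith
    · rw [hagree.2]
      exact hτ i hi
  · exact fun S m hm hmn P P' z z' h => ⟨h.asymm hmn, fun h' => (h.path_unique hmn h').symm⟩
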